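/- Notation. Let $n\ge 1$ and write $x=(x',x_n)\in\mathbb{R}^{n-1}\times\mathbb{R}$, $\mathbb{R}^n_\pm=\{x:\pm x_n>0\}$, $\langle x\rangle=\sqrt{1+|x|^2}$, $\hat u(\xi)=\int e^{-ix\xi}u(x)\,dx$; $\alpha,\beta$ denote multi-indices. For an open set $\Omega\subset\mathbb{R}^n$ and $\theta>1$, $\mathcal{S}_\theta^\theta(\Omega)$ is the set of $u\in C^\infty(\Omega)$ for which there are $C,D>0$ with $|x^\alpha\partial^\beta u(x)|\le CD^{|\alpha|+|\beta|}(\alpha!)^\theta(\beta!)^\theta$ for all $\alpha,\beta$ and all $x\in\Omega$. Let $\mu>1$, $\nu>1$, $m_1\in\mathbb{Z}$, $m_2\in\mathbb{R}$. The class $S_{\mu\nu}^{m_1,m_2}(\mathbb{R}^n\times\mathbb{R}^n)$ consists of all $a\in C^\infty(\mathbb{R}^n\times\mathbb{R}^n)$ for which there are $C,D>0$ with $$|\partial_x^\beta\partial_\xi^\alpha a(x,\xi)|\le CD^{|\alpha|+|\beta|}(\alpha!)^\mu(\beta!)^\nu\langle\xi\rangle^{m_1-|\alpha|}\langle x\rangle^{m_2-|\beta|}\quad\text{for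 all }\alpha,\beta,x,\xi .$$ For Schwartz functions $u$, $op(a)u(x)=(2\pi)^{-n}\int e^{ix\xi}a(x,\xi)\hat u(\xi)\,d\xi$; for $f\in L^1\cap L^2$, $op(a)f$ denotes the distribution obtained by continuous extension, that is, $\langle op(a)f,\varphi\rangle=(2\pi)^{-n}\int\hat f(\xi)\left(\int e^{ix\xi}a(x,\xi)\varphi(x)\,dx\right)d\xi$ for test functions $\varphi$. A symbol $a\in S_{\mu\nu}^{m_1,m_2}(\mathbb{R}^n\times\mathbb{R}^n)$ satisfies assumption (A) if there are functions $a_j(x,\xi)$, $j=0,1,2,\dots$, rational in $\xi$ for every $x$, and constants $C,D>0$ and $B>r>0$ such that the following hold for all $j$, $\alpha$, $\beta$. 1) At all real $(x,\xi)$ with $|(x,\xi)|\ge B$, $a_j$ is smooth and $$|\partial_x^\beta\partial_\xi^\alpha a_j(x,\xi)|\le CD^{|\alpha|+|\beta|+2j}(j!\,\beta!)^\nu\alpha!\,\langle x\rangle^{m_2-j-|\beta|}\langle\xi\rangle^{m_1-j-|\alpha|}.$$ 2) For all $x\in\mathbb{R}^n$, $\xi'\in\mathbb{R}^{n-1}$: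 every pole $z_0$ of $z\in\mathbb{C}\mapsto a_j(x,\xi',z)$ satisfies $|z_0|\le r\langle\xi'\rangle$, and if $z_0$ is real, then also $|(x,\xi',z_0)|\le B$. Moreover, for all $t\in\mathbb{R}$, $a_j$ is smooth at $(x,\xi',B\langle\xi'\rangle e^{it})$ and $$|(\partial_x^\beta\partial_\xi^\alpha a_j)(x,\xi',B\langle\xi'\rangle e^{it})|\le CD^{|\alpha|+|\beta|+2j}(j!\,\beta!)^\nu\alpha!\,\langle x\rangle^{m_2-j-|\beta|}\langle\xi'\rangle^{m_1-j-|\alpha|}.$$ 3) For every $M\in\mathbb{N}_0$ and all $(x,\xi)\in\mathbb{R}^n\times\mathbb{R}^n$ with $\max\{\langle x\rangle,\langle\xi\rangle\}\ge BM^{\mu+\nu-1}$, $$\Big|\partial_x^\beta\partial_\xi^\alpha\Big(a-\sum_{j=0}^{M-1}a_j\Big)(x,\xi)\Big|\le CD^{|\alpha|+|\beta|+2M}(\alpha!)^\mu(\beta!)^\nu(M!)^{\mu+\nu-1}\langle x\rangle^{m_2-M-|\beta|}\langle\xi\rangle^{m_1-M-|\alpha|}.$$ Proposition. Let $\mu,\nu>1$,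 let $a\in S_{\mu\nu}^{m_1,m_2}(\mathbb{R}^n\times\mathbb{R}^n)$ with $m_1\in\mathbb{Z}$, $m_2\in\mathbb{R}$ satisfy assumption (A), let $\theta\ge\mu+\nu-1$ and let $u\in\mathcal{S}_\theta^\theta(\mathbb{R}^n_-)$. Let $e^-u$ be the extension of $u$ by zero to $\mathbb{R}^n$, and let $r^+$ denote the restriction of distributions to $\mathbb{R}^n_+$. Then $r^+\,op(a)\,e^-u$ belongs to $\mathcal{S}_\theta^\theta(\mathbb{R}^n_+)$; that is, there is $v\in\mathcal{S}_\theta^\theta(\mathbb{R}^n_+)$ with $\langle op(a)e^-u,\varphi\rangle=\int_{\mathbb{R}^n_+}v\varphi\,dx$ for all $\varphi\in C_c^\infty(\mathbb{R}^n_+)$. -/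

import Mathlib

open scoped ContDiff

noncomputable section

namespace SGHalfSpace

/-- Real Euclidean space of dimension `n`. -/
abbrev RSpace (n : ℕ) : Type := EuclideanSpace ℝ (Fin n)

/-- Complex Euclidean space of dimension `n`. -/
abbrev CSpace (n : ℕ) : Type := EuclideanSpace ℂ (Fin n)

/-- `⟨x⟩ = √(1 + |x|²)`. -/
def bracket {n : ℕ} (x : RSpace n) : ℝ := Real.sqrt (1 + ‖x‖ ^ 2)

/-- The Euclidean norm `|(x, ξ)|` of a pair. -/
def pairNorm {m n : ℕ} (x : RSpace m) (ξ : RSpace n) : ℝ := Real.sqrt (‖x‖ ^ 2 + ‖ξ‖ ^ 2)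

/-! ### Multi-indices and partial derivatives -/

/-- `|α| = α₁ + ⋯ + αₙ`. -/
def msum {n : ℕ} (α : Fin n → ℕ) : ℕ := ∑ i, α i

/-- `α! = α₁! ⋯ αₙ!`, as a real number. -/
def mfact {n : ℕ} (α : Fin n → ℕ) : ℝ := ∏ i, ((α i).factorial : ℝ)

/-- `x^α`. -/
def mpow {n : ℕ} (x : RSpace n) (α : Fin n → ℕ) : ℝ := ∏ i, x i ^ α i

/-- The partial derivative `∂_i f`; complex partial derivatives for `𝕜 = ℂ`. -/
def pderiv (𝕜 : Type) [RCLike 𝕜] [NormedSpace 𝕜 ℂ] {n : ℕ} (i : Fin n)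
    (f : EuclideanSpace 𝕜 (Fin n) → ℂ) : EuclideanSpace 𝕜 (Fin n) → ℂ :=
  fun x => fderiv 𝕜 f x (EuclideanSpace.single i 1)

/-- `∂^α f = ∂₁^{α₁} ⋯ ∂ₙ^{αₙ} f`. -/
def mderiv (𝕜 : Type) [RCLike 𝕜] [NormedSpace 𝕜 ℂ] {n : ℕ} (α : Fin n → ℕ)
    (f : EuclideanSpace 𝕜 (Fin n) → ℂ) : EuclideanSpace 𝕜 (Fin n) → ℂ :=
  (List.finRange n).foldr (fun i g => (pderiv 𝕜 i)^[α i] g) f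

/-- `(∂_x^β ∂_ξ^α F)(x, ξ)`, where `x` is real and `ξ` is in `𝕜ⁿ`. -/
def symDeriv (𝕜 : Type) [RCLike 𝕜] [NormedSpace 𝕜 ℂ] {n : ℕ} (β α : Fin n → ℕ)
    (F : RSpace n → EuclideanSpace 𝕜 (Fin n) → ℂ) (x : RSpace n)
    (ξ : EuclideanSpace 𝕜 (Fin n)) : ℂ :=
  mderiv ℝ β (fun y => mderiv 𝕜 α (F y) ξ) x

/-! ### Gelfand-Shilov functions on an open set -/

/-- `u` (restricted to `Ω`) belongs to the Gelfand-Shilov space `S^μ_ν(Ω)`. Only the values of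
`u` on the open set `Ω` matter. -/
def IsGelfandShilov {n : ℕ} (μ ν : ℝ) (Ω : Set (RSpace n)) (u : RSpace n → ℂ) : Prop :=
  ContDiffOn ℝ ∞ u Ω ∧
    ∃ C D : ℝ, 0 < C ∧ 0 < D ∧ ∀ (α β : Fin n → ℕ), ∀ x ∈ Ω,
      |mpow x α| * ‖mderiv ℝ β u x‖ ≤
        C * D ^ (msum α + msum β) * mfact α ^ ν * mfact β ^ μ

/-- The open half-space of points with positive last coordinate. -/
def upperHalf (d : ℕ) : Set (RSpace (d + 1)) := {x | 0 < x (Fin.last d)}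

/-- The open half-space of points with negative last coordinate. -/
def lowerHalf (d : ℕ) : Set (RSpace (d + 1)) := {x | x (Fin.last d) < 0}

/-- Extension by zero of (the restriction to `Ω` of) a function. -/
def extendZero {n : ℕ} (Ω : Set (RSpace n)) (u : RSpace n → ℂ) : RSpace n → ℂ := Ω.indicator u

/-! ### SG symbols and their operators -/

/-- The class `S_{μν}^{m₁,m₂}(ℝⁿ × ℝⁿ)`. -/
def IsSGSymbol {n : ℕ} (μ ν m₁ m₂ : ℝ) (a : RSpace n → RSpace n → ℂ) : Prop :=
  ContDiff ℝ ∞ (fun p : RSpace n × RSpace n => a p.1 p.2) ∧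
    ∃ C D : ℝ, 0 < C ∧ 0 < D ∧ ∀ (α β : Fin n → ℕ) (x ξ : RSpace n),
      ‖symDeriv ℝ β α a x ξ‖ ≤
        C * D ^ (msum α + msum β) * mfact α ^ μ * mfact β ^ ν *
          bracket ξ ^ (m₁ - msum α) * bracket x ^ (m₂ - msum β)

/-- The Fourier transform `û(ξ) = ∫ e^{-ixξ} u(x) dx`. -/
def hat {n : ℕ} (u : RSpace n → ℂ) (ξ : RSpace n) : ℂ :=
  ∫ x, Complex.exp (-(Complex.I * (inner ℝ x ξ : ℝ))) * u x

/-- `(op(a) u)(x) = (2π)^{-n} ∫ e^{ixξ} a(x, ξ) û(ξ) dξ`, for Schwartz functions `u`. -/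
def op {n : ℕ} (a : RSpace n → RSpace n → ℂ) (u : RSpace n → ℂ) (x : RSpace n) : ℂ :=
  ((2 * Real.pi : ℝ) : ℂ)⁻¹ ^ n *
    ∫ ξ, Complex.exp (Complex.I * (inner ℝ x ξ : ℝ)) * a x ξ * hat u ξ

/-- `∫ e^{ixξ} a(x, ξ) φ(x) dx`. -/
def testTransform {n : ℕ} (a : RSpace n → RSpace n → ℂ) (φ : RSpace n → ℂ) (ξ : RSpace n) : ℂ :=
  ∫ x, Complex.exp (Complex.I * (inner ℝ x ξ : ℝ)) * a x ξ * φ x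

/-- The distribution `op(a) f`, for a function `f` in `L¹ ∩ L²`, evaluated at a test function `φ`:
`⟨op(a) f, φ⟩ = (2π)^{-n} ∫ f̂(ξ) (∫ e^{ixξ} a(x, ξ) φ(x) dx) dξ`.
For SG symbols the inner integral is rapidly decreasing in `ξ`, so that this is the extension of
`op(a)` from Schwartz functions that is continuous in `f` for the `L²` norm;
see `opPairing_schwartz` for the agreement on Schwartz functions. -/
def opPairing {n : ℕ} (a : RSpace n → RSpace n → ℂ) (f φ : RSpace n → ℂ) : ℂ :=
  ((2 * Real.pi : ℝ) : ℂ)⁻¹ ^ n * ∫ ξ, hat f ξ * testTransform a φ ξ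

theorem IsSGSymbol.norm_le {n : ℕ} {μ ν m₁ m₂ : ℝ} {a : RSpace n → RSpace n → ℂ}
    (ha : IsSGSymbol μ ν m₁ m₂ a) :
    ∃ C : ℝ, 0 < C ∧ ∀ x ξ, ‖a x ξ‖ ≤ C * bracket ξ ^ m₁ * bracket x ^ m₂ := by
  obtain ⟨C, D, hC, hD, h⟩ := ha.2
  refine ⟨C, hC, fun x ξ => ?_⟩
  have h0 := h 0 0 x ξ
  simpa [symDeriv, mderiv, msum, mfact] using h0

theorem bracket_pos {n : ℕ} (x : RSpace n) : 0 < bracket x :=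
  Real.sqrt_pos.mpr (by positivity)

theorem continuous_bracket {n : ℕ} : Continuous (bracket (n := n)) := by
  unfold bracket
  fun_prop

theorem bracket_rpow_le {n : ℕ} (m : ℝ) :
    ∃ (K : ℝ) (k : ℕ), ∀ ξ : RSpace n, bracket ξ ^ m ≤ K * (1 + ‖ξ‖ ^ k) := by
  refine ⟨2 ^ (⌈|m|⌉₊ - 1), ⌈|m|⌉₊, fun ξ => ?_⟩
  have h1 : 1 ≤ bracket ξ := by
    unfold bracket
    exact Real.one_le_sqrt.mpr (by nlinarith [sq_nonneg ‖ξ‖])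
  have h2 : bracket ξ ≤ 1 + ‖ξ‖ := by
    unfold bracket
    exact Real.sqrt_le_iff.mpr ⟨by positivity, by nlinarith [norm_nonneg ξ]⟩
  calc bracket ξ ^ m ≤ bracket ξ ^ ((⌈|m|⌉₊ : ℕ) : ℝ) :=
        Real.rpow_le_rpow_of_exponent_le h1 ((le_abs_self m).trans (Nat.le_ceil _))
    _ = bracket ξ ^ ⌈|m|⌉₊ := Real.rpow_natCast _ _
    _ ≤ (1 + ‖ξ‖) ^ ⌈|m|⌉₊ := pow_le_pow_left₀ (bracket_pos ξ).le h2 _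
    _ ≤ _ := by simpa using add_pow_le zero_le_one (norm_nonneg ξ) ⌈|m|⌉₊

/-- The Fourier transform of a Schwartz function is a Schwartz function. -/
theorem exists_schwartz_hat {n : ℕ} (u : SchwartzMap (RSpace n) ℂ) :
    ∃ U : SchwartzMap (RSpace n) ℂ, ∀ ξ, U ξ = hat u ξ := by
  have hpi : (2 * Real.pi)⁻¹ ≠ 0 := by positivity
  refine ⟨SchwartzMap.compCLMOfContinuousLinearEquiv ℂ
    (ContinuousLinearEquiv.smulLeft (R₁ := ℝ) (M₁ := RSpace n) (Units.mk0 _ hpi))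
    (FourierTransform.fourier u), fun ξ => ?_⟩
  rw [SchwartzMap.compCLMOfContinuousLinearEquiv_apply, Function.comp_apply,
    SchwartzMap.fourier_coe, Real.fourier_eq']
  unfold hat
  congr 1
  ext x
  have : ((ContinuousLinearEquiv.smulLeft (R₁ := ℝ) (M₁ := RSpace n) (Units.mk0 _ hpi)) ξ)
      = (2 * Real.pi)⁻¹ • ξ := rfl
  rw [this, inner_smul_right, smul_eq_mul]
  congr 2
  have hp : (Real.pi : ℂ) ≠ 0 := by exact_mod_cast Real.pi_ne_zero
  push_cast
  field_simp

/-- On Schwartz functions the distribution `op(a) u` is the function `op(a) u`. -/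
theorem opPairing_schwartz {n : ℕ} {μ ν m₁ m₂ : ℝ} {a : RSpace n → RSpace n → ℂ}
    (ha : IsSGSymbol μ ν m₁ m₂ a) (u : SchwartzMap (RSpace n) ℂ) {φ : RSpace n → ℂ}
    (hφ : ContDiff ℝ ∞ φ) (hφc : HasCompactSupport φ) :
    opPairing a u φ = ∫ x, op a u x * φ x := by
  obtain ⟨C, hC, hbound⟩ := ha.norm_le
  obtain ⟨U, hU⟩ := exists_schwartz_hat u
  obtain ⟨K, k, hK⟩ := bracket_rpow_le (n := n) m₁
  have hcont : Continuous (fun p : RSpace n × RSpace n => a p.1 p.2) := ha.1.continuous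
  have hF : MeasureTheory.Integrable (fun p : RSpace n × RSpace n =>
      (Complex.exp (Complex.I * (inner ℝ p.2 p.1 : ℝ)) * a p.2 p.1 * φ p.2) * U p.1)
      (MeasureTheory.volume.prod MeasureTheory.volume) := by
    have h1 : MeasureTheory.Integrable (fun ξ : RSpace n => C * (K * (‖U ξ‖ + ‖ξ‖ ^ k * ‖U ξ‖))) :=
      ((U.integrable.norm.add (U.integrable_pow_mul MeasureTheory.volume k)).const_mul K).const_mul C
    have h2 : MeasureTheory.Integrable (fun x : RSpace n => bracket x ^ m₂ * ‖φ x‖) := by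
      refine Continuous.integrable_of_hasCompactSupport ?_ ?_
      · exact (continuous_bracket.rpow_const fun x => Or.inl (bracket_pos x).ne').mul
          hφ.continuous.norm
      · exact hφc.norm.mul_left
    refine (h1.mul_prod h2).mono' ?_ ?_
    · refine Continuous.aestronglyMeasurable ?_
      have e1 : Continuous (fun p : RSpace n × RSpace n => a p.2 p.1) :=
        hcont.comp continuous_swap
      have e2 := hφ.continuous
      have e3 := U.continuous
      fun_prop
    · refine Filter.Eventually.of_forall fun p => ?_
      have e : ‖Complex.exp (Complex.I * (inner ℝ p.2 p.1 : ℝ))‖ = 1 := by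
        rw [mul_comm]; exact Complex.norm_exp_ofReal_mul_I _
      rw [norm_mul, norm_mul, norm_mul, e, one_mul]
      have hb := hbound p.2 p.1
      have hk := hK p.1
      have hx : 0 < bracket p.2 ^ m₂ := Real.rpow_pos_of_pos (bracket_pos _) _
      calc ‖a p.2 p.1‖ * ‖φ p.2‖ * ‖U p.1‖
          ≤ (C * bracket p.1 ^ m₁ * bracket p.2 ^ m₂) * ‖φ p.2‖ * ‖U p.1‖ := by gcongr
        _ ≤ (C * (K * (1 + ‖p.1‖ ^ k)) * bracket p.2 ^ m₂) * ‖φ p.2‖ * ‖U p.1‖ := by gcongr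
        _ = _ := by ring
  have hswap := MeasureTheory.integral_integral_swap (f := fun ξ x : RSpace n =>
    (Complex.exp (Complex.I * (inner ℝ x ξ : ℝ)) * a x ξ * φ x) * U ξ) hF
  unfold opPairing op testTransform
  calc _ = ((2 * Real.pi : ℝ) : ℂ)⁻¹ ^ n * ∫ ξ : RSpace n, ∫ x : RSpace n,
        (Complex.exp (Complex.I * (inner ℝ x ξ : ℝ)) * a x ξ * φ x) * U ξ := by
        congr 2
        ext ξ
        rw [MeasureTheory.integral_mul_const, hU, mul_comm]
    _ = _ := by
        rw [hswap, ← MeasureTheory.integral_const_mul]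
        congr 1
        ext x
        rw [mul_assoc, ← MeasureTheory.integral_mul_const]
        congr 2
        ext ξ
        rw [hU]
        ring

/-- The restriction to the open set `Ω` of the distribution `op(a) f` is the function `v`. -/
def OpRestrictsTo {n : ℕ} (a : RSpace n → RSpace n → ℂ) (f : RSpace n → ℂ)
    (Ω : Set (RSpace n)) (v : RSpace n → ℂ) : Prop :=
  ∀ φ : RSpace n → ℂ, ContDiff ℝ ∞ φ → HasCompactSupport φ → tsupport φ ⊆ Ω →
    MeasureTheory.Integrable (fun ξ => hat f ξ * testTransform a φ ξ) ∧
      opPairing a f φ = ∫ x in Ω, v x * φ x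

/-! ### Assumption (A) -/

/-- A real vector as a complex vector. -/
def toC {n : ℕ} (ξ : RSpace n) : CSpace n := WithLp.toLp 2 (fun i => (ξ i : ℂ))

/-- The point `(ξ', z)` of `ℂ^{d+1}`, for `ξ'` in `ℝ^d` and `z` in `ℂ`. -/
def snocC {d : ℕ} (ξ' : RSpace d) (z : ℂ) : CSpace (d + 1) :=
  WithLp.toLp 2 (Fin.snoc (α := fun _ => ℂ) (fun i => (ξ' i : ℂ)) z)

/-- The function `(x, ζ) ↦ p_x(ζ) / q_x(ζ)`, rational in `ζ` for every `x`. -/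
def ratFun {n : ℕ} (p q : RSpace n → MvPolynomial (Fin n) ℂ) (x : RSpace n) (ζ : CSpace n) : ℂ :=
  MvPolynomial.eval (fun i => ζ i) (p x) / MvPolynomial.eval (fun i => ζ i) (q x)

/-- Assumption (A) on a symbol `a` of order `(m₁, m₂)` in dimension `n = d + 1`. The `j`-th
function, rational in `ξ`, is written as `p j / q j`; the fraction may always be taken in lowest
terms, and the poles are the zeros of the denominator. -/
def AssumptionA {d : ℕ} (μ ν : ℝ) (m₁ : ℤ) (m₂ : ℝ)
    (a : RSpace (d + 1) → RSpace (d + 1) → ℂ) : Prop :=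
  ∃ (p q : ℕ → RSpace (d + 1) → MvPolynomial (Fin (d + 1)) ℂ) (C D B r : ℝ),
    0 < C ∧ 0 < D ∧ 0 < r ∧ r < B ∧
    -- 1) smoothness and estimates at the real points with `|(x, ξ)| ≥ B`
    (∀ (j : ℕ) (x ξ : RSpace (d + 1)), B ≤ pairNorm x ξ →
      ContDiffAt ℝ ∞ (fun w : RSpace (d + 1) × RSpace (d + 1) =>
        ratFun (p j) (q j) w.1 (toC w.2)) (x, ξ) ∧
      ∀ α β : Fin (d + 1) → ℕ,
        ‖symDeriv ℝ β α (fun y η => ratFun (p j) (q j) y (toC η)) x ξ‖ ≤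
          C * D ^ (msum α + msum β + 2 * j) * ((j.factorial : ℝ) * mfact β) ^ ν * mfact α *
            bracket x ^ (m₂ - j - msum β) * bracket ξ ^ (m₁ - j - msum α)) ∧
    -- 2) location of the poles in the last variable
    (∀ (j : ℕ) (x : RSpace (d + 1)) (ξ' : RSpace d) (z : ℂ),
      MvPolynomial.eval (fun i => snocC ξ' z i) (q j x) = 0 → ‖z‖ ≤ r * bracket ξ') ∧
    (∀ (j : ℕ) (x : RSpace (d + 1)) (ξ' : RSpace d) (t : ℝ),
      MvPolynomial.eval (fun i => snocC ξ' (t : ℂ) i) (q j x) = 0 →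
        Real.sqrt (‖x‖ ^ 2 + ‖ξ'‖ ^ 2 + t ^ 2) ≤ B) ∧
    -- 2) smoothness and estimates on the circle of radius `B⟨ξ'⟩` in the last variable
    (∀ (j : ℕ) (x : RSpace (d + 1)) (ξ' : RSpace d) (s : ℝ),
      ContDiffAt ℝ ∞ (fun w : RSpace (d + 1) × CSpace (d + 1) =>
        ratFun (p j) (q j) w.1 w.2)
        (x, snocC ξ' (((B * bracket ξ' : ℝ) : ℂ) * Complex.exp (Complex.I * s))) ∧
      ∀ α β : Fin (d + 1) → ℕ,
        ‖symDeriv ℂ β α (ratFun (p j) (q j)) x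
            (snocC ξ' (((B * bracket ξ' : ℝ) : ℂ) * Complex.exp (Complex.I * s)))‖ ≤
          C * D ^ (msum α + msum β + 2 * j) * ((j.factorial : ℝ) * mfact β) ^ ν * mfact α *
            bracket x ^ (m₂ - j - msum β) * bracket ξ' ^ (m₁ - j - msum α)) ∧
    -- 3) estimates of the remainders
    (∀ (M : ℕ) (x ξ : RSpace (d + 1)),
      B * (M : ℝ) ^ (μ + ν - 1) ≤ max (bracket x) (bracket ξ) →
      ∀ α β : Fin (d + 1) → ℕ,
        ‖symDeriv ℝ β α
            (fun y η => a y η - ∑ j ∈ Finset.range M, ratFun (p j) (q j) y (toC η)) x ξ‖ ≤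
          C * D ^ (msum α + msum β + 2 * M) * mfact α ^ μ * mfact β ^ ν *
            (M.factorial : ℝ) ^ (μ + ν - 1) *
            bracket x ^ (m₂ - M - msum β) * bracket ξ ^ (m₁ - M - msum α))

end SGHalfSpace

end

noncomputable section

namespace SGHalfSpace

/-! ### Partial derivatives along words -/

/-! Let f be y_k^r u extended by zero; r = 0 is e^-u. The jump of f at y_n = 0 destroys the decay of
its Fourier transform in ξ_n, but only there. Tangential integration by parts still gives Gevrey
decay in ξ' (`IsGelfandShilov.exists_hatC_moment_le`). Since f lives in y_n ≤ 0, its transform also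
continues to a bounded function, holomorphic in Im ξ_n > 0. For x_n > 0 the factor e^{ixξ} is
bounded there too. Hence, for a symbol rational in ξ_n, the bad frequencies |ξ_n| > R can be moved
to the upper half circle of radius R. All frequencies on it are O(R), and differentiation in x is
harmless. Assumption (A) says that the symbol is of this kind up to remainders of low order.

To control S derivatives, M = S + M₀ terms of the expansion are used, with a contour of radius R(ξ')
comparable to ⟨ξ'⟩ + M^{μ+ν-1}. The operator then splits into the pieces of
`IsRatExpansion.density`.

Frequencies with |ξ_n| ≤ R (`exists_oscData_inside`): S derivatives cost R^S. The part ⟨ξ'⟩^S is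
paid by the decay in ξ'. The part M^{(μ+ν-1)S} is O(A^S S!^θ), because θ ≥ μ+ν-1.

The remainder on |ξ_n| > R (`IsRatExpansion.exists_oscData_rem`): its order m₁ - M - l leaves an
integrable function after S derivatives, and its constant M!^{μ+ν-1} is admissible.

The terms a_j on the arc (`IsRatExpansion.exists_oscData_arc`): the available complex estimates are
those on the circle |z| = B⟨ξ'⟩. The Cauchy formula in the exterior of that disc
(`IsRatExpansion.real_eq_integral`) carries them to the arc. The gain R^{-j} swallows j!^ν.

The half-line integrals of the a_j need not converge absolutely. A factor (1 - iεξ_n)^{-K},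
holomorphic and bounded by 1 in the upper half-plane, legitimises Fubini and the change of contour
(`IsRatExpansion.integral_halflines_term`). It is removed by letting ε tend to 0
(`IsRatExpansion.pairing_eq_integral`). Altogether `exists_density` yields, for each S, a density of
class C^S with Gevrey bounds whose constants do not depend on S.

Decay in x comes from commutation: x_k op(b) f = op(b)(y_k f) + i op(∂_{ξ_k} b) f
(`pairing_coord_mul`). Repeating this N times gives 2^N terms with l derivatives of the symbol and r
moments of u, l + r = N, each costing l!^θ r!^θ ≤ N!^θ (`exists_density_coord_pow`). Densities of
one distribution agree (`eqOn_of_integral_mul_test`), so all of them are x_k^N v for a single smooth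
v (`exists_smooth_density`). Commuting powers with derivatives
(`norm_wderiv_coord_pow_mul_wderiv_le`) and spending a few more powers on the factor ⟨x⟩^{m₂}
(`isGelfandShilov_of_coord_pow`) gives the claim. -/

/-- The iterated partial derivative `∂_{i₁} ⋯ ∂_{iₖ} f` along the word `[i₁, …, iₖ]`. -/
def wderiv {n : ℕ} (W : List (Fin n)) (f : RSpace n → ℂ) : RSpace n → ℂ :=
  W.foldr (fun i g => pderiv ℝ i g) f

@[simp] theorem wderiv_nil {n : ℕ} (f : RSpace n → ℂ) : wderiv [] f = f := rfl

@[simp] theorem wderiv_cons {n : ℕ} (i : Fin n) (W : List (Fin n)) (f : RSpace n → ℂ) :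
    wderiv (i :: W) f = pderiv ℝ i (wderiv W f) := rfl

theorem wderiv_append {n : ℕ} (V W : List (Fin n)) (f : RSpace n → ℂ) :
    wderiv (V ++ W) f = wderiv V (wderiv W f) := by
  simp [wderiv, List.foldr_append]

theorem wderiv_replicate {n : ℕ} (i : Fin n) (k : ℕ) (f : RSpace n → ℂ) :
    wderiv (List.replicate k i) f = (pderiv ℝ i)^[k] f := by
  induction k with
  | zero => rfl
  | succ k ih => rw [List.replicate_succ, wderiv_cons, ih, Function.iterate_succ_apply']

theorem pderiv_congr {n : ℕ} {U : Set (RSpace n)} (hU : IsOpen U) (i : Fin n)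
    {f g : RSpace n → ℂ} (h : Set.EqOn f g U) : Set.EqOn (pderiv ℝ i f) (pderiv ℝ i g) U := by
  intro x hx
  have : f =ᶠ[nhds x] g := Filter.eventuallyEq_of_mem (hU.mem_nhds hx) h
  simp only [pderiv, this.fderiv_eq]

theorem wderiv_congr {n : ℕ} {U : Set (RSpace n)} (hU : IsOpen U) (W : List (Fin n))
    {f g : RSpace n → ℂ} (h : Set.EqOn f g U) : Set.EqOn (wderiv W f) (wderiv W g) U := by
  induction W with
  | nil => exact h
  | cons i W ih => exact pderiv_congr hU i ih

theorem contDiffOn_pderiv {n : ℕ} {U : Set (RSpace n)} (hU : IsOpen U) (i : Fin n)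
    {f : RSpace n → ℂ} {k m : WithTop ℕ∞} (h : ContDiffOn ℝ k f U) (hm : m + 1 ≤ k) :
    ContDiffOn ℝ m (pderiv ℝ i f) U :=
  (h.fderiv_of_isOpen hU hm).clm_apply contDiffOn_const

theorem contDiffOn_wderiv {n : ℕ} {U : Set (RSpace n)} (hU : IsOpen U) (W : List (Fin n))
    {f : RSpace n → ℂ} (h : ContDiffOn ℝ ∞ f U) : ContDiffOn ℝ ∞ (wderiv W f) U := by
  induction W with
  | nil => exact h
  | cons i W ih => exact contDiffOn_pderiv hU i ih (by simp)

theorem contDiff_pderiv {n : ℕ} (i : Fin n) {f : RSpace n → ℂ} (h : ContDiff ℝ ∞ f) :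
    ContDiff ℝ ∞ (pderiv ℝ i f) :=
  contDiffOn_univ.1 (contDiffOn_pderiv isOpen_univ i h.contDiffOn (by simp))

theorem pderiv_comm {n : ℕ} {U : Set (RSpace n)} (hU : IsOpen U) (i j : Fin n)
    {f : RSpace n → ℂ} (h : ContDiffOn ℝ ∞ f U) :
    Set.EqOn (pderiv ℝ i (pderiv ℝ j f)) (pderiv ℝ j (pderiv ℝ i f)) U := by
  intro x hx
  have hx' : ContDiffAt ℝ ∞ f x := h.contDiffAt (hU.mem_nhds hx)
  have hs : IsSymmSndFDerivAt ℝ f x := hx'.isSymmSndFDerivAt (by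
    rw [minSmoothness_of_isRCLikeNormedField]
    exact WithTop.coe_le_coe.2 (le_top : (2 : ℕ∞) ≤ ⊤))
  have hd : DifferentiableAt ℝ (fderiv ℝ f) x :=
    (hx'.fderiv_right (m := 1) (by norm_cast)).differentiableAt (by simp)
  have key : ∀ v w : RSpace n, fderiv ℝ (fun y => fderiv ℝ f y v) x w
      = fderiv ℝ (fderiv ℝ f) x w v := by
    intro v w
    rw [fderiv_clm_apply hd (differentiableAt_const v)]
    simp
  unfold pderiv
  rw [key, key]
  exact hs _ _

/-- Permutations of words are generated by swaps of adjacent letters, and each swap is the symmetry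
of second derivatives. -/
theorem wderiv_perm {n : ℕ} {U : Set (RSpace n)} (hU : IsOpen U) {V W : List (Fin n)}
    (hp : V.Perm W) {f : RSpace n → ℂ} (h : ContDiffOn ℝ ∞ f U) :
    Set.EqOn (wderiv V f) (wderiv W f) U := by
  induction hp with
  | nil => exact fun _ _ => rfl
  | cons i _ ih => exact pderiv_congr hU i ih
  | swap i j l => exact pderiv_comm hU j i (contDiffOn_wderiv hU l h)
  | trans _ _ ih1 ih2 => exact ih1.trans ih2

/-- The sorted word with `α i` letters `i`. -/
def mword {n : ℕ} (α : Fin n → ℕ) : List (Fin n) :=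
  (List.finRange n).flatMap fun i => List.replicate (α i) i

theorem mderiv_eq_wderiv {n : ℕ} (α : Fin n → ℕ) (f : RSpace n → ℂ) :
    mderiv ℝ α f = wderiv (mword α) f := by
  unfold mderiv mword
  induction List.finRange n with
  | nil => rfl
  | cons i l ih => rw [List.foldr_cons, ih, List.flatMap_cons, wderiv_append, wderiv_replicate]

theorem length_mword {n : ℕ} (α : Fin n → ℕ) : (mword α).length = msum α := by
  simp [mword, msum, List.length_flatMap, ← List.ofFn_eq_map, List.sum_ofFn]

theorem count_mword {n : ℕ} (α : Fin n → ℕ) (i : Fin n) : (mword α).count i = α i := by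
  unfold mword
  rw [List.count_flatMap, ← List.ofFn_eq_map, List.sum_ofFn]
  simp [List.count_replicate]

theorem msum_count {n : ℕ} (W : List (Fin n)) : msum (fun i => W.count i) = W.length := by
  rw [← length_mword]
  refine List.Perm.length_eq ?_
  rw [List.perm_iff_count]
  intro i
  rw [count_mword]

/-- On smooth functions, the derivative along a word depends only on the multi-index. -/
theorem wderiv_eq_mderiv {n : ℕ} {U : Set (RSpace n)} (hU : IsOpen U) (W : List (Fin n))
    {f : RSpace n → ℂ} (h : ContDiffOn ℝ ∞ f U) {x : RSpace n} (hx : x ∈ U) :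
    wderiv W f x = mderiv ℝ (fun i => W.count i) f x := by
  rw [mderiv_eq_wderiv]
  refine wderiv_perm hU ?_ h hx
  rw [List.perm_iff_count]
  intro i
  rw [count_mword]

/-! ### Multi-index combinatorics and elementary inequalities for the bracket -/

theorem mderiv_single {n : ℕ} (𝕜 : Type) [RCLike 𝕜] [NormedSpace 𝕜 ℂ] (k : Fin n) (l : ℕ)
    (f : EuclideanSpace 𝕜 (Fin n) → ℂ) :
    mderiv 𝕜 (Pi.single k l) f = (pderiv 𝕜 k)^[l] f := by
  have aux : ∀ L : List (Fin n), L.Nodup →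
      L.foldr (fun i g => (pderiv 𝕜 i)^[(Pi.single k l : Fin n → ℕ) i] g) f
        = if k ∈ L then (pderiv 𝕜 k)^[l] f else f := by
    intro L
    induction L with
    | nil => simp
    | cons i L ih =>
      intro hL
      rw [List.nodup_cons] at hL
      rw [List.foldr_cons, ih hL.2]
      by_cases hik : i = k
      · subst hik
        simp [hL.1]
      · have : k ≠ i := fun h => hik h.symm
        simp [hik, this]
  rw [mderiv, aux _ (List.nodup_finRange n)]
  simp

theorem msum_single {n : ℕ} (k : Fin n) (l : ℕ) : msum (Pi.single k l) = l := by
  simp [msum]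

theorem mfact_single {n : ℕ} (k : Fin n) (l : ℕ) : mfact (Pi.single k l) = l.factorial := by
  unfold mfact
  rw [Finset.prod_eq_single k]
  · simp
  · intro b _ hb; simp [hb]
  · simp

theorem mfact_pos {n : ℕ} (α : Fin n → ℕ) : 0 < mfact α :=
  Finset.prod_pos fun i _ => by exact_mod_cast (α i).factorial_pos

theorem mfact_le {n : ℕ} (α : Fin n → ℕ) : mfact α ≤ (msum α).factorial := by
  unfold mfact msum
  exact_mod_cast Nat.le_of_dvd (Nat.factorial_pos _)
    (Nat.prod_factorial_dvd_factorial_sum Finset.univ α)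

/-- The multinomial coefficient |α|!/α! is one summand in the expansion of (1 + ⋯ + 1)^{|α|} =
n^{|α|}. -/
theorem factorial_msum_le {n : ℕ} (α : Fin n → ℕ) :
    ((msum α).factorial : ℝ) ≤ (n : ℝ) ^ msum α * mfact α := by
  have h1 := Nat.multinomial_spec Finset.univ α
  have h2 : Nat.multinomial Finset.univ α ≤ n ^ msum α := by
    have h3 := Finset.sum_pow_eq_sum_piAntidiag Finset.univ (fun _ : Fin n => (1 : ℕ)) (msum α)
    simp only [Finset.sum_const, Finset.card_univ, Fintype.card_fin, smul_eq_mul, mul_one,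
      one_pow, Finset.prod_const_one] at h3
    rw [h3]
    refine Finset.single_le_sum (f := fun k => Nat.multinomial Finset.univ k)
      (fun _ _ => Nat.zero_le _) ?_
    simp [msum]
  unfold mfact
  have h3 : (msum α).factorial ≤ n ^ msum α * ∏ i, (α i).factorial := by
    rw [msum, ← h1, mul_comm]
    exact Nat.mul_le_mul_right _ h2
  exact_mod_cast h3

theorem bracket_ge_one {n : ℕ} (x : RSpace n) : 1 ≤ bracket x :=
  Real.one_le_sqrt.mpr (by nlinarith [sq_nonneg ‖x‖])

theorem norm_le_bracket {n : ℕ} (x : RSpace n) : ‖x‖ ≤ bracket x :=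
  Real.le_sqrt_of_sq_le (by linarith)

theorem abs_apply_le_norm {n : ℕ} (x : RSpace n) (i : Fin n) : |x i| ≤ ‖x‖ := by
  simpa using PiLp.norm_apply_le x i

theorem abs_apply_le_bracket {n : ℕ} (x : RSpace n) (i : Fin n) : |x i| ≤ bracket x :=
  (abs_apply_le_norm x i).trans (norm_le_bracket x)

theorem bracket_le_one_add_norm {n : ℕ} (x : RSpace n) : bracket x ≤ 1 + ‖x‖ :=
  Real.sqrt_le_iff.mpr ⟨by positivity, by nlinarith [norm_nonneg x]⟩

/-- The largest coordinate dominates |x|/n, so powers of single coordinates are the only monomial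
weights ever needed. The summand 1 keeps the inequality true for n = 0 and N = 0. -/
theorem norm_mul_pow_le_sum {n : ℕ} (x : RSpace n) (N : ℕ) :
    ‖x‖ ^ N ≤ (n : ℝ) ^ N * (∑ i, |x i| ^ N + 1) := by
  have h1 : ‖x‖ ≤ ∑ i, |x i| := by
    rw [EuclideanSpace.norm_eq]
    refine Real.sqrt_le_iff.mpr ⟨by positivity, ?_⟩
    simpa using Finset.sum_sq_le_sq_sum_of_nonneg (s := Finset.univ) (f := fun i => |x i|)
      (fun i _ => abs_nonneg _)
  rcases Nat.eq_zero_or_pos n with rfl | hn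
  · have : ‖x‖ ≤ 0 := by simpa using h1
    have h0 : ‖x‖ = 0 := le_antisymm this (norm_nonneg _)
    rw [h0]
    rcases Nat.eq_zero_or_pos N with rfl | hN
    · simp
    · simp [hN.ne']
  · obtain ⟨k, hk⟩ : ∃ k : Fin n, ∀ i, |x i| ≤ |x k| := by
      have : Nonempty (Fin n) := ⟨⟨0, hn⟩⟩
      exact Finite.exists_max (fun i => |x i|)
    have h2 : ‖x‖ ≤ n * |x k| := by
      refine h1.trans ?_
      calc ∑ i, |x i| ≤ ∑ _i : Fin n, |x k| := Finset.sum_le_sum fun i _ => hk i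
        _ = n * |x k| := by simp
    calc ‖x‖ ^ N ≤ (n * |x k|) ^ N := pow_le_pow_left₀ (norm_nonneg _) h2 _
      _ = (n : ℝ) ^ N * |x k| ^ N := mul_pow _ _ _
      _ ≤ (n : ℝ) ^ N * (∑ i, |x i| ^ N + 1) := by
        gcongr
        have := Finset.single_le_sum (f := fun i => |x i| ^ N) (s := Finset.univ)
          (fun i _ => by positivity) (Finset.mem_univ k)
        simp only at this
        linarith

end SGHalfSpace

end


noncomputable section

namespace SGHalfSpace

open MeasureTheory

/-! ### Differentiation under the integral sign -/

theorem wderiv_add {n : ℕ} {U : Set (RSpace n)} (hU : IsOpen U) (W : List (Fin n))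
    {f g : RSpace n → ℂ} (hf : ContDiffOn ℝ ∞ f U) (hg : ContDiffOn ℝ ∞ g U) :
    Set.EqOn (wderiv W (fun x => f x + g x)) (fun x => wderiv W f x + wderiv W g x) U := by
  induction W with
  | nil => exact fun _ _ => rfl
  | cons i W ih =>
    intro x hx
    rw [wderiv_cons, pderiv_congr hU i ih hx]
    have h1 := ((contDiffOn_wderiv hU W hf).contDiffAt (hU.mem_nhds hx)).differentiableAt
      (by simp)
    have h2 := ((contDiffOn_wderiv hU W hg).contDiffAt (hU.mem_nhds hx)).differentiableAt
      (by simp)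
    simp only [pderiv, wderiv_cons]
    rw [fderiv_fun_add h1 h2]
    rfl

theorem wderiv_const_mul {n : ℕ} {U : Set (RSpace n)} (hU : IsOpen U) (W : List (Fin n)) (c : ℂ)
    {f : RSpace n → ℂ} (hf : ContDiffOn ℝ ∞ f U) :
    Set.EqOn (wderiv W (fun x => c * f x)) (fun x => c * wderiv W f x) U := by
  induction W with
  | nil => exact fun _ _ => rfl
  | cons i W ih =>
    intro x hx
    rw [wderiv_cons, pderiv_congr hU i ih hx]
    have h1 := ((contDiffOn_wderiv hU W hf).contDiffAt (hU.mem_nhds hx)).differentiableAt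
      (by simp)
    simp only [pderiv, wderiv_cons]
    rw [fderiv_const_mul h1]
    rfl

theorem clm_eq_sum {n : ℕ} (A : RSpace n →L[ℝ] ℂ) :
    A = ∑ i, (EuclideanSpace.proj i : RSpace n →L[ℝ] ℝ).smulRight
      (A (EuclideanSpace.single i 1)) := by
  ext x
  have hx : x = ∑ i, x i • EuclideanSpace.single i (1 : ℝ) := by
    ext j
    simp [Finset.sum_apply, Pi.single_apply]
  conv_lhs => rw [hx]
  simp

theorem norm_clm_le {n : ℕ} (A : RSpace n →L[ℝ] ℂ) (c : ℝ)
    (h : ∀ i, ‖A (EuclideanSpace.single i 1)‖ ≤ c) : ‖A‖ ≤ n * c := by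
  rw [clm_eq_sum A]
  refine (norm_sum_le _ _).trans ?_
  calc _ ≤ ∑ _i : Fin n, c := by
        refine Finset.sum_le_sum fun i _ => ?_
        refine (ContinuousLinearMap.opNorm_le_bound _ ((norm_nonneg _).trans (h i)) fun x => ?_)
        simp only [ContinuousLinearMap.smulRight_apply, PiLp.proj_apply, norm_smul]
        rw [mul_comm]
        exact mul_le_mul (h i) (PiLp.norm_apply_le x i) (norm_nonneg _)
          ((norm_nonneg _).trans (h i))
    _ = n * c := by simp

/-- The derivative is the limit of difference quotients along the steps 1/(k+1), so measurability in
`t` at each fixed point passes to derivatives without any joint measurability. -/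
theorem aestronglyMeasurable_pderiv {n : ℕ} {T : Type*} [MeasurableSpace T] {m : Measure T}
    {h : T → RSpace n → ℂ} (hmeas : ∀ x, AEStronglyMeasurable (fun t => h t x) m)
    (hsm : ∀ᵐ t ∂m, ContDiff ℝ ∞ (h t)) (i : Fin n) (x : RSpace n) :
    AEStronglyMeasurable (fun t => pderiv ℝ i (h t) x) m := by
  have hlim : Filter.Tendsto (fun k : ℕ => ((k : ℝ) + 1)⁻¹) Filter.atTop (nhdsWithin 0 {0}ᶜ) := by
    rw [tendsto_nhdsWithin_iff]
    refine ⟨?_, Filter.Eventually.of_forall fun k => ?_⟩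
    · simpa using tendsto_one_div_add_atTop_nhds_zero_nat (𝕜 := ℝ)
    · simp only [Set.mem_compl_iff, Set.mem_singleton_iff]
      positivity
  refine aestronglyMeasurable_of_tendsto_ae (u := Filter.atTop)
    (f := fun (k : ℕ) t => (((k : ℝ) + 1)⁻¹)⁻¹ •
      (h t (x + (((k : ℝ) + 1)⁻¹) • EuclideanSpace.single i 1) - h t x)) ?_ ?_
  · intro k
    exact ((hmeas _).sub (hmeas _)).const_smul (((k : ℝ) + 1)⁻¹)⁻¹
  · filter_upwards [hsm] with t ht
    have hd : HasLineDerivAt ℝ (h t) (pderiv ℝ i (h t) x) x (EuclideanSpace.single i 1) :=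
      ((ht.differentiable (by simp)) x).hasFDerivAt.hasLineDerivAt _
    exact hd.tendsto_slope_zero.comp hlim

/-- The majorant has the product form H(t) P(x). As P is continuous it is locally bounded, and this
gives the local domination needed to differentiate under the integral sign, once per induction step.
-/
theorem contDiffOn_integral {n : ℕ} {T : Type*} [MeasurableSpace T] {m : Measure T}
    {Ω : Set (RSpace n)} (hΩ : IsOpen Ω) {P : RSpace n → ℝ} (hP : Continuous P) (S : ℕ) :
    ∀ (h : T → RSpace n → ℂ) (H : ℕ → T → ℝ), (∀ s ≤ S, Integrable (H s) m) →
      (∀ x, AEStronglyMeasurable (fun t => h t x) m) → (∀ᵐ t ∂m, ContDiff ℝ ∞ (h t)) →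
      (∀ᵐ t ∂m, ∀ W : List (Fin n), W.length ≤ S → ∀ x ∈ Ω,
        ‖wderiv W (h t) x‖ ≤ H W.length t * P x) →
      ContDiffOn ℝ S (fun x => ∫ t, h t x ∂m) Ω ∧
        ∀ W : List (Fin n), W.length ≤ S → ∀ x ∈ Ω,
          wderiv W (fun x => ∫ t, h t x ∂m) x = ∫ t, wderiv W (h t) x ∂m := by
  have bnd : ∀ x₀ : RSpace n, ∀ᶠ x in nhds x₀, |P x| ≤ |P x₀| + 1 := fun x₀ =>
    (hP.abs.tendsto x₀).eventually_le_const (by linarith)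
  have bnd' : ∀ {a b c d : ℝ}, a ≤ b * c → |c| ≤ d → a ≤ |b| * d := by
    intro a b c d h1 h2
    calc a ≤ b * c := h1
      _ ≤ |b * c| := le_abs_self _
      _ = |b| * |c| := abs_mul _ _
      _ ≤ |b| * d := by gcongr
  induction S with
  | zero =>
    intro h H hH hmeas hsm hb
    refine ⟨?_, ?_⟩
    · rw [Nat.cast_zero, contDiffOn_zero]
      intro x₀ hx₀
      refine ContinuousAt.continuousWithinAt ?_
      refine continuousAt_of_dominated (bound := fun t => |H 0 t| * (|P x₀| + 1))
        (Filter.Eventually.of_forall hmeas) ?_ (((hH 0 le_rfl).abs).mul_const _) ?_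
      · filter_upwards [bnd x₀, hΩ.mem_nhds hx₀] with x hx hxΩ
        filter_upwards [hb] with t ht
        exact bnd' (ht [] (by simp) x hxΩ) hx
      · filter_upwards [hsm] with t ht
        exact ht.continuous.continuousAt
    · intro W hW x hx
      obtain rfl : W = [] := List.length_eq_zero_iff.1 (by omega)
      rfl
  | succ S ih =>
    intro h H hH hmeas hsm hb
    have hder : ∀ x₀ ∈ Ω, HasFDerivAt (fun x => ∫ t, h t x ∂m)
        (∫ t, fderiv ℝ (h t) x₀ ∂m) x₀ ∧ Integrable (fun t => fderiv ℝ (h t) x₀) m := by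
      intro x₀ hx₀
      have hfm : AEStronglyMeasurable (fun t => fderiv ℝ (h t) x₀) m := by
        have : (fun t => fderiv ℝ (h t) x₀) = fun t => ∑ i,
            (ContinuousLinearMap.smulRightL ℝ (RSpace n) ℂ
              (EuclideanSpace.proj i : RSpace n →L[ℝ] ℝ)) (pderiv ℝ i (h t) x₀) := by
          ext1 t
          exact clm_eq_sum _
        rw [this]
        refine Finset.aestronglyMeasurable_fun_sum _ fun i _ => ?_
        exact (ContinuousLinearMap.continuous _).comp_aestronglyMeasurable
          (aestronglyMeasurable_pderiv hmeas hsm i x₀)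
      have hbd : ∀ᵐ t ∂m, ∀ x ∈ {x | |P x| ≤ |P x₀| + 1} ∩ Ω,
          ‖fderiv ℝ (h t) x‖ ≤ n * (|H 1 t| * (|P x₀| + 1)) := by
        filter_upwards [hb] with t ht x hx
        refine norm_clm_le _ _ fun i => ?_
        exact bnd' (ht [i] (by simp) x hx.2) hx.1
      have hbi : Integrable (fun t => n * (|H 1 t| * (|P x₀| + 1))) m :=
        (((hH 1 (by omega)).abs).mul_const _).const_mul _
      have hs : {x | |P x| ≤ |P x₀| + 1} ∩ Ω ∈ nhds x₀ :=
        Filter.inter_mem (bnd x₀) (hΩ.mem_nhds hx₀)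
      refine ⟨hasFDerivAt_integral_of_dominated_of_fderiv_le
        (F' := fun x t => fderiv ℝ (h t) x) hs (Filter.Eventually.of_forall hmeas) ?_ hfm hbd
        hbi ?_, ?_⟩
      · refine Integrable.mono' ((((hH 0 (by omega)).abs).mul_const (|P x₀| + 1))) (hmeas _) ?_
        filter_upwards [hb] with t ht
        exact bnd' (ht [] (by simp) x₀ hx₀) (by linarith)
      · filter_upwards [hsm] with t ht x _
        exact ((ht.differentiable (by simp)) x).hasFDerivAt
      · refine Integrable.mono' hbi hfm ?_
        filter_upwards [hbd] with t ht
        exact ht x₀ (mem_of_mem_nhds hs)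
    have hpd : ∀ i : Fin n, Set.EqOn (pderiv ℝ i (fun x => ∫ t, h t x ∂m))
        (fun x => ∫ t, pderiv ℝ i (h t) x ∂m) Ω := by
      intro i x hx
      obtain ⟨h1, h2⟩ := hder x hx
      simp only [pderiv]
      rw [h1.fderiv, ContinuousLinearMap.integral_apply h2]
    -- The family ∂_i h satisfies the same hypotheses with one derivative fewer, hence with the
    -- majorants shifted by one.
    have ih' := fun i : Fin n => ih (fun t => pderiv ℝ i (h t)) (fun s => H (s + 1))
      (fun s hs => hH _ (by omega)) (aestronglyMeasurable_pderiv hmeas hsm i)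
      (by filter_upwards [hsm] with t ht using contDiff_pderiv i ht)
      (by
        filter_upwards [hb] with t ht W hW x hx
        have := ht (W ++ [i]) (by simp; omega) x hx
        rwa [wderiv_append, List.length_append] at this)
    refine ⟨?_, ?_⟩
    · rw [Nat.cast_succ, contDiffOn_succ_iff_fderiv_of_isOpen hΩ]
      refine ⟨fun x hx => (hder x hx).1.differentiableAt.differentiableWithinAt, by simp, ?_⟩
      have : fderiv ℝ (fun x => ∫ t, h t x ∂m) = fun x => ∑ i,
          (ContinuousLinearMap.smulRightL ℝ (RSpace n) ℂ
            (EuclideanSpace.proj i : RSpace n →L[ℝ] ℝ))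
            (pderiv ℝ i (fun x => ∫ t, h t x ∂m) x) := by
        ext1 x
        exact clm_eq_sum _
      rw [this]
      refine ContDiffOn.sum fun i _ => ?_
      refine (ContinuousLinearMap.contDiff _).comp_contDiffOn ?_
      exact ((ih' i).1).congr (hpd i)
    · intro W hW x hx
      rcases List.eq_nil_or_concat W with rfl | ⟨V, i, rfl⟩
      · rfl
      · rw [List.concat_eq_append, wderiv_append]
        have h1 := wderiv_congr hΩ V (hpd i) hx
        simp only [wderiv_cons, wderiv_nil] at h1 ⊢
        rw [h1, (ih' i).2 V (by simp at hW; omega) x hx]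
        simp [wderiv_append]

/-! ### Oscillatory factors -/

/-- The bilinear product `x · ζ` of a real and a complex vector. -/
def cdot {n : ℕ} (x : RSpace n) (ζ : CSpace n) : ℂ := ∑ i, (x i : ℂ) * ζ i

/-- `(∂_{i₁} + i ζ_{i₁}) ⋯ (∂_{iₖ} + i ζ_{iₖ}) g` for the word `[i₁, …, iₖ]`. -/
def twisted {n : ℕ} (ζ : CSpace n) (W : List (Fin n)) (g : RSpace n → ℂ) : RSpace n → ℂ :=
  W.foldr (fun i g' x => Complex.I * ζ i * g' x + pderiv ℝ i g' x) g

theorem contDiff_twisted {n : ℕ} (ζ : CSpace n) (W : List (Fin n)) {g : RSpace n → ℂ}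
    (hg : ContDiff ℝ ∞ g) : ContDiff ℝ ∞ (twisted ζ W g) := by
  induction W with
  | nil => exact hg
  | cons i W ih => exact (contDiff_const.mul ih).add (contDiff_pderiv i ih)

/-- A letter either multiplies by iζ_i, which costs Z, or differentiates g, which costs qZ; so each
letter contributes (1 + q)Z. Measuring derivatives of the amplitude in units of the frequency bound
Z keeps the result geometric in the length of the word. -/
theorem norm_wderiv_twisted_le {n : ℕ} {ζ : CSpace n} {g : RSpace n → ℂ} (hg : ContDiff ℝ ∞ g)
    {S : ℕ} {x : RSpace n} {A q Z : ℝ} (hZ : ∀ i, ‖ζ i‖ ≤ Z)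
    (h : ∀ V : List (Fin n), V.length ≤ S → ‖wderiv V g x‖ ≤ A * (q * Z) ^ V.length)
    (W : List (Fin n)) : ∀ V : List (Fin n), V.length + W.length ≤ S →
      ‖wderiv V (twisted ζ W g) x‖ ≤ A * (q * Z) ^ V.length * ((1 + q) * Z) ^ W.length := by
  induction W with
  | nil => intro V hV; simpa [twisted] using h V (by simpa using hV)
  | cons i W ih =>
    intro V hV
    have hs := contDiff_twisted ζ W hg
    have e : wderiv V (twisted ζ (i :: W) g) x
        = Complex.I * ζ i * wderiv V (twisted ζ W g) x
          + wderiv (V ++ [i]) (twisted ζ W g) x := by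
      have h1 := wderiv_add isOpen_univ V (contDiff_const.mul hs :
        ContDiff ℝ ∞ fun x => Complex.I * ζ i * twisted ζ W g x).contDiffOn
        (contDiff_pderiv i hs).contDiffOn (Set.mem_univ x)
      have h2 := wderiv_const_mul isOpen_univ V (Complex.I * ζ i) hs.contDiffOn (Set.mem_univ x)
      rw [wderiv_append]
      simp only [wderiv_cons, wderiv_nil]
      beta_reduce at h1 h2
      rw [← h2, ← h1]
      rfl
    rw [e]
    simp only [List.length_cons] at hV ⊢
    have b1 := ih V (by omega)
    have b2 := ih (V ++ [i]) (by simp; omega)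
    rw [List.length_append, List.length_singleton] at b2
    refine (norm_add_le _ _).trans ?_
    rw [norm_mul, norm_mul, Complex.norm_I, one_mul]
    have hZ0 : 0 ≤ Z := (norm_nonneg _).trans (hZ i)
    calc ‖ζ i‖ * ‖wderiv V (twisted ζ W g) x‖ + ‖wderiv (V ++ [i]) (twisted ζ W g) x‖
        ≤ Z * (A * (q * Z) ^ V.length * ((1 + q) * Z) ^ W.length)
          + A * (q * Z) ^ (V.length + 1) * ((1 + q) * Z) ^ W.length :=
        add_le_add (mul_le_mul (hZ i) b1 (norm_nonneg _) hZ0) b2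
      _ = _ := by ring

theorem cdot_add {n : ℕ} (x y : RSpace n) (ζ : CSpace n) :
    cdot (x + y) ζ = cdot x ζ + cdot y ζ := by
  simp [cdot, add_mul, Finset.sum_add_distrib]

theorem cdot_smul {n : ℕ} (c : ℝ) (x : RSpace n) (ζ : CSpace n) :
    cdot (c • x) ζ = c * cdot x ζ := by
  simp [cdot, Finset.mul_sum, mul_assoc]

/-- `x ↦ x · ζ` as a continuous linear map. -/
def cdotL {n : ℕ} (ζ : CSpace n) : RSpace n →L[ℝ] ℂ :=
  LinearMap.toContinuousLinearMap
    { toFun := fun x => cdot x ζ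
      map_add' := fun x y => cdot_add x y ζ
      map_smul' := fun c x => by simp [cdot_smul] }

@[simp] theorem cdotL_apply {n : ℕ} (ζ : CSpace n) (x : RSpace n) : cdotL ζ x = cdot x ζ := rfl

theorem cdot_single {n : ℕ} (i : Fin n) (ζ : CSpace n) :
    cdot (EuclideanSpace.single i 1) ζ = ζ i := by
  simp [cdot, apply_ite]

theorem hasFDerivAt_cexp_cdot {n : ℕ} (ζ : CSpace n) (c : ℂ) (x : RSpace n) :
    HasFDerivAt (fun x => Complex.exp (c * cdot x ζ))
      (Complex.exp (c * cdot x ζ) • (c • cdotL ζ)) x := by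
  have h : HasFDerivAt (fun x => c * cdot x ζ) (c • cdotL ζ) x :=
    ((cdotL ζ).hasFDerivAt).const_mul c
  exact h.cexp

theorem contDiff_cexp_cdot {n : ℕ} (ζ : CSpace n) (c : ℂ) :
    ContDiff ℝ ∞ (fun x : RSpace n => Complex.exp (c * cdot x ζ)) := by
  have : ContDiff ℝ ∞ (fun x : RSpace n => cdot x ζ) := (cdotL ζ).contDiff
  exact (contDiff_const.mul this).cexp

theorem wderiv_cexp_mul {n : ℕ} (ζ : CSpace n) (W : List (Fin n)) {g : RSpace n → ℂ}
    (hg : ContDiff ℝ ∞ g) :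
    wderiv W (fun x => Complex.exp (Complex.I * cdot x ζ) * g x)
      = fun x => Complex.exp (Complex.I * cdot x ζ) * twisted ζ W g x := by
  induction W with
  | nil => rfl
  | cons i W ih =>
    ext x
    rw [wderiv_cons, ih]
    have hd := ((contDiff_twisted ζ W hg).differentiable (by simp) x).hasFDerivAt
    have := (hasFDerivAt_cexp_cdot ζ Complex.I x).fun_mul hd
    simp only [pderiv]
    rw [this.fderiv]
    simp only [twisted, List.foldr_cons, pderiv, add_apply,
      smul_apply, cdotL_apply, cdot_single, smul_eq_mul]
    ring

/-- Integrals of oscillating families `e^{i x·ζ(t)} g_t(x) wt(t)`. -/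
theorem contDiffOn_oscillatory {n : ℕ} {T : Type*} [MeasurableSpace T] {m : Measure T}
    {Ω : Set (RSpace n)} (hΩ : IsOpen Ω) {P : RSpace n → ℝ} (hP : Continuous P) {S : ℕ}
    {ζ : T → CSpace n} {g : T → RSpace n → ℂ} {wt : T → ℂ} {G Z : T → ℝ} {q : ℝ}
    (hmeas : ∀ x, AEStronglyMeasurable
      (fun t => Complex.exp (Complex.I * cdot x (ζ t)) * g t x * wt t) m)
    (hexp : ∀ᵐ t ∂m, ∀ x ∈ Ω, ‖Complex.exp (Complex.I * cdot x (ζ t))‖ ≤ 1)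
    (hsm : ∀ᵐ t ∂m, ContDiff ℝ ∞ (g t)) (hζ : ∀ᵐ t ∂m, ∀ i, ‖ζ t i‖ ≤ Z t)
    (hg : ∀ᵐ t ∂m, ∀ V : List (Fin n), V.length ≤ S → ∀ x ∈ Ω,
      ‖wderiv V (g t) x‖ ≤ G t * P x * (q * Z t) ^ V.length)
    (hint : ∀ s ≤ S, Integrable (fun t => ‖wt t‖ * G t * Z t ^ s) m) :
    ContDiffOn ℝ S (fun x => ∫ t, Complex.exp (Complex.I * cdot x (ζ t)) * g t x * wt t ∂m) Ω ∧
      ∀ W : List (Fin n), W.length ≤ S → ∀ x ∈ Ω,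
        ‖wderiv W (fun x => ∫ t, Complex.exp (Complex.I * cdot x (ζ t)) * g t x * wt t ∂m) x‖
          ≤ (1 + q) ^ W.length * (∫ t, ‖wt t‖ * G t * Z t ^ W.length ∂m) * P x := by
  have hb : ∀ᵐ t ∂m, ∀ W : List (Fin n), W.length ≤ S → ∀ x ∈ Ω,
      ‖wderiv W (fun x => Complex.exp (Complex.I * cdot x (ζ t)) * g t x * wt t) x‖
        ≤ ((1 + q) ^ W.length * (‖wt t‖ * G t * Z t ^ W.length)) * P x := by
    filter_upwards [hexp, hsm, hζ, hg] with t h1 h2 h3 h4 W hW x hx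
    have e1 : (fun x => Complex.exp (Complex.I * cdot x (ζ t)) * g t x * wt t)
        = fun x => wt t * (Complex.exp (Complex.I * cdot x (ζ t)) * g t x) := by
      ext x; ring
    rw [e1, wderiv_const_mul isOpen_univ W (wt t)
      ((contDiff_cexp_cdot (ζ t) Complex.I).mul h2).contDiffOn (Set.mem_univ x),
      wderiv_cexp_mul _ _ h2, norm_mul, norm_mul]
    have h5 := norm_wderiv_twisted_le (S := S) (x := x) (A := G t * P x) (q := q) h2 h3
      (fun V hV => h4 V hV x hx) W [] (by simpa using hW)
    simp only [wderiv_nil, List.length_nil, pow_zero, mul_one] at h5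
    calc ‖wt t‖ * (‖Complex.exp (Complex.I * cdot x (ζ t))‖ * ‖twisted (ζ t) W (g t) x‖)
        ≤ ‖wt t‖ * (1 * (G t * P x * ((1 + q) * Z t) ^ W.length)) := by
          gcongr
          exact h1 x hx
      _ = _ := by rw [mul_pow]; ring
  have key := contDiffOn_integral hΩ hP S
    (fun t x => Complex.exp (Complex.I * cdot x (ζ t)) * g t x * wt t)
    (fun s t => (1 + q) ^ s * (‖wt t‖ * G t * Z t ^ s)) (fun s hs => (hint s hs).const_mul _)
    hmeas (by
      filter_upwards [hsm] with t ht
      exact ((contDiff_cexp_cdot (ζ t) Complex.I).mul ht).mul contDiff_const) hb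
  refine ⟨key.1, fun W hW x hx => ?_⟩
  rw [key.2 W hW x hx]
  refine (norm_integral_le_integral_norm _).trans ?_
  have hi := ((hint W.length hW).const_mul ((1 + q) ^ W.length)).mul_const (P x)
  calc ∫ t, ‖wderiv W (fun x => Complex.exp (Complex.I * cdot x (ζ t)) * g t x * wt t) x‖ ∂m
      ≤ ∫ t, (1 + q) ^ W.length * (‖wt t‖ * G t * Z t ^ W.length) * P x ∂m := by
        refine integral_mono_of_nonneg (Filter.Eventually.of_forall fun t => norm_nonneg _) hi ?_
        filter_upwards [hb] with t ht
        exact ht W hW x hx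
    _ = _ := by rw [integral_mul_const, integral_const_mul]

end SGHalfSpace

end


noncomputable section

namespace SGHalfSpace

open MeasureTheory

/-! ### Gevrey weights -/

/-- `(n!)^θ`. -/
def rfac (θ : ℝ) (n : ℕ) : ℝ := (n.factorial : ℝ) ^ θ

theorem one_le_factorial (n : ℕ) : (1 : ℝ) ≤ n.factorial := by
  exact_mod_cast n.factorial_pos

theorem one_le_rfac {θ : ℝ} (hθ : 0 ≤ θ) (n : ℕ) : 1 ≤ rfac θ n :=
  Real.one_le_rpow (one_le_factorial n) hθ

theorem rfac_pos (θ : ℝ) (n : ℕ) : 0 < rfac θ n :=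
  Real.rpow_pos_of_pos (by exact_mod_cast n.factorial_pos) _

theorem rfac_mono {θ : ℝ} (hθ : 0 ≤ θ) {a b : ℕ} (h : a ≤ b) : rfac θ a ≤ rfac θ b :=
  Real.rpow_le_rpow (by positivity) (by exact_mod_cast Nat.factorial_le h) hθ

theorem rfac_le_rfac {θ θ' : ℝ} (h : θ ≤ θ') (n : ℕ) : rfac θ n ≤ rfac θ' n :=
  Real.rpow_le_rpow_of_exponent_le (one_le_factorial n) h

theorem rfac_mul_le {θ : ℝ} (hθ : 0 ≤ θ) (a b : ℕ) : rfac θ a * rfac θ b ≤ rfac θ (a + b) := by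
  unfold rfac
  rw [← Real.mul_rpow (by positivity) (by positivity)]
  refine Real.rpow_le_rpow (by positivity) ?_ hθ
  exact_mod_cast Nat.le_of_dvd (Nat.factorial_pos _) (Nat.factorial_mul_factorial_dvd_factorial_add a b)

theorem rfac_add_le {θ : ℝ} (hθ : 0 ≤ θ) (a b : ℕ) :
    rfac θ (a + b) ≤ ((2 : ℝ) ^ θ) ^ (a + b) * (rfac θ a * rfac θ b) := by
  unfold rfac
  rw [← Real.mul_rpow (by positivity) (by positivity), ← Real.rpow_natCast ((2 : ℝ) ^ θ),
    ← Real.rpow_mul (by norm_num), mul_comm θ, Real.rpow_mul (by norm_num),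
    ← Real.mul_rpow (by positivity) (by positivity), Real.rpow_natCast]
  refine Real.rpow_le_rpow (by positivity) ?_ hθ
  have h1 := Nat.add_choose_mul_factorial_mul_factorial a b
  have h2 : (a + b).choose b ≤ 2 ^ (a + b) := Nat.choose_le_two_pow _ _
  have : (a + b).factorial ≤ 2 ^ (a + b) * (a.factorial * b.factorial) := by
    rw [← h1, mul_assoc]
    exact Nat.mul_le_mul_right _ h2
  exact_mod_cast this

/-- This is where θ ≥ 1 is used: the factor produced by differentiating a power of a coordinate is
absorbed by the factorial that the lower power no longer needs. -/
theorem natCast_mul_rfac_le {θ : ℝ} (hθ : 1 ≤ θ) (n : ℕ) :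
    (n + 1 : ℝ) * rfac θ n ≤ rfac θ (n + 1) := by
  unfold rfac
  rw [Nat.factorial_succ, Nat.cast_mul, Real.mul_rpow (by positivity) (by positivity)]
  push_cast
  gcongr
  exact Real.self_le_rpow_of_one_le (by linarith [Nat.cast_nonneg (α := ℝ) n]) hθ

/-! ### Half spaces -/

theorem isOpen_lowerHalf (d : ℕ) : IsOpen (lowerHalf d) :=
  isOpen_lt (by fun_prop) continuous_const

theorem isOpen_upperHalf (d : ℕ) : IsOpen (upperHalf d) :=
  isOpen_lt continuous_const (by fun_prop)

/-- All derivatives of `h` decay on `Ω` like `(1 + |y|)^{-L}`. -/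
def DecaysOn {n : ℕ} (L : ℕ) (Ω : Set (RSpace n)) (h : RSpace n → ℂ) : Prop :=
  ContDiffOn ℝ ∞ h Ω ∧ ∀ W : List (Fin n), ∃ C : ℝ, ∀ y ∈ Ω,
    (1 + ‖y‖) ^ L * ‖wderiv W h y‖ ≤ C

theorem DecaysOn.pderiv {n L : ℕ} {Ω : Set (RSpace n)} (hΩ : IsOpen Ω) {h : RSpace n → ℂ}
    (hh : DecaysOn L Ω h) (i : Fin n) : DecaysOn L Ω (pderiv ℝ i h) := by
  refine ⟨contDiffOn_pderiv hΩ i hh.1 (by simp), fun W => ?_⟩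
  obtain ⟨C, hC⟩ := hh.2 (W ++ [i])
  exact ⟨C, by simpa [wderiv_append] using hC⟩

theorem hasFDerivAt_coord_pow {n : ℕ} (k : Fin n) (r : ℕ) (x : RSpace n) :
    HasFDerivAt (fun y : RSpace n => ((y k : ℂ)) ^ r)
      ((r * (x k : ℂ) ^ (r - 1)) •
        (Complex.ofRealCLM.comp (EuclideanSpace.proj k : RSpace n →L[ℝ] ℝ))) x := by
  have h : HasFDerivAt (fun y : RSpace n => (y k : ℂ))
      (Complex.ofRealCLM.comp (EuclideanSpace.proj k : RSpace n →L[ℝ] ℝ)) x :=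
    (Complex.ofRealCLM.comp (EuclideanSpace.proj k : RSpace n →L[ℝ] ℝ)).hasFDerivAt
  simpa using h.pow r

theorem contDiff_coord_pow {n : ℕ} (k : Fin n) (r : ℕ) :
    ContDiff ℝ ∞ (fun y : RSpace n => (y k : ℂ) ^ r) := by
  have : ContDiff ℝ ∞ (fun y : RSpace n => (y k : ℂ)) :=
    (Complex.ofRealCLM.comp (EuclideanSpace.proj k : RSpace n →L[ℝ] ℝ)).contDiff
  exact this.pow r

theorem pderiv_coord_pow_mul {n : ℕ} (k i : Fin n) (r : ℕ) {h : RSpace n → ℂ} {x : RSpace n}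
    (hh : DifferentiableAt ℝ h x) :
    pderiv ℝ i (fun y => (y k : ℂ) ^ r * h y) x =
      (if i = k then (r : ℂ) else 0) * ((x k : ℂ) ^ (r - 1) * h x)
        + (x k : ℂ) ^ r * pderiv ℝ i h x := by
  have := (hasFDerivAt_coord_pow k r x).fun_mul hh.hasFDerivAt
  simp only [pderiv]
  rw [this.fderiv]
  by_cases hik : i = k
  · subst hik
    simp
    ring
  · have : k ≠ i := fun h => hik h.symm
    simp [hik, this]

/-- Derivatives of `y_k^r ∂_W u`, from bounds on `|y_k|^r |∂_W u|`. -/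
theorem wderiv_coord_pow_mul_le {n : ℕ} {Ω : Set (RSpace n)} (hΩ : IsOpen Ω) {u : RSpace n → ℂ}
    (hu : ContDiffOn ℝ ∞ u Ω) (k : Fin n) {θ K D : ℝ} (hθ : 1 ≤ θ) (hK : 0 ≤ K) (hD : 1 ≤ D)
    {y : RSpace n} (hy : y ∈ Ω)
    (hb : ∀ (r : ℕ) (W : List (Fin n)), |y k| ^ r * ‖wderiv W u y‖ ≤
      K * D ^ (r + W.length) * rfac θ r * rfac θ W.length) :
    ∀ (m : ℕ) (V : List (Fin n)), V.length = m → ∀ (r : ℕ) (W : List (Fin n)),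
      ‖wderiv V (fun y => (y k : ℂ) ^ r * wderiv W u y) y‖ ≤
        K * D ^ (r + V.length + W.length) * 2 ^ V.length * rfac θ r
          * rfac θ (V.length + W.length) := by
  have hθ0 : 0 ≤ θ := by linarith
  intro m
  induction m with
  | zero =>
    intro V hV r W
    obtain rfl := List.length_eq_zero_iff.1 hV
    simpa using hb r W
  | succ m ih =>
    intro V hV r W
    -- The last letter acts first, so the product rule is applied to it, and the induction
    -- hypothesis handles the remaining word.
    rcases List.eq_nil_or_concat V with rfl | ⟨V, i, rfl⟩
    · simp at hV
    rw [List.concat_eq_append] at hV ⊢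
    simp only [List.length_append, List.length_singleton] at hV ⊢
    have hVm : V.length = m := by omega
    have hWs := contDiffOn_wderiv hΩ W hu
    have hcs : ∀ r (W : List (Fin n)),
        ContDiffOn ℝ ∞ (fun y => (y k : ℂ) ^ r * wderiv W u y) Ω := fun r W =>
      (contDiff_coord_pow k r).contDiffOn.mul (contDiffOn_wderiv hΩ W hu)
    have e1 : Set.EqOn (pderiv ℝ i (fun y => (y k : ℂ) ^ r * wderiv W u y))
        (fun y => (if i = k then (r : ℂ) else 0) * ((y k : ℂ) ^ (r - 1) * wderiv W u y)
          + (y k : ℂ) ^ r * wderiv (i :: W) u y) Ω := fun x hx =>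
      pderiv_coord_pow_mul k i r ((hWs.contDiffAt (hΩ.mem_nhds hx)).differentiableAt (by simp))
    rw [wderiv_append]
    simp only [wderiv_cons, wderiv_nil]
    rw [wderiv_congr hΩ V e1 hy,
      wderiv_add hΩ V (contDiffOn_const.mul (hcs (r - 1) W)) (hcs r (i :: W)) hy]
    beta_reduce
    rw [wderiv_const_mul hΩ V _ (hcs (r - 1) W) hy]
    refine (norm_add_le _ _).trans ?_
    have b2 := ih V hVm r (i :: W)
    have b1 := ih V hVm (r - 1) W
    rw [List.length_cons] at b2
    have step1 : ‖(if i = k then (r : ℂ) else 0) *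
        wderiv V (fun y => (y k : ℂ) ^ (r - 1) * wderiv W u y) y‖ ≤
        K * D ^ (r + (V.length + 1) + W.length) * 2 ^ V.length * rfac θ r
          * rfac θ (V.length + 1 + W.length) := by
      rw [norm_mul]
      have hc : ‖(if i = k then (r : ℂ) else 0)‖ ≤ r := by
        split_ifs <;> simp
      -- For r = 0 the coefficient vanishes, so the truncated exponent r - 1 does no harm.
      rcases r with _ | r
      · have : ‖(if i = k then ((0 : ℕ) : ℂ) else 0)‖ = 0 := by simp
        rw [this, zero_mul]
        have := rfac_pos θ 0
        have := rfac_pos θ (V.length + 1 + W.length)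
        positivity
      · simp only [Nat.add_sub_cancel] at b1 ⊢
        have hf := natCast_mul_rfac_le hθ r
        have hm := rfac_mono hθ0 (show V.length + W.length ≤ V.length + 1 + W.length by omega)
        have hp : D ^ (r + V.length + W.length) ≤ D ^ (r + 1 + (V.length + 1) + W.length) :=
          pow_le_pow_right₀ hD (by omega)
        have p1 := rfac_pos θ r
        have p3 := rfac_pos θ (r + 1)
        have p2 := rfac_pos θ (V.length + W.length)
        calc _ ≤ ((r + 1 : ℕ) : ℝ) * (K * D ^ (r + V.length + W.length) * 2 ^ V.length
              * rfac θ r * rfac θ (V.length + W.length)) :=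
              mul_le_mul hc b1 (norm_nonneg _) (by positivity)
          _ = K * D ^ (r + V.length + W.length) * 2 ^ V.length * ((r + 1 : ℝ) * rfac θ r)
              * rfac θ (V.length + W.length) := by push_cast; ring
          _ ≤ _ := by gcongr
    have step2 : ‖wderiv V (fun y => (y k : ℂ) ^ r * wderiv (i :: W) u y) y‖ ≤
        K * D ^ (r + (V.length + 1) + W.length) * 2 ^ V.length * rfac θ r
          * rfac θ (V.length + 1 + W.length) := by
      refine b2.trans (le_of_eq ?_)
      rw [show r + V.length + (W.length + 1) = r + (V.length + 1) + W.length by ring,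
        show V.length + (W.length + 1) = V.length + 1 + W.length by ring]
    refine (add_le_add step1 step2).trans (le_of_eq ?_)
    rw [pow_succ (2 : ℝ)]
    ring

/-- Only the multi-indices r e_i and 0 are needed to pass from monomial weights to powers of |y|;
the index 0 supplies the extra summand of `norm_mul_pow_le_sum`. -/
theorem IsGelfandShilov.norm_pow_mul_le {n : ℕ} {θ : ℝ} (hθ : 1 ≤ θ) {Ω : Set (RSpace n)}
    (hΩ : IsOpen Ω) {u : RSpace n → ℂ} (hu : IsGelfandShilov θ θ Ω u) :
    ∃ K D : ℝ, 0 ≤ K ∧ 1 ≤ D ∧ ∀ (r : ℕ) (W : List (Fin n)), ∀ y ∈ Ω,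
      ‖y‖ ^ r * ‖wderiv W u y‖ ≤ K * D ^ (r + W.length) * rfac θ r * rfac θ W.length := by
  obtain ⟨hs, C, D, hC, hD, h⟩ := hu
  have hθ0 : 0 ≤ θ := by linarith
  set D' : ℝ := D + 1 with hD'
  have hD1 : 1 ≤ D' := by linarith
  refine ⟨(n + 1) * C, (n + 1) * D', by positivity, ?_, fun r W y hy => ?_⟩
  · nlinarith [Nat.cast_nonneg (α := ℝ) n]
  have hcoord : ∀ (α : Fin n → ℕ), msum α ≤ r → mfact α ≤ (r.factorial : ℝ) →
      |mpow y α| * ‖wderiv W u y‖ ≤ C * D' ^ (r + W.length) * rfac θ r * rfac θ W.length := by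
    intro α hα hα2
    rw [wderiv_eq_mderiv hΩ W hs hy]
    refine (h α _ y hy).trans ?_
    have hm : mfact (fun i => W.count i) ≤ (W.length.factorial : ℝ) := by
      rw [← msum_count]; exact mfact_le _
    have e1 : D ^ (msum α + msum fun i => W.count i) ≤ D' ^ (r + W.length) := by
      rw [msum_count]
      exact (pow_le_pow_left₀ hD.le (by linarith) _).trans
        (pow_le_pow_right₀ hD1 (by omega))
    have p1 := (mfact_pos α).le
    have p2 := (mfact_pos (fun i => W.count i)).le
    unfold rfac
    gcongr
  have hsum : ∀ i, |y i| ^ r * ‖wderiv W u y‖ ≤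
      C * D' ^ (r + W.length) * rfac θ r * rfac θ W.length := by
    intro i
    have := hcoord (Pi.single i r) (msum_single i r).le (mfact_single i r).le
    have e : mpow y (Pi.single i r) = y i ^ r := by
      unfold mpow
      rw [Finset.prod_eq_single i]
      · simp
      · intro b _ hb; simp [hb]
      · simp
    rwa [e, abs_pow] at this
  have hzero := hcoord 0 (by simp [msum]) (by simpa [mfact] using one_le_factorial r)
  have e0 : mpow y 0 = 1 := by simp [mpow]
  rw [e0, abs_one, one_mul] at hzero
  set X := C * D' ^ (r + W.length) * rfac θ r * rfac θ W.length with hX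
  have hX0 : 0 ≤ X := (norm_nonneg _).trans hzero
  calc ‖y‖ ^ r * ‖wderiv W u y‖
      ≤ ((n : ℝ) ^ r * (∑ i, |y i| ^ r + 1)) * ‖wderiv W u y‖ := by
        gcongr
        exact norm_mul_pow_le_sum y r
    _ = (n : ℝ) ^ r * (∑ i, |y i| ^ r * ‖wderiv W u y‖ + ‖wderiv W u y‖) := by
        rw [mul_assoc, add_mul, Finset.sum_mul, one_mul]
    _ ≤ (n : ℝ) ^ r * (∑ _i : Fin n, X + X) := by
        gcongr with i
        exact hsum i
    _ = (n : ℝ) ^ r * ((n + 1) * X) := by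
        rw [Finset.sum_const, Finset.card_univ, Fintype.card_fin, nsmul_eq_mul]; ring
    _ ≤ (n + 1 : ℝ) ^ (r + W.length) * ((n + 1) * X) := by
        gcongr
        calc (n : ℝ) ^ r ≤ (n + 1 : ℝ) ^ r := by gcongr; linarith
          _ ≤ _ := pow_le_pow_right₀ (by linarith [Nat.cast_nonneg (α := ℝ) n]) (by omega)
    _ = _ := by rw [hX, mul_pow]; ring

/-- A fixed number L of additional powers changes r!^θ into (r+L)!^θ, which is r!^θ up to a
geometric factor. Thus polynomial weights cost nothing, and differentiating y_k^r costs only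
2^{|V|}. -/
theorem IsGelfandShilov.weighted_le {n : ℕ} {θ : ℝ} (hθ : 1 ≤ θ) {Ω : Set (RSpace n)}
    (hΩ : IsOpen Ω) {u : RSpace n → ℂ} (hu : IsGelfandShilov θ θ Ω u) (L : ℕ) :
    ∃ K D : ℝ, 0 ≤ K ∧ 1 ≤ D ∧ ∀ (k : Fin n) (r : ℕ) (V : List (Fin n)), ∀ y ∈ Ω,
      (1 + ‖y‖) ^ L * ‖wderiv V (fun y => (y k : ℂ) ^ r * u y) y‖
        ≤ K * D ^ (r + V.length) * rfac θ r * rfac θ V.length := by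
  obtain ⟨K, D, hK, hD, h⟩ := hu.norm_pow_mul_le hθ hΩ
  have hθ0 : 0 ≤ θ := by linarith
  have h2 : (1 : ℝ) ≤ 2 ^ θ := Real.one_le_rpow (by norm_num) hθ0
  set E : ℝ := (2 : ℝ) ^ θ * D with hE
  have hE1 : 1 ≤ E := one_le_mul_of_one_le_of_one_le h2 hD
  have hDE : D ≤ E := le_mul_of_one_le_left (by linarith) h2
  set K' : ℝ := 2 ^ L * (2 * (K * E ^ L * rfac θ L)) with hK'
  have hL1 := one_le_rfac hθ0 L
  refine ⟨K', E * 2, by positivity, by linarith, fun k r V y hy => ?_⟩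
  -- The point y is fixed, so the weight (1+|y|)^{-L} may be hidden in the constant passed to
  -- `wderiv_coord_pow_mul_le`, which works at a single point.
  have hbase : ∀ (r : ℕ) (W : List (Fin n)), |y k| ^ r * ‖wderiv W u y‖ ≤
      K' / (1 + ‖y‖) ^ L * E ^ (r + W.length) * rfac θ r * rfac θ W.length := by
    intro r W
    have hp : 0 < (1 + ‖y‖) ^ L := by positivity
    have b0 := h r W y hy
    have b1 := h (r + L) W y hy
    have pr := rfac_pos θ r
    have pW := rfac_pos θ W.length
    have pL := rfac_pos θ L
    set X := K * E ^ L * rfac θ L * (E ^ (r + W.length) * rfac θ r * rfac θ W.length) with hX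
    have c0 : ‖y‖ ^ r * ‖wderiv W u y‖ ≤ X := by
      refine b0.trans ?_
      calc _ ≤ K * E ^ (r + W.length) * rfac θ r * rfac θ W.length := by gcongr
        _ = (K * 1 * 1) * (E ^ (r + W.length) * rfac θ r * rfac θ W.length) := by ring
        _ ≤ X := by
          rw [hX]
          gcongr
          exact one_le_pow₀ hE1
    have c1 : ‖y‖ ^ (r + L) * ‖wderiv W u y‖ ≤ X := by
      refine b1.trans ?_
      calc _ ≤ K * D ^ (r + L + W.length) * (((2 : ℝ) ^ θ) ^ (r + L) * (rfac θ r * rfac θ L))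
            * rfac θ W.length := by
            gcongr
            exact rfac_add_le hθ0 r L
        _ ≤ K * D ^ (r + L + W.length) *
            (((2 : ℝ) ^ θ) ^ (r + L + W.length) * (rfac θ r * rfac θ L))
            * rfac θ W.length := by
            gcongr ?_ * (?_ * _) * _
            exact pow_le_pow_right₀ h2 (by omega)
        _ = X := by rw [hX, hE, mul_pow, mul_pow]; ring
    have c2 : (1 + ‖y‖) ^ L ≤ 2 ^ L * (1 + ‖y‖ ^ L) := by
      have h3 := add_pow_le zero_le_one (norm_nonneg y) L
      rw [one_pow] at h3
      refine h3.trans ?_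
      gcongr
      · norm_num
      · omega
    rw [div_mul_eq_mul_div, div_mul_eq_mul_div, div_mul_eq_mul_div, le_div_iff₀ hp]
    have hyk : |y k| ^ r ≤ ‖y‖ ^ r := pow_le_pow_left₀ (abs_nonneg _) (abs_apply_le_norm y k) _
    calc |y k| ^ r * ‖wderiv W u y‖ * (1 + ‖y‖) ^ L
        ≤ ‖y‖ ^ r * ‖wderiv W u y‖ * (2 ^ L * (1 + ‖y‖ ^ L)) := by gcongr
      _ = 2 ^ L * (‖y‖ ^ r * ‖wderiv W u y‖ + ‖y‖ ^ (r + L) * ‖wderiv W u y‖) := by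
        rw [pow_add]; ring
      _ ≤ 2 ^ L * (X + X) := by gcongr
      _ = _ := by rw [hX, hK']; ring
  have key := wderiv_coord_pow_mul_le hΩ hu.1 k hθ
    (div_nonneg (by positivity) (by positivity : (0 : ℝ) ≤ (1 + ‖y‖) ^ L)) hE1 hy hbase
    V.length V rfl r []
  simp only [List.length_nil, add_zero, wderiv_nil] at key
  have hp : 0 < (1 + ‖y‖) ^ L := by positivity
  have pr := rfac_pos θ r
  have pV := rfac_pos θ V.length
  calc _ ≤ (1 + ‖y‖) ^ L * (K' / (1 + ‖y‖) ^ L * E ^ (r + V.length) * 2 ^ V.length * rfac θ r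
        * rfac θ V.length) := by gcongr
    _ = K' * E ^ (r + V.length) * 2 ^ V.length * rfac θ r * rfac θ V.length := by
        field_simp
    _ ≤ K' * E ^ (r + V.length) * 2 ^ (r + V.length) * rfac θ r * rfac θ V.length := by
        gcongr
        · norm_num
        · omega
    _ = _ := by rw [mul_pow]; ring

end SGHalfSpace

end


noncomputable section

namespace SGHalfSpace

open MeasureTheory

/-! ### The Fourier-Laplace transform -/

/-- `∫ e^{-i y·ζ} f(y) dy`. -/
def hatC {n : ℕ} (f : RSpace n → ℂ) (ζ : CSpace n) : ℂ :=
  ∫ y, Complex.exp (-(Complex.I * cdot y ζ)) * f y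

theorem cdot_toC {n : ℕ} (x ξ : RSpace n) : cdot x (toC ξ) = (inner ℝ x ξ : ℝ) := by
  simp [cdot, toC, PiLp.inner_apply, mul_comm]

theorem hat_eq_hatC {n : ℕ} (f : RSpace n → ℂ) (ξ : RSpace n) : hat f ξ = hatC f (toC ξ) := by
  simp only [hat, hatC, cdot_toC]

@[simp] theorem snocC_castSucc {d : ℕ} (ξ' : RSpace d) (z : ℂ) (i : Fin d) :
    snocC ξ' z i.castSucc = ξ' i := by simp [snocC]

@[simp] theorem snocC_last {d : ℕ} (ξ' : RSpace d) (z : ℂ) :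
    snocC ξ' z (Fin.last d) = z := by simp [snocC]

theorem cdot_snocC {d : ℕ} (x : RSpace (d + 1)) (ξ' : RSpace d) (z : ℂ) :
    cdot x (snocC ξ' z) = ((∑ i : Fin d, x i.castSucc * ξ' i : ℝ) : ℂ) + x (Fin.last d) * z := by
  simp [cdot, Fin.sum_univ_castSucc]

theorem cdot_snocC_im {d : ℕ} (x : RSpace (d + 1)) (ξ' : RSpace d) (z : ℂ) :
    (cdot x (snocC ξ' z)).im = x (Fin.last d) * z.im := by
  rw [cdot_snocC, Complex.add_im, Complex.ofReal_im, Complex.im_ofReal_mul, zero_add]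

theorem norm_cexp_cdot {d : ℕ} (x : RSpace (d + 1)) (ξ' : RSpace d) (z : ℂ) :
    ‖Complex.exp (Complex.I * cdot x (snocC ξ' z))‖ = Real.exp (-(x (Fin.last d) * z.im)) := by
  rw [Complex.norm_exp]
  simp [cdot_snocC_im]

theorem norm_cexp_neg_cdot {d : ℕ} (x : RSpace (d + 1)) (ξ' : RSpace d) (z : ℂ) :
    ‖Complex.exp (-(Complex.I * cdot x (snocC ξ' z)))‖ = Real.exp (x (Fin.last d) * z.im) := by
  rw [Complex.norm_exp]
  simp [cdot_snocC_im]

theorem norm_cexp_cdot_le {d : ℕ} {x : RSpace (d + 1)} (hx : 0 ≤ x (Fin.last d)) (ξ' : RSpace d)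
    {z : ℂ} (hz : 0 ≤ z.im) : ‖Complex.exp (Complex.I * cdot x (snocC ξ' z))‖ ≤ 1 := by
  rw [norm_cexp_cdot, Real.exp_le_one_iff, neg_nonpos]
  positivity

theorem norm_cexp_neg_cdot_le {d : ℕ} {y : RSpace (d + 1)} (hy : y (Fin.last d) ≤ 0)
    (ξ' : RSpace d) {z : ℂ} (hz : 0 ≤ z.im) :
    ‖Complex.exp (-(Complex.I * cdot y (snocC ξ' z)))‖ ≤ 1 := by
  rw [norm_cexp_neg_cdot, Real.exp_le_one_iff]
  exact mul_nonpos_of_nonpos_of_nonneg hy hz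

theorem continuous_snocC {d : ℕ} : Continuous (fun p : RSpace d × ℂ => snocC p.1 p.2) := by
  refine (PiLp.continuous_toLp 2 _).comp (continuous_pi fun i => ?_)
  refine Fin.lastCases ?_ (fun i => ?_) i
  · simpa using continuous_snd
  · simp only [Fin.snoc_castSucc]
    fun_prop

theorem continuous_cdot {n : ℕ} : Continuous (fun p : RSpace n × CSpace n => cdot p.1 p.2) := by
  unfold cdot
  fun_prop

theorem integrable_one_add_norm_pow (n : ℕ) :
    Integrable (fun y : RSpace n => ((1 + ‖y‖) ^ (n + 1))⁻¹) := by
  have h := integrable_one_add_norm (E := RSpace n) (μ := volume) (r := ((n + 1 : ℕ) : ℝ))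
    (by simp)
  refine h.congr (Filter.Eventually.of_forall fun y => ?_)
  simp only
  rw [Real.rpow_neg (by positivity), Real.rpow_natCast]

theorem extendZero_norm_le {n L : ℕ} {Ω : Set (RSpace n)} {h : RSpace n → ℂ} {C : ℝ} (hC : 0 ≤ C)
    (hb : ∀ y ∈ Ω, (1 + ‖y‖) ^ L * ‖h y‖ ≤ C) (y : RSpace n) :
    ‖extendZero Ω h y‖ ≤ C * ((1 + ‖y‖) ^ L)⁻¹ := by
  unfold extendZero
  by_cases hy : y ∈ Ω
  · rw [Set.indicator_of_mem hy, ← div_eq_mul_inv, le_div_iff₀ (by positivity), mul_comm]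
    exact hb y hy
  · rw [Set.indicator_of_notMem hy, norm_zero]
    positivity

theorem aestronglyMeasurable_extendZero {n : ℕ} {Ω : Set (RSpace n)} (hΩ : IsOpen Ω)
    {h : RSpace n → ℂ} (hh : ContinuousOn h Ω) :
    AEStronglyMeasurable (extendZero Ω h) volume :=
  (aestronglyMeasurable_indicator_iff hΩ.measurableSet).2
    (hh.aestronglyMeasurable hΩ.measurableSet)

theorem DecaysOn.exists_bound {n L : ℕ} {Ω : Set (RSpace n)} {h : RSpace n → ℂ}
    (hh : DecaysOn L Ω h) : ∃ C, 0 ≤ C ∧ ∀ y ∈ Ω, (1 + ‖y‖) ^ L * ‖h y‖ ≤ C := by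
  obtain ⟨C, hC⟩ := hh.2 []
  exact ⟨|C|, abs_nonneg _, fun y hy => (hC y hy).trans (le_abs_self _)⟩

/-- Of the n + 2 powers, n + 1 give integrability and one pays for the weight 1 + |y|, which
differentiation of the transform will need. -/
theorem DecaysOn.integrable {n : ℕ} {Ω : Set (RSpace n)} (hΩ : IsOpen Ω)
    {h : RSpace n → ℂ} (hh : DecaysOn (n + 2) Ω h) :
    Integrable (fun y => (1 + ‖y‖) * ‖extendZero Ω h y‖) := by
  obtain ⟨C, hC0, hC⟩ := hh.exists_bound
  refine ((integrable_one_add_norm_pow n).const_mul C).mono' ?_ ?_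
  · have : Continuous (fun y : RSpace n => 1 + ‖y‖) := by fun_prop
    exact this.aestronglyMeasurable.mul
      (aestronglyMeasurable_extendZero hΩ hh.1.continuousOn).norm
  · refine Filter.Eventually.of_forall fun y => ?_
    have := extendZero_norm_le hC0 hC y
    rw [norm_mul, norm_norm, Real.norm_of_nonneg (by positivity)]
    calc (1 + ‖y‖) * ‖extendZero Ω h y‖ ≤ (1 + ‖y‖) * (C * ((1 + ‖y‖) ^ (n + 2))⁻¹) := by gcongr
      _ = _ := by field_simp; ring

theorem integrable_of_weighted {n : ℕ} {f : RSpace n → ℂ} (hm : AEStronglyMeasurable f volume)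
    (hf : Integrable (fun y => (1 + ‖y‖) * ‖f y‖)) : Integrable f := by
  refine hf.mono' hm (Filter.Eventually.of_forall fun y => ?_)
  nlinarith [norm_nonneg y, norm_nonneg (f y), mul_nonneg (norm_nonneg y) (norm_nonneg (f y))]

/-- The properties of `e^- u` needed for its Fourier-Laplace transform. -/
structure LowerSupported {d : ℕ} (f : RSpace (d + 1) → ℂ) : Prop where
  meas : AEStronglyMeasurable f volume
  int : Integrable (fun y => (1 + ‖y‖) * ‖f y‖)
  supp : ∀ y, 0 < y (Fin.last d) → f y = 0

theorem DecaysOn.lowerSupported {d : ℕ} {h : RSpace (d + 1) → ℂ}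
    (hh : DecaysOn (d + 1 + 2) (lowerHalf d) h) :
    LowerSupported (extendZero (lowerHalf d) h) where
  meas := aestronglyMeasurable_extendZero (isOpen_lowerHalf d) hh.1.continuousOn
  int := hh.integrable (isOpen_lowerHalf d)
  supp y hy := Set.indicator_of_notMem (by simp [lowerHalf]; exact hy.le) _

theorem LowerSupported.integrable {d : ℕ} {f : RSpace (d + 1) → ℂ} (hf : LowerSupported f) :
    Integrable f := integrable_of_weighted hf.meas hf.int

/-- The modulus of e^{-iy·(ξ',z)} is e^{y_n Im z}, at most 1 on the support of f when Im z ≥ 0. This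
is why the transform extends to the upper half-plane in the last variable. -/
theorem LowerSupported.norm_le {d : ℕ} {f : RSpace (d + 1) → ℂ} (hf : LowerSupported f)
    (ξ' : RSpace d) {z : ℂ} (hz : 0 ≤ z.im) (y : RSpace (d + 1)) :
    ‖Complex.exp (-(Complex.I * cdot y (snocC ξ' z))) * f y‖ ≤ ‖f y‖ := by
  rw [norm_mul]
  by_cases hy : 0 < y (Fin.last d)
  · simp [hf.supp y hy]
  · exact mul_le_of_le_one_left (norm_nonneg _) (norm_cexp_neg_cdot_le (not_lt.1 hy) ξ' hz)

theorem continuous_cexp_neg_cdot {n : ℕ} (ζ : CSpace n) :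
    Continuous (fun y : RSpace n => Complex.exp (-(Complex.I * cdot y ζ))) := by
  have : Continuous (fun y : RSpace n => cdot y ζ) := (cdotL ζ).continuous
  fun_prop

theorem LowerSupported.integrable_cexp_mul {d : ℕ} {f : RSpace (d + 1) → ℂ}
    (hf : LowerSupported f) (ξ' : RSpace d) {z : ℂ} (hz : 0 ≤ z.im) :
    Integrable (fun y => Complex.exp (-(Complex.I * cdot y (snocC ξ' z))) * f y) :=
  hf.integrable.norm.mono' ((continuous_cexp_neg_cdot _).aestronglyMeasurable.mul hf.meas)
    (Filter.Eventually.of_forall fun y => hf.norm_le ξ' hz y)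

theorem LowerSupported.norm_hatC_le {d : ℕ} {f : RSpace (d + 1) → ℂ}
    (hf : LowerSupported f) (ξ' : RSpace d) {z : ℂ} (hz : 0 ≤ z.im) :
    ‖hatC f (snocC ξ' z)‖ ≤ ∫ y, ‖f y‖ :=
  (norm_integral_le_integral_norm _).trans (integral_mono (hf.integrable_cexp_mul ξ' hz).norm
    hf.integrable.norm fun y => hf.norm_le ξ' hz y)

theorem LowerSupported.continuousOn_hatC {d : ℕ} {f : RSpace (d + 1) → ℂ}
    (hf : LowerSupported f) :
    ContinuousOn (fun p : RSpace d × ℂ => hatC f (snocC p.1 p.2)) {p | 0 ≤ p.2.im} := by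
  refine continuousOn_of_dominated (bound := fun y => ‖f y‖) ?_ ?_ hf.integrable.norm ?_
  · exact fun p hp => (hf.integrable_cexp_mul p.1 hp).aestronglyMeasurable
  · exact fun p hp => Filter.Eventually.of_forall fun y => hf.norm_le p.1 hp y
  · refine Filter.Eventually.of_forall fun y => Continuous.continuousOn ?_
    have : Continuous (fun p : RSpace d × ℂ => cdot y (snocC p.1 p.2)) :=
      continuous_cdot.comp (continuous_const.prodMk continuous_snocC)
    fun_prop

/-- Differentiating in z brings down y_n, which the weight in `LowerSupported.int` dominates. -/
theorem LowerSupported.differentiableAt_hatC {d : ℕ} {f : RSpace (d + 1) → ℂ}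
    (hf : LowerSupported f) (ξ' : RSpace d) {z : ℂ} (hz : 0 < z.im) :
    DifferentiableAt ℂ (fun z => hatC f (snocC ξ' z)) z := by
  have hs : {w : ℂ | 0 < w.im} ∈ nhds z :=
    (isOpen_lt continuous_const Complex.continuous_im).mem_nhds hz
  have hder : ∀ (y : RSpace (d + 1)) (w : ℂ), HasDerivAt
      (fun w => Complex.exp (-(Complex.I * cdot y (snocC ξ' w))) * f y)
      (-(Complex.I * y (Fin.last d)) * (Complex.exp (-(Complex.I * cdot y (snocC ξ' w))) * f y))
      w := by
    intro y w
    have h1 : HasDerivAt (fun w => -(Complex.I * cdot y (snocC ξ' w)))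
        (-(Complex.I * (y (Fin.last d) * 1))) w := by
      simp only [cdot_snocC]
      exact ((((hasDerivAt_id w).const_mul _).const_add _).const_mul _).neg
    refine (h1.cexp.mul_const (f y)).congr_deriv ?_
    ring
  have hm : ∀ w, AEStronglyMeasurable
      (fun y => Complex.exp (-(Complex.I * cdot y (snocC ξ' w))) * f y) volume := fun w =>
    (continuous_cexp_neg_cdot _).aestronglyMeasurable.mul hf.meas
  have := hasDerivAt_integral_of_dominated_loc_of_deriv_le (μ := volume)
    (bound := fun y => (1 + ‖y‖) * ‖f y‖) hs (Filter.Eventually.of_forall hm)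
    (hf.integrable_cexp_mul ξ' hz.le) (F' := fun w y => -(Complex.I * y (Fin.last d)) *
      (Complex.exp (-(Complex.I * cdot y (snocC ξ' w))) * f y)) ?_ ?_ hf.int
    (Filter.Eventually.of_forall fun y w _ => hder y w)
  · exact this.2.differentiableAt
  · have : Continuous (fun y : RSpace (d + 1) => -(Complex.I * (y (Fin.last d) : ℂ))) := by
      fun_prop
    exact this.aestronglyMeasurable.mul (hm z)
  · refine Filter.Eventually.of_forall fun y w hw => ?_
    rw [norm_mul]
    refine mul_le_mul ?_ (hf.norm_le ξ' (le_of_lt hw) y) (norm_nonneg _) (by positivity)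
    simpa using (abs_apply_le_norm y (Fin.last d)).trans (by linarith)

/-- A tangential line keeps y_n constant, so it lies entirely in the half-space or entirely outside
it. The jump at the boundary is therefore invisible to tangential derivatives. -/
theorem hasLineDerivAt_extendZero {d : ℕ} {h : RSpace (d + 1) → ℂ}
    (hh : DifferentiableOn ℝ h (lowerHalf d)) (i : Fin d) (y : RSpace (d + 1)) :
    HasLineDerivAt ℝ (extendZero (lowerHalf d) h)
      (extendZero (lowerHalf d) (pderiv ℝ i.castSucc h) y) y
      (EuclideanSpace.single i.castSucc 1) := by
  by_cases hy : y ∈ lowerHalf d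
  · have h1 : HasFDerivAt h (fderiv ℝ h y) y :=
      ((hh y hy).differentiableAt ((isOpen_lowerHalf d).mem_nhds hy)).hasFDerivAt
    have h2 : extendZero (lowerHalf d) h =ᶠ[nhds y] h :=
      Filter.eventuallyEq_of_mem ((isOpen_lowerHalf d).mem_nhds hy)
        fun x hx => Set.indicator_of_mem hx _
    have h3 := (h1.congr_of_eventuallyEq h2).hasLineDerivAt (EuclideanSpace.single i.castSucc 1)
    unfold extendZero at h3 ⊢
    rwa [Set.indicator_of_mem hy]
  · have e : ∀ t : ℝ, extendZero (lowerHalf d) h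
        (y + t • EuclideanSpace.single i.castSucc 1) = 0 := by
      intro t
      refine Set.indicator_of_notMem ?_ _
      have : (Fin.last d) ≠ i.castSucc := (Fin.castSucc_lt_last i).ne'
      simp only [lowerHalf, Set.mem_ofPred_eq] at hy ⊢
      simpa [this] using hy
    unfold HasLineDerivAt
    simp only [e]
    have : extendZero (lowerHalf d) (pderiv ℝ i.castSucc h) y = 0 :=
      Set.indicator_of_notMem hy _
    rw [this]
    exact hasDerivAt_const _ _

/-- Integration by parts in the tangential directions. -/
theorem hatC_extendZero_pderiv {d : ℕ} {h : RSpace (d + 1) → ℂ}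
    (hh : DecaysOn (d + 1 + 2) (lowerHalf d) h) (i : Fin d) (ξ' : RSpace d) {z : ℂ}
    (hz : 0 ≤ z.im) :
    hatC (extendZero (lowerHalf d) (pderiv ℝ i.castSucc h)) (snocC ξ' z)
      = Complex.I * ξ' i * hatC (extendZero (lowerHalf d) h) (snocC ξ' z) := by
  set ζ := snocC ξ' z with hζ
  have hl := hh.lowerSupported
  have hl' := (hh.pderiv (isOpen_lowerHalf d) i.castSucc).lowerSupported
  have h1 := hl.integrable_cexp_mul ξ' hz
  have h2 := hl'.integrable_cexp_mul ξ' hz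
  have key := integral_bilinear_hasLineDerivAt_right_eq_neg_left_of_integrable
    (μ := volume) (f := fun y : RSpace (d + 1) => Complex.exp (-(Complex.I * cdot y ζ)))
    (f' := fun y => -(Complex.I * ξ' i) * Complex.exp (-(Complex.I * cdot y ζ)))
    (g := extendZero (lowerHalf d) h)
    (g' := extendZero (lowerHalf d) (pderiv ℝ i.castSucc h))
    (v := EuclideanSpace.single i.castSucc 1) (B := ContinuousLinearMap.mul ℝ ℂ)
    ?_ (by simpa using h2) (by simpa using h1) ?_ ?_
  · simp only [ContinuousLinearMap.mul_apply'] at key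
    unfold hatC
    rw [key, ← integral_neg, ← integral_const_mul]
    congr 1
    ext y
    ring
  · simp only [ContinuousLinearMap.mul_apply']
    refine (h1.const_mul (-(Complex.I * ξ' i))).congr (Filter.Eventually.of_forall fun y => ?_)
    simp only
    ring
  · intro y _
    have := (hasFDerivAt_cexp_cdot ζ (-Complex.I) y).hasLineDerivAt
      (EuclideanSpace.single i.castSucc 1)
    simp only [smul_apply, cdotL_apply, cdot_single, smul_eq_mul] at this
    rw [hζ, snocC_castSucc, ← hζ] at this
    simp only [neg_mul] at this ⊢
    convert this using 1
    ring
  · intro y _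
    exact hasLineDerivAt_extendZero (hh.1.differentiableOn (by simp)) i y

/-- Repeated tangential integration by parts without boundary terms; the last integral is bounded by
the L¹ norm, uniformly for Im z ≥ 0. -/
theorem norm_pow_mul_hatC_le {d : ℕ} {h : RSpace (d + 1) → ℂ}
    (hh : DecaysOn (d + 1 + 2) (lowerHalf d) h) (i : Fin d) (ξ' : RSpace d) {z : ℂ}
    (hz : 0 ≤ z.im) (p : ℕ) {C : ℝ} (hC : 0 ≤ C)
    (hb : ∀ y ∈ lowerHalf d, (1 + ‖y‖) ^ (d + 1 + 2) *
      ‖wderiv (List.replicate p i.castSucc) h y‖ ≤ C) :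
    |ξ' i| ^ p * ‖hatC (extendZero (lowerHalf d) h) (snocC ξ' z)‖ ≤
      C * ∫ y : RSpace (d + 1), ((1 + ‖y‖) ^ (d + 1 + 1))⁻¹ := by
  induction p generalizing h with
  | zero =>
    rw [pow_zero, one_mul]
    refine (hh.lowerSupported.norm_hatC_le ξ' hz).trans ?_
    rw [← integral_const_mul]
    refine integral_mono hh.lowerSupported.integrable.norm
      ((integrable_one_add_norm_pow _).const_mul C) fun y => ?_
    refine (extendZero_norm_le hC hb y).trans ?_
    gcongr
    · linarith [norm_nonneg y]
    · omega
  | succ p ih =>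
    have h1 := ih (hh.pderiv (isOpen_lowerHalf d) i.castSucc) (by
      intro y hy
      have := hb y hy
      rwa [List.replicate_succ', wderiv_append] at this)
    rw [hatC_extendZero_pderiv hh i ξ' hz] at h1
    refine le_trans (le_of_eq ?_) h1
    rw [norm_mul, norm_mul, Complex.norm_I, one_mul, Complex.norm_real, Real.norm_eq_abs]
    ring

/-- The decay is in ξ' only and uniform in z. None is claimed in z, where the jump of the extension
at the boundary obstructs it. -/
theorem bracket_pow_mul_hatC_le {d : ℕ} {h : RSpace (d + 1) → ℂ}
    (hh : DecaysOn (d + 1 + 2) (lowerHalf d) h) (ξ' : RSpace d) {z : ℂ}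
    (hz : 0 ≤ z.im) (p : ℕ) {C : ℝ} (hC : 0 ≤ C)
    (hb : ∀ V : List (Fin (d + 1)), V.length ≤ p → ∀ y ∈ lowerHalf d,
      (1 + ‖y‖) ^ (d + 1 + 2) * ‖wderiv V h y‖ ≤ C) :
    bracket ξ' ^ p * ‖hatC (extendZero (lowerHalf d) h) (snocC ξ' z)‖ ≤
      (2 * (d + 1)) ^ (p + 1) * (C * ∫ y : RSpace (d + 1), ((1 + ‖y‖) ^ (d + 1 + 1))⁻¹) := by
  set X := C * ∫ y : RSpace (d + 1), ((1 + ‖y‖) ^ (d + 1 + 1))⁻¹ with hX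
  set w := ‖hatC (extendZero (lowerHalf d) h) (snocC ξ' z)‖ with hw
  have h0 : w ≤ X := by
    have h1 := hh.lowerSupported.norm_hatC_le ξ' hz
    refine h1.trans ?_
    rw [hX, ← integral_const_mul]
    refine integral_mono hh.lowerSupported.integrable.norm
      ((integrable_one_add_norm_pow _).const_mul C) fun y => ?_
    refine (extendZero_norm_le hC (hb [] (by simp)) y).trans ?_
    gcongr
    · linarith [norm_nonneg y]
    · omega
  have hX0 : 0 ≤ X := (norm_nonneg _).trans h0
  have hw0 : 0 ≤ w := norm_nonneg _
  have hi : ∀ i, |ξ' i| ^ p * w ≤ X := fun i =>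
    norm_pow_mul_hatC_le hh i ξ' hz p hC (hb _ (by simp))
  have hd1 : (1 : ℝ) ≤ d + 1 := by linarith [Nat.cast_nonneg (α := ℝ) d]
  have hnorm : ‖ξ'‖ ^ p * w ≤ (d + 1 : ℝ) ^ (p + 1) * X := by
    calc ‖ξ'‖ ^ p * w ≤ ((d : ℝ) ^ p * (∑ i, |ξ' i| ^ p + 1)) * w := by
          gcongr
          exact norm_mul_pow_le_sum ξ' p
      _ = (d : ℝ) ^ p * (∑ i, |ξ' i| ^ p * w + w) := by
          rw [mul_assoc, add_mul, Finset.sum_mul, one_mul]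
      _ ≤ (d + 1 : ℝ) ^ p * (∑ _i : Fin d, X + X) := by
          gcongr with i
          · linarith
          · exact hi i
      _ = _ := by
          rw [Finset.sum_const, Finset.card_univ, Fintype.card_fin, nsmul_eq_mul]; ring
  have hbr : bracket ξ' ^ p ≤ 2 ^ p * (1 + ‖ξ'‖ ^ p) := by
    calc bracket ξ' ^ p ≤ (1 + ‖ξ'‖) ^ p :=
          pow_le_pow_left₀ (bracket_pos _).le (bracket_le_one_add_norm _) _
      _ ≤ 2 ^ (p - 1) * (1 ^ p + ‖ξ'‖ ^ p) := add_pow_le zero_le_one (norm_nonneg _) p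
      _ ≤ _ := by
          rw [one_pow]
          gcongr
          · norm_num
          · omega
  calc bracket ξ' ^ p * w ≤ 2 ^ p * (1 + ‖ξ'‖ ^ p) * w := by gcongr
    _ = 2 ^ p * (w + ‖ξ'‖ ^ p * w) := by ring
    _ ≤ 2 ^ p * ((d + 1 : ℝ) ^ (p + 1) * X + (d + 1 : ℝ) ^ (p + 1) * X) := by
        gcongr
        exact h0.trans (le_mul_of_one_le_left hX0 (one_le_pow₀ hd1))
    _ = _ := by rw [mul_pow]; ring

/-- Half of the commutator identity `pairing_coord_mul`: a coordinate on the f side is a frequency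
derivative of the transform. -/
theorem hasLineDerivAt_hat {n : ℕ} {f : RSpace n → ℂ} (hm : AEStronglyMeasurable f volume)
    (hf : Integrable (fun y => (1 + ‖y‖) * ‖f y‖)) (k : Fin n) (ξ : RSpace n) :
    HasLineDerivAt ℝ (hat f) (-Complex.I * hat (fun y => (y k : ℂ) * f y) ξ) ξ
      (EuclideanSpace.single k 1) := by
  unfold HasLineDerivAt
  have hder : ∀ (y : RSpace n) (t : ℝ), HasDerivAt
      (fun t : ℝ => Complex.exp (-(Complex.I *
        (inner ℝ y (ξ + t • EuclideanSpace.single k (1 : ℝ)) : ℝ))) * f y)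
      (Complex.exp (-(Complex.I * (inner ℝ y (ξ + t • EuclideanSpace.single k (1 : ℝ)) : ℝ))) *
        (-Complex.I * ((y k : ℂ) * f y))) t := by
    intro y t
    have h0 : HasDerivAt (fun t : ℝ => inner ℝ y (ξ + t • EuclideanSpace.single k (1 : ℝ)))
        (y k) t := by
      simp only [inner_add_right, inner_smul_right]
      have h1 : inner ℝ y (EuclideanSpace.single k (1 : ℝ)) = y k := by
        simp [EuclideanSpace.inner_single_right]
      rw [h1]
      simpa using ((hasDerivAt_id t).mul_const (y k)).const_add (inner ℝ y ξ)
    have h2 := ((h0.ofReal_comp.const_mul Complex.I).neg.cexp).mul_const (f y)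
    refine h2.congr_deriv ?_
    simp only [Pi.neg_apply]
    ring
  have hn : ∀ (y ξ : RSpace n), ‖Complex.exp (-(Complex.I * (inner ℝ y ξ : ℝ)))‖ = 1 := by
    intro y ξ
    rw [Complex.norm_exp]
    simp
  have hmeas : ∀ η : RSpace n, AEStronglyMeasurable
      (fun y => Complex.exp (-(Complex.I * (inner ℝ y η : ℝ))) * f y) volume := by
    intro η
    have : Continuous (fun y : RSpace n => Complex.exp (-(Complex.I * (inner ℝ y η : ℝ)))) := by
      fun_prop
    exact this.aestronglyMeasurable.mul hm
  have hcoord : Continuous (fun y : RSpace n => (y k : ℂ)) := by fun_prop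
  have hmeas' : ∀ η : RSpace n, AEStronglyMeasurable
      (fun y => Complex.exp (-(Complex.I * (inner ℝ y η : ℝ))) *
        (-Complex.I * ((y k : ℂ) * f y))) volume := by
    intro η
    have : Continuous (fun y : RSpace n => Complex.exp (-(Complex.I * (inner ℝ y η : ℝ)))) := by
      fun_prop
    exact this.aestronglyMeasurable.mul
      ((hcoord.aestronglyMeasurable.mul hm).const_mul (-Complex.I))
  have key := hasDerivAt_integral_of_dominated_loc_of_deriv_le (μ := volume) (x₀ := (0 : ℝ))
    (bound := fun y => (1 + ‖y‖) * ‖f y‖) Filter.univ_mem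
    (Filter.Eventually.of_forall fun t => hmeas (ξ + t • EuclideanSpace.single k (1 : ℝ)))
    ((integrable_of_weighted hm hf).norm.mono' (hmeas _)
      (Filter.Eventually.of_forall fun y => by rw [norm_mul, hn, one_mul]))
    (hmeas' _) ?_ hf (Filter.Eventually.of_forall fun y t _ => hder y t)
  · refine key.2.congr_deriv ?_
    simp only [hat, zero_smul, add_zero]
    rw [← integral_const_mul]
    congr 1
    ext y
    ring
  · refine Filter.Eventually.of_forall fun y t _ => ?_
    rw [norm_mul, hn, one_mul, norm_mul, norm_mul, norm_neg, Complex.norm_I, one_mul,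
      Complex.norm_real, Real.norm_eq_abs]
    gcongr
    linarith [abs_apply_le_norm y k]

end SGHalfSpace

end


noncomputable section

namespace SGHalfSpace

open MeasureTheory Filter Topology

/-! ### Complex analysis in one variable -/

/-- The difference quotient of f at z is holomorphic in the whole exterior, including z, so its
circle integrals do not depend on the radius. Comparing R₀ with R → ∞, where f vanishes, leaves the
Cauchy formula for an exterior domain. -/
theorem circleIntegral_exterior {f : ℂ → ℂ} {R₀ : ℝ} (hR₀ : 0 < R₀)
    (hd : ∀ z, R₀ ≤ ‖z‖ → DifferentiableAt ℂ f z)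
    (hf : Tendsto f (Bornology.cobounded ℂ) (𝓝 0)) {z : ℂ} (hz : R₀ < ‖z‖) :
    (∮ w in C(0, R₀), (w - z)⁻¹ • f w) = -(2 * Real.pi * Complex.I * f z) := by
  set E : Set ℂ := {w | R₀ ≤ ‖w‖} with hE
  have hEz : E ∈ 𝓝 z := by
    refine mem_of_superset ((isOpen_lt continuous_const continuous_norm).mem_nhds hz) ?_
    exact fun w hw => show R₀ ≤ ‖w‖ from le_of_lt hw
  have hfd : DifferentiableOn ℂ f E := fun w hw => (hd w hw).differentiableWithinAt
  have hg : DifferentiableOn ℂ (dslope f z) E := (Complex.differentiableOn_dslope hEz).2 hfd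
  have hgeq : ∀ R, R₀ ≤ R → (∮ w in C(0, R), dslope f z w) = ∮ w in C(0, R₀), dslope f z w := by
    intro R hR
    refine Complex.circleIntegral_eq_of_differentiable_on_annulus_off_countable hR₀ hR
      Set.countable_empty (hg.continuousOn.mono ?_) ?_
    · intro w hw
      simpa [hE] using hw.2
    · intro w hw
      have hw' : R₀ < ‖w‖ := by simpa using hw.1.2
      refine (hg w hw'.le).differentiableAt ?_
      exact mem_of_superset ((isOpen_lt continuous_const continuous_norm).mem_nhds hw')
        fun w hw => show R₀ ≤ ‖w‖ from le_of_lt hw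
  -- Off the circle through z the quotient splits into the Cauchy integral of f and f(z) times the
  -- integral of 1/(w-z). The latter is 0 for R = R₀ and 2πi for R > |z|.
  have hsplit : ∀ R, R₀ ≤ R → R ≠ ‖z‖ → (∮ w in C(0, R), dslope f z w)
      = (∮ w in C(0, R), (w - z)⁻¹ • f w) - (∮ w in C(0, R), (w - z)⁻¹) * f z := by
    intro R hR hRz
    have hRpos : 0 < R := hR₀.trans_le hR
    have hne : ∀ w ∈ Metric.sphere (0 : ℂ) R, w ≠ z := by
      rintro w hw rfl
      exact hRz (by simpa using hw.symm)
    have hci : ContinuousOn (fun w : ℂ => (w - z)⁻¹) (Metric.sphere (0 : ℂ) R) :=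
      (continuousOn_id.sub continuousOn_const).inv₀ fun w hw => sub_ne_zero.2 (hne w hw)
    have hcf : ContinuousOn f (Metric.sphere (0 : ℂ) R) :=
      hfd.continuousOn.mono fun w hw => by
        have : ‖w‖ = R := by simpa using hw
        simpa [hE, this] using hR
    have i1 : CircleIntegrable (fun w => (w - z)⁻¹ • f w) 0 R :=
      (hci.smul hcf).circleIntegrable hRpos.le
    have i2 : CircleIntegrable (fun w => f z • (w - z)⁻¹) 0 R :=
      (hci.const_smul (f z)).circleIntegrable hRpos.le
    rw [mul_comm, ← smul_eq_mul (a := f z), ← circleIntegral.integral_smul,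
      ← circleIntegral.integral_sub i1 i2]
    refine circleIntegral.integral_congr hRpos.le fun w hw => ?_
    rw [dslope_of_ne _ (hne w hw), slope_def_field]
    simp only [smul_eq_mul]
    rw [div_eq_inv_mul]
    ring
  have hinner : (∮ w in C(0, R₀), (w - z)⁻¹) = 0 := by
    refine Complex.circleIntegral_eq_zero_of_differentiable_on_off_countable hR₀.le
      Set.countable_empty ?_ ?_
    · refine (continuousOn_id.sub continuousOn_const).inv₀ fun w hw => sub_ne_zero.2 ?_
      rintro rfl
      have : ‖w‖ ≤ R₀ := by simpa using hw
      simp only [id] at hz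
      linarith
    · intro w hw
      refine (differentiableAt_id.sub_const z).inv (sub_ne_zero.2 ?_)
      rintro rfl
      have : ‖w‖ < R₀ := by simpa using hw.1
      simp only [id] at hz
      linarith
  have hlim : Tendsto (fun R : ℝ => ∮ w in C(0, R), (w - z)⁻¹ • f w) atTop (𝓝 0) := by
    rw [Metric.tendsto_nhds]
    intro ε hε
    have hε' : 0 < ε / (8 * Real.pi) := by positivity
    have h1 : ∀ᶠ w in Bornology.cobounded ℂ, ‖f w‖ < ε / (8 * Real.pi) := by
      have := (Metric.tendsto_nhds.1 hf) _ hε'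
      simpa using this
    obtain ⟨M, hM⟩ : ∃ M, ∀ w : ℂ, M ≤ ‖w‖ → ‖f w‖ < ε / (8 * Real.pi) := by
      rw [← comap_norm_atTop, eventually_comap] at h1
      obtain ⟨M, hM⟩ := eventually_atTop.1 h1
      exact ⟨M, fun w hw => hM _ hw w rfl⟩
    filter_upwards [eventually_ge_atTop M, eventually_ge_atTop (2 * ‖z‖ + 1),
      eventually_gt_atTop 0] with R h2 h3 h4
    rw [dist_zero_right]
    have hb : ‖∮ w in C(0, R), (w - z)⁻¹ • f w‖
        ≤ 2 * Real.pi * R * ((R / 2)⁻¹ * (ε / (8 * Real.pi))) := by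
      refine circleIntegral.norm_integral_le_of_norm_le_const h4.le fun w hw => ?_
      have hw' : ‖w‖ = R := by simpa using hw
      rw [norm_smul, norm_inv]
      have h5 : R / 2 ≤ ‖w - z‖ := by
        have := norm_sub_norm_le w z
        linarith
      exact mul_le_mul (inv_anti₀ (by positivity) h5) (hM w (by rw [hw']; exact h2)).le
        (norm_nonneg _) (by positivity)
    refine hb.trans_lt ?_
    have : 2 * Real.pi * R * ((R / 2)⁻¹ * (ε / (8 * Real.pi))) = ε / 2 := by
      field_simp
      ring
    rw [this]
    linarith
  have hconst : ∀ᶠ R : ℝ in atTop, (∮ w in C(0, R), (w - z)⁻¹ • f w)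
      = (∮ w in C(0, R₀), (w - z)⁻¹ • f w) + 2 * Real.pi * Complex.I * f z := by
    filter_upwards [eventually_ge_atTop R₀, eventually_gt_atTop ‖z‖] with R h1 h2
    have e1 := hsplit R h1 h2.ne'
    have e2 := hsplit R₀ le_rfl hz.ne
    rw [hinner, zero_mul, sub_zero] at e2
    have e3 : (∮ w in C(0, R), (w - z)⁻¹) = 2 * Real.pi * Complex.I :=
      circleIntegral.integral_sub_inv_of_mem_ball (by simpa using h2)
    rw [hgeq R h1, e2, e3] at e1
    rw [e1]
    ring
  have := tendsto_nhds_unique (hlim.congr' hconst) tendsto_const_nhds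
  exact eq_neg_of_add_eq_zero_left this.symm

/-- The kernel of the Cauchy formula in the exterior of a disc. -/
def kern (m : ℤ) (z w : ℂ) : ℂ := (z / w) ^ m * (w / (z - w)) / (2 * Real.pi)

/-- The exterior formula is applied to A(z) z^{-m}, which tends to 0, and z^m is multiplied back.
The factor w in `kern` comes from dw = iw dσ. -/
theorem exterior_formula {A : ℂ → ℂ} {R₀ : ℝ} (hR₀ : 0 < R₀) (m : ℤ)
    (hd : ∀ z, R₀ ≤ ‖z‖ → DifferentiableAt ℂ A z)
    (hA : Tendsto (fun z => A z * z ^ (-m)) (Bornology.cobounded ℂ) (𝓝 0)) {z : ℂ}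
    (hz : R₀ < ‖z‖) :
    A z = ∫ σ in (0 : ℝ)..(2 * Real.pi), A (R₀ * Complex.exp (Complex.I * σ)) *
      kern m z (R₀ * Complex.exp (Complex.I * σ)) := by
  have hne : ∀ w : ℂ, R₀ ≤ ‖w‖ → w ≠ 0 := fun w hw h => by
    rw [h, norm_zero] at hw; linarith
  have h := circleIntegral_exterior hR₀ (f := fun z => A z * z ^ (-m))
    (fun w hw => (hd w hw).mul (differentiableAt_zpow.2 (Or.inl (hne w hw)))) hA hz
  have hz0 : z ≠ 0 := hne z hz.le
  have hpi : (Real.pi : ℂ) ≠ 0 := by exact_mod_cast Real.pi_ne_zero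
  have h2 : A z = -(z ^ m / (2 * Real.pi * Complex.I)) *
      (-(2 * Real.pi * Complex.I * (A z * z ^ (-m)))) := by
    rw [zpow_neg]
    have := zpow_ne_zero m hz0
    field_simp [Complex.I_ne_zero]
  rw [h2, ← h, circleIntegral, ← intervalIntegral.integral_const_mul]
  refine intervalIntegral.integral_congr fun σ _ => ?_
  have ew : circleMap 0 R₀ σ = R₀ * Complex.exp (Complex.I * σ) := by
    rw [circleMap, zero_add, mul_comm (σ : ℂ)]
  simp only [deriv_circleMap, smul_eq_mul]
  rw [ew]
  set w : ℂ := R₀ * Complex.exp (Complex.I * σ) with hw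
  have hwn : ‖w‖ = R₀ := by
    rw [hw, norm_mul, mul_comm Complex.I, Complex.norm_exp_ofReal_mul_I, mul_one,
      Complex.norm_real, Real.norm_of_nonneg hR₀.le]
  have hw0 : w ≠ 0 := hne w hwn.ge
  have hzw : z - w ≠ 0 := by
    intro h0
    rw [sub_eq_zero] at h0
    rw [h0, hwn] at hz
    exact lt_irrefl _ hz
  have hwz : w - z ≠ 0 := by rwa [← neg_ne_zero, neg_sub]
  unfold kern
  rw [div_zpow, zpow_neg]
  have := zpow_ne_zero m hw0
  rw [show w - z = -(z - w) by ring]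
  field_simp [Complex.I_ne_zero]

/-- For |z| ≥ 2|w| one has |z - w| ≥ |z|/2, so the Cauchy factor gains one power of |w|/|z|. This
lowers the exponent to m - 1, and the constant 2 disappears in 2π. -/
theorem norm_kern_le {m : ℤ} {z w : ℂ} (hw : w ≠ 0) (h : 2 * ‖w‖ ≤ ‖z‖) :
    ‖kern m z w‖ ≤ (‖z‖ / ‖w‖) ^ (m - 1) := by
  have hw' : 0 < ‖w‖ := norm_pos_iff.2 hw
  have hz' : 0 < ‖z‖ := by linarith
  have h1 : ‖z‖ / 2 ≤ ‖z - w‖ := by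
    have := norm_sub_norm_le z w
    linarith
  have hp : (1 : ℝ) ≤ Real.pi := by linarith [Real.pi_gt_three]
  unfold kern
  rw [norm_div, norm_mul, norm_zpow, norm_div, norm_div, norm_mul, Complex.norm_real,
    Real.norm_of_nonneg Real.pi_pos.le, Complex.norm_ofNat, zpow_sub_one₀ (by positivity)]
  have h2 : ‖w‖ / ‖z - w‖ ≤ 2 * (‖z‖ / ‖w‖)⁻¹ := by
    rw [inv_div, ← mul_div_assoc, div_le_div_iff₀ (by linarith) hz']
    nlinarith
  rw [div_le_iff₀ (by positivity)]
  calc (‖z‖ / ‖w‖) ^ m * (‖w‖ / ‖z - w‖) ≤ (‖z‖ / ‖w‖) ^ m * (2 * (‖z‖ / ‖w‖)⁻¹) := by gcongr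
    _ = (‖z‖ / ‖w‖) ^ m * (‖z‖ / ‖w‖)⁻¹ * (2 * 1) := by ring
    _ ≤ _ := by gcongr

theorem tendsto_eval_div_pow (P : Polynomial ℂ) :
    Tendsto (fun z : ℂ => P.eval z / z ^ P.natDegree) (Bornology.cobounded ℂ)
      (𝓝 P.leadingCoeff) := by
  have h1 : Tendsto (fun z : ℂ => P.reverse.eval z⁻¹) (Bornology.cobounded ℂ)
      (𝓝 P.leadingCoeff) := by
    have h2 : Tendsto (fun z : ℂ => P.reverse.eval z) (𝓝 0) (𝓝 (P.reverse.eval 0)) :=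
      P.reverse.continuous.tendsto 0
    rw [← Polynomial.coeff_zero_eq_eval_zero, Polynomial.coeff_zero_reverse] at h2
    exact h2.comp tendsto_inv₀_cobounded
  refine h1.congr' ?_
  filter_upwards [Bornology.eventually_ne_cobounded (0 : ℂ)] with z hz
  let _ := invertibleOfNonzero hz
  have h3 := Polynomial.eval₂_reverse_mul_pow (RingHom.id ℂ) z P
  rw [eq_div_iff (pow_ne_zero _ hz)]
  simpa using h3

/-- A rational function that is `O(t^e)` on the real axis is `o(z^{e+1})` at infinity. -/
theorem tendsto_rational_of_real_bound (P Q : Polynomial ℂ) (hQ : Q ≠ 0) (e : ℤ) (C t₀ : ℝ)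
    (hb : ∀ t : ℝ, t₀ ≤ t → ‖P.eval (t : ℂ) / Q.eval (t : ℂ)‖ ≤ C * t ^ e) :
    Tendsto (fun z : ℂ => P.eval z / Q.eval z * z ^ (-(e + 1))) (Bornology.cobounded ℂ) (𝓝 0) := by
  by_cases hP : P = 0
  · simp [hP]
  set δ : ℤ := P.natDegree - Q.natDegree with hδ
  have hlQ : Q.leadingCoeff ≠ 0 := Polynomial.leadingCoeff_ne_zero.2 hQ
  have hlP : P.leadingCoeff ≠ 0 := Polynomial.leadingCoeff_ne_zero.2 hP
  have hlim : Tendsto (fun z : ℂ => P.eval z / Q.eval z * z ^ (-δ)) (Bornology.cobounded ℂ)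
      (𝓝 (P.leadingCoeff / Q.leadingCoeff)) := by
    refine ((tendsto_eval_div_pow P).div (tendsto_eval_div_pow Q) hlQ).congr' ?_
    filter_upwards [Bornology.eventually_ne_cobounded (0 : ℂ)] with z hz
    have e1 : z ^ (-δ) = z ^ Q.natDegree / z ^ P.natDegree := by
      rw [hδ, neg_sub, zpow_sub₀ hz, zpow_natCast, zpow_natCast]
    rw [e1, Pi.div_apply, div_div_div_eq]
    ring
  have hpow : ∀ k : ℤ, k < 0 → Tendsto (fun z : ℂ => z ^ k) (Bornology.cobounded ℂ) (𝓝 0) := by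
    intro k hk
    obtain ⟨j, hj⟩ : ∃ j : ℕ, k = -((j + 1 : ℕ) : ℤ) := ⟨(-k - 1).toNat, by omega⟩
    have h0 : Tendsto (fun z : ℂ => (z⁻¹) ^ (j + 1)) (Bornology.cobounded ℂ) (𝓝 0) := by
      have := (tendsto_inv₀_cobounded (α := ℂ)).pow (j + 1)
      simpa using this
    refine h0.congr fun z => ?_
    rw [hj, zpow_neg, zpow_natCast, inv_pow]
  -- The quotient behaves like a nonzero multiple of z^δ. If δ exceeded e, the bound along the
  -- positive axis would force the ratio of the leading coefficients to vanish.
  have hδe : δ ≤ e := by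
    by_contra hlt
    have hreal : Tendsto (fun t : ℝ => (t : ℂ)) atTop (Bornology.cobounded ℂ) := by
      rw [← tendsto_norm_atTop_iff_cobounded]
      simpa using tendsto_abs_atTop_atTop (G := ℝ)
    have h1 := (hlim.comp hreal).norm
    have h2 : Tendsto (fun t : ℝ => C * ‖((t : ℂ)) ^ (e - δ)‖) atTop (𝓝 0) := by
      have := (((hpow (e - δ) (by omega)).comp hreal).norm).const_mul C
      simpa using this
    have h3 : ‖P.leadingCoeff / Q.leadingCoeff‖ ≤ 0 := by
      refine le_of_tendsto_of_tendsto h1 h2 ?_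
      filter_upwards [eventually_ge_atTop t₀, eventually_gt_atTop 0] with t ht ht0
      simp only [Function.comp_apply]
      rw [norm_mul, norm_zpow, norm_zpow, Complex.norm_real, Real.norm_of_nonneg ht0.le,
        sub_eq_add_neg e, zpow_add₀ ht0.ne', ← mul_assoc]
      gcongr
      exact hb t ht
    have h4 : P.leadingCoeff / Q.leadingCoeff = 0 := norm_le_zero_iff.1 h3
    exact (div_ne_zero hlP hlQ) h4
  have h5 := hlim.mul (hpow (δ - (e + 1)) (by omega))
  rw [mul_zero] at h5
  refine h5.congr' ?_
  filter_upwards [Bornology.eventually_ne_cobounded (0 : ℂ)] with z hz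
  rw [mul_assoc, ← zpow_add₀ hz]
  congr 2
  ring

/-- Deformation of the half lines `|t| > R` to the upper half circle of radius `R`. -/
theorem integral_halflines_eq_arc {h : ℂ → ℂ} {R C : ℝ} (hR : 0 < R)
    (hc : ContinuousOn h {z | 0 ≤ z.im ∧ R ≤ ‖z‖})
    (hd : ∀ z : ℂ, 0 < z.im → R < ‖z‖ → DifferentiableAt ℂ h z)
    (hb : ∀ z : ℂ, 0 ≤ z.im → R ≤ ‖z‖ → ‖h z‖ ≤ C * (‖z‖ ^ 2)⁻¹) :
    ∫ t in {t : ℝ | R < |t|}, h t =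
      ∫ s in (0 : ℝ)..Real.pi, h (R * Complex.exp (Complex.I * s)) *
        (Complex.I * (R * Complex.exp (Complex.I * s))) := by
  have hcpos : ContinuousOn (fun t : ℝ => h t) (Set.Ici R) :=
    hc.comp Complex.continuous_ofReal.continuousOn fun t ht => by
      simp only [Set.mem_Ici] at ht
      simp [abs_of_pos (hR.trans_le ht), ht]
  have hcneg : ContinuousOn (fun t : ℝ => h (-t : ℝ)) (Set.Ici R) :=
    hc.comp (Complex.continuous_ofReal.comp continuous_neg).continuousOn fun t ht => by
      simp only [Set.mem_Ici] at ht
      simp [abs_of_pos (hR.trans_le ht), ht]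
  have hdom : IntegrableOn (fun t : ℝ => C * (t ^ 2)⁻¹) (Set.Ioi R) := by
    have := (integrableOn_Ioi_rpow_of_lt (show (-2 : ℝ) < -1 by norm_num) hR).const_mul C
    refine this.congr ?_
    filter_upwards [ae_restrict_mem measurableSet_Ioi] with t ht
    have ht0 : 0 < t := hR.trans ht
    rw [Real.rpow_neg ht0.le]
    norm_cast
  have ipos : IntegrableOn (fun t : ℝ => h t) (Set.Ioi R) := by
    refine hdom.mono' ((hcpos.mono Set.Ioi_subset_Ici_self).aestronglyMeasurable
      measurableSet_Ioi) ?_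
    filter_upwards [ae_restrict_mem measurableSet_Ioi] with t ht
    have ht0 : R < t := ht
    have := hb (t : ℂ) (by simp) (by simp [abs_of_pos (hR.trans ht0), ht0.le])
    simpa using this
  have ineg : IntegrableOn (fun t : ℝ => h (-t : ℝ)) (Set.Ioi R) := by
    refine hdom.mono' ((hcneg.mono Set.Ioi_subset_Ici_self).aestronglyMeasurable
      measurableSet_Ioi) ?_
    filter_upwards [ae_restrict_mem measurableSet_Ioi] with t ht
    have ht0 : R < t := ht
    have := hb ((-t : ℝ) : ℂ) (by simp) (by simp [abs_of_pos (hR.trans ht0), ht0.le])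
    simpa using this
  set a := Real.log R with ha
  have hea : Real.exp a = R := Real.exp_log hR
  -- The substitution z = e^ζ turns the upper half annulus into the rectangle [log R, b] × [0, π],
  -- where Cauchy's theorem for rectangles applies.
  set H : ℂ → ℂ := fun ζ => h (Complex.exp ζ) * Complex.exp ζ with hH
  have hrect : ∀ b, a ≤ b → (∫ t in R..Real.exp b, h t) + (∫ t in R..Real.exp b, h (-t : ℝ))
      + Complex.I * (∫ y in (0 : ℝ)..Real.pi, H (b + y * Complex.I))
      - Complex.I * (∫ y in (0 : ℝ)..Real.pi, H (a + y * Complex.I)) = 0 := by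
    intro b hab
    have key := Complex.integral_boundary_rect_eq_zero_of_continuousOn_of_differentiableOn H
      (a : ℂ) (b + Real.pi * Complex.I) ?_ ?_
    · simp only [Complex.ofReal_re, Complex.ofReal_im, Complex.add_re, Complex.mul_re,
        Complex.I_re, mul_zero, Complex.I_im, mul_one, sub_self, add_zero, Complex.add_im,
        Complex.mul_im, zero_add, smul_eq_mul, zero_mul, Complex.ofReal_zero] at key
      have e1 : ∫ x in a..b, H x = ∫ t in R..Real.exp b, h t := by
        rw [← hea]
        have := intervalIntegral.integral_deriv_smul_comp'' (a := a) (b := b)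
          (f := Real.exp) (f' := Real.exp) (g := fun t : ℝ => h t)
          Real.continuous_exp.continuousOn
          (fun x _ => (Real.hasDerivAt_exp x).hasDerivWithinAt)
          Real.continuous_exp.continuousOn ?_
        · rw [← this]
          refine intervalIntegral.integral_congr fun x _ => ?_
          simp [hH, mul_comm]
        · refine hcpos.mono ?_
          rintro _ ⟨x, hx, rfl⟩
          rw [Set.uIcc_of_le hab] at hx
          rw [Set.mem_Ici, ← hea]
          exact Real.exp_le_exp.2 hx.1
      -- On the upper edge e^{x + iπ} = -e^x, so this edge gives the negative half line.
      have e2 : ∫ x in a..b, H (x + Real.pi * Complex.I)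
          = -∫ t in R..Real.exp b, h (-t : ℝ) := by
        rw [← hea]
        have := intervalIntegral.integral_deriv_smul_comp'' (a := a) (b := b)
          (f := Real.exp) (f' := Real.exp) (g := fun t : ℝ => h (-t : ℝ))
          Real.continuous_exp.continuousOn
          (fun x _ => (Real.hasDerivAt_exp x).hasDerivWithinAt)
          Real.continuous_exp.continuousOn ?_
        · rw [← this, ← intervalIntegral.integral_neg]
          refine intervalIntegral.integral_congr fun x _ => ?_
          simp [hH, Complex.exp_add, Complex.exp_pi_mul_I, mul_comm (h _)]
        · refine hcneg.mono ?_
          rintro _ ⟨x, hx, rfl⟩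
          rw [Set.uIcc_of_le hab] at hx
          rw [Set.mem_Ici, ← hea]
          exact Real.exp_le_exp.2 hx.1
      rw [e1, e2, sub_neg_eq_add] at key
      exact key
    · simp only [Complex.ofReal_re, Complex.ofReal_im, Complex.add_re, Complex.mul_re,
        Complex.I_re, mul_zero, Complex.I_im, mul_one, sub_self, add_zero, Complex.add_im,
        Complex.mul_im, zero_add]
      refine ContinuousOn.mul (hc.comp Complex.continuous_exp.continuousOn ?_)
        Complex.continuous_exp.continuousOn
      intro ζ hζ
      rw [Complex.mem_reProdIm, Set.uIcc_of_le hab, Set.uIcc_of_le Real.pi_pos.le] at hζ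
      refine ⟨?_, ?_⟩
      · rw [Complex.exp_im]
        have := Real.sin_nonneg_of_mem_Icc hζ.2
        positivity
      · rw [Complex.norm_exp, ← hea]
        exact Real.exp_le_exp.2 hζ.1.1
    · simp only [Complex.ofReal_re, Complex.ofReal_im, Complex.add_re, Complex.mul_re,
        Complex.I_re, mul_zero, Complex.I_im, mul_one, sub_self, add_zero, Complex.add_im,
        Complex.mul_im, zero_add]
      intro ζ hζ
      rw [Complex.mem_reProdIm, min_eq_left hab, min_eq_left Real.pi_pos.le,
        max_eq_right hab, max_eq_right Real.pi_pos.le] at hζ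
      refine DifferentiableAt.differentiableWithinAt ?_
      refine ((hd _ ?_ ?_).comp ζ Complex.differentiableAt_exp).mul Complex.differentiableAt_exp
      · rw [Complex.exp_im]
        have := Real.sin_pos_of_mem_Ioo hζ.2
        positivity
      · rw [Complex.norm_exp, ← hea]
        exact Real.exp_lt_exp.2 hζ.1.1
  -- The bound |h| ≤ C|z|^{-2} leaves O(e^{-b}) on the outer arc.
  have hfar : Tendsto (fun b : ℝ => ∫ y in (0 : ℝ)..Real.pi, H (b + y * Complex.I)) atTop
      (𝓝 0) := by
    have hle : ∀ᶠ b : ℝ in atTop, ‖∫ y in (0 : ℝ)..Real.pi, H (b + y * Complex.I)‖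
        ≤ C * Real.exp (-b) * |Real.pi - 0| := by
      filter_upwards [eventually_ge_atTop a] with b hab
      refine intervalIntegral.norm_integral_le_of_norm_le_const fun y hy => ?_
      rw [Set.uIoc_of_le Real.pi_pos.le] at hy
      have hn : ‖Complex.exp (b + y * Complex.I)‖ = Real.exp b := by
        rw [Complex.norm_exp]; simp
      have him : 0 ≤ (Complex.exp (b + y * Complex.I)).im := by
        rw [Complex.exp_im]
        have := Real.sin_nonneg_of_mem_Icc ⟨hy.1.le, hy.2⟩
        simp only [Complex.add_im, Complex.ofReal_im, Complex.mul_im, Complex.ofReal_re,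
          Complex.I_im, mul_one, Complex.I_re, mul_zero, add_zero, zero_add]
        positivity
      have h1 := hb _ him (by rw [hn, ← hea]; exact Real.exp_le_exp.2 hab)
      rw [hH, norm_mul, hn]
      rw [hn] at h1
      calc _ ≤ C * (Real.exp b ^ 2)⁻¹ * Real.exp b := by gcongr
        _ = _ := by
          rw [Real.exp_neg]
          have := Real.exp_pos b
          field_simp
    have h0 : Tendsto (fun b : ℝ => C * Real.exp (-b) * |Real.pi - 0|) atTop (𝓝 0) := by
      have := (Real.tendsto_exp_neg_atTop_nhds_zero.const_mul C).mul_const |Real.pi - 0|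
      simpa using this
    exact squeeze_zero_norm' hle h0
  have l1 := (intervalIntegral_tendsto_integral_Ioi R ipos tendsto_id).comp Real.tendsto_exp_atTop
  have l2 := (intervalIntegral_tendsto_integral_Ioi R ineg tendsto_id).comp Real.tendsto_exp_atTop
  have l3 := ((l1.add l2).add (hfar.const_mul Complex.I)).sub
    (tendsto_const_nhds (x := Complex.I * (∫ y in (0 : ℝ)..Real.pi, H (a + y * Complex.I))))
  have l4 := tendsto_nhds_unique (tendsto_const_nhds.congr' (by
    filter_upwards [eventually_ge_atTop a] with b hab
    exact (hrect b hab).symm)) l3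
  rw [mul_zero, add_zero] at l4
  have hset : {t : ℝ | R < |t|} = Set.Ioi R ∪ Set.Iio (-R) := by
    ext t
    simp only [Set.mem_ofPred_eq, lt_abs, Set.mem_union, Set.mem_Ioi, Set.mem_Iio]
    constructor <;> rintro (h | h)
    · exact Or.inl h
    · exact Or.inr (by linarith)
    · exact Or.inl h
    · exact Or.inr (by linarith)
  have e3 : ∫ t in Set.Iio (-R), h t = ∫ t in Set.Ioi R, h (-t : ℝ) := by
    rw [integral_comp_neg_Ioi R (fun t : ℝ => h t), integral_Iic_eq_integral_Iio]
  have i3 : IntegrableOn (fun t : ℝ => h t) (Set.Iio (-R)) := by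
    have := ineg.comp_neg
    simpa using this
  rw [hset, setIntegral_union ?_ measurableSet_Iio ipos i3, e3]
  · have : (∫ t in Set.Ioi R, h t) + (∫ t in Set.Ioi R, h (-t : ℝ))
        = Complex.I * ∫ y in (0 : ℝ)..Real.pi, H (a + y * Complex.I) :=
      (sub_eq_zero.1 l4.symm)
    rw [this, ← intervalIntegral.integral_const_mul]
    refine intervalIntegral.integral_congr fun y _ => ?_
    have e4 : Complex.exp (a + y * Complex.I) = R * Complex.exp (Complex.I * y) := by
      rw [Complex.exp_add, ← Complex.ofReal_exp, hea, mul_comm (y : ℂ)]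
    simp only [hH]
    rw [e4]
    ring
  · rw [Set.disjoint_left]
    intro t h1 h2
    simp only [Set.mem_Ioi, Set.mem_Iio] at h1 h2
    linarith

end SGHalfSpace

end


noncomputable section

namespace SGHalfSpace

open MeasureTheory Filter Topology

/-! ### Partial derivatives of families -/

/-- A partial derivative in the second group of variables, taken slice by slice, is the total
derivative in the direction (0, e_k). This identity holds in a neighbourhood and can therefore be
iterated. -/
theorem contDiffAt_iterate_pderiv_snd {m n : ℕ} {F : RSpace m → RSpace n → ℂ}
    {w₀ : RSpace m × RSpace n} (hF : ContDiffAt ℝ ∞ (fun w : RSpace m × RSpace n => F w.1 w.2) w₀)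
    (k : Fin n) (l : ℕ) :
    ContDiffAt ℝ ∞ (fun w : RSpace m × RSpace n => (pderiv ℝ k)^[l] (F w.1) w.2) w₀ := by
  induction l with
  | zero => exact hF
  | succ l ih =>
    have h1 : ContDiffAt ℝ ∞ (fun w => fderiv ℝ
        (fun w : RSpace m × RSpace n => (pderiv ℝ k)^[l] (F w.1) w.2) w
          ((0 : RSpace m), EuclideanSpace.single k (1 : ℝ))) w₀ :=
      (ih.fderiv_right (m := ∞) (by simp)).clm_apply contDiffAt_const
    refine h1.congr_of_eventuallyEq ?_
    have h2 : ∀ᶠ w in 𝓝 w₀, ContDiffAt ℝ 1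
        (fun w : RSpace m × RSpace n => (pderiv ℝ k)^[l] (F w.1) w.2) w :=
      (ih.of_le (by norm_cast)).eventually (by simp)
    filter_upwards [h2] with w hw
    rw [Function.iterate_succ_apply']
    have h3 := (hw.differentiableAt (by simp)).hasFDerivAt
    have h4 : HasFDerivAt (fun η : RSpace n => (w.1, η))
        (ContinuousLinearMap.inr ℝ (RSpace m) (RSpace n)) w.2 := hasFDerivAt_prodMk_right w.1 w.2
    have h5 := HasFDerivAt.comp w.2 (f := fun η : RSpace n => (w.1, η)) h3 h4
    simp only [pderiv]
    have : (fun w : RSpace m × RSpace n => (pderiv ℝ k)^[l] (F w.1) w.2) ∘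
      (fun η : RSpace n => (w.1, η)) = (pderiv ℝ k)^[l] (F w.1) := rfl
    rw [this] at h5
    change fderiv ℝ ((pderiv ℝ k)^[l] (F w.1)) w.2 _ = _
    rw [h5.fderiv]
    rfl

/-! ### Rational functions -/

theorem hasFDerivAt_mvEval {n : ℕ} (P : MvPolynomial (Fin n) ℂ) (ζ : CSpace n) :
    HasFDerivAt (fun ζ : CSpace n => MvPolynomial.eval (fun i => ζ i) P)
      (∑ i, MvPolynomial.eval (fun i => ζ i) (MvPolynomial.pderiv i P) •
        (EuclideanSpace.proj i : CSpace n →L[ℂ] ℂ)) ζ := by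
  induction P using MvPolynomial.induction_on with
  | C a =>
    simp only [MvPolynomial.eval_C]
    refine (hasFDerivAt_const (𝕜 := ℂ) a ζ).congr_fderiv ?_
    ext v
    simp
  | add P Q hP hQ =>
    simp only [map_add]
    refine (hP.fun_add hQ).congr_fderiv ?_
    ext v
    simp [add_mul, Finset.sum_add_distrib]
  | mul_X P j hP =>
    simp only [map_mul, MvPolynomial.eval_X]
    have hX : HasFDerivAt (fun ζ : CSpace n => ζ j) (EuclideanSpace.proj j : CSpace n →L[ℂ] ℂ) ζ :=
      (EuclideanSpace.proj j : CSpace n →L[ℂ] ℂ).hasFDerivAt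
    refine (hP.fun_mul hX).congr_fderiv ?_
    ext v
    simp [MvPolynomial.pderiv_X, Pi.single_apply, add_mul,
      Finset.sum_add_distrib, Finset.mul_sum, apply_ite, ite_mul]
    refine Finset.sum_congr rfl fun i _ => ?_
    ring

/-- Numerator and denominator of `∂_k^l (P / Q)`. -/
def ratIter {n : ℕ} (k : Fin n) (P Q : MvPolynomial (Fin n) ℂ) :
    ℕ → MvPolynomial (Fin n) ℂ × MvPolynomial (Fin n) ℂ
  | 0 => (P, Q)
  | l + 1 => (MvPolynomial.pderiv k (ratIter k P Q l).1 * (ratIter k P Q l).2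
      - (ratIter k P Q l).1 * MvPolynomial.pderiv k (ratIter k P Q l).2, (ratIter k P Q l).2 ^ 2)

/-- The value of the quotient of two polynomials. -/
def quotEval {n : ℕ} (PQ : MvPolynomial (Fin n) ℂ × MvPolynomial (Fin n) ℂ) (ζ : CSpace n) : ℂ :=
  MvPolynomial.eval (fun i => ζ i) PQ.1 / MvPolynomial.eval (fun i => ζ i) PQ.2

theorem ratIter_snd_ne_zero {n : ℕ} (k : Fin n) {P Q : MvPolynomial (Fin n) ℂ} {ζ : CSpace n}
    (h : MvPolynomial.eval (fun i => ζ i) Q ≠ 0) (l : ℕ) :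
    MvPolynomial.eval (fun i => ζ i) (ratIter k P Q l).2 ≠ 0 := by
  induction l with
  | zero => exact h
  | succ l ih =>
    rw [ratIter, map_pow]
    exact pow_ne_zero 2 ih

theorem hasFDerivAt_quotEval {n : ℕ} (k : Fin n) (P Q : MvPolynomial (Fin n) ℂ) (l : ℕ)
    {ζ : CSpace n} (h : MvPolynomial.eval (fun i => ζ i) Q ≠ 0) :
    ∃ A : CSpace n →L[ℂ] ℂ, HasFDerivAt (quotEval (ratIter k P Q l)) A ζ ∧
      A (EuclideanSpace.single k 1) = quotEval (ratIter k P Q (l + 1)) ζ := by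
  have h0 := ratIter_snd_ne_zero k (P := P) h l
  have hinv := (hasDerivAt_inv h0).comp_hasFDerivAt ζ
    (hasFDerivAt_mvEval (ratIter k P Q l).2 ζ)
  have hq : quotEval (ratIter k P Q l) = fun ζ =>
      MvPolynomial.eval (fun i => ζ i) (ratIter k P Q l).1 *
        (MvPolynomial.eval (fun i => ζ i) (ratIter k P Q l).2)⁻¹ := by
    ext ζ
    rw [quotEval, div_eq_mul_inv]
  rw [hq]
  refine ⟨_, (hasFDerivAt_mvEval _ ζ).fun_mul hinv, ?_⟩
  have hs : ∀ P : MvPolynomial (Fin n) ℂ,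
      (∑ i, MvPolynomial.eval (fun i => ζ i) (MvPolynomial.pderiv i P) •
        (EuclideanSpace.proj i : CSpace n →L[ℂ] ℂ)) (EuclideanSpace.single k 1)
        = MvPolynomial.eval (fun i => ζ i) (MvPolynomial.pderiv k P) := by
    intro P
    simp [sum_apply, apply_ite]
  simp only [smul_apply, add_apply, hs, smul_eq_mul]
  rw [quotEval, ratIter]
  simp only [map_sub, map_mul, map_pow]
  field_simp
  ring

theorem isOpen_eval_ne_zero {n : ℕ} (Q : MvPolynomial (Fin n) ℂ) :
    IsOpen {ζ : CSpace n | MvPolynomial.eval (fun i => ζ i) Q ≠ 0} :=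
  isOpen_ne_fun (continuous_iff_continuousAt.2 fun ζ => (hasFDerivAt_mvEval Q ζ).continuousAt)
    continuous_const

theorem iterate_pderiv_complex {n : ℕ} (k : Fin n) (P Q : MvPolynomial (Fin n) ℂ) (l : ℕ) :
    Set.EqOn ((pderiv ℂ k)^[l] (quotEval (P, Q))) (quotEval (ratIter k P Q l))
      {ζ : CSpace n | MvPolynomial.eval (fun i => ζ i) Q ≠ 0} := by
  induction l with
  | zero => exact fun _ _ => rfl
  | succ l ih =>
    intro ζ hζ
    rw [Function.iterate_succ_apply']
    obtain ⟨A, hA, hA'⟩ := hasFDerivAt_quotEval k P Q l hζ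
    have h1 := hA.congr_of_eventuallyEq
      (eventuallyEq_of_mem ((isOpen_eval_ne_zero Q).mem_nhds hζ) ih)
    rw [pderiv, h1.fderiv, hA']

/-- `toC` as a real linear map. -/
def toCL (n : ℕ) : RSpace n →L[ℝ] CSpace n :=
  LinearMap.toContinuousLinearMap
    { toFun := toC
      map_add' := fun x y => by ext i; simp [toC]
      map_smul' := fun c x => by ext i; simp [toC] }

theorem toC_single {n : ℕ} (k : Fin n) :
    toC (EuclideanSpace.single k (1 : ℝ)) = EuclideanSpace.single k (1 : ℂ) := by
  ext i
  by_cases h : i = k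
  · subst h; simp [toC]
  · simp [toC, h]

theorem continuous_toC {n : ℕ} : Continuous (toC (n := n)) := (toCL n).continuous

theorem isOpen_eval_toC_ne_zero {n : ℕ} (Q : MvPolynomial (Fin n) ℂ) :
    IsOpen {η : RSpace n | MvPolynomial.eval (fun i => toC η i) Q ≠ 0} :=
  (isOpen_eval_ne_zero Q).preimage continuous_toC

/-- Real derivatives on the real axis and complex derivatives off it are values of one and the same
rational function. This links the estimates on the axis with those on the circle in
`IsRatExpansion.real_eq_integral`. -/
theorem iterate_pderiv_real {n : ℕ} (k : Fin n) (P Q : MvPolynomial (Fin n) ℂ) (l : ℕ) :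
    Set.EqOn ((pderiv ℝ k)^[l] (fun η => quotEval (P, Q) (toC η)))
      (fun η => quotEval (ratIter k P Q l) (toC η))
      {η : RSpace n | MvPolynomial.eval (fun i => toC η i) Q ≠ 0} := by
  induction l with
  | zero => exact fun _ _ => rfl
  | succ l ih =>
    intro η hη
    rw [Function.iterate_succ_apply']
    obtain ⟨A, hA, hA'⟩ := hasFDerivAt_quotEval k P Q l hη
    have h0 : HasFDerivAt (toC (n := n)) (toCL n) η := (toCL n).hasFDerivAt
    have h2 := (hA.restrictScalars ℝ).comp η h0
    have h1 := h2.congr_of_eventuallyEq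
      (eventuallyEq_of_mem ((isOpen_eval_toC_ne_zero Q).mem_nhds hη) ih)
    rw [pderiv, h1.fderiv]
    beta_reduce
    rw [← hA', ← toC_single]
    rfl

theorem contDiffOn_quotEval_toC {n : ℕ} (P Q : MvPolynomial (Fin n) ℂ) :
    ContDiffOn ℝ ∞ (fun η => quotEval (P, Q) (toC η))
      {η : RSpace n | MvPolynomial.eval (fun i => toC η i) Q ≠ 0} := by
  have hp : ∀ P : MvPolynomial (Fin n) ℂ,
      ContDiff ℝ ∞ (fun η : RSpace n => MvPolynomial.eval (fun i => toC η i) P) := by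
    intro P
    induction P using MvPolynomial.induction_on with
    | C a => simpa using contDiff_const
    | add P Q hP hQ => simpa only [map_add] using hP.add hQ
    | mul_X P j hP =>
      simp only [map_mul, MvPolynomial.eval_X]
      refine hP.mul ?_
      exact (Complex.ofRealCLM.comp (EuclideanSpace.proj j : RSpace n →L[ℝ] ℝ)).contDiff
  simp only [quotEval, div_eq_mul_inv]
  exact (hp P).contDiffOn.mul ((hp Q).contDiffOn.inv fun x hx => hx)

/-- Joint smoothness of complex derivatives of a family of rational functions. -/
theorem eventually_iterate_pderiv_eq {n : ℕ} {p q : RSpace n → MvPolynomial (Fin n) ℂ}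
    {y : RSpace n} {ζ : CSpace n} (k : Fin n)
    (hF : ContDiffAt ℝ ∞ (fun w : RSpace n × CSpace n => ratFun p q w.1 w.2) (y, ζ))
    (hq : MvPolynomial.eval (fun i => ζ i) (q y) ≠ 0) (l : ℕ) :
    ContDiffAt ℝ ∞ ((fun (G : RSpace n × CSpace n → ℂ) w => fderiv ℝ G w
        ((0 : RSpace n), EuclideanSpace.single k (1 : ℂ)))^[l]
        (fun w : RSpace n × CSpace n => ratFun p q w.1 w.2)) (y, ζ) ∧
    ∀ᶠ ζ' in 𝓝 ζ, (pderiv ℂ k)^[l] (ratFun p q y) ζ' =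
      (fun (G : RSpace n × CSpace n → ℂ) w => fderiv ℝ G w
        ((0 : RSpace n), EuclideanSpace.single k (1 : ℂ)))^[l]
        (fun w : RSpace n × CSpace n => ratFun p q w.1 w.2) (y, ζ') := by
  induction l with
  | zero => exact ⟨hF, Eventually.of_forall fun _ => rfl⟩
  | succ l ih =>
    obtain ⟨ih1, ih2⟩ := ih
    simp only [Function.iterate_succ_apply']
    set G := (fun (G : RSpace n × CSpace n → ℂ) w => fderiv ℝ G w
        ((0 : RSpace n), EuclideanSpace.single k (1 : ℂ)))^[l]
        (fun w : RSpace n × CSpace n => ratFun p q w.1 w.2) with hG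
    refine ⟨(ih1.fderiv_right (m := ∞) (by simp)).clm_apply contDiffAt_const, ?_⟩
    have h2 : ∀ᶠ w in 𝓝 (y, ζ), ContDiffAt ℝ 1 G w :=
      (ih1.of_le (by norm_cast)).eventually (by simp)
    have h3 : ∀ᶠ ζ' in 𝓝 ζ, ContDiffAt ℝ 1 G (y, ζ') :=
      (Continuous.prodMk_right y).tendsto ζ |>.eventually h2
    filter_upwards [h3, ih2.eventually_nhds, (isOpen_eval_ne_zero (q y)).mem_nhds hq]
      with ζ' h4 h5 h6
    obtain ⟨A, hA, -⟩ := hasFDerivAt_quotEval k (p y) (q y) l h6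
    have h7 : HasFDerivAt ((pderiv ℂ k)^[l] (ratFun p q y)) A ζ' :=
      hA.congr_of_eventuallyEq (eventuallyEq_of_mem ((isOpen_eval_ne_zero (q y)).mem_nhds h6)
        (iterate_pderiv_complex k (p y) (q y) l))
    have h8 : HasFDerivAt (fun ζ'' : CSpace n => (y, ζ''))
        (ContinuousLinearMap.inr ℝ (RSpace n) (CSpace n)) ζ' := hasFDerivAt_prodMk_right y ζ'
    have h9 := HasFDerivAt.comp ζ' (f := fun ζ'' : CSpace n => (y, ζ''))
      (h4.differentiableAt (by simp)).hasFDerivAt h8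
    have h10 := h9.congr_of_eventuallyEq (f₁ := (pderiv ℂ k)^[l] (ratFun p q y)) h5
    have h11 := h10.unique (h7.restrictScalars ℝ)
    rw [pderiv, h7.fderiv]
    have := DFunLike.congr_fun h11 (EuclideanSpace.single k (1 : ℂ))
    exact this.symm

theorem exists_univariate {d : ℕ} (ξ' : RSpace d) (P : MvPolynomial (Fin (d + 1)) ℂ) :
    ∃ p : Polynomial ℂ, ∀ z, p.eval z = MvPolynomial.eval (fun i => snocC ξ' z i) P := by
  induction P using MvPolynomial.induction_on with
  | C a => exact ⟨Polynomial.C a, fun z => by simp⟩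
  | add P Q hP hQ =>
    obtain ⟨p, hp⟩ := hP
    obtain ⟨q, hq⟩ := hQ
    exact ⟨p + q, fun z => by simp [hp, hq]⟩
  | mul_X P j hP =>
    obtain ⟨p, hp⟩ := hP
    refine Fin.lastCases ?_ (fun i => ?_) j
    · exact ⟨p * Polynomial.X, fun z => by simp [hp]⟩
    · exact ⟨p * Polynomial.C (ξ' i : ℂ), fun z => by simp [hp]⟩

/-- The real vector `(ξ', t)`. -/
def snocR {d : ℕ} (ξ' : RSpace d) (t : ℝ) : RSpace (d + 1) :=
  WithLp.toLp 2 (Fin.snoc (α := fun _ => ℝ) (fun i => ξ' i) t)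

@[simp] theorem snocR_castSucc {d : ℕ} (ξ' : RSpace d) (t : ℝ) (i : Fin d) :
    snocR ξ' t i.castSucc = ξ' i := by simp [snocR]

@[simp] theorem snocR_last {d : ℕ} (ξ' : RSpace d) (t : ℝ) :
    snocR ξ' t (Fin.last d) = t := by simp [snocR]

theorem toC_snocR {d : ℕ} (ξ' : RSpace d) (t : ℝ) : toC (snocR ξ' t) = snocC ξ' t := by
  ext i
  refine Fin.lastCases ?_ (fun i => ?_) i
  · simp [toC]
  · simp [toC]

theorem norm_snocR_sq {d : ℕ} (ξ' : RSpace d) (t : ℝ) :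
    ‖snocR ξ' t‖ ^ 2 = ‖ξ'‖ ^ 2 + t ^ 2 := by
  rw [EuclideanSpace.norm_sq_eq, EuclideanSpace.norm_sq_eq, Fin.sum_univ_castSucc]
  simp

theorem bracket_sq {n : ℕ} (x : RSpace n) : bracket x ^ 2 = 1 + ‖x‖ ^ 2 :=
  Real.sq_sqrt (by positivity)

theorem bracket_snocR_sq {d : ℕ} (ξ' : RSpace d) (t : ℝ) :
    bracket (snocR ξ' t) ^ 2 = bracket ξ' ^ 2 + t ^ 2 := by
  rw [bracket_sq, bracket_sq, norm_snocR_sq]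
  ring

theorem abs_le_bracket_snocR {d : ℕ} (ξ' : RSpace d) (t : ℝ) : |t| ≤ bracket (snocR ξ' t) := by
  refine abs_le_of_sq_le_sq ?_ (bracket_pos _).le
  rw [bracket_snocR_sq]
  nlinarith [bracket_pos ξ']

theorem bracket_snocR_le {d : ℕ} (ξ' : RSpace d) (t : ℝ) :
    bracket (snocR ξ' t) ≤ bracket ξ' + |t| := by
  refine le_of_sq_le_sq ?_ (by have := bracket_pos ξ'; positivity)
  rw [bracket_snocR_sq, add_sq, sq_abs]
  have := mul_nonneg (bracket_pos ξ').le (abs_nonneg t)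
  linarith

theorem bracket_le_bracket_snocR {d : ℕ} (ξ' : RSpace d) (t : ℝ) :
    bracket ξ' ≤ bracket (snocR ξ' t) := by
  refine le_of_sq_le_sq ?_ (bracket_pos _).le
  rw [bracket_snocR_sq]
  nlinarith [sq_nonneg t]

end SGHalfSpace

end


noncomputable section

namespace SGHalfSpace

open MeasureTheory Filter Topology

/-! ### Consequences of assumption (A) -/

/-- The conditions of assumption (A) for given rational functions and constants. -/
structure IsRatExpansion {d : ℕ} (μ ν : ℝ) (m₁ : ℤ) (m₂ : ℝ)
    (a : RSpace (d + 1) → RSpace (d + 1) → ℂ)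
    (p q : ℕ → RSpace (d + 1) → MvPolynomial (Fin (d + 1)) ℂ) (C D B r : ℝ) : Prop where
  hC : 0 < C
  hD : 0 < D
  hr : 0 < r
  hrB : r < B
  real_bound : ∀ (j : ℕ) (x ξ : RSpace (d + 1)), B ≤ pairNorm x ξ →
    ContDiffAt ℝ ∞ (fun w : RSpace (d + 1) × RSpace (d + 1) =>
      ratFun (p j) (q j) w.1 (toC w.2)) (x, ξ) ∧
    ∀ α β : Fin (d + 1) → ℕ,
      ‖symDeriv ℝ β α (fun y η => ratFun (p j) (q j) y (toC η)) x ξ‖ ≤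
        C * D ^ (msum α + msum β + 2 * j) * ((j.factorial : ℝ) * mfact β) ^ ν * mfact α *
          bracket x ^ (m₂ - j - msum β) * bracket ξ ^ (m₁ - j - msum α)
  poles : ∀ (j : ℕ) (x : RSpace (d + 1)) (ξ' : RSpace d) (z : ℂ),
    MvPolynomial.eval (fun i => snocC ξ' z i) (q j x) = 0 → ‖z‖ ≤ r * bracket ξ'
  circle_bound : ∀ (j : ℕ) (x : RSpace (d + 1)) (ξ' : RSpace d) (s : ℝ),
    ContDiffAt ℝ ∞ (fun w : RSpace (d + 1) × CSpace (d + 1) =>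
      ratFun (p j) (q j) w.1 w.2)
      (x, snocC ξ' (((B * bracket ξ' : ℝ) : ℂ) * Complex.exp (Complex.I * s))) ∧
    ∀ α β : Fin (d + 1) → ℕ,
      ‖symDeriv ℂ β α (ratFun (p j) (q j)) x
          (snocC ξ' (((B * bracket ξ' : ℝ) : ℂ) * Complex.exp (Complex.I * s)))‖ ≤
        C * D ^ (msum α + msum β + 2 * j) * ((j.factorial : ℝ) * mfact β) ^ ν * mfact α *
          bracket x ^ (m₂ - j - msum β) * bracket ξ' ^ (m₁ - j - msum α)
  remainder : ∀ (M : ℕ) (x ξ : RSpace (d + 1)),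
    B * (M : ℝ) ^ (μ + ν - 1) ≤ max (bracket x) (bracket ξ) →
    ∀ α β : Fin (d + 1) → ℕ,
      ‖symDeriv ℝ β α
          (fun y η => a y η - ∑ j ∈ Finset.range M, ratFun (p j) (q j) y (toC η)) x ξ‖ ≤
        C * D ^ (msum α + msum β + 2 * M) * mfact α ^ μ * mfact β ^ ν *
          (M.factorial : ℝ) ^ (μ + ν - 1) *
          bracket x ^ (m₂ - M - msum β) * bracket ξ ^ (m₁ - M - msum α)

theorem AssumptionA.exists_isRatExpansion {d : ℕ} {μ ν : ℝ} {m₁ : ℤ} {m₂ : ℝ}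
    {a : RSpace (d + 1) → RSpace (d + 1) → ℂ} (h : AssumptionA μ ν m₁ m₂ a) :
    ∃ p q C D B r, IsRatExpansion μ ν m₁ m₂ a p q C D B r := by
  obtain ⟨p, q, C, D, B, r, hC, hD, hr, hrB, h1, h2, -, h3, h4⟩ := h
  exact ⟨p, q, C, D, B, r, hC, hD, hr, hrB, h1, h2, h3, h4⟩

/-- `∂_{ξ_k}^l a`. -/
def symIter {n : ℕ} (k : Fin n) (l : ℕ) (a : RSpace n → RSpace n → ℂ) (x ξ : RSpace n) : ℂ :=
  (pderiv ℝ k)^[l] (a x) ξ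

/-- The point with parameter `σ` on the circle of radius `B⟨ξ'⟩`. -/
def circlePt {d : ℕ} (B : ℝ) (ξ' : RSpace d) (σ : ℝ) : ℂ :=
  ((B * bracket ξ' : ℝ) : ℂ) * Complex.exp (Complex.I * σ)

/-- The values of `∂_{ξ_k}^l (p / q)` on the circle of radius `B⟨ξ'⟩`. -/
def circ {d : ℕ} (k : Fin (d + 1)) (l : ℕ) (B : ℝ)
    (p q : RSpace (d + 1) → MvPolynomial (Fin (d + 1)) ℂ) (ξ' : RSpace d) (σ : ℝ)
    (x : RSpace (d + 1)) : ℂ :=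
  (pderiv ℂ k)^[l] (ratFun p q x) (snocC ξ' (circlePt B ξ' σ))

theorem norm_circlePt {d : ℕ} {B : ℝ} (hB : 0 ≤ B) (ξ' : RSpace d) (σ : ℝ) :
    ‖circlePt B ξ' σ‖ = B * bracket ξ' := by
  rw [circlePt, norm_mul, mul_comm Complex.I, Complex.norm_exp_ofReal_mul_I, mul_one,
    Complex.norm_real, Real.norm_of_nonneg (mul_nonneg hB (bracket_pos ξ').le)]

theorem continuous_circlePt {d : ℕ} (B : ℝ) :
    Continuous (fun w : RSpace d × ℝ => circlePt B w.1 w.2) := by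
  have := continuous_bracket (n := d)
  unfold circlePt
  fun_prop

theorem abs_last_le_pairNorm {d : ℕ} (x ξ : RSpace (d + 1)) :
    |ξ (Fin.last d)| ≤ pairNorm x ξ := by
  refine (abs_apply_le_norm ξ _).trans (Real.le_sqrt_of_sq_le ?_)
  nlinarith [sq_nonneg ‖x‖]

theorem wderiv_bound_of_mderiv {n : ℕ} {g : RSpace n → ℂ} (hg : ContDiff ℝ ∞ g) (x : RSpace n)
    (V : List (Fin n)) {X : (Fin n → ℕ) → ℝ} (h : ∀ β, ‖mderiv ℝ β g x‖ ≤ X β) :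
    ‖wderiv V g x‖ ≤ X (fun i => V.count i) := by
  rw [wderiv_eq_mderiv isOpen_univ V hg.contDiffOn (Set.mem_univ x)]
  exact h _

theorem mfact_count_le {n : ℕ} (V : List (Fin n)) :
    mfact (fun i => V.count i) ≤ V.length.factorial := by
  rw [← msum_count V]
  exact mfact_le _

namespace IsSGSymbol

variable {n : ℕ} {μ ν m₁ m₂ : ℝ} {a : RSpace n → RSpace n → ℂ}

theorem contDiff_symIter (ha : IsSGSymbol μ ν m₁ m₂ a) (k : Fin n) (l : ℕ) :
    ContDiff ℝ ∞ (fun w : RSpace n × RSpace n => symIter k l a w.1 w.2) :=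
  contDiff_iff_contDiffAt.2 fun _ => contDiffAt_iterate_pderiv_snd ha.1.contDiffAt k l

theorem contDiff_symIter_left (ha : IsSGSymbol μ ν m₁ m₂ a) (k : Fin n) (l : ℕ) (ξ : RSpace n) :
    ContDiff ℝ ∞ (fun x => symIter k l a x ξ) :=
  (ha.contDiff_symIter k l).comp (contDiff_id.prodMk contDiff_const)

/-- The gain ⟨x⟩^{-|β|} of the symbol class is thrown away: decay in x will come from commutators,
not from the symbol. -/
theorem exists_wderiv_le (ha : IsSGSymbol μ ν m₁ m₂ a) (hν : 0 ≤ ν) :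
    ∃ C D : ℝ, 0 < C ∧ 1 ≤ D ∧ ∀ (k : Fin n) (l : ℕ) (V : List (Fin n)) (x ξ : RSpace n),
      ‖wderiv V (fun x => symIter k l a x ξ) x‖ ≤ C * D ^ (l + V.length) * rfac μ l *
        rfac ν V.length * bracket ξ ^ (m₁ - l) * bracket x ^ m₂ := by
  obtain ⟨C, D, hC, hD, h⟩ := ha.2
  refine ⟨C, D + 1, hC, by linarith, fun k l V x ξ => ?_⟩
  have h1 := wderiv_bound_of_mderiv (ha.contDiff_symIter_left k l ξ) x V
    (X := fun β => C * D ^ (l + msum β) * (l.factorial : ℝ) ^ μ * mfact β ^ ν *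
          bracket ξ ^ (m₁ - l) * bracket x ^ (m₂ - msum β)) (fun β => by
      have := h (Pi.single k l) β x ξ
      simp only [symDeriv, mderiv_single, msum_single, mfact_single] at this
      exact this)
  refine h1.trans ?_
  simp only [msum_count]
  have hb := bracket_pos ξ
  have e1 : D ^ (l + V.length) ≤ (D + 1) ^ (l + V.length) :=
    pow_le_pow_left₀ hD.le (by linarith) _
  have e2 : mfact (fun i => V.count i) ^ ν ≤ rfac ν V.length :=
    Real.rpow_le_rpow (mfact_pos _).le (mfact_count_le V) hν
  have e3 : bracket x ^ (m₂ - V.length) ≤ bracket x ^ m₂ :=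
    Real.rpow_le_rpow_of_exponent_le (bracket_ge_one x) (by linarith [Nat.cast_nonneg (α := ℝ) V.length])
  have e4 := (rfac_pos ν V.length).le
  have e5 := (mfact_pos (fun i => V.count i)).le
  unfold rfac at *
  have p1 := Real.rpow_pos_of_pos hb (m₁ - l)
  have p2 := Real.rpow_pos_of_pos (bracket_pos x) (m₂ - V.length)
  gcongr

end IsSGSymbol

namespace IsRatExpansion

variable {d : ℕ} {μ ν : ℝ} {m₁ : ℤ} {m₂ : ℝ} {a : RSpace (d + 1) → RSpace (d + 1) → ℂ}
  {p q : ℕ → RSpace (d + 1) → MvPolynomial (Fin (d + 1)) ℂ} {C D B r : ℝ}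

theorem hB (h : IsRatExpansion μ ν m₁ m₂ a p q C D B r) : 0 < B := h.hr.trans h.hrB

theorem eval_ne_zero (h : IsRatExpansion μ ν m₁ m₂ a p q C D B r) (j : ℕ) (x : RSpace (d + 1))
    (ξ' : RSpace d) {z : ℂ} (hz : B * bracket ξ' ≤ ‖z‖) :
    MvPolynomial.eval (fun i => snocC ξ' z i) (q j x) ≠ 0 := by
  intro h0
  have := h.poles j x ξ' z h0
  have := mul_lt_mul_of_pos_right h.hrB (bracket_pos ξ')
  linarith

/-- A large last frequency alone makes |(x, ξ)| ≥ B, uniformly in x. -/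
theorem contDiffAt_real (h : IsRatExpansion μ ν m₁ m₂ a p q C D B r) (k : Fin (d + 1)) (l j : ℕ)
    (x : RSpace (d + 1)) {ξ : RSpace (d + 1)} (hξ : B ≤ |ξ (Fin.last d)|) :
    ContDiffAt ℝ ∞ (fun w : RSpace (d + 1) × RSpace (d + 1) =>
      symIter k l (fun y η => ratFun (p j) (q j) y (toC η)) w.1 w.2) (x, ξ) :=
  contDiffAt_iterate_pderiv_snd (F := fun y η => ratFun (p j) (q j) y (toC η))
    (h.real_bound j x ξ (hξ.trans (abs_last_le_pairNorm x ξ))).1 k l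

theorem contDiff_real_left (h : IsRatExpansion μ ν m₁ m₂ a p q C D B r) (k : Fin (d + 1))
    (l j : ℕ) {ξ : RSpace (d + 1)} (hξ : B ≤ |ξ (Fin.last d)|) :
    ContDiff ℝ ∞ (fun x => symIter k l (fun y η => ratFun (p j) (q j) y (toC η)) x ξ) :=
  contDiff_iff_contDiffAt.2 fun x => ContDiffAt.comp (f := fun x => (x, ξ)) x
    (h.contDiffAt_real k l j x hξ) (contDiff_id.prodMk contDiff_const).contDiffAt

/-- Replaces slicewise complex derivatives by total real derivatives of the jointly smooth function
of (x, ζ). Smoothness in x and continuity in all parameters are then immediate. -/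
theorem circ_eq (h : IsRatExpansion μ ν m₁ m₂ a p q C D B r) (k : Fin (d + 1)) (l j : ℕ)
    (ξ' : RSpace d) (σ : ℝ) (x : RSpace (d + 1)) :
    circ k l B (p j) (q j) ξ' σ x = (fun (G : RSpace (d + 1) × CSpace (d + 1) → ℂ) w =>
        fderiv ℝ G w ((0 : RSpace (d + 1)), EuclideanSpace.single k (1 : ℂ)))^[l]
        (fun w : RSpace (d + 1) × CSpace (d + 1) => ratFun (p j) (q j) w.1 w.2)
        (x, snocC ξ' (circlePt B ξ' σ)) :=
  (eventually_iterate_pderiv_eq k (h.circle_bound j x ξ' σ).1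
    (h.eval_ne_zero j x ξ' (norm_circlePt h.hB.le ξ' σ).ge) l).2.self_of_nhds

theorem contDiffAt_circ (h : IsRatExpansion μ ν m₁ m₂ a p q C D B r) (k : Fin (d + 1)) (l j : ℕ)
    (ξ' : RSpace d) (σ : ℝ) (x : RSpace (d + 1)) :
    ContDiffAt ℝ ∞ ((fun (G : RSpace (d + 1) × CSpace (d + 1) → ℂ) w =>
        fderiv ℝ G w ((0 : RSpace (d + 1)), EuclideanSpace.single k (1 : ℂ)))^[l]
        (fun w : RSpace (d + 1) × CSpace (d + 1) => ratFun (p j) (q j) w.1 w.2))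
        (x, snocC ξ' (circlePt B ξ' σ)) :=
  (eventually_iterate_pderiv_eq k (h.circle_bound j x ξ' σ).1
    (h.eval_ne_zero j x ξ' (norm_circlePt h.hB.le ξ' σ).ge) l).1

theorem contDiff_circ (h : IsRatExpansion μ ν m₁ m₂ a p q C D B r) (k : Fin (d + 1)) (l j : ℕ)
    (ξ' : RSpace d) (σ : ℝ) : ContDiff ℝ ∞ (circ k l B (p j) (q j) ξ' σ) := by
  rw [funext (h.circ_eq k l j ξ' σ)]
  exact contDiff_iff_contDiffAt.2 fun x => ContDiffAt.comp
    (f := fun x => (x, snocC ξ' (circlePt B ξ' σ))) x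
    (h.contDiffAt_circ k l j ξ' σ x) (contDiff_id.prodMk contDiff_const).contDiffAt

theorem continuous_circ (h : IsRatExpansion μ ν m₁ m₂ a p q C D B r) (k : Fin (d + 1))
    (l j : ℕ) : Continuous (fun w : (RSpace d × ℝ) × RSpace (d + 1) =>
      circ k l B (p j) (q j) w.1.1 w.1.2 w.2) := by
  rw [funext fun w : (RSpace d × ℝ) × RSpace (d + 1) => h.circ_eq k l j w.1.1 w.1.2 w.2]
  refine continuous_iff_continuousAt.2 fun w => ?_
  have hc : Continuous (fun w : (RSpace d × ℝ) × RSpace (d + 1) =>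
      (w.2, snocC w.1.1 (circlePt B w.1.1 w.1.2))) :=
    continuous_snd.prodMk (continuous_snocC.comp
      ((continuous_fst.comp continuous_fst).prodMk ((continuous_circlePt B).comp continuous_fst)))
  exact ContinuousAt.comp
    (f := fun w : (RSpace d × ℝ) × RSpace (d + 1) => (w.2, snocC w.1.1 (circlePt B w.1.1 w.1.2)))
    (h.contDiffAt_circ k l j w.1.1 w.1.2 w.2).continuousAt hc.continuousAt

theorem wderiv_circ_le (h : IsRatExpansion μ ν m₁ m₂ a p q C D B r) (hν : 0 ≤ ν)
    (k : Fin (d + 1)) (l j : ℕ) (ξ' : RSpace d) (σ : ℝ) (V : List (Fin (d + 1)))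
    (x : RSpace (d + 1)) :
    ‖wderiv V (circ k l B (p j) (q j) ξ' σ) x‖ ≤ C * (D + 1) ^ (l + V.length + 2 * j) *
      (rfac ν j * rfac ν V.length) * l.factorial * bracket x ^ m₂ *
        bracket ξ' ^ (m₁ - j - l) := by
  have h1 := wderiv_bound_of_mderiv (h.contDiff_circ k l j ξ' σ) x V
    (X := fun β => C * D ^ (l + msum β + 2 * j) * ((j.factorial : ℝ) * mfact β) ^ ν *
      l.factorial * bracket x ^ (m₂ - j - msum β) * bracket ξ' ^ (m₁ - j - l)) (fun β => by
      have := (h.circle_bound j x ξ' σ).2 (Pi.single k l) β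
      simp only [symDeriv, mderiv_single, msum_single, mfact_single] at this
      exact this)
  refine h1.trans ?_
  simp only [msum_count]
  have hD := h.hD
  have hC := h.hC
  have e1 : D ^ (l + V.length + 2 * j) ≤ (D + 1) ^ (l + V.length + 2 * j) :=
    pow_le_pow_left₀ hD.le (by linarith) _
  have e2 : ((j.factorial : ℝ) * mfact (fun i => V.count i)) ^ ν ≤ rfac ν j * rfac ν V.length := by
    unfold rfac
    rw [← Real.mul_rpow (by positivity) (by positivity)]
    have := (mfact_pos (fun i => V.count i)).le
    have := mfact_count_le V
    gcongr
  have e3 : bracket x ^ (m₂ - j - V.length) ≤ bracket x ^ m₂ :=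
    Real.rpow_le_rpow_of_exponent_le (bracket_ge_one x)
      (by linarith [Nat.cast_nonneg (α := ℝ) V.length, Nat.cast_nonneg (α := ℝ) j])
  have e4 := mul_pos (rfac_pos ν j) (rfac_pos ν V.length)
  have p1 := zpow_pos (bracket_pos ξ') (m₁ - j - l)
  have p2 := Real.rpow_pos_of_pos (bracket_pos x) (m₂ - j - V.length)
  have p3 : 0 ≤ ((j.factorial : ℝ) * mfact (fun i => V.count i)) ^ ν := by
    have := (mfact_pos (fun i => V.count i)).le
    positivity
  gcongr

theorem real_eq_quotEval (h : IsRatExpansion μ ν m₁ m₂ a p q C D B r) (k : Fin (d + 1)) (l j : ℕ)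
    (x : RSpace (d + 1)) (ξ' : RSpace d) {t : ℝ} (ht : B * bracket ξ' ≤ |t|) :
    symIter k l (fun y η => ratFun (p j) (q j) y (toC η)) x (snocR ξ' t)
      = quotEval (ratIter k (p j x) (q j x) l) (snocC ξ' t) := by
  have := iterate_pderiv_real k (p j x) (q j x) l (x := snocR ξ' t) (by
    change MvPolynomial.eval (fun i => toC (snocR ξ' t) i) (q j x) ≠ 0
    rw [toC_snocR]
    exact h.eval_ne_zero j x ξ' (by simpa using ht))
  rw [symIter, ← toC_snocR]
  exact this

/-- The Cauchy formula for `∂_{ξ_k}^l a_j` in the exterior of the disc of radius `B⟨ξ'⟩`. -/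
theorem real_eq_integral (h : IsRatExpansion μ ν m₁ m₂ a p q C D B r) (k : Fin (d + 1))
    (l j : ℕ) (x : RSpace (d + 1)) (ξ' : RSpace d) {t : ℝ} (ht : B * bracket ξ' < |t|) :
    symIter k l (fun y η => ratFun (p j) (q j) y (toC η)) x (snocR ξ' t)
      = ∫ σ in (0 : ℝ)..(2 * Real.pi), circ k l B (p j) (q j) ξ' σ x *
        kern (m₁ - j - l + 1) t (circlePt B ξ' σ) := by
  have hR₀ : 0 < B * bracket ξ' := mul_pos h.hB (bracket_pos ξ')
  set A : ℂ → ℂ := fun z => quotEval (ratIter k (p j x) (q j x) l) (snocC ξ' z) with hA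
  obtain ⟨P, hP⟩ := exists_univariate ξ' (ratIter k (p j x) (q j x) l).1
  obtain ⟨Q, hQ⟩ := exists_univariate ξ' (ratIter k (p j x) (q j x) l).2
  have hne : ∀ z : ℂ, B * bracket ξ' ≤ ‖z‖ → Q.eval z ≠ 0 := fun z hz => by
    rw [hQ]
    exact ratIter_snd_ne_zero k (h.eval_ne_zero j x ξ' hz) l
  have hAPQ : A = fun z => P.eval z / Q.eval z := by
    ext z
    rw [hA, hP, hQ]
    rfl
  have hQ0 : Q ≠ 0 := by
    rintro rfl
    exact hne (B * bracket ξ' : ℝ) (by rw [Complex.norm_real]; exact le_abs_self _) (by simp)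
  set e : ℤ := m₁ - j - l with he
  have hgrow : Tendsto (fun z : ℂ => A z * z ^ (-(e + 1))) (Bornology.cobounded ℂ) (𝓝 0) := by
    rw [hAPQ]
    -- Beyond this threshold the point satisfies |(x, ξ)| ≥ B, lies outside the disc containing the
    -- poles, and has ⟨(ξ',t)⟩ comparable to t. The constant may depend on x and ξ', since only the
    -- growth order at infinity matters.
    refine tendsto_rational_of_real_bound P Q hQ0 e
      (C * D ^ (l + 0 + 2 * j) * ((j.factorial : ℝ) * 1) ^ ν * l.factorial *
        bracket x ^ (m₂ - j) * 2 ^ e.natAbs)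
      (max (max B (B * bracket ξ')) (bracket ξ')) fun t ht => ?_
    have t1 : B ≤ t := (le_max_left _ _).trans ((le_max_left _ _).trans ht)
    have t2 : B * bracket ξ' ≤ t := (le_max_right _ _).trans ((le_max_left _ _).trans ht)
    have t3 : bracket ξ' ≤ t := (le_max_right _ _).trans ht
    have t0 : 0 < t := (bracket_pos ξ').trans_le t3
    have habs : |t| = t := abs_of_pos t0
    have h1 := (h.real_bound j x (snocR ξ' t) ((t1.trans (by
      have := abs_last_le_pairNorm x (snocR ξ' t)
      rwa [snocR_last, habs] at this)))).2 (Pi.single k l) 0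
    simp only [symDeriv, mderiv_single, msum_single, mfact_single] at h1
    have e0 : (mderiv ℝ (0 : Fin (d + 1) → ℕ) fun y : RSpace (d + 1) =>
        (pderiv ℝ k)^[l] (fun η => ratFun (p j) (q j) y (toC η)) (snocR ξ' t)) x
        = symIter k l (fun y η => ratFun (p j) (q j) y (toC η)) x (snocR ξ' t) := by
      simp [mderiv, symIter]
    have e1 : msum (0 : Fin (d + 1) → ℕ) = 0 := by simp [msum]
    have e2 : mfact (0 : Fin (d + 1) → ℕ) = 1 := by simp [mfact]
    rw [e0, h.real_eq_quotEval k l j x ξ' (by rwa [habs]), e1, e2, Nat.cast_zero, sub_zero] at h1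
    rw [← he] at h1
    have hAt : Polynomial.eval (t : ℂ) P / Polynomial.eval (t : ℂ) Q = A t := by rw [hAPQ]
    rw [hAt]
    refine h1.trans ?_
    -- The bracket lies between t and 2t; which of the two is used depends on the sign of e.
    have hp : (bracket (snocR ξ' t)) ^ e ≤ 2 ^ e.natAbs * t ^ e := by
      have b1 : t ≤ bracket (snocR ξ' t) := by
        have := abs_le_bracket_snocR ξ' t
        rwa [habs] at this
      have b2 : bracket (snocR ξ' t) ≤ 2 * t := by
        have := bracket_snocR_le ξ' t
        rw [habs] at this
        linarith
      rcases le_total 0 e with he0 | he0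
      · calc (bracket (snocR ξ' t)) ^ e ≤ (2 * t) ^ e :=
              zpow_le_zpow_left₀ he0 (bracket_pos _).le b2
          _ = _ := by
              rw [mul_zpow, ← zpow_natCast, Int.natAbs_of_nonneg he0]
      · calc (bracket (snocR ξ' t)) ^ e ≤ t ^ e := by
              obtain ⟨i, hi⟩ := Int.exists_eq_neg_ofNat he0
              rw [hi, zpow_neg, zpow_neg, zpow_natCast, zpow_natCast]
              gcongr
          _ ≤ _ := le_mul_of_one_le_left (by positivity) (one_le_pow₀ (by norm_num))
    have hC := h.hC
    have hD := h.hD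
    have p2 := Real.rpow_pos_of_pos (bracket_pos x) (m₂ - j)
    calc _ ≤ C * D ^ (l + 0 + 2 * j) * ((j.factorial : ℝ) * 1) ^ ν * l.factorial *
          bracket x ^ (m₂ - j) * (2 ^ e.natAbs * t ^ e) := by gcongr
      _ = _ := by ring
  have hd : ∀ z, B * bracket ξ' ≤ ‖z‖ → DifferentiableAt ℂ A z := by
    intro z hz
    rw [hAPQ]
    exact P.differentiable.differentiableAt.fun_div Q.differentiable.differentiableAt (hne z hz)
  -- The exponent is e + 1 because O(t^e) on the axis gives o(z^{e+1}) at infinity.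
  have key := exterior_formula hR₀ (e + 1) hd hgrow (z := (t : ℂ)) (by simpa using ht)
  rw [h.real_eq_quotEval k l j x ξ' ht.le]
  change A t = _
  rw [key]
  refine intervalIntegral.integral_congr fun σ _ => ?_
  change _ * kern (e + 1) t (circlePt B ξ' σ) = _ * kern (e + 1) t (circlePt B ξ' σ)
  congr 1
  have := iterate_pderiv_complex k (p j x) (q j x) l
    (x := snocC ξ' (circlePt B ξ' σ)) (h.eval_ne_zero j x ξ' (norm_circlePt h.hB.le ξ' σ).ge)
  exact this.symm

/-- `∂_{ξ_k}^l (a - ∑_{j < M} a_j)`. -/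
def rem (_ : IsRatExpansion μ ν m₁ m₂ a p q C D B r) (k : Fin (d + 1)) (l M : ℕ)
    (x ξ : RSpace (d + 1)) : ℂ :=
  symIter k l a x ξ - ∑ j ∈ Finset.range M,
    symIter k l (fun y η => ratFun (p j) (q j) y (toC η)) x ξ

/-- The derivatives distribute over the finite sum on the open set where none of its denominators
vanishes; the exterior of the disc of radius B⟨ξ'⟩ lies in that set. -/
theorem rem_eq (h : IsRatExpansion μ ν m₁ m₂ a p q C D B r)
    (ha : IsSGSymbol μ ν m₁ m₂ a) (k : Fin (d + 1)) (l M : ℕ) (x : RSpace (d + 1))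
    (ξ' : RSpace d) {t : ℝ} (ht : B * bracket ξ' ≤ |t|) :
    h.rem k l M x (snocR ξ' t) = symIter k l
      (fun y η => a y η - ∑ j ∈ Finset.range M, ratFun (p j) (q j) y (toC η)) x
        (snocR ξ' t) := by
  have hax : ContDiff ℝ ∞ (a x) := ha.1.comp (contDiff_const.prodMk contDiff_id)
  set U : ℕ → Set (RSpace (d + 1)) := fun M => {η | ∀ j ∈ Finset.range M,
    MvPolynomial.eval (fun i => toC η i) (q j x) ≠ 0} with hU
  have hUo : ∀ M, IsOpen (U M) := fun M => by
    rw [hU]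
    simp only [Set.ofPred_forall]
    exact isOpen_biInter_finset fun j _ => isOpen_eval_toC_ne_zero (q j x)
  have hUmem : ∀ M, snocR ξ' t ∈ U M := fun M j _ => by
    rw [toC_snocR]
    exact h.eval_ne_zero j x ξ' (by simpa using ht)
  have hUj : ∀ M j, j < M → ContDiffOn ℝ ∞ (fun η => ratFun (p j) (q j) x (toC η)) (U M) :=
    fun M j hj => (contDiffOn_quotEval_toC (p j x) (q j x)).mono
      fun η hη => hη j (Finset.mem_range.2 hj)
  simp only [rem, symIter, ← wderiv_replicate]
  induction M with
  | zero => simp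
  | succ M ih =>
    rw [Finset.sum_range_succ, ← sub_sub, ih]
    simp only [Finset.sum_range_succ]
    have hs : ContDiffOn ℝ ∞ (fun η => a x η - ∑ j ∈ Finset.range M,
        ratFun (p j) (q j) x (toC η)) (U (M + 1)) :=
      hax.contDiffOn.sub (ContDiffOn.sum fun j hj =>
        hUj (M + 1) j (by have := Finset.mem_range.1 hj; omega))
    have hM := hUj (M + 1) M (by omega)
    have e1 := wderiv_add (hUo (M + 1)) (List.replicate l k) hs
      (contDiffOn_const.mul hM : ContDiffOn ℝ ∞
        (fun η => (-1 : ℂ) * ratFun (p M) (q M) x (toC η)) (U (M + 1))) (hUmem (M + 1))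
    have e2 := wderiv_const_mul (hUo (M + 1)) (List.replicate l k) (-1) hM (hUmem (M + 1))
    beta_reduce at e1 e2
    rw [e2, neg_one_mul, ← sub_eq_add_neg] at e1
    rw [← e1]
    congr 1
    ext η
    ring

theorem contDiff_rem_left (h : IsRatExpansion μ ν m₁ m₂ a p q C D B r)
    (ha : IsSGSymbol μ ν m₁ m₂ a) (k : Fin (d + 1)) (l M : ℕ) {ξ : RSpace (d + 1)}
    (hξ : B ≤ |ξ (Fin.last d)|) : ContDiff ℝ ∞ (fun x => h.rem k l M x ξ) :=
  (ha.contDiff_symIter_left k l ξ).sub (ContDiff.sum fun j _ => h.contDiff_real_left k l j hξ)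

/-- Condition 3 asks for max{⟨x⟩, ⟨ξ⟩} to be large. Here ⟨ξ⟩ alone ensures it, so the bound holds
for every x. -/
theorem wderiv_rem_le (h : IsRatExpansion μ ν m₁ m₂ a p q C D B r)
    (ha : IsSGSymbol μ ν m₁ m₂ a) (hν : 0 ≤ ν) (k : Fin (d + 1)) (l M : ℕ)
    (V : List (Fin (d + 1))) (x : RSpace (d + 1)) (ξ' : RSpace d) {t : ℝ}
    (ht : B * bracket ξ' ≤ |t|)
    (hM : B * (M : ℝ) ^ (μ + ν - 1) ≤ bracket (snocR ξ' t)) :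
    ‖wderiv V (fun x => h.rem k l M x (snocR ξ' t)) x‖ ≤ C * (D + 1) ^ (l + V.length + 2 * M) *
      rfac μ l * rfac ν V.length * rfac (μ + ν - 1) M * bracket x ^ m₂ *
        bracket (snocR ξ' t) ^ (m₁ - M - l) := by
  have hBt : B ≤ |t| := by
    refine le_trans ?_ ht
    exact le_mul_of_one_le_right h.hB.le (bracket_ge_one ξ')
  have hsm := h.contDiff_rem_left ha k l M (ξ := snocR ξ' t) (by simpa using hBt)
  have h1 := wderiv_bound_of_mderiv hsm x V
    (X := fun β => C * D ^ (l + msum β + 2 * M) * (l.factorial : ℝ) ^ μ * mfact β ^ ν *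
      (M.factorial : ℝ) ^ (μ + ν - 1) *
      bracket x ^ (m₂ - M - msum β) * bracket (snocR ξ' t) ^ (m₁ - M - l)) (fun β => by
      have := h.remainder M x (snocR ξ' t) (hM.trans (le_max_right _ _)) (Pi.single k l) β
      simp only [symDeriv, mderiv_single, msum_single, mfact_single] at this
      rw [funext fun x => h.rem_eq ha k l M x ξ' ht]
      exact this)
  refine h1.trans ?_
  simp only [msum_count]
  have hD := h.hD
  have hC := h.hC
  have e1 : D ^ (l + V.length + 2 * M) ≤ (D + 1) ^ (l + V.length + 2 * M) :=
    pow_le_pow_left₀ hD.le (by linarith) _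
  have e2 : mfact (fun i => V.count i) ^ ν ≤ rfac ν V.length :=
    Real.rpow_le_rpow (mfact_pos _).le (mfact_count_le V) hν
  have e3 : bracket x ^ (m₂ - M - V.length) ≤ bracket x ^ m₂ :=
    Real.rpow_le_rpow_of_exponent_le (bracket_ge_one x)
      (by linarith [Nat.cast_nonneg (α := ℝ) V.length, Nat.cast_nonneg (α := ℝ) M])
  have e4 := (rfac_pos ν V.length).le
  have e5 := (mfact_pos (fun i => V.count i)).le
  have p1 := zpow_pos (bracket_pos (snocR ξ' t)) (m₁ - M - l)
  have p2 := Real.rpow_pos_of_pos (bracket_pos x) (m₂ - M - V.length)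
  unfold rfac at *
  gcongr

end IsRatExpansion

end SGHalfSpace

end


noncomputable section

namespace SGHalfSpace

open MeasureTheory Filter Topology

/-! ### Test functions and symbols paired with them -/

/-- Smooth symbols whose `x`-derivatives are `O(⟨ξ⟩^m ⟨x⟩^{m₂})`. -/
def IsTame {n : ℕ} (m m₂ : ℝ) (b : RSpace n → RSpace n → ℂ) : Prop :=
  ContDiff ℝ ∞ (fun w : RSpace n × RSpace n => b w.1 w.2) ∧
    ∀ W : List (Fin n), ∃ C : ℝ, 0 ≤ C ∧ ∀ x ξ,
      ‖wderiv W (fun x => b x ξ) x‖ ≤ C * bracket ξ ^ m * bracket x ^ m₂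

theorem IsSGSymbol.isTame_symIter {n : ℕ} {μ ν m₁ m₂ : ℝ} {a : RSpace n → RSpace n → ℂ}
    (ha : IsSGSymbol μ ν m₁ m₂ a) (hν : 0 ≤ ν) (k : Fin n) (l : ℕ) :
    IsTame m₁ m₂ (symIter k l a) := by
  refine ⟨ha.contDiff_symIter k l, fun W => ?_⟩
  obtain ⟨C, D, hC, hD, h⟩ := ha.exists_wderiv_le hν
  have p1 := rfac_pos μ l
  have p2 := rfac_pos ν W.length
  refine ⟨C * D ^ (l + W.length) * rfac μ l * rfac ν W.length, by positivity, fun x ξ => ?_⟩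
  refine (h k l W x ξ).trans ?_
  have p3 := Real.rpow_pos_of_pos (bracket_pos x) m₂
  have : bracket ξ ^ (m₁ - l) ≤ bracket ξ ^ m₁ :=
    Real.rpow_le_rpow_of_exponent_le (bracket_ge_one ξ) (by linarith [Nat.cast_nonneg (α := ℝ) l])
  gcongr

theorem contDiff_pderiv_fst {n : ℕ} {b : RSpace n → RSpace n → ℂ}
    (hb : ContDiff ℝ ∞ (fun w : RSpace n × RSpace n => b w.1 w.2)) (i : Fin n) :
    ContDiff ℝ ∞ (fun w : RSpace n × RSpace n => pderiv ℝ i (fun x => b x w.2) w.1) := by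
  have hswap : ContDiff ℝ ∞ (fun w : RSpace n × RSpace n => b w.2 w.1) :=
    hb.comp (contDiff_snd.prodMk contDiff_fst)
  have h1 : ContDiff ℝ ∞ (fun w : RSpace n × RSpace n =>
      (pderiv ℝ i)^[1] ((fun ξ x => b x ξ) w.1) w.2) :=
    contDiff_iff_contDiffAt.2 fun w =>
      contDiffAt_iterate_pderiv_snd (F := fun ξ x => b x ξ) hswap.contDiffAt i 1
  exact h1.comp (contDiff_snd.prodMk contDiff_fst)

theorem IsTame.pderiv {n : ℕ} {m m₂ : ℝ} {b : RSpace n → RSpace n → ℂ} (hb : IsTame m m₂ b)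
    (i : Fin n) : IsTame m m₂ (fun x ξ => pderiv ℝ i (fun x => b x ξ) x) := by
  refine ⟨contDiff_pderiv_fst hb.1 i, fun W => ?_⟩
  obtain ⟨C, hC, h⟩ := hb.2 (W ++ [i])
  exact ⟨C, hC, fun x ξ => by simpa [wderiv_append] using h x ξ⟩

/-- Test functions. -/
def IsTest {n : ℕ} (φ : RSpace n → ℂ) : Prop := ContDiff ℝ ∞ φ ∧ HasCompactSupport φ

theorem IsTest.pderiv {n : ℕ} {φ : RSpace n → ℂ} (hφ : IsTest φ) (i : Fin n) :
    IsTest (pderiv ℝ i φ) :=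
  ⟨contDiff_pderiv i hφ.1, hφ.2.fderiv_apply (𝕜 := ℝ) _⟩

theorem IsTest.coord_mul {n : ℕ} {φ : RSpace n → ℂ} (hφ : IsTest φ) (k : Fin n) :
    IsTest (fun x => (x k : ℂ) * φ x) := by
  refine ⟨?_, hφ.2.mul_left⟩
  have := contDiff_coord_pow k 1
  simp only [pow_one] at this
  exact this.mul hφ.1

theorem IsTest.integrable_mul {n : ℕ} {φ : RSpace n → ℂ} (hφ : IsTest φ) {g : RSpace n → ℂ}
    (hg : Continuous g) : Integrable (fun x => g x * φ x) :=
  (hg.mul hφ.1.continuous).integrable_of_hasCompactSupport hφ.2.mul_left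

theorem norm_cexp_I_inner {n : ℕ} (x ξ : RSpace n) :
    ‖Complex.exp (Complex.I * (inner ℝ x ξ : ℝ))‖ = 1 := by
  rw [mul_comm]; exact Complex.norm_exp_ofReal_mul_I _

theorem continuous_slice {n : ℕ} {b : RSpace n → RSpace n → ℂ}
    (hb : ContDiff ℝ ∞ (fun w : RSpace n × RSpace n => b w.1 w.2)) (ξ : RSpace n) :
    Continuous (fun x => b x ξ) :=
  hb.continuous.comp (continuous_id.prodMk continuous_const)

theorem integrable_bracket_mul {n : ℕ} {φ : RSpace n → ℂ} (hφ : IsTest φ) (m₂ : ℝ) :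
    Integrable (fun x => bracket x ^ m₂ * ‖φ x‖) :=
  ((continuous_bracket.rpow_const fun x => Or.inl (bracket_pos x).ne').mul
    hφ.1.continuous.norm).integrable_of_hasCompactSupport hφ.2.norm.mul_left

/-- A factor ξ_i is traded for an x-derivative of the symbol or of the test function. Neither raises
the order in ξ, which is why tame symbols form the right class. -/
theorem testTransform_by_parts {n : ℕ} {b : RSpace n → RSpace n → ℂ}
    (hb : ContDiff ℝ ∞ (fun w : RSpace n × RSpace n => b w.1 w.2)) {φ : RSpace n → ℂ}
    (hφ : IsTest φ) (i : Fin n) (ξ : RSpace n) :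
    Complex.I * ξ i * testTransform b φ ξ =
      -(testTransform (fun x ξ => pderiv ℝ i (fun x => b x ξ) x) φ ξ
        + testTransform b (pderiv ℝ i φ) ξ) := by
  have hbs : ContDiff ℝ ∞ (fun x => b x ξ) := hb.comp (contDiff_id.prodMk contDiff_const)
  set e : RSpace n → ℂ := fun x => Complex.exp (Complex.I * cdot x (toC ξ)) with he
  have hes : ContDiff ℝ ∞ e := contDiff_cexp_cdot (toC ξ) Complex.I
  have hee : ∀ x, Complex.exp (Complex.I * (inner ℝ x ξ : ℝ)) = e x := fun x => by
    simp only [he, cdot_toC]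
  have hde : ∀ x, HasFDerivAt e (e x • (Complex.I • cdotL (toC ξ))) x := fun x =>
    hasFDerivAt_cexp_cdot (toC ξ) Complex.I x
  have hdb : ∀ x, HasFDerivAt (fun x => b x ξ) (fderiv ℝ (fun x => b x ξ) x) x := fun x =>
    (hbs.differentiable (by simp) x).hasFDerivAt
  have hdφ : ∀ x, HasFDerivAt φ (fderiv ℝ φ x) x := fun x =>
    (hφ.1.differentiable (by simp) x).hasFDerivAt
  have hi1 := hφ.integrable_mul (g := fun x => e x * b x ξ) (hes.continuous.mul hbs.continuous)
  have hi2 := hφ.integrable_mul (g := fun x => e x * pderiv ℝ i (fun x => b x ξ) x)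
    (hes.continuous.mul (contDiff_pderiv i hbs).continuous)
  have hi3 := (hφ.pderiv i).integrable_mul (g := fun x => e x * b x ξ)
    (hes.continuous.mul hbs.continuous)
  have key := integral_bilinear_hasLineDerivAt_right_eq_neg_left_of_integrable
    (μ := volume) (f := e) (f' := fun x => Complex.I * ξ i * e x)
    (g := fun x => b x ξ * φ x)
    (g' := fun x => pderiv ℝ i (fun x => b x ξ) x * φ x + b x ξ * pderiv ℝ i φ x)
    (v := EuclideanSpace.single i 1) (B := ContinuousLinearMap.mul ℝ ℂ) ?_ ?_ ?_ ?_ ?_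
  · simp only [ContinuousLinearMap.mul_apply'] at key
    unfold testTransform
    simp only [hee]
    rw [← integral_add hi2 hi3, ← integral_const_mul]
    have e1 : ∀ x, e x * pderiv ℝ i (fun x => b x ξ) x * φ x + e x * b x ξ * pderiv ℝ i φ x
        = e x * (pderiv ℝ i (fun x => b x ξ) x * φ x + b x ξ * pderiv ℝ i φ x) := fun x => by ring
    have e2 : ∀ x, Complex.I * ξ i * (e x * b x ξ * φ x)
        = Complex.I * ξ i * e x * (b x ξ * φ x) := fun x => by ring
    simp only [e1, e2]
    rw [key, neg_neg]
  · simp only [ContinuousLinearMap.mul_apply']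
    refine (hi1.const_mul (Complex.I * ξ i)).congr (Eventually.of_forall fun x => ?_)
    simp only
    ring
  · simp only [ContinuousLinearMap.mul_apply']
    refine (hi2.add hi3).congr (Eventually.of_forall fun x => ?_)
    simp only [Pi.add_apply]
    ring
  · simp only [ContinuousLinearMap.mul_apply']
    refine hi1.congr (Eventually.of_forall fun x => ?_)
    simp only
    ring
  · intro x _
    have := (hde x).hasLineDerivAt (EuclideanSpace.single i 1)
    simp only [smul_apply, cdotL_apply, cdot_single, smul_eq_mul] at this
    convert this using 1
    simp only [toC]
    ring
  · intro x _
    have := ((hdb x).fun_mul (hdφ x)).hasLineDerivAt (EuclideanSpace.single i 1)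
    simp only [add_apply, smul_apply, smul_eq_mul] at this
    convert this using 1
    simp only [SGHalfSpace.pderiv]
    ring

/-- Integration by parts replaces b or φ by a derivative, so the induction on p must leave both
arbitrary. -/
theorem IsTame.norm_testTransform_le {n : ℕ} {m m₂ : ℝ} (i : Fin n) (p : ℕ) :
    ∀ {b : RSpace n → RSpace n → ℂ}, IsTame m m₂ b → ∀ {φ : RSpace n → ℂ}, IsTest φ →
      ∃ C : ℝ, 0 ≤ C ∧ ∀ ξ, |ξ i| ^ p * ‖testTransform b φ ξ‖ ≤ C * bracket ξ ^ m := by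
  induction p with
  | zero =>
    intro b hb φ hφ
    obtain ⟨C, hC, h⟩ := hb.2 []
    refine ⟨C * ∫ x, bracket x ^ m₂ * ‖φ x‖, mul_nonneg hC (integral_nonneg fun x => ?_),
      fun ξ => ?_⟩
    · have := Real.rpow_pos_of_pos (bracket_pos x) m₂
      positivity
    rw [pow_zero, one_mul]
    refine (norm_integral_le_integral_norm _).trans ?_
    have e : C * (∫ x, bracket x ^ m₂ * ‖φ x‖) * bracket ξ ^ m
        = ∫ x, C * bracket ξ ^ m * (bracket x ^ m₂ * ‖φ x‖) := by
      rw [integral_const_mul]; ring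
    rw [e]
    refine integral_mono_of_nonneg (Eventually.of_forall fun x => norm_nonneg _)
      ((integrable_bracket_mul hφ m₂).const_mul _) (Eventually.of_forall fun x => ?_)
    simp only
    rw [norm_mul, norm_mul, norm_cexp_I_inner, one_mul, ← mul_assoc]
    gcongr
    exact h x ξ
  | succ p ih =>
    intro b hb φ hφ
    obtain ⟨C1, hC1, h1⟩ := ih (hb.pderiv i) hφ
    obtain ⟨C2, hC2, h2⟩ := ih hb (hφ.pderiv i)
    refine ⟨C1 + C2, by positivity, fun ξ => ?_⟩
    have e : |ξ i| * ‖testTransform b φ ξ‖ = ‖Complex.I * ξ i * testTransform b φ ξ‖ := by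
      simp
    rw [pow_succ, mul_assoc, e, testTransform_by_parts hb.1 hφ i ξ, norm_neg]
    calc _ ≤ |ξ i| ^ p * (‖testTransform (fun x ξ => SGHalfSpace.pderiv ℝ i
          (fun x => b x ξ) x) φ ξ‖ + ‖testTransform b (SGHalfSpace.pderiv ℝ i φ) ξ‖) := by
          gcongr
          exact norm_add_le _ _
      _ ≤ _ := by
          rw [mul_add, add_mul]
          exact add_le_add (h1 ξ) (h2 ξ)

/-- Taking K + ⌈|m|⌉ powers of ξ pays for the growth ⟨ξ⟩^m of the symbol and leaves K powers of
decay. -/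
theorem IsTame.testTransform_decay {n : ℕ} {m m₂ : ℝ} {b : RSpace n → RSpace n → ℂ}
    (hb : IsTame m m₂ b) {φ : RSpace n → ℂ} (hφ : IsTest φ) (hn : 0 < n) (K : ℕ) :
    ∃ C : ℝ, 0 ≤ C ∧ ∀ ξ, ‖testTransform b φ ξ‖ ≤ C * ((1 + ‖ξ‖) ^ K)⁻¹ := by
  set p := K + ⌈|m|⌉₊ with hp
  choose C hC h using fun i => IsTame.norm_testTransform_le i p hb hφ
  obtain ⟨C0, hC0, h0⟩ := IsTame.norm_testTransform_le ⟨0, hn⟩ 0 hb hφ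
  set X := (n : ℝ) ^ p * (∑ i, C i + C0) with hX
  have hsum : 0 ≤ ∑ i, C i := Finset.sum_nonneg fun i _ => hC i
  have hX0 : 0 ≤ X := by positivity
  refine ⟨2 ^ p * (C0 + X), by positivity, fun ξ => ?_⟩
  have hbm : bracket ξ ^ m ≤ (1 + ‖ξ‖) ^ ⌈|m|⌉₊ := by
    rw [← Real.rpow_natCast]
    calc bracket ξ ^ m ≤ bracket ξ ^ ((⌈|m|⌉₊ : ℕ) : ℝ) :=
          Real.rpow_le_rpow_of_exponent_le (bracket_ge_one ξ)
            ((le_abs_self m).trans (Nat.le_ceil _))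
      _ ≤ _ := Real.rpow_le_rpow (bracket_pos ξ).le (bracket_le_one_add_norm ξ) (by positivity)
  have hb0 : 0 < bracket ξ ^ m := Real.rpow_pos_of_pos (bracket_pos ξ) m
  have h1 : ‖testTransform b φ ξ‖ ≤ C0 * bracket ξ ^ m := by simpa using h0 ξ
  have h2 : ‖ξ‖ ^ p * ‖testTransform b φ ξ‖ ≤ X * bracket ξ ^ m := by
    calc _ ≤ ((n : ℝ) ^ p * (∑ i, |ξ i| ^ p + 1)) * ‖testTransform b φ ξ‖ := by
          gcongr
          exact norm_mul_pow_le_sum ξ p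
      _ = (n : ℝ) ^ p * (∑ i, |ξ i| ^ p * ‖testTransform b φ ξ‖ + ‖testTransform b φ ξ‖) := by
          rw [mul_assoc, add_mul, Finset.sum_mul, one_mul]
      _ ≤ (n : ℝ) ^ p * (∑ i, C i * bracket ξ ^ m + C0 * bracket ξ ^ m) := by
          exact mul_le_mul_of_nonneg_left
            (add_le_add (Finset.sum_le_sum fun i _ => h i ξ) h1) (by positivity)
      _ = _ := by rw [← Finset.sum_mul, hX]; ring
  have h3 : (1 + ‖ξ‖) ^ p * ‖testTransform b φ ξ‖ ≤ 2 ^ p * (C0 + X) * bracket ξ ^ m := by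
    have h4 : (1 + ‖ξ‖) ^ p ≤ 2 ^ p * (1 + ‖ξ‖ ^ p) := by
      refine (add_pow_le zero_le_one (norm_nonneg ξ) p).trans ?_
      rw [one_pow]
      gcongr
      · norm_num
      · omega
    calc _ ≤ 2 ^ p * (1 + ‖ξ‖ ^ p) * ‖testTransform b φ ξ‖ := by gcongr
      _ = 2 ^ p * (‖testTransform b φ ξ‖ + ‖ξ‖ ^ p * ‖testTransform b φ ξ‖) := by ring
      _ ≤ 2 ^ p * (C0 * bracket ξ ^ m + X * bracket ξ ^ m) := by gcongr
      _ = _ := by ring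
  have hpos : 0 < (1 + ‖ξ‖) ^ ⌈|m|⌉₊ := by positivity
  rw [← div_eq_mul_inv, le_div_iff₀ (by positivity)]
  have h5 : (1 + ‖ξ‖) ^ ⌈|m|⌉₊ * (‖testTransform b φ ξ‖ * (1 + ‖ξ‖) ^ K)
      ≤ (1 + ‖ξ‖) ^ ⌈|m|⌉₊ * (2 ^ p * (C0 + X)) := by
    calc _ = (1 + ‖ξ‖) ^ p * ‖testTransform b φ ξ‖ := by rw [hp, pow_add]; ring
      _ ≤ 2 ^ p * (C0 + X) * bracket ξ ^ m := h3
      _ ≤ 2 ^ p * (C0 + X) * (1 + ‖ξ‖) ^ ⌈|m|⌉₊ := by gcongr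
      _ = _ := by ring
  exact le_of_mul_le_mul_left h5 hpos

theorem setIntegral_tsupport {n : ℕ} {φ : RSpace n → ℂ} (g : RSpace n → ℂ) :
    ∫ x in tsupport φ, g x * φ x = ∫ x, g x * φ x := by
  refine setIntegral_eq_integral_of_forall_compl_eq_zero fun x hx => ?_
  rw [image_eq_zero_of_notMem_tsupport hx, mul_zero]

theorem continuous_testTransform {n : ℕ} {b : RSpace n → RSpace n → ℂ}
    (hb : ContDiff ℝ ∞ (fun w : RSpace n × RSpace n => b w.1 w.2)) {φ : RSpace n → ℂ}
    (hφ : IsTest φ) : Continuous (testTransform b φ) := by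
  have h := continuous_parametric_integral_of_continuous (μ := (volume : Measure (RSpace n)))
    (f := fun ξ x => Complex.exp (Complex.I * (inner ℝ x ξ : ℝ)) * b x ξ * φ x) ?_ hφ.2
  · have e : testTransform b φ = fun ξ => ∫ x in tsupport φ,
        Complex.exp (Complex.I * (inner ℝ x ξ : ℝ)) * b x ξ * φ x := by
      ext ξ
      exact (setIntegral_tsupport _).symm
    rw [e]
    exact h
  · have h1 : Continuous (fun w : RSpace n × RSpace n => b w.2 w.1) :=
      hb.continuous.comp continuous_swap
    have h2 := hφ.1.continuous
    unfold Function.uncurry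
    fun_prop

theorem IsTame.integrable_testTransform {n : ℕ} {m m₂ : ℝ} {b : RSpace n → RSpace n → ℂ}
    (hb : IsTame m m₂ b) {φ : RSpace n → ℂ} (hφ : IsTest φ) (hn : 0 < n) :
    Integrable (testTransform b φ) := by
  obtain ⟨C, hC, h⟩ := hb.testTransform_decay hφ hn (n + 1)
  exact ((integrable_one_add_norm_pow n).const_mul C).mono'
    (continuous_testTransform hb.1 hφ).aestronglyMeasurable (Eventually.of_forall h)

theorem norm_hat_le {n : ℕ} (f : RSpace n → ℂ) (ξ : RSpace n) : ‖hat f ξ‖ ≤ ∫ y, ‖f y‖ := by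
  refine (norm_integral_le_integral_norm _).trans (le_of_eq ?_)
  congr 1
  ext y
  rw [norm_mul, Complex.norm_exp]
  simp

theorem continuous_hat {n : ℕ} {f : RSpace n → ℂ} (hf : Integrable f) : Continuous (hat f) := by
  refine continuous_of_dominated (bound := fun y => ‖f y‖) (fun ξ => ?_) (fun ξ => ?_)
    hf.norm ?_
  · have : Continuous (fun y : RSpace n => Complex.exp (-(Complex.I * (inner ℝ y ξ : ℝ)))) := by
      fun_prop
    exact this.aestronglyMeasurable.mul hf.aestronglyMeasurable
  · refine Eventually.of_forall fun y => ?_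
    rw [norm_mul, Complex.norm_exp]
    simp
  · refine Eventually.of_forall fun y => ?_
    fun_prop

theorem IsTame.integrable_pairing {n : ℕ} {m m₂ : ℝ} {b : RSpace n → RSpace n → ℂ}
    (hb : IsTame m m₂ b) {f φ : RSpace n → ℂ} (hf : Integrable f) (hφ : IsTest φ) (hn : 0 < n) :
    Integrable (fun ξ => hat f ξ * testTransform b φ ξ) :=
  (hb.integrable_testTransform hφ hn).bdd_mul (continuous_hat hf).aestronglyMeasurable
    (Eventually.of_forall fun ξ => norm_hat_le f ξ)

/-- The other half of the commutator: ∂_{ξ_k} falls on the symbol or produces i x_k, which joins the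
test function. -/
theorem hasLineDerivAt_testTransform {n : ℕ} {b : RSpace n → RSpace n → ℂ}
    (hb : ContDiff ℝ ∞ (fun w : RSpace n × RSpace n => b w.1 w.2)) {φ : RSpace n → ℂ}
    (hφ : IsTest φ) (k : Fin n) (ξ : RSpace n) :
    HasLineDerivAt ℝ (testTransform b φ) (testTransform (symIter k 1 b) φ ξ
      + Complex.I * testTransform b (fun x => (x k : ℂ) * φ x) ξ) ξ (EuclideanSpace.single k 1) := by
  unfold HasLineDerivAt
  set v : RSpace n := EuclideanSpace.single k (1 : ℝ) with hv
  have hb1 : ContDiff ℝ ∞ (fun w : RSpace n × RSpace n => symIter k 1 b w.1 w.2) :=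
    contDiff_iff_contDiffAt.2 fun w => contDiffAt_iterate_pderiv_snd hb.contDiffAt k 1
  set F : ℝ → RSpace n → ℂ := fun t x =>
    Complex.exp (Complex.I * (inner ℝ x (ξ + t • v) : ℝ)) * b x (ξ + t • v) * φ x with hF
  set F' : ℝ → RSpace n → ℂ := fun t x =>
    Complex.exp (Complex.I * (inner ℝ x (ξ + t • v) : ℝ)) * symIter k 1 b x (ξ + t • v) * φ x +
    Complex.I * (Complex.exp (Complex.I * (inner ℝ x (ξ + t • v) : ℝ)) * b x (ξ + t • v) *
      ((x k : ℂ) * φ x)) with hF'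
  have hφc := hφ.1.continuous
  have hbc : Continuous (fun w : ℝ × RSpace n => b w.2 (ξ + w.1 • v)) :=
    hb.continuous.comp (f := fun w : ℝ × RSpace n => (w.2, ξ + w.1 • v)) (by fun_prop)
  have hb1c : Continuous (fun w : ℝ × RSpace n => symIter k 1 b w.2 (ξ + w.1 • v)) :=
    hb1.continuous.comp (f := fun w : ℝ × RSpace n => (w.2, ξ + w.1 • v)) (by fun_prop)
  have hFc : Continuous (fun w : ℝ × RSpace n => F w.1 w.2) := by
    rw [hF]; fun_prop
  have hF'c : Continuous (fun w : ℝ × RSpace n => F' w.1 w.2) := by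
    rw [hF']; fun_prop
  have hder : ∀ x t, HasDerivAt (fun t => F t x) (F' t x) t := by
    intro x t
    have h0 : HasDerivAt (fun t : ℝ => inner ℝ x (ξ + t • v)) (x k) t := by
      simp only [inner_add_right, inner_smul_right]
      have h1 : inner ℝ x v = x k := by
        rw [hv]
        simp [EuclideanSpace.inner_single_right]
      rw [h1]
      simpa using ((hasDerivAt_id t).mul_const (x k)).const_add (inner ℝ x ξ)
    have h1 : HasDerivAt (fun t : ℝ => b x (ξ + t • v)) (symIter k 1 b x (ξ + t • v)) t := by
      have hbx : ContDiff ℝ ∞ (b x) := hb.comp (contDiff_const.prodMk contDiff_id)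
      have h2 := (hbx.differentiable (by simp) (ξ + t • v)).hasFDerivAt
      have h3 : HasDerivAt (fun t : ℝ => ξ + t • v) v t := by
        simpa using ((hasDerivAt_id t).smul_const v).const_add ξ
      exact h2.comp_hasDerivAt t h3
    refine ((((h0.ofReal_comp.const_mul Complex.I).cexp).mul h1).mul_const (φ x)).congr_deriv ?_
    simp only [hF']
    ring
  -- The derivative of the integrand vanishes off the support of φ and is continuous, so compactness
  -- of [-1, 1] × supp φ gives a constant majorant.
  obtain ⟨C, hC⟩ := ((isCompact_Icc (a := (-1 : ℝ)) (b := 1)).prod hφ.2).exists_bound_of_continuousOn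
    hF'c.continuousOn
  have hz : ∀ t, ∀ x ∉ tsupport φ, F t x = 0 ∧ F' t x = 0 := by
    intro t x hx
    have := image_eq_zero_of_notMem_tsupport hx
    simp [hF, hF', this]
  have hint : ∀ t, Integrable (F t) := fun t =>
    (hFc.comp (Continuous.prodMk_right t)).integrable_of_hasCompactSupport
      (HasCompactSupport.intro hφ.2 fun x hx => (hz t x hx).1)
  have key := hasDerivAt_integral_of_dominated_loc_of_deriv_le (μ := volume) (x₀ := (0 : ℝ))
    (s := Set.Icc (-1) 1) (F := F) (F' := F')
    (bound := (tsupport φ).indicator fun _ => C) (Icc_mem_nhds (by norm_num) (by norm_num))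
    (Eventually.of_forall fun t => (hint t).aestronglyMeasurable) (hint 0)
    (hF'c.comp (Continuous.prodMk_right 0)).aestronglyMeasurable ?_ ?_
    (Eventually.of_forall fun x t _ => hder x t)
  · refine key.2.congr_deriv ?_
    simp only [hF', zero_smul, add_zero]
    have hi1 := hφ.integrable_mul (g := fun x =>
      Complex.exp (Complex.I * (inner ℝ x ξ : ℝ)) * symIter k 1 b x ξ) (by
        have := continuous_slice hb1 ξ
        fun_prop)
    have hi2 := (hφ.coord_mul k).integrable_mul (g := fun x =>
      Complex.exp (Complex.I * (inner ℝ x ξ : ℝ)) * b x ξ) (by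
        have := continuous_slice hb ξ
        fun_prop)
    rw [integral_add hi1 (hi2.const_mul _), integral_const_mul]
    rfl
  · refine Eventually.of_forall fun x t ht => ?_
    by_cases hx : x ∈ tsupport φ
    · rw [Set.indicator_of_mem hx]
      exact hC (t, x) ⟨ht, hx⟩
    · rw [Set.indicator_of_notMem hx, (hz t x hx).2, norm_zero]
  · exact (integrable_indicator_iff (isClosed_tsupport φ).measurableSet).2
      (integrableOn_const hφ.2.measure_lt_top.ne)

/-- `∫ f̂(ξ) (∫ e^{ixξ} b(x, ξ) φ(x) dx) dξ`. -/
def pairing {n : ℕ} (b : RSpace n → RSpace n → ℂ) (f φ : RSpace n → ℂ) : ℂ :=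
  ∫ ξ, hat f ξ * testTransform b φ ξ

/-- Commutation of multiplication by a coordinate with pseudodifferential operators. -/
theorem pairing_coord_mul {n : ℕ} {m m₂ : ℝ} {b : RSpace n → RSpace n → ℂ} (k : Fin n)
    (hb : IsTame m m₂ b) (hb1 : IsTame m m₂ (symIter k 1 b)) {f φ : RSpace n → ℂ}
    (hm : AEStronglyMeasurable f volume) (hf : Integrable (fun y => (1 + ‖y‖) * ‖f y‖))
    (hφ : IsTest φ) :
    pairing b f (fun x => (x k : ℂ) * φ x) =
      pairing b (fun y => (y k : ℂ) * f y) φ + Complex.I * pairing (symIter k 1 b) f φ := by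
  have hn : 0 < n := k.pos
  have hfi := integrable_of_weighted hm hf
  have hyf : Integrable (fun y => (y k : ℂ) * f y) := by
    refine hf.mono' ?_ (Eventually.of_forall fun y => ?_)
    · have : Continuous (fun y : RSpace n => (y k : ℂ)) := by fun_prop
      exact this.aestronglyMeasurable.mul hm
    · rw [norm_mul, Complex.norm_real, Real.norm_eq_abs]
      gcongr
      linarith [abs_apply_le_norm y k]
  have i1 := hb.integrable_pairing hyf hφ hn
  have i2 := hb1.integrable_pairing hfi hφ hn
  have i3 := hb.integrable_pairing hfi (hφ.coord_mul k) hn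
  have i4 := hb.integrable_pairing hfi hφ hn
  -- Integration by parts in ξ_k has no boundary terms, because the transform of the test function
  -- decays rapidly and f̂ is bounded.
  have key := integral_bilinear_hasLineDerivAt_right_eq_neg_left_of_integrable
    (μ := volume) (f := hat f) (f' := fun ξ => -Complex.I * hat (fun y => (y k : ℂ) * f y) ξ)
    (g := testTransform b φ)
    (g' := fun ξ => testTransform (symIter k 1 b) φ ξ
      + Complex.I * testTransform b (fun x => (x k : ℂ) * φ x) ξ)
    (v := EuclideanSpace.single k 1) (B := ContinuousLinearMap.mul ℝ ℂ)
    ?_ ?_ (by simpa using i4) (fun ξ _ => hasLineDerivAt_hat hm hf k ξ)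
    (fun ξ _ => hasLineDerivAt_testTransform hb.1 hφ k ξ)
  · simp only [ContinuousLinearMap.mul_apply'] at key
    have e1 : (∫ ξ, hat f ξ * (testTransform (symIter k 1 b) φ ξ
        + Complex.I * testTransform b (fun x => (x k : ℂ) * φ x) ξ))
        = pairing (symIter k 1 b) f φ + Complex.I * pairing b f (fun x => (x k : ℂ) * φ x) := by
      unfold pairing
      rw [← integral_const_mul, ← integral_add i2 (i3.const_mul _)]
      congr 1
      ext ξ
      ring
    have e2 : (∫ ξ, -Complex.I * hat (fun y => (y k : ℂ) * f y) ξ * testTransform b φ ξ)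
        = -Complex.I * pairing b (fun y => (y k : ℂ) * f y) φ := by
      unfold pairing
      rw [← integral_const_mul]
      congr 1
      ext ξ
      ring
    rw [e1, e2] at key
    linear_combination (-Complex.I) * key + (pairing b f (fun x => (x k : ℂ) * φ x)
      - pairing b (fun y => (y k : ℂ) * f y) φ) * Complex.I_sq
  · simp only [ContinuousLinearMap.mul_apply']
    refine (i1.const_mul (-Complex.I)).congr (Eventually.of_forall fun ξ => ?_)
    simp only
    ring
  · simp only [ContinuousLinearMap.mul_apply']
    refine (i2.add (i3.const_mul Complex.I)).congr (Eventually.of_forall fun ξ => ?_)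
    simp only [Pi.add_apply]
    ring

end SGHalfSpace

end


noncomputable section

namespace SGHalfSpace

open MeasureTheory Filter Topology

/-! ### Splitting off the last frequency variable -/

/-- The measurable equivalence `(ξ', t) ↦ (ξ', t)` of `ℝ^d × ℝ` and `ℝ^{d+1}`. -/
def snocEquiv (d : ℕ) : RSpace d × ℝ ≃ᵐ RSpace (d + 1) :=
  (MeasurableEquiv.prodComm.trans ((MeasurableEquiv.refl ℝ).prodCongr
    (MeasurableEquiv.toLp 2 (Fin d → ℝ)).symm)).trans
    ((MeasurableEquiv.piFinSuccAbove (fun _ => ℝ) (Fin.last d)).symm.trans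
      (MeasurableEquiv.toLp 2 (Fin (d + 1) → ℝ)))

theorem snocEquiv_apply {d : ℕ} (w : RSpace d × ℝ) : snocEquiv d w = snocR w.1 w.2 := by
  ext i
  refine Fin.lastCases ?_ (fun i => ?_) i
  · simp [snocEquiv, MeasurableEquiv.piFinSuccAbove]; rfl
  · simp [snocEquiv, MeasurableEquiv.piFinSuccAbove]; rfl

theorem measurePreserving_snocEquiv (d : ℕ) :
    MeasurePreserving (snocEquiv d) (volume.prod volume) volume := by
  have h1 : MeasurePreserving (MeasurableEquiv.prodComm (α := RSpace d) (β := ℝ))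
    (volume.prod volume) (volume.prod volume) := Measure.measurePreserving_swap
  have h2 : MeasurePreserving ((MeasurableEquiv.refl ℝ).prodCongr
    (MeasurableEquiv.toLp 2 (Fin d → ℝ)).symm) (volume.prod volume) (volume.prod volume) :=
    (MeasurePreserving.id volume).prod (EuclideanSpace.volume_preserving_symm_measurableEquiv_toLp (Fin d))
  have h3 := (volume_preserving_piFinSuccAbove (fun _ : Fin (d + 1) => ℝ) (Fin.last d)).symm
  have h4 := (EuclideanSpace.volume_preserving_symm_measurableEquiv_toLp (Fin (d + 1))).symm
  exact (h4.comp h3).comp (h2.comp h1)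

theorem integral_snocR {d : ℕ} (f : RSpace (d + 1) → ℂ) :
    ∫ ξ, f ξ = ∫ w : RSpace d × ℝ, f (snocR w.1 w.2) := by
  rw [← (measurePreserving_snocEquiv d).integral_comp (snocEquiv d).measurableEmbedding]
  simp only [snocEquiv_apply]
  rfl

theorem integrable_snocR {d : ℕ} {f : RSpace (d + 1) → ℂ} (hf : Integrable f) :
    Integrable (fun w : RSpace d × ℝ => f (snocR w.1 w.2)) := by
  have := (measurePreserving_snocEquiv d).integrable_comp_of_integrable hf
  simp only [Function.comp_def, snocEquiv_apply] at this
  exact this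

theorem continuous_snocR {d : ℕ} : Continuous (fun w : RSpace d × ℝ => snocR w.1 w.2) := by
  unfold snocR
  refine (PiLp.continuous_toLp 2 _).comp (continuous_pi fun i => ?_)
  refine Fin.lastCases ?_ (fun i => ?_) i
  · simpa using continuous_snd
  · simp only [Fin.snoc_castSucc]
    fun_prop

/-! ### Exchanging a pairing with an integral over parameters -/

/-- Fubini in the form used for every piece: the majorant factorises, and compact support of φ makes
⟨x⟩^{m₂} integrable against it. -/
theorem integral_integral_mul_test {n : ℕ} {T : Type*} [MeasurableSpace T] {m : Measure T}
    [SFinite m] {f : T → RSpace n → ℂ} {G : T → ℝ} {m₂ : ℝ} {φ : RSpace n → ℂ} (hφ : IsTest φ)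
    (hf : AEStronglyMeasurable (fun w : T × RSpace n => f w.1 w.2) (m.prod volume))
    (hG : Integrable G m) (hb : ∀ᵐ t ∂m, ∀ x, ‖f t x‖ ≤ G t * bracket x ^ m₂) :
    Integrable (fun t => ∫ x, f t x * φ x) m ∧
      Integrable (fun x => (∫ t, f t x ∂m) * φ x) ∧
      ∫ t, (∫ x, f t x * φ x) ∂m = ∫ x, (∫ t, f t x ∂m) * φ x := by
  have hI : Integrable (fun w : T × RSpace n => f w.1 w.2 * φ w.2) (m.prod volume) := by
    refine (hG.mul_prod (integrable_bracket_mul hφ m₂)).mono'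
      (hf.mul hφ.1.continuous.aestronglyMeasurable.comp_snd) ?_
    have h1 : ∀ᵐ w ∂(m.prod (volume : Measure (RSpace n))),
        ∀ x, ‖f w.1 x‖ ≤ G w.1 * bracket x ^ m₂ := Measure.quasiMeasurePreserving_fst.ae hb
    filter_upwards [h1] with w hw
    rw [norm_mul, ← mul_assoc]
    gcongr
    exact hw w.2
  have e : ∀ x, (∫ t, f t x ∂m) * φ x = ∫ t, f t x * φ x ∂m := fun x =>
    (integral_mul_const _ _).symm
  refine ⟨hI.integral_prod_left, ?_, ?_⟩
  · simp only [e]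
    exact hI.integral_prod_right
  · simp only [e]
    exact integral_integral_swap (f := fun t x => f t x * φ x) hI

/-! ### Finite regularity with explicit bounds -/

/-- `V` is `C^S` on `Ω`, with derivatives bounded by `H ⟨x⟩^{m₂}`. -/
def BoundedOrder {n : ℕ} (Ω : Set (RSpace n)) (m₂ : ℝ) (S : ℕ) (H : ℝ) (V : RSpace n → ℂ) : Prop :=
  ContDiffOn ℝ S V Ω ∧
    ∀ W : List (Fin n), W.length ≤ S → ∀ x ∈ Ω, ‖wderiv W V x‖ ≤ H * bracket x ^ m₂

theorem contDiffOn_wderiv_nat {n : ℕ} {U : Set (RSpace n)} (hU : IsOpen U) (W : List (Fin n)) :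
    ∀ {T : ℕ} {f : RSpace n → ℂ}, ContDiffOn ℝ ((W.length + T : ℕ) : WithTop ℕ∞) f U →
      ContDiffOn ℝ T (wderiv W f) U := by
  induction W with
  | nil => intro T f h; simpa using h
  | cons i W ih =>
    intro T f h
    refine contDiffOn_pderiv hU i (k := ((T + 1 : ℕ) : WithTop ℕ∞)) (ih (h.of_le ?_)) (by simp)
    exact_mod_cast (by simp only [List.length_cons]; omega)

theorem differentiableAt_wderiv_nat {n : ℕ} {U : Set (RSpace n)} (hU : IsOpen U) {S : ℕ}
    {W : List (Fin n)} {f : RSpace n → ℂ} (h : ContDiffOn ℝ S f U) (hW : W.length + 1 ≤ S)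
    {x : RSpace n} (hx : x ∈ U) : DifferentiableAt ℝ (wderiv W f) x :=
  ((contDiffOn_wderiv_nat hU W (T := 1) (h.of_le (by exact_mod_cast hW))).contDiffAt
    (hU.mem_nhds hx)).differentiableAt (by simp)

theorem wderiv_lin_nat {n : ℕ} {U : Set (RSpace n)} (hU : IsOpen U) {S : ℕ} (W : List (Fin n))
    {f g : RSpace n → ℂ} (hf : ContDiffOn ℝ S f U) (hg : ContDiffOn ℝ S g U) (c e : ℂ)
    (hW : W.length ≤ S) :
    Set.EqOn (wderiv W (fun x => c * f x + e * g x))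
      (fun x => c * wderiv W f x + e * wderiv W g x) U := by
  induction W with
  | nil => exact fun _ _ => rfl
  | cons i W ih =>
    intro x hx
    simp only [List.length_cons] at hW
    rw [wderiv_cons, pderiv_congr hU i (ih (by omega)) hx]
    have h1 := (differentiableAt_wderiv_nat hU hf hW hx).hasFDerivAt.const_mul c
    have h2 := (differentiableAt_wderiv_nat hU hg hW hx).hasFDerivAt.const_mul e
    simp only [pderiv, wderiv_cons, (h1.fun_add h2).fderiv, add_apply, smul_apply, smul_eq_mul]

theorem BoundedOrder.lin {n : ℕ} {Ω : Set (RSpace n)} (hΩ : IsOpen Ω) {m₂ : ℝ} {S : ℕ}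
    {H₁ H₂ : ℝ} {V₁ V₂ : RSpace n → ℂ} (h₁ : BoundedOrder Ω m₂ S H₁ V₁)
    (h₂ : BoundedOrder Ω m₂ S H₂ V₂) (c e : ℂ) :
    BoundedOrder Ω m₂ S (‖c‖ * H₁ + ‖e‖ * H₂) (fun x => c * V₁ x + e * V₂ x) := by
  refine ⟨(contDiffOn_const.mul h₁.1).add (contDiffOn_const.mul h₂.1), fun W hW x hx => ?_⟩
  rw [wderiv_lin_nat hΩ W h₁.1 h₂.1 c e hW hx]
  refine (norm_add_le _ _).trans ?_
  rw [norm_mul, norm_mul, add_mul, mul_assoc, mul_assoc]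
  gcongr
  · exact h₁.2 W hW x hx
  · exact h₂.2 W hW x hx

theorem BoundedOrder.add {n : ℕ} {Ω : Set (RSpace n)} (hΩ : IsOpen Ω) {m₂ : ℝ} {S : ℕ}
    {H₁ H₂ : ℝ} {V₁ V₂ : RSpace n → ℂ} (h₁ : BoundedOrder Ω m₂ S H₁ V₁)
    (h₂ : BoundedOrder Ω m₂ S H₂ V₂) :
    BoundedOrder Ω m₂ S (H₁ + H₂) (fun x => V₁ x + V₂ x) := by
  simpa using h₁.lin hΩ h₂ 1 1

theorem BoundedOrder.mono {n : ℕ} {Ω : Set (RSpace n)} {m₂ : ℝ} {S : ℕ}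
    {H₁ H₂ : ℝ} {V : RSpace n → ℂ} (h : BoundedOrder Ω m₂ S H₁ V) (hH : H₁ ≤ H₂) :
    BoundedOrder Ω m₂ S H₂ V := by
  refine ⟨h.1, fun W hW x hx => (h.2 W hW x hx).trans ?_⟩
  have := Real.rpow_pos_of_pos (bracket_pos x) m₂
  gcongr

theorem wderiv_zero {n : ℕ} (W : List (Fin n)) :
    wderiv W (fun _ : RSpace n => (0 : ℂ)) = fun _ => 0 := by
  induction W with
  | nil => rfl
  | cons i W ih => rw [wderiv_cons, ih]; ext x; simp [pderiv]

theorem BoundedOrder.sum {n : ℕ} {Ω : Set (RSpace n)} (hΩ : IsOpen Ω) {m₂ : ℝ} {S : ℕ}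
    {H : ℝ} {V : ℕ → RSpace n → ℂ} (M : ℕ) (h : ∀ j < M, BoundedOrder Ω m₂ S H (V j)) :
    BoundedOrder Ω m₂ S (M * H) (fun x => ∑ j ∈ Finset.range M, V j x) := by
  induction M with
  | zero =>
    simp only [Nat.cast_zero, zero_mul, Finset.range_zero, Finset.sum_empty]
    refine ⟨contDiffOn_const, fun W _ x _ => ?_⟩
    simp [wderiv_zero]
  | succ M ih =>
    simp only [Finset.sum_range_succ, Nat.cast_succ, add_mul, one_mul]
    exact (ih fun j hj => h j (by omega)).add hΩ (h M (by omega))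

/-- Oscillatory integrals with a common dominating function. -/
theorem boundedOrder_oscillatory {n : ℕ} {T : Type*} [MeasurableSpace T] {m : Measure T}
    {Ω : Set (RSpace n)} (hΩ : IsOpen Ω) {m₂ : ℝ} {S : ℕ}
    {ζ : T → CSpace n} {g : T → RSpace n → ℂ} {wt : T → ℂ} {G Z β : T → ℝ} {q H : ℝ} (hq : 0 ≤ q)
    (hmeas : ∀ x, AEStronglyMeasurable
      (fun t => Complex.exp (Complex.I * cdot x (ζ t)) * g t x * wt t) m)
    (hexp : ∀ᵐ t ∂m, ∀ x ∈ Ω, ‖Complex.exp (Complex.I * cdot x (ζ t))‖ ≤ 1)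
    (hsm : ∀ᵐ t ∂m, ContDiff ℝ ∞ (g t)) (hζ : ∀ᵐ t ∂m, ∀ i, ‖ζ t i‖ ≤ Z t)
    (hg : ∀ᵐ t ∂m, ∀ V : List (Fin n), V.length ≤ S → ∀ x ∈ Ω,
      ‖wderiv V (g t) x‖ ≤ G t * bracket x ^ m₂ * (q * Z t) ^ V.length)
    (hwt : AEStronglyMeasurable wt m) (hG : AEStronglyMeasurable G m)
    (hZ : AEStronglyMeasurable Z m) (hG0 : ∀ᵐ t ∂m, 0 ≤ G t ∧ 0 ≤ Z t) (hβ : Integrable β m)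
    (hdom : ∀ᵐ t ∂m, ∀ s ≤ S, ‖wt t‖ * G t * Z t ^ s ≤ H * β t) :
    BoundedOrder Ω m₂ S ((1 + q) ^ S * (H * ∫ t, β t ∂m))
      (fun x => ∫ t, Complex.exp (Complex.I * cdot x (ζ t)) * g t x * wt t ∂m) := by
  have hint : ∀ s ≤ S, Integrable (fun t => ‖wt t‖ * G t * Z t ^ s) m := fun s hs => by
    refine (hβ.const_mul H).mono' ((hwt.norm.mul hG).mul (hZ.pow s)) ?_
    filter_upwards [hdom, hG0] with t h1 h2
    have h3 := h2.1
    have h4 := h2.2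
    rw [Real.norm_of_nonneg (by positivity)]
    exact h1 s hs
  have hP : Continuous (fun x : RSpace n => bracket x ^ m₂) :=
    continuous_bracket.rpow_const fun x => Or.inl (bracket_pos x).ne'
  obtain ⟨k1, k2⟩ := contDiffOn_oscillatory (S := S) (P := fun x => bracket x ^ m₂)
    hΩ hP hmeas hexp hsm hζ hg hint
  refine ⟨k1, fun W hW x hx => (k2 W hW x hx).trans ?_⟩
  have h0 := Real.rpow_pos_of_pos (bracket_pos x) m₂
  have h1 : ∫ t, ‖wt t‖ * G t * Z t ^ W.length ∂m ≤ H * ∫ t, β t ∂m := by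
    rw [← integral_const_mul]
    refine integral_mono_ae (hint _ hW) (hβ.const_mul H) ?_
    filter_upwards [hdom] with t h1
    exact h1 _ hW
  have h2 : 0 ≤ ∫ t, ‖wt t‖ * G t * Z t ^ W.length ∂m := by
    refine integral_nonneg_of_ae ?_
    filter_upwards [hG0] with t h2
    have h3 := h2.1
    have h4 := h2.2
    simp only [Pi.zero_apply]
    positivity
  gcongr
  linarith

end SGHalfSpace

end


noncomputable section

namespace SGHalfSpace

open MeasureTheory Filter Topology

/-! ### The radius of the contour -/

/-- Since v! ≤ v^v ≤ M^v, factorial powers of up to M derivatives are no worse than powers of any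
frequency X ≥ M^θ. This is why the contour lies beyond a threshold growing with M. -/
theorem rfac_le_pow {θ X : ℝ} (hθ : 0 ≤ θ) {M : ℕ} (hX : (M : ℝ) ^ θ ≤ X) {v : ℕ} (hv : v ≤ M) :
    rfac θ v ≤ X ^ v := by
  have h1 : ((M : ℝ) ^ θ) ^ v ≤ X ^ v := pow_le_pow_left₀ (by positivity) hX v
  refine le_trans ?_ h1
  unfold rfac
  rw [← Real.rpow_natCast, ← Real.rpow_mul (by positivity), mul_comm θ, Real.rpow_mul (by positivity),
    Real.rpow_natCast]
  refine Real.rpow_le_rpow (by positivity) ?_ hθ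
  exact_mod_cast (Nat.factorial_le_pow v).trans (Nat.pow_le_pow_left hv v)

/-- The threshold beyond which `M` terms of the expansion are used. -/
def threshold (B τ : ℝ) (M : ℕ) : ℝ := (B + 1) * ((M : ℝ) + 1) ^ τ

/-- The radius of the contour in the last frequency variable. -/
def radius {d : ℕ} (B τ : ℝ) (M : ℕ) (ξ' : RSpace d) : ℝ :=
  (2 * B + 2) * (bracket ξ' + threshold B τ M)

section

variable {d : ℕ} {B τ : ℝ} {M : ℕ}

theorem pow_le_threshold (hB : 0 ≤ B) {ν : ℝ} (hν : 0 ≤ ν) (hντ : ν ≤ τ) :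
    (M : ℝ) ^ ν ≤ threshold B τ M := by
  have h0 : (0 : ℝ) ≤ M := Nat.cast_nonneg M
  have h1 : (M : ℝ) ^ ν ≤ ((M : ℝ) + 1) ^ ν := Real.rpow_le_rpow h0 (by linarith) hν
  have h2 : ((M : ℝ) + 1) ^ ν ≤ ((M : ℝ) + 1) ^ τ :=
    Real.rpow_le_rpow_of_exponent_le (by linarith) hντ
  unfold threshold
  nlinarith [Real.rpow_pos_of_pos (show (0 : ℝ) < M + 1 by linarith) τ]

theorem one_le_threshold (hB : 0 ≤ B) (hτ : 0 ≤ τ) : 1 ≤ threshold B τ M := by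
  have h0 : (0 : ℝ) ≤ M := Nat.cast_nonneg M
  have h1 : (1 : ℝ) ≤ ((M : ℝ) + 1) ^ τ := Real.one_le_rpow (by linarith) hτ
  unfold threshold
  nlinarith

theorem mul_pow_le_threshold (hB : 0 ≤ B) (hτ : 0 ≤ τ) : B * (M : ℝ) ^ τ ≤ threshold B τ M := by
  have h0 : (0 : ℝ) ≤ M := Nat.cast_nonneg M
  have h1 : (M : ℝ) ^ τ ≤ ((M : ℝ) + 1) ^ τ := Real.rpow_le_rpow h0 (by linarith) hτ
  have h2 : 0 ≤ (M : ℝ) ^ τ := by positivity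
  unfold threshold
  nlinarith

theorem threshold_le_radius (hB : 0 ≤ B) (hτ : 0 ≤ τ) (ξ' : RSpace d) :
    threshold B τ M ≤ radius B τ M ξ' := by
  have h1 := bracket_ge_one ξ'
  have h2 := one_le_threshold (M := M) hB hτ
  unfold radius
  nlinarith

theorem one_le_radius (hB : 0 ≤ B) (hτ : 0 ≤ τ) (ξ' : RSpace d) : 1 ≤ radius B τ M ξ' :=
  (one_le_threshold hB hτ).trans (threshold_le_radius hB hτ ξ')

/-- The factor 2 separates the contour from the circle of radius B⟨ξ'⟩, as `norm_kern_le` requires.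
-/
theorem mul_bracket_lt_radius (hB : 0 ≤ B) (hτ : 0 ≤ τ) (ξ' : RSpace d) :
    2 * (B * bracket ξ') < radius B τ M ξ' := by
  have h1 := bracket_ge_one ξ'
  have h2 := one_le_threshold (M := M) hB hτ
  unfold radius
  nlinarith

theorem bracket_le_radius (hB : 0 ≤ B) (hτ : 0 ≤ τ) (ξ' : RSpace d) :
    bracket ξ' ≤ radius B τ M ξ' := by
  have h1 := bracket_ge_one ξ'
  have h2 := one_le_threshold (M := M) hB hτ
  unfold radius
  nlinarith

theorem continuous_radius : Continuous (radius (d := d) B τ M) := by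
  have := continuous_bracket (n := d)
  unfold radius
  fun_prop

end

/-! ### Growth of constants -/

/-- `f S = O(A^S S!^θ)` in a form with explicit constants. -/
theorem rfac_add_const_le {θ : ℝ} (hθ : 0 ≤ θ) (c : ℕ) :
    ∃ K A : ℝ, 1 ≤ K ∧ 1 ≤ A ∧ ∀ S, rfac θ (S + c) ≤ K * A ^ S * rfac θ S := by
  have h1 : (1 : ℝ) ≤ 2 ^ θ := Real.one_le_rpow (by norm_num) hθ
  refine ⟨((2 : ℝ) ^ θ) ^ c * rfac θ c, 2 ^ θ,
    one_le_mul_of_one_le_of_one_le (one_le_pow₀ h1) (one_le_rfac hθ c), h1, fun S => ?_⟩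
  refine (rfac_add_le hθ S c).trans (le_of_eq ?_)
  ring

/-- By N^N ≤ e^N N! the power (N^θ)^N is N!^θ up to a geometric factor. The hypothesis τ ≤ θ,
applied with τ = μ+ν-1, is exactly what limits the Gevrey index of the result. -/
theorem threshold_pow_le {B τ θ : ℝ} (hB : 0 ≤ B) (hτ : 0 ≤ τ) (hθ : τ ≤ θ) (M₀ c : ℕ) :
    ∃ K A : ℝ, 1 ≤ K ∧ 1 ≤ A ∧ ∀ S p, p ≤ S + c →
      threshold B τ (S + M₀) ^ p ≤ K * A ^ S * rfac θ S := by
  have hθ0 : 0 ≤ θ := hτ.trans hθ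
  obtain ⟨K, A, hK, hA, h⟩ := rfac_add_const_le hθ0 (M₀ + 1 + c)
  set L := M₀ + 1 + c with hL
  set X : ℝ := (B + 1) * Real.exp θ with hX
  have hX1 : 1 ≤ X := one_le_mul_of_one_le_of_one_le (by linarith) (Real.one_le_exp hθ0)
  refine ⟨X ^ L * K, X * A, one_le_mul_of_one_le_of_one_le (one_le_pow₀ hX1) hK,
    one_le_mul_of_one_le_of_one_le hX1 hA, fun S p hp => ?_⟩
  -- This N exceeds both M + 1 = S + M₀ + 1 and the exponent p ≤ S + c.
  set N := S + L with hN
  have hN1 : 1 ≤ N := by omega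
  have hNr : (1 : ℝ) ≤ N := by exact_mod_cast hN1
  have h1 : threshold B τ (S + M₀) ≤ (B + 1) * (N : ℝ) ^ θ := by
    unfold threshold
    have e1 : (((S + M₀ : ℕ) : ℝ) + 1) ≤ N := by exact_mod_cast (by omega)
    have e2 : (((S + M₀ : ℕ) : ℝ) + 1) ^ τ ≤ (N : ℝ) ^ τ :=
      Real.rpow_le_rpow (by positivity) e1 hτ
    have e3 : (N : ℝ) ^ τ ≤ (N : ℝ) ^ θ := Real.rpow_le_rpow_of_exponent_le hNr hθ
    have := e2.trans e3
    gcongr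
  have h2 : threshold B τ (S + M₀) ^ p ≤ ((B + 1) * (N : ℝ) ^ θ) ^ N := by
    have h3 := one_le_threshold (M := S + M₀) hB hτ
    exact (pow_le_pow_right₀ h3 (show p ≤ N by omega)).trans
      (pow_le_pow_left₀ (by linarith) h1 N)
  have h4 : ((N : ℝ) ^ θ) ^ N ≤ Real.exp θ ^ N * rfac θ N := by
    unfold rfac
    have e1 : (N : ℝ) ^ N ≤ Real.exp N * N.factorial := by
      have := Real.pow_div_factorial_le_exp (N : ℝ) (by positivity) N
      rwa [div_le_iff₀ (by positivity)] at this
    have e2 : ((N : ℝ) ^ θ) ^ N = ((N : ℝ) ^ N) ^ θ := by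
      rw [← Real.rpow_natCast, ← Real.rpow_mul (by positivity), mul_comm,
        Real.rpow_mul (by positivity), Real.rpow_natCast]
    have e3 : Real.exp θ ^ N = (Real.exp N) ^ θ := by
      rw [← Real.exp_nat_mul, ← Real.exp_mul]
    rw [e2, e3, ← Real.mul_rpow (by positivity) (by positivity)]
    exact Real.rpow_le_rpow (by positivity) e1 hθ0
  refine h2.trans ?_
  rw [mul_pow]
  calc (B + 1) ^ N * ((N : ℝ) ^ θ) ^ N ≤ (B + 1) ^ N * (Real.exp θ ^ N * rfac θ N) := by gcongr
    _ = X ^ N * rfac θ N := by rw [hX, mul_pow]; ring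
    _ ≤ X ^ N * (K * A ^ S * rfac θ S) := by gcongr; exact h S
    _ = _ := by rw [hN]; ring_nf

/-! ### The Fourier-Laplace transforms of the moments of a Gelfand-Shilov function -/

/-- `y_k^r u`, extended by zero from the lower half-space. -/
def moment {d : ℕ} (k : Fin (d + 1)) (u : RSpace (d + 1) → ℂ) (r : ℕ) : RSpace (d + 1) → ℂ :=
  extendZero (lowerHalf d) (fun y => (y k : ℂ) ^ r * u y)

theorem coord_mul_moment {d : ℕ} (k : Fin (d + 1)) (u : RSpace (d + 1) → ℂ) (r : ℕ) :
    (fun y => (y k : ℂ) * moment k u r y) = moment k u (r + 1) := by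
  ext y
  by_cases hy : y ∈ lowerHalf d
  · simp [moment, extendZero, hy, pow_succ']; ring
  · simp [moment, extendZero, hy]

theorem IsGelfandShilov.decaysOn_coord_pow_mul {n : ℕ} {θ : ℝ} (hθ : 1 ≤ θ) {Ω : Set (RSpace n)}
    (hΩ : IsOpen Ω) {u : RSpace n → ℂ} (hu : IsGelfandShilov θ θ Ω u) (L : ℕ) (k : Fin n) (r : ℕ) :
    DecaysOn L Ω (fun y => (y k : ℂ) ^ r * u y) := by
  obtain ⟨K, D, hK, hD, h⟩ := hu.weighted_le hθ hΩ L
  exact ⟨(contDiff_coord_pow k r).contDiffOn.mul hu.1, fun W => ⟨_, fun y hy => h k r W y hy⟩⟩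

theorem IsGelfandShilov.lowerSupported_moment {d : ℕ} {θ : ℝ} (hθ : 1 ≤ θ)
    {u : RSpace (d + 1) → ℂ} (hu : IsGelfandShilov θ θ (lowerHalf d) u) (k : Fin (d + 1)) (r : ℕ) :
    LowerSupported (moment k u r) :=
  (hu.decaysOn_coord_pow_mul hθ (isOpen_lowerHalf d) _ k r).lowerSupported

theorem IsGelfandShilov.exists_hatC_moment_le {d : ℕ} {θ : ℝ} (hθ : 1 ≤ θ)
    {u : RSpace (d + 1) → ℂ} (hu : IsGelfandShilov θ θ (lowerHalf d) u) :
    ∃ K A : ℝ, 0 ≤ K ∧ 1 ≤ A ∧ ∀ (k : Fin (d + 1)) (r p : ℕ) (ξ' : RSpace d) (z : ℂ), 0 ≤ z.im →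
      bracket ξ' ^ p * ‖hatC (moment k u r) (snocC ξ' z)‖ ≤
        K * A ^ (r + p) * rfac θ r * rfac θ p := by
  obtain ⟨K, D, hK, hD, h⟩ := hu.weighted_le hθ (isOpen_lowerHalf d) (d + 1 + 2)
  have hθ0 : 0 ≤ θ := by linarith
  set X : ℝ := 2 * (d + 1) with hX
  have hX1 : 1 ≤ X := by rw [hX]; linarith [Nat.cast_nonneg (α := ℝ) d]
  set I := ∫ y : RSpace (d + 1), ((1 + ‖y‖) ^ (d + 1 + 1))⁻¹ with hI
  have hI0 : 0 ≤ I := integral_nonneg fun y => by positivity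
  refine ⟨X * K * I, X * D, by positivity, one_le_mul_of_one_le_of_one_le hX1 hD,
    fun k r p ξ' z hz => ?_⟩
  have p1 := rfac_pos θ r
  have p2 := rfac_pos θ p
  have key := bracket_pow_mul_hatC_le
    (hu.decaysOn_coord_pow_mul hθ (isOpen_lowerHalf d) (d + 1 + 2) k r) ξ' hz p
    (C := K * D ^ (r + p) * rfac θ r * rfac θ p) (by positivity) fun V hV y hy =>
      (h k r V y hy).trans (by
        have e1 := rfac_mono hθ0 hV
        have e3 := rfac_pos θ V.length
        have e2 : D ^ (r + V.length) ≤ D ^ (r + p) := pow_le_pow_right₀ hD (by omega)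
        gcongr)
  refine key.trans ?_
  calc X ^ (p + 1) * (K * D ^ (r + p) * rfac θ r * rfac θ p * I)
      ≤ X ^ (r + p + 1) * (K * D ^ (r + p) * rfac θ r * rfac θ p * I) := by
        refine mul_le_mul_of_nonneg_right (pow_le_pow_right₀ hX1 (by omega)) (by positivity)
    _ = _ := by ring_nf

/-- R^p is at most a geometric factor times ⟨ξ'⟩^p plus the p-th power of the threshold. The first
is absorbed by the decay of the transform in ξ', the second by `threshold_pow_le`. Keeping d + 1
further powers of ⟨ξ'⟩ leaves an integrable function of ξ'. -/
theorem IsGelfandShilov.exists_radius_pow_mul_hatC_le {d : ℕ} {θ B τ : ℝ} (hθ : 1 ≤ θ)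
    (hB : 0 ≤ B) (hτ : 0 ≤ τ) (hτθ : τ ≤ θ)
    {u : RSpace (d + 1) → ℂ} (hu : IsGelfandShilov θ θ (lowerHalf d) u) (M₀ c : ℕ) :
    ∃ K A : ℝ, 0 ≤ K ∧ 1 ≤ A ∧ ∀ (k : Fin (d + 1)) (r S p : ℕ), p ≤ S + c →
      ∀ (ξ' : RSpace d) (z : ℂ), 0 ≤ z.im →
        radius B τ (S + M₀) ξ' ^ p * ‖hatC (moment k u r) (snocC ξ' z)‖ ≤
          K * A ^ (S + r) * rfac θ S * rfac θ r * (bracket ξ' ^ (d + 1))⁻¹ := by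
  have hθ0 : 0 ≤ θ := by linarith
  obtain ⟨K₁, A₁, hK₁, hA₁, h₁⟩ := hu.exists_hatC_moment_le hθ
  obtain ⟨K₂, A₂, hK₂, hA₂, h₂⟩ := threshold_pow_le hB hτ hτθ M₀ c
  obtain ⟨K₃, A₃, hK₃, hA₃, h₃⟩ := rfac_add_const_le hθ0 (c + (d + 1))
  set κ : ℝ := 2 * (2 * B + 2) with hκ
  have hκ1 : 1 ≤ κ := by rw [hκ]; linarith
  set L := c + (d + 1) with hL
  have pL := rfac_pos θ (d + 1)
  refine ⟨κ ^ c * (K₁ * A₁ ^ L * K₃ + K₂ * (K₁ * A₁ ^ L * rfac θ (d + 1))),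
    κ * A₁ * A₂ * A₃, by positivity, ?_, fun k r S p hp ξ' z hz => ?_⟩
  · exact one_le_mul_of_one_le_of_one_le (one_le_mul_of_one_le_of_one_le
      (one_le_mul_of_one_le_of_one_le hκ1 hA₁) hA₂) hA₃
  set w := ‖hatC (moment k u r) (snocC ξ' z)‖ with hw
  have hw0 : 0 ≤ w := norm_nonneg _
  have hb := bracket_ge_one ξ'
  have ht := one_le_threshold (M := S + M₀) hB hτ
  have pr := rfac_pos θ r
  have pS := rfac_pos θ S
  have hR : radius B τ (S + M₀) ξ' ^ p ≤
      κ ^ (S + c) * (bracket ξ' ^ p + threshold B τ (S + M₀) ^ p) := by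
    unfold radius
    rw [mul_pow]
    have e1 := add_pow_le (a := bracket ξ') (b := threshold B τ (S + M₀)) (by linarith)
      (by linarith) p
    have e2 : (2 : ℝ) ^ (p - 1) ≤ 2 ^ p := pow_le_pow_right₀ (by norm_num) (by omega)
    calc _ ≤ (2 * B + 2) ^ p * (2 ^ p * (bracket ξ' ^ p + threshold B τ (S + M₀) ^ p)) := by
          gcongr
          exact e1.trans (by gcongr)
      _ = κ ^ p * (bracket ξ' ^ p + threshold B τ (S + M₀) ^ p) := by rw [hκ, mul_pow 2]; ring
      _ ≤ _ := by gcongr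
  have hp1 : bracket ξ' ^ (p + (d + 1)) * w ≤
      K₁ * A₁ ^ (r + (S + L)) * rfac θ r * (K₃ * A₃ ^ S * rfac θ S) := by
    refine (h₁ k r (p + (d + 1)) ξ' z hz).trans ?_
    have e1 : rfac θ (p + (d + 1)) ≤ K₃ * A₃ ^ S * rfac θ S :=
      (rfac_mono hθ0 (by omega)).trans (h₃ S)
    have e2 : A₁ ^ (r + (p + (d + 1))) ≤ A₁ ^ (r + (S + L)) := pow_le_pow_right₀ hA₁ (by omega)
    have := rfac_pos θ (p + (d + 1))
    gcongr
  have hp2 : bracket ξ' ^ (d + 1) * w ≤ K₁ * A₁ ^ (r + (S + L)) * rfac θ r * rfac θ (d + 1) := by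
    refine (h₁ k r (d + 1) ξ' z hz).trans ?_
    have e2 : A₁ ^ (r + (d + 1)) ≤ A₁ ^ (r + (S + L)) := pow_le_pow_right₀ hA₁ (by omega)
    gcongr
  have hp3 := h₂ S p hp
  rw [← div_eq_mul_inv, le_div_iff₀ (by positivity)]
  calc _ = bracket ξ' ^ (d + 1) * w * radius B τ (S + M₀) ξ' ^ p := by ring
    _ ≤ bracket ξ' ^ (d + 1) * w *
        (κ ^ (S + c) * (bracket ξ' ^ p + threshold B τ (S + M₀) ^ p)) := by gcongr
    _ = κ ^ (S + c) * (bracket ξ' ^ (p + (d + 1)) * w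
        + threshold B τ (S + M₀) ^ p * (bracket ξ' ^ (d + 1) * w)) := by ring
    _ ≤ κ ^ (S + c) * (K₁ * A₁ ^ (r + (S + L)) * rfac θ r * (K₃ * A₃ ^ S * rfac θ S)
        + K₂ * A₂ ^ S * rfac θ S * (K₁ * A₁ ^ (r + (S + L)) * rfac θ r * rfac θ (d + 1))) := by
        gcongr
    _ = κ ^ c * (K₁ * A₁ ^ L * K₃) * ((κ * A₁ * A₃) ^ S * A₁ ^ r * rfac θ S * rfac θ r)
        + κ ^ c * (K₂ * (K₁ * A₁ ^ L * rfac θ (d + 1))) *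
          ((κ * A₁ * A₂) ^ S * A₁ ^ r * rfac θ S * rfac θ r) := by ring_nf
    _ ≤ κ ^ c * (K₁ * A₁ ^ L * K₃) * ((κ * A₁ * A₂ * A₃) ^ S * (κ * A₁ * A₂ * A₃) ^ r *
          rfac θ S * rfac θ r)
        + κ ^ c * (K₂ * (K₁ * A₁ ^ L * rfac θ (d + 1))) *
          ((κ * A₁ * A₂ * A₃) ^ S * (κ * A₁ * A₂ * A₃) ^ r * rfac θ S * rfac θ r) := by
        have e1 : A₁ ≤ κ * A₁ * A₂ * A₃ := by
          calc A₁ = 1 * A₁ * 1 * 1 := by ring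
            _ ≤ _ := by gcongr
        have e2 : κ * A₁ * A₃ ≤ κ * A₁ * A₂ * A₃ := by
          calc κ * A₁ * A₃ = κ * A₁ * 1 * A₃ := by ring
            _ ≤ _ := by gcongr
        have e3 : κ * A₁ * A₂ ≤ κ * A₁ * A₂ * A₃ := le_mul_of_one_le_right (by positivity) hA₃
        gcongr
    _ = _ := by ring

end SGHalfSpace

end


/-! ### Oscillatory integrals with Gevrey data; the frequencies inside the contour -/

noncomputable section

namespace SGHalfSpace

open MeasureTheory Filter Topology

/-- `F t x = O(⟨x⟩^{m₂})` on `Ω`, with a constant integrable in `t`. -/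
def DominatedOn {n : ℕ} {T : Type*} [MeasurableSpace T] (m : Measure T) (Ω : Set (RSpace n))
    (m₂ : ℝ) (F : T → RSpace n → ℂ) : Prop :=
  ∃ G : T → ℝ, Integrable G m ∧ ∀ᵐ t ∂m, ∀ x ∈ Ω, ‖F t x‖ ≤ G t * bracket x ^ m₂

/-- Phase, amplitude and weight of an oscillatory integral, with bounds for up to `S` derivatives
of the amplitude. -/
structure OscData {n : ℕ} {T : Type*} [MeasurableSpace T] (m : Measure T) (Ω : Set (RSpace n))
    (m₂ : ℝ) (S : ℕ) (ζ : T → CSpace n) (g : T → RSpace n → ℂ) (wt : T → ℂ) (β : T → ℝ)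
    (q H : ℝ) (G Z : T → ℝ) : Prop where
  meas : ∀ x, AEStronglyMeasurable
    (fun t => Complex.exp (Complex.I * cdot x (ζ t)) * g t x * wt t) m
  exp_le : ∀ᵐ t ∂m, ∀ x ∈ Ω, ‖Complex.exp (Complex.I * cdot x (ζ t))‖ ≤ 1
  smooth : ∀ᵐ t ∂m, ContDiff ℝ ∞ (g t)
  freq : ∀ᵐ t ∂m, ∀ i, ‖ζ t i‖ ≤ Z t
  amp : ∀ᵐ t ∂m, ∀ V : List (Fin n), V.length ≤ S → ∀ x ∈ Ω,
    ‖wderiv V (g t) x‖ ≤ G t * bracket x ^ m₂ * (q * Z t) ^ V.length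
  weight_meas : AEStronglyMeasurable wt m
  amp_meas : AEStronglyMeasurable G m
  freq_meas : AEStronglyMeasurable Z m
  nonneg : ∀ᵐ t ∂m, 0 ≤ G t ∧ 0 ≤ Z t
  dom : ∀ᵐ t ∂m, ∀ s ≤ S, ‖wt t‖ * G t * Z t ^ s ≤ H * β t

theorem OscData.boundedOrder {n : ℕ} {T : Type*} [MeasurableSpace T] {m : Measure T}
    {Ω : Set (RSpace n)} {m₂ : ℝ} {S : ℕ} {ζ : T → CSpace n} {g : T → RSpace n → ℂ} {wt : T → ℂ}
    {β : T → ℝ} {q H : ℝ} {G Z : T → ℝ} (h : OscData m Ω m₂ S ζ g wt β q H G Z) (hΩ : IsOpen Ω)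
    (hq : 0 ≤ q) (hβ : Integrable β m) :
    BoundedOrder Ω m₂ S ((1 + q) ^ S * (H * ∫ t, β t ∂m))
      (fun x => ∫ t, Complex.exp (Complex.I * cdot x (ζ t)) * g t x * wt t ∂m) :=
  boundedOrder_oscillatory hΩ hq h.meas h.exp_le h.smooth h.freq h.amp h.weight_meas h.amp_meas
    h.freq_meas h.nonneg hβ h.dom

theorem OscData.dominatedOn {n : ℕ} {T : Type*} [MeasurableSpace T] {m : Measure T}
    {Ω : Set (RSpace n)} {m₂ : ℝ} {S : ℕ} {ζ : T → CSpace n} {g : T → RSpace n → ℂ} {wt : T → ℂ}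
    {β : T → ℝ} {q H : ℝ} {G Z : T → ℝ} (h : OscData m Ω m₂ S ζ g wt β q H G Z)
    (hβ : Integrable β m) :
    DominatedOn m Ω m₂ (fun t x => Complex.exp (Complex.I * cdot x (ζ t)) * g t x * wt t) := by
  refine ⟨fun t => H * β t, hβ.const_mul H, ?_⟩
  filter_upwards [h.exp_le, h.amp, h.dom, h.nonneg] with t h1 h2 h3 h4 x hx
  have e1 := h1 x hx
  have e2 : ‖g t x‖ ≤ G t * bracket x ^ m₂ := by simpa using h2 [] (by simp) x hx
  have e3 : ‖wt t‖ * G t ≤ H * β t := by simpa using h3 0 (by simp)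
  have hb := Real.rpow_pos_of_pos (bracket_pos x) m₂
  have hG := h4.1
  rw [norm_mul, norm_mul]
  calc _ ≤ 1 * (G t * bracket x ^ m₂) * ‖wt t‖ := by gcongr
    _ = ‖wt t‖ * G t * bracket x ^ m₂ := by ring
    _ ≤ _ := by gcongr

theorem BoundedOrder.subset {n : ℕ} {Ω Ω' : Set (RSpace n)} {m₂ : ℝ} {S : ℕ} {H : ℝ}
    {V : RSpace n → ℂ} (h : BoundedOrder Ω m₂ S H V) (hs : Ω' ⊆ Ω) : BoundedOrder Ω' m₂ S H V :=
  ⟨h.1.mono hs, fun W hW x hx => h.2 W hW x (hs hx)⟩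

/-! ### Dominating functions -/

theorem integrable_inv_bracket_pow (d : ℕ) :
    Integrable (fun ξ' : RSpace d => (bracket ξ' ^ (d + 1))⁻¹) := by
  have h1 := (integrable_one_add_norm_pow d).const_mul (2 ^ (d + 1))
  refine h1.mono' ?_ (Eventually.of_forall fun ξ' => ?_)
  · exact ((continuous_bracket.pow _).inv₀ fun ξ' => (pow_pos (bracket_pos _) _).ne').aestronglyMeasurable
  · have h2 := bracket_pos ξ'
    have h3 : 1 + ‖ξ'‖ ≤ 2 * bracket ξ' := by
      linarith [bracket_ge_one ξ', norm_le_bracket ξ']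
    rw [Real.norm_of_nonneg (by positivity), ← div_eq_mul_inv, inv_le_comm₀ (by positivity)
      (by positivity), inv_div, div_le_iff₀ (by positivity), mul_comm, ← mul_pow]
    gcongr

/-- The dominating function in `(ξ', t)`. -/
def freqWeight {d : ℕ} (w : RSpace d × ℝ) : ℝ := (bracket w.1 ^ (d + 1))⁻¹ * (1 + w.2 ^ 2)⁻¹

theorem integrable_freqWeight (d : ℕ) : Integrable (freqWeight (d := d)) :=
  (integrable_inv_bracket_pow d).mul_prod integrable_inv_one_add_sq

/-- The size of constants: factorials in the number `S` of derivatives, in `l` and in `r`. -/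
def gevrey (K A θ : ℝ) (S l r : ℕ) : ℝ := K * A ^ (S + l + r) * (rfac θ S * rfac θ l * rfac θ r)

theorem gevrey_pos {K A : ℝ} (hK : 0 < K) (hA : 0 < A) (θ : ℝ) (S l r : ℕ) :
    0 < gevrey K A θ S l r := by
  have h1 := rfac_pos θ S
  have h2 := rfac_pos θ l
  have h3 := rfac_pos θ r
  unfold gevrey
  positivity

/-! ### Inside the contour -/

/-- The frequencies inside the contour. -/
def insideSet {d : ℕ} (R : RSpace d → ℝ) : Set (RSpace d × ℝ) := {w | |w.2| ≤ R w.1}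

/-- The frequencies outside the contour. -/
def outsideSet {d : ℕ} (R : RSpace d → ℝ) : Set (RSpace d × ℝ) := {w | R w.1 < |w.2|}

theorem isClosed_insideSet {d : ℕ} {R : RSpace d → ℝ} (hR : Continuous R) :
    IsClosed (insideSet R) :=
  isClosed_le continuous_snd.abs (hR.comp continuous_fst)

theorem isOpen_outsideSet {d : ℕ} {R : RSpace d → ℝ} (hR : Continuous R) :
    IsOpen (outsideSet R) :=
  isOpen_lt (hR.comp continuous_fst) continuous_snd.abs

theorem compl_insideSet {d : ℕ} (R : RSpace d → ℝ) : (insideSet R)ᶜ = outsideSet R := by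
  ext w
  simp [insideSet, outsideSet]

theorem norm_cexp_cdot_real {d : ℕ} (x : RSpace (d + 1)) (ξ' : RSpace d) (t : ℝ) :
    ‖Complex.exp (Complex.I * cdot x (snocC ξ' (t : ℂ)))‖ = 1 := by
  rw [norm_cexp_cdot]; simp

theorem LowerSupported.continuous_hatC_real {d : ℕ} {f : RSpace (d + 1) → ℂ}
    (hf : LowerSupported f) : Continuous (fun w : RSpace d × ℝ => hatC f (snocC w.1 (w.2 : ℂ))) :=
  hf.continuousOn_hatC.comp_continuous (f := fun w : RSpace d × ℝ => (w.1, (w.2 : ℂ)))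
    (by fun_prop) fun w => by simp

theorem continuous_cexp_cdot_real {d : ℕ} : Continuous (fun w : (RSpace d × ℝ) × RSpace (d + 1) =>
    Complex.exp (Complex.I * cdot w.2 (snocC w.1.1 (w.1.2 : ℂ)))) := by
  have h1 : Continuous (fun w : (RSpace d × ℝ) × RSpace (d + 1) =>
      (w.2, snocC w.1.1 (w.1.2 : ℂ))) :=
    continuous_snd.prodMk (continuous_snocC.comp
      (f := fun w : (RSpace d × ℝ) × RSpace (d + 1) => (w.1.1, (w.1.2 : ℂ))) (by fun_prop))
  exact (continuous_const.mul (continuous_cdot.comp h1)).cexp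

theorem norm_snocC_apply_le {d : ℕ} {ξ' : RSpace d} {z : ℂ} {R : ℝ} (h1 : bracket ξ' ≤ R)
    (h2 : ‖z‖ ≤ R) (i : Fin (d + 1)) : ‖snocC ξ' z i‖ ≤ R := by
  refine Fin.lastCases ?_ (fun i => ?_) i
  · simpa using h2
  · simpa using (abs_apply_le_bracket ξ' i).trans h1

theorem rfac_le_radius_pow {d : ℕ} {B τ ν : ℝ} {S M₀ : ℕ} (hB : 0 ≤ B) (hν : 0 ≤ ν) (hντ : ν ≤ τ)
    (ξ' : RSpace d) {v : ℕ} (hv : v ≤ S + M₀) : rfac ν v ≤ radius B τ (S + M₀) ξ' ^ v :=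
  rfac_le_pow hν ((pow_le_threshold hB hν hντ).trans
    (threshold_le_radius hB (hν.trans hντ) ξ')) hv

section

variable {d : ℕ} {μ ν θ : ℝ} {m₁ : ℤ} {m₂ : ℝ} {a : RSpace (d + 1) → RSpace (d + 1) → ℂ}
  {u : RSpace (d + 1) → ℂ}

theorem rpow_sub_le_pow {X : ℝ} (hX : 1 ≤ X) (m₁ : ℤ) (l : ℕ) :
    X ^ ((m₁ : ℝ) - l) ≤ X ^ m₁.toNat := by
  rw [← Real.rpow_natCast]
  refine Real.rpow_le_rpow_of_exponent_le hX ?_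
  have : (m₁ : ℝ) ≤ (m₁.toNat : ℝ) := by exact_mod_cast Int.self_le_toNat m₁
  linarith [Nat.cast_nonneg (α := ℝ) l]

set_option maxHeartbeats 1000000 in
-- For |ξ_n| ≤ R every frequency is at most R, the symbol is O(R^{max(m₁,0)}), and factorials of
-- x-derivatives are at most powers of R. So only powers of R meet the transform, and
-- `IsGelfandShilov.exists_radius_pow_mul_hatC_le` converts them.
theorem exists_oscData_inside (hμ : 1 ≤ μ) (hν : 1 ≤ ν) (hθ : μ + ν - 1 ≤ θ) {B : ℝ} (hB : 0 ≤ B)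
    (ha : IsSGSymbol μ ν m₁ m₂ a) (hu : IsGelfandShilov θ θ (lowerHalf d) u) (M₀ : ℕ) :
    ∃ K A q : ℝ, 0 < K ∧ 1 ≤ A ∧ 0 ≤ q ∧ ∀ (k : Fin (d + 1)) (l r S : ℕ), ∃ G Z,
      OscData (volume.restrict (insideSet (radius B (μ + ν - 1) (S + M₀)))) Set.univ m₂ S
        (fun w => snocC w.1 (w.2 : ℂ)) (fun w x => symIter k l a x (snocR w.1 w.2))
        (fun w => hatC (moment k u r) (snocC w.1 (w.2 : ℂ))) freqWeight q
        (gevrey K A θ S l r) G Z := by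
  set τ := μ + ν - 1 with hτ
  obtain ⟨C₁, D₁, hC₁, hD₁, h₁⟩ := ha.exists_wderiv_le (by linarith)
  obtain ⟨K, A, hK, hA, hmom⟩ := hu.exists_radius_pow_mul_hatC_le (B := B) (τ := τ) (by linarith) hB
    (by linarith) hθ M₀ (m₁.toNat + 2)
  refine ⟨2 ^ (m₁.toNat + 1) * C₁ * (K + 1), A * D₁, D₁, by positivity,
    one_le_mul_of_one_le_of_one_le hA hD₁, by positivity, fun k l r S => ?_⟩
  set R := radius (d := d) B τ (S + M₀) with hR
  have hRc : Continuous R := continuous_radius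
  have hR1 : ∀ ξ', 1 ≤ R ξ' := fun ξ' => one_le_radius hB (by linarith) ξ'
  have hf := hu.lowerSupported_moment (by linarith) k r
  have hw := hf.continuous_hatC_real
  have hmS : MeasurableSet (insideSet R) := (isClosed_insideSet hRc).measurableSet
  refine ⟨fun w => C₁ * D₁ ^ l * rfac μ l * (2 * R w.1) ^ m₁.toNat, fun w => R w.1, ?_⟩
  have pl := rfac_pos μ l
  constructor
  · intro x
    have c1 : Continuous fun w : RSpace d × ℝ => symIter k l a x (snocR w.1 w.2) :=
      (ha.contDiff_symIter k l).continuous.comp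
        (f := fun w : RSpace d × ℝ => (x, snocR w.1 w.2)) (continuous_const.prodMk continuous_snocR)
    have c2 : Continuous fun w : RSpace d × ℝ =>
        Complex.exp (Complex.I * cdot x (snocC w.1 (w.2 : ℂ))) :=
      continuous_cexp_cdot_real.comp (Continuous.prodMk_left x)
    exact ((c2.mul c1).mul hw).aestronglyMeasurable
  · exact Eventually.of_forall fun w x _ => (norm_cexp_cdot_real x w.1 w.2).le
  · exact Eventually.of_forall fun w => ha.contDiff_symIter_left k l _
  · refine (ae_restrict_iff' hmS).2 (Eventually.of_forall fun w hwm i => ?_)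
    refine norm_snocC_apply_le (bracket_le_radius hB (by linarith) w.1) ?_ i
    rw [Complex.norm_real]
    exact hwm
  · refine (ae_restrict_iff' hmS).2 (Eventually.of_forall fun w hwm V hV x _ => ?_)
    refine (h₁ k l V x (snocR w.1 w.2)).trans ?_
    have e0 := bracket_ge_one (snocR w.1 w.2)
    have e1 : bracket (snocR w.1 w.2) ≤ 2 * R w.1 := by
      have := bracket_snocR_le w.1 w.2
      have h2 : bracket w.1 ≤ R w.1 := bracket_le_radius hB (by linarith) w.1
      have h3 : |w.2| ≤ R w.1 := hwm
      linarith
    have e2 : bracket (snocR w.1 w.2) ^ ((m₁ : ℝ) - l) ≤ (2 * R w.1) ^ m₁.toNat :=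
      (rpow_sub_le_pow e0 m₁ l).trans (pow_le_pow_left₀ (by linarith) e1 _)
    have e3 : rfac ν V.length ≤ R w.1 ^ V.length :=
      rfac_le_radius_pow hB (by linarith) (by linarith) w.1 (by omega)
    have p1 := rfac_pos ν V.length
    have p2 := Real.rpow_pos_of_pos (bracket_pos x) m₂
    have p3 := Real.rpow_pos_of_pos (bracket_pos (snocR w.1 w.2)) ((m₁ : ℝ) - l)
    have p4 := hR1 w.1
    calc _ ≤ C₁ * D₁ ^ (l + V.length) * rfac μ l * R w.1 ^ V.length * (2 * R w.1) ^ m₁.toNat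
          * bracket x ^ m₂ := by gcongr
      _ = _ := by rw [pow_add, mul_pow D₁]; ring
  · exact hw.aestronglyMeasurable
  · have : Continuous fun w : RSpace d × ℝ => C₁ * D₁ ^ l * rfac μ l * (2 * R w.1) ^ m₁.toNat := by
      fun_prop
    exact this.aestronglyMeasurable
  · exact (hRc.comp continuous_fst).aestronglyMeasurable
  · refine Eventually.of_forall fun w => ?_
    have p4 := hR1 w.1
    constructor <;> positivity
  · refine (ae_restrict_iff' hmS).2 (Eventually.of_forall fun w hwm s hs => ?_)
    have p4 := hR1 w.1
    have h3 : |w.2| ≤ R w.1 := hwm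
    have e1 : 1 + w.2 ^ 2 ≤ 2 * R w.1 ^ 2 := by
      have := sq_le_sq' (by linarith [abs_nonneg w.2]) (h3)
      rw [sq_abs] at this
      nlinarith
    -- The powers of R pay for the order of the symbol, for s derivatives, and, with the last two,
    -- for the weight 1 + t² ≤ 2R².
    have e2 := hmom k r S (m₁.toNat + s + 2) (by omega) w.1 w.2 (by simp)
    set X := ‖hatC (moment k u r) (snocC w.1 (w.2 : ℂ))‖ with hX
    have e3 : rfac μ l ≤ rfac θ l := rfac_le_rfac (by linarith) l
    have q1 := rfac_pos θ S
    have q2 := rfac_pos θ r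
    have q3 := rfac_pos θ l
    have q4 := bracket_pos w.1
    unfold freqWeight
    rw [← mul_assoc (gevrey _ _ _ _ _ _), ← div_eq_mul_inv _ (1 + w.2 ^ 2),
      le_div_iff₀ (by positivity)]
    calc X * (C₁ * D₁ ^ l * rfac μ l * (2 * R w.1) ^ m₁.toNat) * R w.1 ^ s * (1 + w.2 ^ 2)
        ≤ X * (C₁ * D₁ ^ l * rfac θ l * (2 * R w.1) ^ m₁.toNat) * R w.1 ^ s *
          (2 * R w.1 ^ 2) := by gcongr
      _ = 2 ^ (m₁.toNat + 1) * C₁ * (D₁ ^ l * rfac θ l) * (R w.1 ^ (m₁.toNat + s + 2) * X) := by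
          rw [mul_pow]; ring
      _ ≤ 2 ^ (m₁.toNat + 1) * C₁ * (D₁ ^ l * rfac θ l) *
          (K * A ^ (S + r) * rfac θ S * rfac θ r * (bracket w.1 ^ (d + 1))⁻¹) := by gcongr
      _ = 2 ^ (m₁.toNat + 1) * C₁ * K * (1 ^ l * A ^ (S + r)) * (1 ^ (S + r) * D₁ ^ l) *
          (rfac θ S * rfac θ l * rfac θ r) * (bracket w.1 ^ (d + 1))⁻¹ := by
          rw [one_pow, one_pow]; ring
      _ ≤ 2 ^ (m₁.toNat + 1) * C₁ * (K + 1) * (A ^ l * A ^ (S + r)) * (D₁ ^ (S + r) * D₁ ^ l) *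
          (rfac θ S * rfac θ l * rfac θ r) * (bracket w.1 ^ (d + 1))⁻¹ := by
          gcongr
          linarith
      _ = _ := by unfold gevrey; rw [mul_pow]; ring

end

end SGHalfSpace

end


noncomputable section

namespace SGHalfSpace

open MeasureTheory Filter Topology

/-! ### The remainder outside the contour -/

namespace IsRatExpansion

variable {d : ℕ} {μ ν θ : ℝ} {m₁ : ℤ} {m₂ : ℝ} {a : RSpace (d + 1) → RSpace (d + 1) → ℂ}
  {p q : ℕ → RSpace (d + 1) → MvPolynomial (Fin (d + 1)) ℂ} {C D B r₀ : ℝ}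
  {u : RSpace (d + 1) → ℂ}

theorem continuousAt_real (h : IsRatExpansion μ ν m₁ m₂ a p q C D B r₀) (k : Fin (d + 1))
    (l j : ℕ) {w : (RSpace d × ℝ) × RSpace (d + 1)} (hw : B ≤ |w.1.2|) :
    ContinuousAt (fun w : (RSpace d × ℝ) × RSpace (d + 1) =>
      symIter k l (fun y η => ratFun (p j) (q j) y (toC η)) w.2 (snocR w.1.1 w.1.2)) w := by
  have h1 := (h.contDiffAt_real k l j w.2 (ξ := snocR w.1.1 w.1.2) (by simpa using hw)).continuousAt
  exact h1.comp (f := fun w : (RSpace d × ℝ) × RSpace (d + 1) => (w.2, snocR w.1.1 w.1.2))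
    (continuous_snd.prodMk (continuous_snocR.comp continuous_fst)).continuousAt

theorem continuousAt_rem (h : IsRatExpansion μ ν m₁ m₂ a p q C D B r₀)
    (ha : IsSGSymbol μ ν m₁ m₂ a) (k : Fin (d + 1)) (l M : ℕ)
    {w : (RSpace d × ℝ) × RSpace (d + 1)} (hw : B ≤ |w.1.2|) :
    ContinuousAt (fun w : (RSpace d × ℝ) × RSpace (d + 1) =>
      h.rem k l M w.2 (snocR w.1.1 w.1.2)) w := by
  have h1 : Continuous (fun w : (RSpace d × ℝ) × RSpace (d + 1) =>
      symIter k l a w.2 (snocR w.1.1 w.1.2)) :=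
    (ha.contDiff_symIter k l).continuous.comp
      (f := fun w : (RSpace d × ℝ) × RSpace (d + 1) => (w.2, snocR w.1.1 w.1.2))
      (continuous_snd.prodMk (continuous_snocR.comp continuous_fst))
  exact h1.continuousAt.sub
    (tendsto_finsetSum _ fun j _ => h.continuousAt_real k l j hw)

theorem le_abs_of_mem_outsideSet (h : IsRatExpansion μ ν m₁ m₂ a p q C D B r₀) {τ : ℝ}
    (hτ : 0 ≤ τ) {M : ℕ} {w : RSpace d × ℝ} (hw : w ∈ outsideSet (radius B τ M)) :
    B * bracket w.1 < |w.2| := by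
  have h1 := mul_bracket_lt_radius (M := M) h.hB.le hτ w.1
  have h2 : radius B τ M w.1 < |w.2| := hw
  nlinarith [h.hB, bracket_pos w.1, mul_pos h.hB (bracket_pos w.1)]

theorem B_le_abs_of_mem_outsideSet (h : IsRatExpansion μ ν m₁ m₂ a p q C D B r₀) {τ : ℝ}
    (hτ : 0 ≤ τ) {M : ℕ} {w : RSpace d × ℝ} (hw : w ∈ outsideSet (radius B τ M)) :
    B ≤ |w.2| := by
  have h1 := h.le_abs_of_mem_outsideSet hτ hw
  nlinarith [h.hB, bracket_ge_one w.1]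

set_option maxHeartbeats 1000000 in
-- Subtracting S + M₀ terms leaves a symbol so small in ξ that S derivatives still give an
-- integrable function. Here the transform is merely bounded; all decay, also in ξ', comes from the
-- remainder.
theorem exists_oscData_rem (h : IsRatExpansion μ ν m₁ m₂ a p q C D B r₀) (hμ : 1 ≤ μ) (hν : 1 ≤ ν)
    (hθ : μ + ν - 1 ≤ θ)
    (ha : IsSGSymbol μ ν m₁ m₂ a) (hu : IsGelfandShilov θ θ (lowerHalf d) u) {M₀ : ℕ}
    (hM₀ : m₁.toNat + d + 3 ≤ M₀) :
    ∃ K A Q : ℝ, 0 < K ∧ 1 ≤ A ∧ 0 ≤ Q ∧ ∀ (k : Fin (d + 1)) (l r S : ℕ), ∃ G Z,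
      OscData (volume.restrict (outsideSet (radius B (μ + ν - 1) (S + M₀)))) Set.univ m₂ S
        (fun w => snocC w.1 (w.2 : ℂ)) (fun w x => h.rem k l (S + M₀) x (snocR w.1 w.2))
        (fun w => hatC (moment k u r) (snocC w.1 (w.2 : ℂ))) freqWeight Q
        (gevrey K A θ S l r) G Z := by
  set τ := μ + ν - 1 with hτ
  have hτ0 : 0 ≤ τ := by linarith
  have hB := h.hB.le
  have hC := h.hC
  have hD : 1 ≤ D + 1 := by linarith [h.hD]
  obtain ⟨K₁, A₁, hK₁, hA₁, h₁⟩ := hu.exists_hatC_moment_le (by linarith)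
  obtain ⟨K₂, A₂, hK₂, hA₂, h₂⟩ := rfac_add_const_le (θ := θ) (by linarith) M₀
  refine ⟨(D + 1) ^ (2 * M₀) * C * (K₁ + 1) * rfac θ 0 * K₂, (D + 1) ^ 2 * A₁ * A₂, D + 1,
    ?_, ?_, by positivity, fun k l r S => ?_⟩
  · have := rfac_pos θ 0
    positivity
  · exact one_le_mul_of_one_le_of_one_le
      (one_le_mul_of_one_le_of_one_le (one_le_pow₀ hD) hA₁) hA₂
  set R := radius (d := d) B τ (S + M₀) with hR
  have hRc : Continuous R := continuous_radius
  have hf := hu.lowerSupported_moment (by linarith) k r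
  have hw := hf.continuous_hatC_real
  have hmS : MeasurableSet (outsideSet R) := (isOpen_outsideSet hRc).measurableSet
  -- Outside the contour ⟨ξ⟩ exceeds the threshold. This activates condition 3 and absorbs v!^ν into
  -- ⟨ξ⟩^v.
  have hlarge : ∀ w ∈ outsideSet R, threshold B τ (S + M₀) ≤ bracket (snocR w.1 w.2) :=
    fun w hwm => (threshold_le_radius hB hτ0 w.1).trans
      ((le_of_lt hwm).trans (abs_le_bracket_snocR w.1 w.2))
  refine ⟨fun w => C * (D + 1) ^ (l + 2 * (S + M₀)) * rfac μ l * rfac τ (S + M₀) *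
    bracket (snocR w.1 w.2) ^ (m₁ - (S + M₀ : ℕ) - l), fun w => bracket (snocR w.1 w.2), ?_⟩
  have pl := rfac_pos μ l
  have pM := rfac_pos τ (S + M₀)
  have hbc : Continuous fun w : RSpace d × ℝ => bracket (snocR w.1 w.2) :=
    continuous_bracket.comp continuous_snocR
  constructor
  · intro x
    have c1 : ContinuousOn (fun w : RSpace d × ℝ => h.rem k l (S + M₀) x (snocR w.1 w.2))
        (outsideSet R) := fun w hwm => by
      have := h.continuousAt_rem ha k l (S + M₀) (w := (w, x))
        (h.B_le_abs_of_mem_outsideSet hτ0 hwm)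
      exact (this.comp (f := fun w : RSpace d × ℝ => (w, x))
        (Continuous.prodMk_left x).continuousAt).continuousWithinAt
    have c2 : Continuous fun w : RSpace d × ℝ =>
        Complex.exp (Complex.I * cdot x (snocC w.1 (w.2 : ℂ))) :=
      continuous_cexp_cdot_real.comp (Continuous.prodMk_left x)
    exact ((c2.continuousOn.mul c1).mul hw.continuousOn).aestronglyMeasurable hmS
  · exact Eventually.of_forall fun w x _ => (norm_cexp_cdot_real x w.1 w.2).le
  · refine (ae_restrict_iff' hmS).2 (Eventually.of_forall fun w hwm => ?_)
    exact h.contDiff_rem_left ha k l _ (by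
      simpa using h.B_le_abs_of_mem_outsideSet hτ0 hwm)
  · refine Eventually.of_forall fun w i => ?_
    refine norm_snocC_apply_le (bracket_le_bracket_snocR w.1 w.2) ?_ i
    rw [Complex.norm_real]
    exact abs_le_bracket_snocR w.1 w.2
  · refine (ae_restrict_iff' hmS).2 (Eventually.of_forall fun w hwm V hV x _ => ?_)
    have hl := hlarge w hwm
    refine (h.wderiv_rem_le ha (by linarith) k l (S + M₀) V x w.1
      (h.le_abs_of_mem_outsideSet hτ0 hwm).le
      ((mul_pow_le_threshold hB hτ0).trans hl)).trans ?_
    have e3 : rfac ν V.length ≤ bracket (snocR w.1 w.2) ^ V.length :=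
      rfac_le_pow (M := S + M₀) (by linarith)
        ((pow_le_threshold hB (by linarith) (by linarith)).trans hl) (by omega)
    have p1 := rfac_pos ν V.length
    have p2 := Real.rpow_pos_of_pos (bracket_pos x) m₂
    have p3 := zpow_pos (bracket_pos (snocR w.1 w.2)) (m₁ - (S + M₀ : ℕ) - l)
    calc _ ≤ C * (D + 1) ^ (l + V.length + 2 * (S + M₀)) * rfac μ l *
          bracket (snocR w.1 w.2) ^ V.length * rfac τ (S + M₀) * bracket x ^ m₂ *
            bracket (snocR w.1 w.2) ^ (m₁ - (S + M₀ : ℕ) - l) := by gcongr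
      _ = _ := by rw [mul_pow (D + 1)]; ring
  · exact hw.aestronglyMeasurable
  · have : Continuous fun w : RSpace d × ℝ => C * (D + 1) ^ (l + 2 * (S + M₀)) * rfac μ l *
        rfac τ (S + M₀) * bracket (snocR w.1 w.2) ^ (m₁ - (S + M₀ : ℕ) - l) :=
      continuous_const.mul (hbc.zpow₀ _ fun w => Or.inl (bracket_pos _).ne')
    exact this.aestronglyMeasurable
  · exact hbc.aestronglyMeasurable
  · refine Eventually.of_forall fun w => ?_
    have p3 := bracket_pos (snocR w.1 w.2)
    constructor <;> positivity
  · refine Eventually.of_forall fun w s hs => ?_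
    have e0 := bracket_ge_one (snocR w.1 w.2)
    have e2 := h₁ k r 0 w.1 w.2 (by simp)
    set X := ‖hatC (moment k u r) (snocC w.1 (w.2 : ℂ))‖ with hX
    set b := bracket (snocR w.1 w.2) with hb
    have hb0 : 0 < b := by linarith
    -- M₀ was chosen for this: after S derivatives at least d + 3 powers of decay remain, d + 1 for
    -- ξ' and 2 for t.
    have e1 : b ^ (m₁ - (S + M₀ : ℕ) - l) * b ^ s ≤ freqWeight w := by
      rw [← zpow_natCast b s, ← zpow_add₀ hb0.ne']
      have k1 : b ^ (m₁ - (S + M₀ : ℕ) - l + s) ≤ b ^ (-((d + 1 + 2 : ℕ) : ℤ)) :=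
        zpow_le_zpow_right₀ e0 (by
          have := Int.self_le_toNat m₁
          push_cast
          omega)
      refine k1.trans ?_
      rw [zpow_neg, zpow_natCast, pow_add, mul_inv]
      have k2 := bracket_le_bracket_snocR w.1 w.2
      have k3 := bracket_pos w.1
      unfold freqWeight
      gcongr
      rw [hb, bracket_snocR_sq]
      have := bracket_ge_one w.1
      nlinarith
    have e3 : rfac μ l ≤ rfac θ l := rfac_le_rfac (by linarith) l
    have e4 : rfac τ (S + M₀) ≤ K₂ * A₂ ^ S * rfac θ S :=
      (rfac_le_rfac hθ _).trans (h₂ S)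
    have e5 : 0 ≤ freqWeight w := by unfold freqWeight; have := bracket_pos w.1; positivity
    rw [pow_zero, one_mul, add_zero] at e2
    have q1 := rfac_pos θ S
    have q2 := rfac_pos θ r
    have q3 := rfac_pos θ l
    have q4 := rfac_pos θ 0
    calc X * (C * (D + 1) ^ (l + 2 * (S + M₀)) * rfac μ l * rfac τ (S + M₀) *
          b ^ (m₁ - (S + M₀ : ℕ) - l)) * b ^ s
        = X * (C * (D + 1) ^ (l + 2 * (S + M₀)) * rfac μ l * rfac τ (S + M₀)) *
          (b ^ (m₁ - (S + M₀ : ℕ) - l) * b ^ s) := by ring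
      _ ≤ (K₁ * A₁ ^ r * rfac θ r * rfac θ 0) * (C * (D + 1) ^ (l + 2 * (S + M₀)) * rfac θ l *
          (K₂ * A₂ ^ S * rfac θ S)) * freqWeight w := by gcongr
      _ = (D + 1) ^ (2 * M₀) * C * K₁ * rfac θ 0 * K₂ * ((D + 1) ^ (2 * S + l) *
          (1 ^ (S + l) * A₁ ^ r) * (1 ^ (l + r) * A₂ ^ S)) *
          (rfac θ S * rfac θ l * rfac θ r) * freqWeight w := by
          rw [one_pow, one_pow]; ring
      _ ≤ (D + 1) ^ (2 * M₀) * C * (K₁ + 1) * rfac θ 0 * K₂ * ((D + 1) ^ (2 * (S + l + r)) *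
          (A₁ ^ (S + l) * A₁ ^ r) * (A₂ ^ (l + r) * A₂ ^ S)) *
          (rfac θ S * rfac θ l * rfac θ r) * freqWeight w := by
          gcongr
          · linarith
          · omega
      _ = _ := by unfold gevrey; rw [mul_pow, mul_pow, ← pow_mul]; ring

end IsRatExpansion

end SGHalfSpace

end


noncomputable section

namespace SGHalfSpace

open MeasureTheory Filter Topology

/-! ### The terms of the expansion on the contour -/

/-- The measure in `(ξ', σ, s)`, where `σ` parametrizes a circle and `s` a semicircle. -/
def arcMeasure (d : ℕ) : Measure (RSpace d × (ℝ × ℝ)) :=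
  volume.prod ((volume.restrict (Set.Ioc 0 (2 * Real.pi))).prod
    (volume.restrict (Set.Ioc 0 Real.pi)))

/-- The point of the semicircle of radius `R`. -/
def arcPt (R s : ℝ) : ℂ := R * Complex.exp (Complex.I * s)

theorem norm_arcPt {R : ℝ} (hR : 0 ≤ R) (s : ℝ) : ‖arcPt R s‖ = R := by
  unfold arcPt
  rw [norm_mul, mul_comm Complex.I, Complex.norm_exp_ofReal_mul_I, mul_one, Complex.norm_real,
    Real.norm_of_nonneg hR]

theorem arcPt_im (R s : ℝ) : (arcPt R s).im = R * Real.sin s := by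
  unfold arcPt
  rw [mul_comm Complex.I, Complex.im_ofReal_mul, Complex.exp_ofReal_mul_I_im]

theorem arcPt_im_nonneg {R : ℝ} (hR : 0 ≤ R) {s : ℝ} (hs : s ∈ Set.Ioc 0 Real.pi) :
    0 ≤ (arcPt R s).im := by
  rw [arcPt_im]
  exact mul_nonneg hR (Real.sin_nonneg_of_nonneg_of_le_pi hs.1.le hs.2)

theorem continuous_arcPt : Continuous (fun w : ℝ × ℝ => arcPt w.1 w.2) := by
  unfold arcPt
  fun_prop

theorem ae_arcMeasure (d : ℕ) :
    ∀ᵐ w ∂(arcMeasure d), w.2.2 ∈ Set.Ioc 0 Real.pi := by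
  have h1 : ∀ᵐ s ∂(volume.restrict (Set.Ioc 0 Real.pi)), s ∈ Set.Ioc 0 Real.pi :=
    ae_restrict_mem measurableSet_Ioc
  have h2 : ∀ᵐ v ∂((volume.restrict (Set.Ioc 0 (2 * Real.pi))).prod
    (volume.restrict (Set.Ioc 0 Real.pi))), v.2 ∈ Set.Ioc 0 Real.pi :=
    Measure.quasiMeasurePreserving_snd.ae h1
  exact Measure.quasiMeasurePreserving_snd.ae h2

/-- The dominating function in `(ξ', σ, s)`. -/
def arcWeight {d : ℕ} (w : RSpace d × (ℝ × ℝ)) : ℝ := (bracket w.1 ^ (d + 1))⁻¹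

theorem integrable_arcWeight (d : ℕ) : Integrable (arcWeight (d := d)) (arcMeasure d) :=
  (integrable_inv_bracket_pow d).comp_fst _

/-- The weight of the oscillatory integrals over `(ξ', σ, s)`. -/
def arcKernel {d : ℕ} (B : ℝ) (R : RSpace d → ℝ) (m : ℤ) (f : RSpace (d + 1) → ℂ)
    (w : RSpace d × (ℝ × ℝ)) : ℂ :=
  hatC f (snocC w.1 (arcPt (R w.1) w.2.2)) *
    (kern m (arcPt (R w.1) w.2.2) (circlePt B w.1 w.2.1) *
      (Complex.I * arcPt (R w.1) w.2.2))

section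

variable {d : ℕ} {R : RSpace d → ℝ}

theorem continuous_arcPt_comp (hR : Continuous R) :
    Continuous (fun w : RSpace d × (ℝ × ℝ) => arcPt (R w.1) w.2.2) :=
  continuous_arcPt.comp (f := fun w : RSpace d × (ℝ × ℝ) => (R w.1, w.2.2)) (by fun_prop)

theorem continuous_snocC_arcPt (hR : Continuous R) :
    Continuous (fun w : RSpace d × (ℝ × ℝ) => snocC w.1 (arcPt (R w.1) w.2.2)) :=
  continuous_snocC.comp (continuous_fst.prodMk (continuous_arcPt_comp hR))

theorem continuous_kern_arcPt {B : ℝ} (hB : 0 < B) (hR : Continuous R)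
    (hRB : ∀ ξ', 2 * (B * bracket ξ') < R ξ') (m : ℤ) :
    Continuous (fun w : RSpace d × (ℝ × ℝ) =>
      kern m (arcPt (R w.1) w.2.2) (circlePt B w.1 w.2.1)) := by
  have hz := continuous_arcPt_comp hR
  have hω : Continuous (fun w : RSpace d × (ℝ × ℝ) => circlePt B w.1 w.2.1) :=
    (continuous_circlePt B).comp (f := fun w : RSpace d × (ℝ × ℝ) => (w.1, w.2.1)) (by fun_prop)
  have hpos : ∀ ξ' : RSpace d, 0 < B * bracket ξ' := fun ξ' => mul_pos hB (bracket_pos ξ')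
  have hωn : ∀ w : RSpace d × (ℝ × ℝ), ‖circlePt B w.1 w.2.1‖ = B * bracket w.1 :=
    fun w => norm_circlePt hB.le _ _
  have hzn : ∀ w : RSpace d × (ℝ × ℝ), ‖arcPt (R w.1) w.2.2‖ = R w.1 :=
    fun w => norm_arcPt (by linarith [hRB w.1, hpos w.1]) _
  have hω0 : ∀ w : RSpace d × (ℝ × ℝ), circlePt B w.1 w.2.1 ≠ 0 := fun w => by
    rw [← norm_pos_iff, hωn]; exact hpos w.1
  have hz0 : ∀ w : RSpace d × (ℝ × ℝ), arcPt (R w.1) w.2.2 ≠ 0 := fun w => by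
    rw [← norm_pos_iff, hzn]; linarith [hRB w.1, hpos w.1]
  have hne : ∀ w : RSpace d × (ℝ × ℝ), arcPt (R w.1) w.2.2 - circlePt B w.1 w.2.1 ≠ 0 :=
    fun w h0 => by
      have := hzn w
      rw [sub_eq_zero.1 h0, hωn] at this
      linarith [hRB w.1, hpos w.1]
  unfold kern
  exact (((hz.div hω hω0).zpow₀ m fun w => Or.inl (div_ne_zero (hz0 w) (hω0 w))).mul
    (hω.div (hz.sub hω) hne)).div_const _

theorem aestronglyMeasurable_arcKernel {B : ℝ} (hB : 0 < B) (hR : Continuous R)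
    (hRB : ∀ ξ', 2 * (B * bracket ξ') < R ξ') (m : ℤ) {f : RSpace (d + 1) → ℂ}
    (hf : LowerSupported f) :
    AEStronglyMeasurable (arcKernel B R m f) (arcMeasure d) := by
  have hz := continuous_arcPt_comp hR
  have hpos : ∀ ξ' : RSpace d, 0 < B * bracket ξ' := fun ξ' => mul_pos hB (bracket_pos ξ')
  have h1 : AEStronglyMeasurable (fun w : RSpace d × (ℝ × ℝ) =>
      hatC f (snocC w.1 (arcPt (R w.1) w.2.2))) (arcMeasure d) := by
    have hE : IsClosed {w : RSpace d × (ℝ × ℝ) | 0 ≤ (arcPt (R w.1) w.2.2).im} :=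
      isClosed_le continuous_const (Complex.continuous_im.comp hz)
    have hres : (arcMeasure d).restrict {w : RSpace d × (ℝ × ℝ) |
        0 ≤ (arcPt (R w.1) w.2.2).im} = arcMeasure d :=
      Measure.restrict_eq_self_of_ae_mem (by
        filter_upwards [ae_arcMeasure d] with w hw
        exact arcPt_im_nonneg (by linarith [hRB w.1, hpos w.1]) hw)
    have hcont : ContinuousOn (fun w : RSpace d × (ℝ × ℝ) =>
        hatC f (snocC w.1 (arcPt (R w.1) w.2.2)))
        {w : RSpace d × (ℝ × ℝ) | 0 ≤ (arcPt (R w.1) w.2.2).im} :=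
      ContinuousOn.comp (g := fun p : RSpace d × ℂ => hatC f (snocC p.1 p.2))
        (f := fun w : RSpace d × (ℝ × ℝ) => (w.1, arcPt (R w.1) w.2.2))
        (t := {p | 0 ≤ p.2.im}) hf.continuousOn_hatC (continuous_fst.prodMk hz).continuousOn
        fun w hw => hw
    have hm := hcont.aestronglyMeasurable (μ := arcMeasure d) hE.measurableSet
    rwa [hres] at hm
  exact h1.mul ((continuous_kern_arcPt hB hR hRB m).mul
    (continuous_const.mul hz)).aestronglyMeasurable

end

theorem div_zpow_le {R B : ℝ} (hR : 1 ≤ R) (hB : 0 < B) (m₁ : ℤ) (j l : ℕ) :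
    (R / B) ^ (m₁ - j - l) ≤ B ^ (-m₁) * (B + 1) ^ (j + l) * R ^ m₁.toNat * (R ^ j)⁻¹ := by
  have hR0 : 0 < R := by linarith
  have e1 : (R / B) ^ (m₁ - j - l) = B ^ (-m₁) * B ^ (j + l) * R ^ (m₁ - l) * (R ^ j)⁻¹ := by
    rw [div_zpow, div_eq_mul_inv, ← zpow_neg, show m₁ - (j : ℤ) - l = (m₁ - l) + -(j : ℤ) by ring,
      show -(m₁ - (l : ℤ) + -(j : ℤ)) = -m₁ + ((j + l : ℕ) : ℤ) by push_cast; ring,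
      zpow_add₀ hR0.ne', zpow_add₀ hB.ne', zpow_neg R, zpow_natCast, zpow_natCast]
    ring
  have e2 : R ^ (m₁ - (l : ℤ)) ≤ R ^ m₁.toNat := by
    rw [← zpow_natCast R]
    refine zpow_le_zpow_right₀ hR ?_
    have := Int.self_le_toNat m₁
    omega
  rw [e1]
  have := zpow_pos hB (-m₁)
  have := zpow_pos hR0 (m₁ - (l : ℤ))
  gcongr
  linarith

namespace IsRatExpansion

variable {d : ℕ} {μ ν θ : ℝ} {m₁ : ℤ} {m₂ : ℝ} {a : RSpace (d + 1) → RSpace (d + 1) → ℂ}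
  {p q : ℕ → RSpace (d + 1) → MvPolynomial (Fin (d + 1)) ℂ} {C D B r₀ : ℝ}
  {u : RSpace (d + 1) → ℂ}

set_option maxHeartbeats 1000000 in
-- The kernel contributes (R/(B⟨ξ'⟩))^{m₁-j-l} and the values on the circle contribute
-- ⟨ξ'⟩^{m₁-j-l}. The powers of ⟨ξ'⟩ cancel and (R/B)^{m₁-j-l} remains. Its factor R^{-j}
-- compensates j!^ν because j < M and R ≥ M^ν, so the number of terms may grow with S.
theorem exists_oscData_arc (h : IsRatExpansion μ ν m₁ m₂ a p q C D B r₀) (hμ : 1 ≤ μ) (hν : 1 ≤ ν)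
    (hθ : μ + ν - 1 ≤ θ) (hu : IsGelfandShilov θ θ (lowerHalf d) u) (M₀ : ℕ) :
    ∃ K A Q : ℝ, 0 < K ∧ 1 ≤ A ∧ 0 ≤ Q ∧ ∀ (k : Fin (d + 1)) (l r S j : ℕ), j < S + M₀ → ∃ G Z,
      OscData (arcMeasure d) (upperHalf d) m₂ S
        (fun w => snocC w.1 (arcPt (radius B (μ + ν - 1) (S + M₀) w.1) w.2.2))
        (fun w x => circ k l B (p j) (q j) w.1 w.2.1 x)
        (arcKernel B (radius B (μ + ν - 1) (S + M₀)) (m₁ - j - l + 1) (moment k u r)) arcWeight Q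
        (gevrey K A θ S l r) G Z := by
  set τ := μ + ν - 1 with hτ
  have hτ0 : 0 ≤ τ := by linarith
  have hB0 := h.hB
  have hB := hB0.le
  have hC := h.hC
  have hD : 1 ≤ D + 1 := by linarith [h.hD]
  have hB1 : 1 ≤ B + 1 := by linarith
  obtain ⟨K₁, A₁, hK₁, hA₁, hmom⟩ := hu.exists_radius_pow_mul_hatC_le (B := B) (τ := τ)
    (by linarith) hB hτ0 hθ M₀ (m₁.toNat + 2)
  have hBm := zpow_pos hB0 (-m₁)
  refine ⟨(D + 1) ^ (2 * M₀) * C * (K₁ + 1) * B ^ (-m₁) * (B + 1) ^ M₀,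
    (D + 1) ^ 2 * (B + 1) * A₁, D + 1, by positivity, ?_, by positivity, fun k l r S j hj => ?_⟩
  · exact one_le_mul_of_one_le_of_one_le
      (one_le_mul_of_one_le_of_one_le (one_le_pow₀ hD) hB1) hA₁
  set R := radius (d := d) B τ (S + M₀) with hR
  have hRc : Continuous R := continuous_radius
  have hR1 : ∀ ξ', 1 ≤ R ξ' := fun ξ' => one_le_radius hB hτ0 ξ'
  have hRB : ∀ ξ', 2 * (B * bracket ξ') < R ξ' := fun ξ' => mul_bracket_lt_radius hB hτ0 ξ'
  have hf := hu.lowerSupported_moment (by linarith) k r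
  have hzc := continuous_arcPt_comp hRc
  have hζc := continuous_snocC_arcPt hRc
  have hK := aestronglyMeasurable_arcKernel hB0 hRc hRB (m₁ - j - l + 1) hf
  have pj := rfac_pos ν j
  have hl : (l.factorial : ℝ) ≤ rfac θ l :=
    Real.self_le_rpow_of_one_le (one_le_factorial l) (by linarith)
  refine ⟨fun w => C * (D + 1) ^ (l + 2 * j) * rfac ν j * l.factorial *
    bracket w.1 ^ (m₁ - j - l), fun w => R w.1, ?_⟩
  constructor
  · intro x
    have c1 : Continuous fun w : RSpace d × (ℝ × ℝ) => circ k l B (p j) (q j) w.1 w.2.1 x :=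
      (h.continuous_circ k l j).comp
        (f := fun w : RSpace d × (ℝ × ℝ) => ((w.1, w.2.1), x)) (by fun_prop)
    have c2 : Continuous fun w : RSpace d × (ℝ × ℝ) =>
        Complex.exp (Complex.I * cdot x (snocC w.1 (arcPt (R w.1) w.2.2))) :=
      (continuous_const.mul (continuous_cdot.comp (continuous_const.prodMk hζc))).cexp
    exact (c2.mul c1).aestronglyMeasurable.mul hK
  · filter_upwards [ae_arcMeasure d] with w hw x hx
    exact norm_cexp_cdot_le (le_of_lt hx) w.1 (arcPt_im_nonneg (by linarith [hR1 w.1]) hw)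
  · exact Eventually.of_forall fun w => h.contDiff_circ k l j _ _
  · refine Eventually.of_forall fun w i => ?_
    refine norm_snocC_apply_le (bracket_le_radius hB hτ0 w.1) ?_ i
    exact (norm_arcPt (by linarith [hR1 w.1]) _).le
  · refine Eventually.of_forall fun w V hV x _ => ?_
    refine (h.wderiv_circ_le (by linarith) k l j w.1 w.2.1 V x).trans ?_
    have e3 : rfac ν V.length ≤ R w.1 ^ V.length :=
      rfac_le_radius_pow hB (by linarith) (by linarith) w.1 (by omega)
    have p1 := rfac_pos ν V.length
    have p2 := Real.rpow_pos_of_pos (bracket_pos x) m₂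
    have p3 := zpow_pos (bracket_pos w.1) (m₁ - j - l)
    calc _ ≤ C * (D + 1) ^ (l + V.length + 2 * j) * (rfac ν j * R w.1 ^ V.length) *
          l.factorial * bracket x ^ m₂ * bracket w.1 ^ (m₁ - j - l) := by gcongr
      _ = _ := by rw [mul_pow (D + 1)]; ring
  · exact hK
  · have : Continuous fun w : RSpace d × (ℝ × ℝ) => C * (D + 1) ^ (l + 2 * j) * rfac ν j *
        l.factorial * bracket w.1 ^ (m₁ - j - l) :=
      continuous_const.mul ((continuous_bracket.comp continuous_fst).zpow₀ _
        fun w => Or.inl (bracket_pos _).ne')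
    exact this.aestronglyMeasurable
  · exact (hRc.comp continuous_fst).aestronglyMeasurable
  · refine Eventually.of_forall fun w => ?_
    have p3 := zpow_pos (bracket_pos w.1) (m₁ - j - l)
    have p4 := hR1 w.1
    constructor <;> positivity
  · filter_upwards [ae_arcMeasure d] with w hw s hs
    have p4 := hR1 w.1
    have hbr := bracket_pos w.1
    have hzn := norm_arcPt (R := R w.1) (by linarith) w.2.2
    have hωn := norm_circlePt hB w.1 w.2.1
    -- The power of R beyond the order and the s derivatives is the length element iz ds of the arc.
    have e2 := hmom k r S (m₁.toNat + 1 + s) (by omega) w.1 (arcPt (R w.1) w.2.2)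
      (arcPt_im_nonneg (by linarith) hw)
    rw [← hR] at e2
    unfold arcKernel arcWeight
    rw [norm_mul, norm_mul, norm_mul, Complex.norm_I, one_mul, hzn]
    set X := ‖hatC (moment k u r) (snocC w.1 (arcPt (R w.1) w.2.2))‖ with hX
    have hX0 : 0 ≤ X := norm_nonneg _
    set κ := ‖kern (m₁ - j - l + 1) (arcPt (R w.1) w.2.2) (circlePt B w.1 w.2.1)‖ with hκ
    have hκb : κ * bracket w.1 ^ (m₁ - j - l) ≤
        B ^ (-m₁) * (B + 1) ^ (j + l) * R w.1 ^ m₁.toNat * (R w.1 ^ j)⁻¹ := by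
      refine le_trans ?_ (div_zpow_le p4 hB0 m₁ j l)
      have k1 : κ ≤ (R w.1 / (B * bracket w.1)) ^ (m₁ - j - l) := by
        have := norm_kern_le (m := m₁ - j - l + 1) (z := arcPt (R w.1) w.2.2)
          (w := circlePt B w.1 w.2.1) (by
            rw [← norm_pos_iff, hωn]; positivity) (by rw [hωn, hzn]; exact (hRB w.1).le)
        rwa [hzn, hωn, add_sub_cancel_right] at this
      have p3 := zpow_pos hbr (m₁ - j - l)
      calc _ ≤ (R w.1 / (B * bracket w.1)) ^ (m₁ - j - l) * bracket w.1 ^ (m₁ - j - l) := by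
            gcongr
        _ = _ := by
            rw [← mul_zpow]
            congr 1
            field_simp
    have e3 : rfac ν j * (R w.1 ^ j)⁻¹ ≤ 1 := by
      rw [← div_eq_mul_inv, div_le_one (by positivity)]
      exact rfac_le_radius_pow hB (by linarith) (by linarith) w.1 hj.le
    have q1 := rfac_pos θ S
    have q2 := rfac_pos θ r
    have q3 := rfac_pos θ l
    calc X * (κ * R w.1) * (C * (D + 1) ^ (l + 2 * j) * rfac ν j * l.factorial *
          bracket w.1 ^ (m₁ - j - l)) * R w.1 ^ s
        = X * R w.1 ^ (s + 1) * (C * (D + 1) ^ (l + 2 * j) * l.factorial) * rfac ν j *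
          (κ * bracket w.1 ^ (m₁ - j - l)) := by ring
      _ ≤ X * R w.1 ^ (s + 1) * (C * (D + 1) ^ (l + 2 * j) * rfac θ l) * rfac ν j *
          (B ^ (-m₁) * (B + 1) ^ (j + l) * R w.1 ^ m₁.toNat * (R w.1 ^ j)⁻¹) := by gcongr
      _ = (R w.1 ^ (m₁.toNat + 1 + s) * X) * (C * (D + 1) ^ (l + 2 * j) * rfac θ l) *
          (B ^ (-m₁) * (B + 1) ^ (j + l)) * (rfac ν j * (R w.1 ^ j)⁻¹) := by ring
      _ ≤ (K₁ * A₁ ^ (S + r) * rfac θ S * rfac θ r * (bracket w.1 ^ (d + 1))⁻¹) *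
          (C * (D + 1) ^ (l + 2 * j) * rfac θ l) *
          (B ^ (-m₁) * (B + 1) ^ (j + l)) * 1 := by gcongr
      _ = C * K₁ * B ^ (-m₁) * ((D + 1) ^ (l + 2 * j) * (B + 1) ^ (j + l) * A₁ ^ (S + r)) *
          (rfac θ S * rfac θ l * rfac θ r) * (bracket w.1 ^ (d + 1))⁻¹ := by ring
      _ ≤ C * (K₁ + 1) * B ^ (-m₁) * ((D + 1) ^ (2 * (S + l + r) + 2 * M₀) *
          (B + 1) ^ ((S + l + r) + M₀) * A₁ ^ (S + l + r)) *
          (rfac θ S * rfac θ l * rfac θ r) * (bracket w.1 ^ (d + 1))⁻¹ := by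
          have f1 : (D + 1) ^ (l + 2 * j) ≤ (D + 1) ^ (2 * (S + l + r) + 2 * M₀) :=
            pow_le_pow_right₀ hD (by omega)
          have f2 : (B + 1) ^ (j + l) ≤ (B + 1) ^ ((S + l + r) + M₀) :=
            pow_le_pow_right₀ hB1 (by omega)
          have f3 : A₁ ^ (S + r) ≤ A₁ ^ (S + l + r) := pow_le_pow_right₀ hA₁ (by omega)
          have f4 : K₁ ≤ K₁ + 1 := by linarith
          gcongr
      _ = _ := by unfold gevrey; rw [mul_pow, mul_pow, ← pow_mul]; ring

end IsRatExpansion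

end SGHalfSpace

end


noncomputable section

namespace SGHalfSpace

open MeasureTheory Filter Topology

/-! ### Damping factors holomorphic in the upper half-plane -/

/-- `(1 - iεz)^{-K}`. -/
def damp (K : ℕ) (ε : ℝ) (z : ℂ) : ℂ := ((1 - Complex.I * ε * z) ^ K)⁻¹

/-- The real part of 1 - iεz is 1 + ε Im z. Thus the damping factor has no pole in the closed upper
half-plane and is bounded by 1 there, uniformly in ε. -/
theorem one_le_norm_one_sub {ε : ℝ} (hε : 0 ≤ ε) {z : ℂ} (hz : 0 ≤ z.im) :
    1 ≤ ‖1 - Complex.I * ε * z‖ := by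
  have h1 : (1 - Complex.I * ε * z).re = 1 + ε * z.im := by simp
  have h2 := Complex.re_le_norm (1 - Complex.I * ε * z)
  rw [h1] at h2
  nlinarith [mul_nonneg hε hz]

theorem mul_norm_le_norm_one_sub {ε : ℝ} (hε : 0 ≤ ε) {z : ℂ} (hz : 0 ≤ z.im) :
    ε * ‖z‖ ≤ ‖1 - Complex.I * ε * z‖ := by
  have h1 : (1 - Complex.I * ε * z).re = 1 + ε * z.im := by simp
  have h2 : (1 - Complex.I * ε * z).im = -(ε * z.re) := by simp
  rw [← Real.sqrt_sq (mul_nonneg hε (norm_nonneg z)), Complex.norm_eq_sqrt_sq_add_sq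
    (1 - Complex.I * ε * z), h1, h2]
  refine Real.sqrt_le_sqrt ?_
  rw [mul_pow, ← Complex.normSq_eq_norm_sq, Complex.normSq_apply]
  nlinarith [mul_nonneg hε hz]

theorem norm_damp_le_one (K : ℕ) {ε : ℝ} (hε : 0 ≤ ε) {z : ℂ} (hz : 0 ≤ z.im) :
    ‖damp K ε z‖ ≤ 1 := by
  unfold damp
  rw [norm_inv, norm_pow]
  exact inv_le_one_of_one_le₀ (one_le_pow₀ (one_le_norm_one_sub hε hz))

theorem norm_damp_le (K : ℕ) {ε : ℝ} (hε : 0 < ε) {z : ℂ} (hz : 0 ≤ z.im) (hz0 : 0 < ‖z‖) :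
    ‖damp K ε z‖ ≤ ((ε * ‖z‖) ^ K)⁻¹ := by
  unfold damp
  rw [norm_inv, norm_pow]
  have h1 := mul_norm_le_norm_one_sub hε.le hz
  have h2 : 0 < ε * ‖z‖ := by positivity
  gcongr

theorem one_sub_ne_zero {ε : ℝ} (hε : 0 ≤ ε) {z : ℂ} (hz : 0 ≤ z.im) :
    1 - Complex.I * ε * z ≠ 0 := by
  have := one_le_norm_one_sub hε hz
  rw [← norm_pos_iff]
  linarith

theorem differentiableAt_damp (K : ℕ) {ε : ℝ} (hε : 0 ≤ ε) {z : ℂ} (hz : 0 ≤ z.im) :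
    DifferentiableAt ℂ (damp K ε) z := by
  unfold damp
  exact DifferentiableAt.inv (by fun_prop) (pow_ne_zero _ (one_sub_ne_zero hε hz))

theorem tendsto_damp (K : ℕ) (z : ℂ) :
    Tendsto (fun N : ℕ => damp K (1 / ((N : ℝ) + 1)) z) atTop (𝓝 1) := by
  have h1 : Tendsto (fun N : ℕ => ((1 / ((N : ℝ) + 1) : ℝ) : ℂ)) atTop (𝓝 ((0 : ℝ) : ℂ)) :=
    (Complex.continuous_ofReal.tendsto 0).comp tendsto_one_div_add_atTop_nhds_zero_nat
  have h2 := (((tendsto_const_nhds (x := (1 : ℂ))).sub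
    ((h1.const_mul Complex.I).mul_const z)).pow K).inv₀ (by simp)
  simpa [damp] using h2

/-! ### Moving the contour -/

/-- The integrand whose contour is moved. -/
def contourFun {d : ℕ} (K : ℕ) (ε : ℝ) (x : RSpace (d + 1)) (f : RSpace (d + 1) → ℂ) (m : ℤ)
    (ξ' : RSpace d) (wt : ℂ) (z : ℂ) : ℂ :=
  damp K ε z * Complex.exp (Complex.I * cdot x (snocC ξ' z)) * hatC f (snocC ξ' z) * kern m z wt

section

variable {d : ℕ} {x : RSpace (d + 1)} {f : RSpace (d + 1) → ℂ} {ξ' : RSpace d}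

/-- The damping exponent e + 2 beats the kernel's growth |z|^e and leaves |z|^{-2}, as needed for
the change of contour. The constant blows up as ε → 0, which is harmless while ε is fixed. -/
theorem norm_contourFun_le (hx : 0 ≤ x (Fin.last d)) {ε : ℝ} (hε : 0 < ε) {c : ℝ}
    (hc : ∀ z : ℂ, 0 ≤ z.im → ‖hatC f (snocC ξ' z)‖ ≤ c) {m : ℤ} {e : ℕ} (hm : m - 1 ≤ e)
    {wt : ℂ} (hω : 0 < ‖wt‖) {z : ℂ} (hz : 0 ≤ z.im) (hzω : 2 * ‖wt‖ ≤ ‖z‖) :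
    ‖contourFun (e + 2) ε x f m ξ' wt z‖ ≤
      ((ε ^ (e + 2))⁻¹ * c * (‖wt‖ ^ e)⁻¹) * (‖z‖ ^ 2)⁻¹ := by
  have hz0 : 0 < ‖z‖ := by linarith
  have h1 := norm_damp_le (e + 2) hε hz hz0
  have h2 := norm_cexp_cdot_le hx ξ' hz
  have h3 := hc z hz
  have h4 : ‖kern m z wt‖ ≤ (‖z‖ / ‖wt‖) ^ e := by
    refine (norm_kern_le (norm_pos_iff.1 hω) hzω).trans ?_
    rw [← zpow_natCast]
    exact zpow_le_zpow_right₀ (by rw [le_div_iff₀ hω]; linarith) hm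
  have hc0 : 0 ≤ c := (norm_nonneg _).trans h3
  unfold contourFun
  rw [norm_mul, norm_mul, norm_mul]
  calc _ ≤ ((ε * ‖z‖) ^ (e + 2))⁻¹ * 1 * c * (‖z‖ / ‖wt‖) ^ e := by gcongr
    _ = _ := by
      rw [div_pow, mul_pow]
      field_simp
      ring

theorem kern_ne {z wt : ℂ} (hω : 0 < ‖wt‖) (hzω : 2 * ‖wt‖ ≤ ‖z‖) : z - wt ≠ 0 ∧ z / wt ≠ 0 := by
  refine ⟨fun h => ?_, div_ne_zero (norm_pos_iff.1 (by linarith)) (norm_pos_iff.1 hω)⟩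
  rw [sub_eq_zero.1 h] at hzω
  linarith

theorem differentiableAt_kern (m : ℤ) {z wt : ℂ} (hω : 0 < ‖wt‖) (hzω : 2 * ‖wt‖ ≤ ‖z‖) :
    DifferentiableAt ℂ (fun z => kern m z wt) z := by
  obtain ⟨h1, h2⟩ := kern_ne hω hzω
  unfold kern
  refine DifferentiableAt.div_const (DifferentiableAt.mul ?_ ?_) _
  · exact DifferentiableAt.zpow (by fun_prop) (Or.inl h2)
  · exact DifferentiableAt.div (by fun_prop) (by fun_prop) h1

theorem differentiable_cexp_cdot (x : RSpace (d + 1)) (ξ' : RSpace d) :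
    Differentiable ℂ (fun z => Complex.exp (Complex.I * cdot x (snocC ξ' z))) := by
  simp only [cdot_snocC]
  fun_prop

theorem integral_contourFun (hf : LowerSupported f) (hx : 0 ≤ x (Fin.last d)) {ε : ℝ} (hε : 0 < ε)
    {c : ℝ} (hc : ∀ z : ℂ, 0 ≤ z.im → ‖hatC f (snocC ξ' z)‖ ≤ c) {m : ℤ} {e : ℕ} (hm : m - 1 ≤ e)
    {wt : ℂ} (hω : 0 < ‖wt‖) {R : ℝ} (hR : 2 * ‖wt‖ ≤ R) :
    ∫ t in {t : ℝ | R < |t|}, contourFun (e + 2) ε x f m ξ' wt t =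
      ∫ s in Set.Ioc 0 Real.pi, contourFun (e + 2) ε x f m ξ' wt (arcPt R s) *
        (Complex.I * arcPt R s) := by
  have hR0 : 0 < R := by linarith
  rw [integral_halflines_eq_arc (h := contourFun (e + 2) ε x f m ξ' wt) hR0 ?_ ?_
    fun z hz hzR => norm_contourFun_le hx hε hc hm hω hz (hR.trans hzR),
    intervalIntegral.integral_of_le Real.pi_pos.le]
  · rfl
  · intro z hz
    have hzω : 2 * ‖wt‖ ≤ ‖z‖ := hR.trans hz.2
    have h1 : ContinuousWithinAt (fun z => hatC f (snocC ξ' z)) {z | 0 ≤ z.im ∧ R ≤ ‖z‖} z :=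
      ((hf.continuousOn_hatC (ξ', z) hz.1).comp (f := fun z : ℂ => (ξ', z))
        (Continuous.prodMk_right ξ').continuousWithinAt fun y hy => hy.1)
    exact (((differentiableAt_damp _ hε.le hz.1).continuousAt.continuousWithinAt.mul
      (differentiable_cexp_cdot x ξ' z).continuousAt.continuousWithinAt).mul h1).mul
      (differentiableAt_kern m hω hzω).continuousAt.continuousWithinAt
  · intro z hz hzR
    exact (((differentiableAt_damp _ hε.le hz.le).mul (differentiable_cexp_cdot x ξ' z)).mul
      (hf.differentiableAt_hatC ξ' hz)).mul (differentiableAt_kern m hω (hR.trans hzR.le))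

end

theorem two_inv_one_add_sq {t : ℝ} (ht : 1 ≤ |t|) : (|t| ^ 2)⁻¹ ≤ 2 * (1 + t ^ 2)⁻¹ := by
  have h1 : 1 ≤ t ^ 2 := by rw [← sq_abs]; nlinarith
  rw [sq_abs, ← div_eq_mul_inv, inv_le_comm₀ (by positivity) (by positivity), inv_div,
    div_le_iff₀ (by norm_num)]
  linarith

namespace IsRatExpansion

variable {d : ℕ} {μ ν θ : ℝ} {m₁ : ℤ} {m₂ : ℝ} {a : RSpace (d + 1) → RSpace (d + 1) → ℂ}
  {p q : ℕ → RSpace (d + 1) → MvPolynomial (Fin (d + 1)) ℂ} {C D B r₀ : ℝ}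

/-- The contour shift for one term of the expansion. -/
theorem integral_halflines_term (h : IsRatExpansion μ ν m₁ m₂ a p q C D B r₀) (hν : 0 ≤ ν)
    {f : RSpace (d + 1) → ℂ} (hf : LowerSupported f) {x : RSpace (d + 1)} (hx : x ∈ upperHalf d)
    (ξ' : RSpace d) {R : ℝ} (hR : 2 * (B * bracket ξ') < R) (hR1 : 1 ≤ R) {ε : ℝ} (hε : 0 < ε)
    (k : Fin (d + 1)) (l j : ℕ) :
    ∫ t in {t : ℝ | R < |t|}, damp (m₁.toNat + 2) ε t *
      (Complex.exp (Complex.I * cdot x (snocC ξ' (t : ℂ))) *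
        symIter k l (fun y η => ratFun (p j) (q j) y (toC η)) x (snocR ξ' t) *
        hatC f (snocC ξ' (t : ℂ))) =
    ∫ σ in Set.Ioc 0 (2 * Real.pi), ∫ s in Set.Ioc 0 Real.pi,
      damp (m₁.toNat + 2) ε (arcPt R s) *
        (Complex.exp (Complex.I * cdot x (snocC ξ' (arcPt R s))) *
          circ k l B (p j) (q j) ξ' σ x *
          (hatC f (snocC ξ' (arcPt R s)) * (kern (m₁ - j - l + 1) (arcPt R s) (circlePt B ξ' σ) *
            (Complex.I * arcPt R s)))) := by
  have hb := bracket_pos ξ'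
  have hBb : 0 < B * bracket ξ' := mul_pos h.hB hb
  have hωn : ∀ σ, ‖circlePt B ξ' σ‖ = B * bracket ξ' := fun σ => norm_circlePt h.hB.le ξ' σ
  set e := m₁.toNat with he
  set m := m₁ - j - l + 1 with hm
  have hme : m - 1 ≤ e := by
    have := Int.self_le_toNat m₁
    omega
  set c := ∫ y, ‖f y‖ with hc
  have hcb : ∀ z : ℂ, 0 ≤ z.im → ‖hatC f (snocC ξ' z)‖ ≤ c := fun z hz => hf.norm_hatC_le ξ' hz
  have hc0 : 0 ≤ c := integral_nonneg fun y => norm_nonneg _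
  have hx0 : 0 ≤ x (Fin.last d) := le_of_lt hx
  set A : Set ℝ := {t : ℝ | R < |t|} with hA
  have hAo : IsOpen A := isOpen_lt continuous_const continuous_abs
  set cf : ℝ → ℝ → ℂ := fun σ t => circ k l B (p j) (q j) ξ' σ x *
    contourFun (e + 2) ε x f m ξ' (circlePt B ξ' σ) t with hcf
  have hcc : Continuous fun σ => circ k l B (p j) (q j) ξ' σ x :=
    (h.continuous_circ k l j).comp (f := fun σ : ℝ => ((ξ', σ), x)) (by fun_prop)
  -- the Cauchy integral
  have step1 : ∀ t ∈ A, damp (e + 2) ε t *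
      (Complex.exp (Complex.I * cdot x (snocC ξ' (t : ℂ))) *
        symIter k l (fun y η => ratFun (p j) (q j) y (toC η)) x (snocR ξ' t) *
        hatC f (snocC ξ' (t : ℂ))) = ∫ σ in Set.Ioc 0 (2 * Real.pi), cf σ t := by
    intro t ht
    have ht' : R < |t| := ht
    rw [h.real_eq_integral k l j x ξ' (t := t) (by linarith),
      intervalIntegral.integral_of_le (by positivity), mul_comm (Complex.exp _), mul_assoc,
      mul_comm, ← integral_mul_const, ← integral_mul_const]
    congr 1
    ext σ
    simp only [hcf, contourFun]
    ring
  rw [setIntegral_congr_fun hAo.measurableSet step1]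
  -- exchange of the integrals
  obtain ⟨c₁, hc₁, hcirc⟩ : ∃ c₁ : ℝ, 0 ≤ c₁ ∧ ∀ σ, ‖circ k l B (p j) (q j) ξ' σ x‖ ≤ c₁ := by
    have h2 : ∀ σ, _ := fun σ => h.wderiv_circ_le hν k l j ξ' σ [] x
    exact ⟨_, (norm_nonneg _).trans (h2 0), h2⟩
  have hI : Integrable (fun w : ℝ × ℝ => cf w.2 w.1) ((volume.restrict A).prod
      (volume.restrict (Set.Ioc 0 (2 * Real.pi)))) := by
    have hdom : Integrable (fun w : ℝ × ℝ => (1 + w.1 ^ 2)⁻¹ * (c₁ * (((ε ^ (e + 2))⁻¹ * c *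
        ((B * bracket ξ') ^ e)⁻¹) * 2))) ((volume.restrict A).prod
        (volume.restrict (Set.Ioc 0 (2 * Real.pi)))) :=
      Integrable.mul_prod (f := fun t : ℝ => (1 + t ^ 2)⁻¹)
        (integrable_inv_one_add_sq.mono_measure Measure.restrict_le_self) (integrable_const _)
    refine hdom.mono' ?_ ?_
    · rw [Measure.prod_restrict]
      refine ContinuousOn.aestronglyMeasurable ?_ (hAo.measurableSet.prod measurableSet_Ioc)
      intro w hw
      have hw1 : R < |w.1| := hw.1
      have hzω : 2 * ‖circlePt B ξ' w.2‖ ≤ ‖(w.1 : ℂ)‖ := by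
        rw [hωn, Complex.norm_real, Real.norm_eq_abs]; linarith
      obtain ⟨k1, k2⟩ := kern_ne (by rw [hωn]; exact hBb) hzω
      have hωc : Continuous fun w : ℝ × ℝ => circlePt B ξ' w.2 :=
        (continuous_circlePt B).comp (f := fun w : ℝ × ℝ => (ξ', w.2)) (by fun_prop)
      have hω0 : circlePt B ξ' w.2 ≠ 0 := by rw [← norm_pos_iff, hωn]; exact hBb
      have htc : Continuous fun w : ℝ × ℝ => (w.1 : ℂ) := by fun_prop
      have a1 : ContinuousAt (fun w : ℝ × ℝ => kern m w.1 (circlePt B ξ' w.2)) w := by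
        unfold kern
        exact (((htc.continuousAt.div hωc.continuousAt hω0).zpow₀ m (Or.inl k2)).mul
          (hωc.continuousAt.div (htc.sub hωc).continuousAt k1)).div_const _
      have a2 : Continuous (fun w : ℝ × ℝ => hatC f (snocC ξ' (w.1 : ℂ))) :=
        hf.continuous_hatC_real.comp (f := fun w : ℝ × ℝ => (ξ', w.1)) (by fun_prop)
      have a3 : Continuous (fun w : ℝ × ℝ =>
          Complex.exp (Complex.I * cdot x (snocC ξ' (w.1 : ℂ)))) :=
        (differentiable_cexp_cdot x ξ').continuous.comp htc
      have a4 : ContinuousAt (fun w : ℝ × ℝ => damp (e + 2) ε w.1) w :=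
        ContinuousAt.comp (g := damp (e + 2) ε) (f := fun w : ℝ × ℝ => (w.1 : ℂ))
          (differentiableAt_damp (e + 2) hε.le (by simp)).continuousAt htc.continuousAt
      exact ((hcc.comp continuous_snd).continuousAt.mul
        (((a4.mul a3.continuousAt).mul a2.continuousAt).mul a1)).continuousWithinAt
    · rw [Measure.prod_restrict]
      refine (ae_restrict_iff' (hAo.measurableSet.prod measurableSet_Ioc)).2
        (Eventually.of_forall fun w hw => ?_)
      have hw1 : R < |w.1| := hw.1
      have hzω : 2 * ‖circlePt B ξ' w.2‖ ≤ ‖(w.1 : ℂ)‖ := by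
        rw [hωn, Complex.norm_real, Real.norm_eq_abs]; linarith
      have b1 := norm_contourFun_le (ε := ε) (x := x) hx0 hε hcb hme
        (by rw [hωn]; exact hBb) (z := (w.1 : ℂ)) (by simp) hzω
      rw [hωn, Complex.norm_real, Real.norm_eq_abs] at b1
      have b2 := two_inv_one_add_sq (t := w.1) (by linarith)
      simp only [hcf]
      rw [norm_mul]
      calc _ ≤ c₁ * (((ε ^ (e + 2))⁻¹ * c * ((B * bracket ξ') ^ e)⁻¹) * (|w.1| ^ 2)⁻¹) :=
            mul_le_mul (hcirc _) b1 (norm_nonneg _) hc₁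
        _ ≤ c₁ * (((ε ^ (e + 2))⁻¹ * c * ((B * bracket ξ') ^ e)⁻¹) * (2 * (1 + w.1 ^ 2)⁻¹)) := by
            gcongr
        _ = _ := by ring
  rw [integral_integral_swap (f := fun t σ => cf σ t) hI]
  congr 1
  ext σ
  simp only [hcf]
  -- For fixed σ the value on the circle does not depend on z, so only the damped kernel,
  -- exponential and transform move to the arc.
  rw [integral_const_mul, integral_contourFun hf hx0 hε hcb hme (by rw [hωn]; exact hBb)
    (by rw [hωn]; exact hR.le), ← integral_const_mul]
  congr 1
  ext s
  simp only [contourFun]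
  ring

end IsRatExpansion

end SGHalfSpace

end


noncomputable section

namespace SGHalfSpace

open MeasureTheory Filter Topology

/-! ### The pairing as an integral over the half-space -/

theorem hat_mul_testTransform {d : ℕ} (f φ : RSpace (d + 1) → ℂ)
    (b : RSpace (d + 1) → RSpace (d + 1) → ℂ) (ξ' : RSpace d) (t : ℝ) :
    hat f (snocR ξ' t) * testTransform b φ (snocR ξ' t) =
      ∫ x, (Complex.exp (Complex.I * cdot x (snocC ξ' (t : ℂ))) * b x (snocR ξ' t) *
        hatC f (snocC ξ' (t : ℂ))) * φ x := by
  rw [hat_eq_hatC, toC_snocR]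
  unfold testTransform
  rw [← integral_const_mul]
  congr 1
  ext x
  rw [← cdot_toC, toC_snocR]
  ring

theorem aestronglyMeasurable_of_continuousOn_prod {X Y : Type*} [TopologicalSpace X]
    [TopologicalSpace Y] [MeasureSpace X] [MeasureSpace Y] [OpensMeasurableSpace (X × Y)]
    [SecondCountableTopologyEither (X × Y) ℂ] [SFinite (volume : Measure X)]
    [SFinite (volume : Measure Y)]
    {F : X × Y → ℂ} {s : Set X} (hs : MeasurableSet s)
    (hF : ContinuousOn F (s ×ˢ Set.univ)) :
    AEStronglyMeasurable F ((volume.restrict s).prod volume) := by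
  rw [Measure.restrict_prod_eq_prod_univ]
  exact hF.aestronglyMeasurable (hs.prod MeasurableSet.univ)

namespace IsRatExpansion

variable {d : ℕ} {μ ν θ : ℝ} {m₁ : ℤ} {m₂ : ℝ} {a : RSpace (d + 1) → RSpace (d + 1) → ℂ}
  {p q : ℕ → RSpace (d + 1) → MvPolynomial (Fin (d + 1)) ℂ} {C D B r₀ : ℝ}

/-- a_j is the difference of two consecutive remainders, and condition 3 is available for both
outside the contour. Polynomial growth in ξ, uniform up to ⟨x⟩^{m₂}, suffices, since it only meets
the damping factor. -/
theorem exists_norm_real_le (h : IsRatExpansion μ ν m₁ m₂ a p q C D B r₀)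
    (ha : IsSGSymbol μ ν m₁ m₂ a) (hμ : 1 ≤ μ) (hν : 1 ≤ ν) (k : Fin (d + 1)) (l j : ℕ) {M : ℕ}
    (hj : j < M) : ∃ c : ℝ, 0 ≤ c ∧ ∀ w ∈ outsideSet (radius (d := d) B (μ + ν - 1) M), ∀ x,
      ‖symIter k l (fun y η => ratFun (p j) (q j) y (toC η)) x (snocR w.1 w.2)‖ ≤
        c * bracket x ^ m₂ * bracket (snocR w.1 w.2) ^ m₁.toNat := by
  set τ := μ + ν - 1 with hτ
  have hτ0 : 0 ≤ τ := by linarith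
  have hC := h.hC
  have hD := h.hD
  set cst : ℕ → ℝ := fun i => C * (D + 1) ^ (l + 0 + 2 * i) * rfac μ l * rfac ν 0 * rfac τ i
    with hcst
  have hcst0 : ∀ i, 0 ≤ cst i := fun i => by
    have := rfac_pos μ l
    have := rfac_pos ν 0
    have := rfac_pos τ i
    positivity
  refine ⟨cst j + cst (j + 1), add_nonneg (hcst0 _) (hcst0 _), fun w hw x => ?_⟩
  have hx := Real.rpow_pos_of_pos (bracket_pos x) m₂
  have hb := bracket_ge_one (snocR w.1 w.2)
  have hlarge : threshold B τ M ≤ bracket (snocR w.1 w.2) :=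
    (threshold_le_radius h.hB.le hτ0 w.1).trans
      ((le_of_lt hw).trans (abs_le_bracket_snocR w.1 w.2))
  have hi : ∀ i ≤ M, ‖h.rem k l i x (snocR w.1 w.2)‖ ≤
      cst i * bracket x ^ m₂ * bracket (snocR w.1 w.2) ^ m₁.toNat := by
    intro i hi
    have h1 := h.wderiv_rem_le ha (by linarith) k l i [] x w.1
      (h.le_abs_of_mem_outsideSet hτ0 hw).le (by
        refine le_trans ?_ ((mul_pow_le_threshold (M := M) h.hB.le hτ0).trans hlarge)
        have : ((i : ℝ)) ^ τ ≤ (M : ℝ) ^ τ :=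
          Real.rpow_le_rpow (by positivity) (by exact_mod_cast hi) hτ0
        have := h.hB
        gcongr)
    refine h1.trans ?_
    have h2 : bracket (snocR w.1 w.2) ^ (m₁ - i - l) ≤ bracket (snocR w.1 w.2) ^ m₁.toNat := by
      rw [← zpow_natCast]
      refine zpow_le_zpow_right₀ hb ?_
      have := Int.self_le_toNat m₁
      omega
    have := hcst0 i
    exact mul_le_mul_of_nonneg_left h2 (by positivity)
  have e : symIter k l (fun y η => ratFun (p j) (q j) y (toC η)) x (snocR w.1 w.2) =
      h.rem k l j x (snocR w.1 w.2) - h.rem k l (j + 1) x (snocR w.1 w.2) := by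
    unfold rem
    rw [Finset.sum_range_succ]
    ring
  rw [e]
  refine (norm_sub_le _ _).trans ((add_le_add (hi j hj.le) (hi (j + 1) hj)).trans (le_of_eq ?_))
  ring

/-- The damped terms of the expansion. -/
def damped (_ : IsRatExpansion μ ν m₁ m₂ a p q C D B r₀) (f : RSpace (d + 1) → ℂ) (ε : ℝ)
    (k : Fin (d + 1)) (l j : ℕ) (w : RSpace d × ℝ) (x : RSpace (d + 1)) : ℂ :=
  damp (m₁.toNat + 2) ε (w.2 : ℂ) * (Complex.exp (Complex.I * cdot x (snocC w.1 (w.2 : ℂ))) *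
    symIter k l (fun y η => ratFun (p j) (q j) y (toC η)) x (snocR w.1 w.2) *
    hatC f (snocC w.1 (w.2 : ℂ)))

/-- Justifies Fubini at fixed ε only: the majorant contains ε^{-(e+2)} and plays no role in the
limit. -/
theorem dominatedOn_damped (h : IsRatExpansion μ ν m₁ m₂ a p q C D B r₀)
    (ha : IsSGSymbol μ ν m₁ m₂ a) (hμ : 1 ≤ μ) (hν : 1 ≤ ν) {f : RSpace (d + 1) → ℂ} {c : ℝ}
    (hdec : ∀ (ξ' : RSpace d) (z : ℂ), 0 ≤ z.im →
      bracket ξ' ^ (d + 1) * ‖hatC f (snocC ξ' z)‖ ≤ c) {ε : ℝ} (hε : 0 < ε)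
    (k : Fin (d + 1)) (l j : ℕ) {M : ℕ} (hj : j < M) :
    DominatedOn (volume.restrict (outsideSet (radius (d := d) B (μ + ν - 1) M))) Set.univ m₂
      (h.damped f ε k l j) := by
  obtain ⟨c₁, hc₁, hb⟩ := h.exists_norm_real_le ha hμ hν k l j hj
  set τ := μ + ν - 1 with hτ
  have hτ0 : 0 ≤ τ := by linarith
  set e := m₁.toNat with he
  have hmS : MeasurableSet (outsideSet (radius (d := d) B τ M)) :=
    (isOpen_outsideSet continuous_radius).measurableSet
  refine ⟨fun w => ((ε ^ (e + 2))⁻¹ * c₁ * 2 ^ e * c * 2) * freqWeight w,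
    (integrable_freqWeight d).restrict.const_mul _,
    (ae_restrict_iff' hmS).2 (Eventually.of_forall fun w hw x _ => ?_)⟩
  have hw' : radius B τ M w.1 < |w.2| := hw
  have ht1 : 1 ≤ |w.2| := ((one_le_radius h.hB.le hτ0 w.1).trans_lt hw').le
  have hx := Real.rpow_pos_of_pos (bracket_pos x) m₂
  have hbr := bracket_pos w.1
  have h1 := norm_damp_le (e + 2) hε (z := (w.2 : ℂ)) (by simp)
    (by rw [Complex.norm_real, Real.norm_eq_abs]; linarith)
  rw [Complex.norm_real, Real.norm_eq_abs] at h1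
  have h2 : bracket (snocR w.1 w.2) ≤ 2 * |w.2| := by
    have := bracket_snocR_le w.1 w.2
    have := bracket_le_radius (M := M) h.hB.le hτ0 w.1
    linarith
  have h3 : bracket (snocR w.1 w.2) ^ e ≤ (2 * |w.2|) ^ e :=
    pow_le_pow_left₀ (bracket_pos _).le h2 e
  have h4 := hdec w.1 w.2 (by simp)
  rw [mul_comm, ← le_div_iff₀ (by positivity), div_eq_mul_inv] at h4
  have h5 := two_inv_one_add_sq ht1
  have hc0 : 0 ≤ c := by
    have := hdec 0 0 (by simp)
    have h0 := bracket_pos (0 : RSpace d)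
    exact le_trans (by positivity) this
  unfold damped freqWeight
  rw [norm_mul, norm_mul, norm_mul, norm_cexp_cdot_real, one_mul]
  calc _ ≤ ((ε * |w.2|) ^ (e + 2))⁻¹ * ((c₁ * bracket x ^ m₂ * (2 * |w.2|) ^ e) *
        (c * (bracket w.1 ^ (d + 1))⁻¹)) := by
        have h6 := (hb w hw x).trans (mul_le_mul_of_nonneg_left h3 (by positivity))
        gcongr
    _ = ((ε ^ (e + 2))⁻¹ * c₁ * 2 ^ e * c) * (bracket w.1 ^ (d + 1))⁻¹ * (|w.2| ^ 2)⁻¹ *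
        bracket x ^ m₂ := by
        rw [mul_pow, mul_pow, pow_add |w.2|]
        field_simp
    _ ≤ ((ε ^ (e + 2))⁻¹ * c₁ * 2 ^ e * c) * (bracket w.1 ^ (d + 1))⁻¹ *
        (2 * (1 + w.2 ^ 2)⁻¹) * bracket x ^ m₂ := by gcongr
    _ = _ := by ring

theorem continuousOn_damped (h : IsRatExpansion μ ν m₁ m₂ a p q C D B r₀)
    {f : RSpace (d + 1) → ℂ} (hf : LowerSupported f) {ε : ℝ} (hε : 0 < ε)
    (k : Fin (d + 1)) (l j : ℕ) {τ : ℝ} (hτ : 0 ≤ τ) (M : ℕ) :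
    ContinuousOn (fun w : (RSpace d × ℝ) × RSpace (d + 1) => h.damped f ε k l j w.1 w.2)
      (outsideSet (radius (d := d) B τ M) ×ˢ Set.univ) := by
  intro w hw
  have htc : Continuous fun w : (RSpace d × ℝ) × RSpace (d + 1) => (w.1.2 : ℂ) := by fun_prop
  have a4 : ContinuousAt (fun w : (RSpace d × ℝ) × RSpace (d + 1) =>
      damp (m₁.toNat + 2) ε (w.1.2 : ℂ)) w :=
    ContinuousAt.comp (g := damp (m₁.toNat + 2) ε)
      (f := fun w : (RSpace d × ℝ) × RSpace (d + 1) => (w.1.2 : ℂ))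
      (differentiableAt_damp _ hε.le (by simp)).continuousAt htc.continuousAt
  have a1 := h.continuousAt_real k l j (w := w) (h.B_le_abs_of_mem_outsideSet hτ hw.1)
  exact (a4.mul ((continuous_cexp_cdot_real.continuousAt.mul a1).mul
    (hf.continuous_hatC_real.comp continuous_fst).continuousAt)).continuousWithinAt

/-- The contour is moved separately for almost every ξ'. Fubini in the remaining variables holds
before the move by damping and after it by the bounds on the arc. -/
theorem integral_damped (h : IsRatExpansion μ ν m₁ m₂ a p q C D B r₀)
    (ha : IsSGSymbol μ ν m₁ m₂ a) (hμ : 1 ≤ μ) (hν : 1 ≤ ν) {f : RSpace (d + 1) → ℂ}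
    (hf : LowerSupported f) {c : ℝ}
    (hdec : ∀ (ξ' : RSpace d) (z : ℂ), 0 ≤ z.im →
      bracket ξ' ^ (d + 1) * ‖hatC f (snocC ξ' z)‖ ≤ c) {ε : ℝ} (hε : 0 < ε)
    (k : Fin (d + 1)) (l j : ℕ) {M : ℕ} (hj : j < M) {x : RSpace (d + 1)} (hx : x ∈ upperHalf d)
    (harc : Integrable (fun w : RSpace d × (ℝ × ℝ) =>
      Complex.exp (Complex.I * cdot x (snocC w.1 (arcPt (radius B (μ + ν - 1) M w.1) w.2.2))) *
        circ k l B (p j) (q j) w.1 w.2.1 x *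
        arcKernel B (radius B (μ + ν - 1) M) (m₁ - j - l + 1) f w) (arcMeasure d)) :
    ∫ w in outsideSet (radius (d := d) B (μ + ν - 1) M), h.damped f ε k l j w x =
      ∫ w, damp (m₁.toNat + 2) ε (arcPt (radius B (μ + ν - 1) M w.1) w.2.2) *
        (Complex.exp (Complex.I * cdot x (snocC w.1 (arcPt (radius B (μ + ν - 1) M w.1) w.2.2))) *
        circ k l B (p j) (q j) w.1 w.2.1 x *
        arcKernel B (radius B (μ + ν - 1) M) (m₁ - j - l + 1) f w) ∂(arcMeasure d) := by
  obtain ⟨G, hG, hGb⟩ := h.dominatedOn_damped ha hμ hν hdec hε k l j hj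
  have hτ0 : 0 ≤ μ + ν - 1 := by linarith
  set R := radius (d := d) B (μ + ν - 1) M with hR
  have hRc : Continuous R := continuous_radius
  have hR1 : ∀ ξ', 1 ≤ R ξ' := fun ξ' => one_le_radius h.hB.le hτ0 ξ'
  have hmS : MeasurableSet (outsideSet R) := (isOpen_outsideSet hRc).measurableSet
  have hco := h.continuousOn_damped hf hε k l j hτ0 M
  rw [← hR] at hco
  have hcx : ContinuousOn (fun w => h.damped f ε k l j w x) (outsideSet R) :=
    hco.comp (f := fun w : RSpace d × ℝ => (w, x)) (Continuous.prodMk_left x).continuousOn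
      fun w hw => ⟨hw, Set.mem_univ _⟩
  have hI : Integrable (fun w => h.damped f ε k l j w x) (volume.restrict (outsideSet R)) := by
    refine (hG.mul_const (bracket x ^ m₂)).mono' (hcx.aestronglyMeasurable hmS) ?_
    filter_upwards [hGb] with w hw
    exact hw x (Set.mem_univ _)
  have hI2 : Integrable ((outsideSet R).indicator fun w => h.damped f ε k l j w x)
      (volume.prod volume) := (integrable_indicator_iff hmS).2 hI
  have hdampm : AEStronglyMeasurable (fun w : RSpace d × (ℝ × ℝ) =>
      damp (m₁.toNat + 2) ε (arcPt (R w.1) w.2.2)) (arcMeasure d) := by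
    have hm : Measurable (damp (m₁.toNat + 2) ε) := by unfold damp; fun_prop
    exact (hm.comp (continuous_arcPt_comp hRc).measurable).aestronglyMeasurable
  have hJ : Integrable (fun w : RSpace d × (ℝ × ℝ) =>
      damp (m₁.toNat + 2) ε (arcPt (R w.1) w.2.2) *
        (Complex.exp (Complex.I * cdot x (snocC w.1 (arcPt (R w.1) w.2.2))) *
        circ k l B (p j) (q j) w.1 w.2.1 x *
        arcKernel B R (m₁ - j - l + 1) f w)) (arcMeasure d) := by
    refine harc.bdd_mul (c := 1) hdampm ?_
    filter_upwards [ae_arcMeasure d] with w hw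
    exact norm_damp_le_one _ hε.le (arcPt_im_nonneg (by linarith [hR1 w.1]) hw)
  rw [← integral_indicator hmS]
  change ∫ w, (outsideSet R).indicator (fun w => h.damped f ε k l j w x) w
    ∂((volume : Measure (RSpace d)).prod (volume : Measure ℝ)) = _
  rw [integral_prod _ hI2]
  unfold arcMeasure at hJ ⊢
  rw [integral_prod _ hJ]
  -- Both sides are now iterated integrals with ξ' outermost, so `integral_halflines_term` applies
  -- in each slice.
  refine integral_congr_ae ?_
  filter_upwards [hJ.prod_right_ae] with ξ' hξ'
  rw [integral_prod _ hξ']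
  have e1 : (fun t : ℝ => (outsideSet R).indicator (fun w => h.damped f ε k l j w x) (ξ', t))
      = {t : ℝ | R ξ' < |t|}.indicator (fun t => h.damped f ε k l j (ξ', t) x) := by
    ext t
    simp only [Set.indicator_apply, outsideSet, Set.mem_ofPred_eq]
  rw [e1, integral_indicator (isOpen_lt continuous_const continuous_abs).measurableSet]
  exact h.integral_halflines_term (by linarith) hf hx ξ'
    (mul_bracket_lt_radius h.hB.le hτ0 ξ') (hR1 ξ') hε k l j

end IsRatExpansion

end SGHalfSpace

end


/-! ### Removing the damping and assembling the density -/

noncomputable section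

namespace SGHalfSpace

open MeasureTheory Filter Topology

theorem integrable_mul_test {n : ℕ} {Ω : Set (RSpace n)} (hΩ : IsOpen Ω) {V φ : RSpace n → ℂ}
    (hV : ContinuousOn V Ω) (hφ : IsTest φ) (hs : tsupport φ ⊆ Ω) :
    Integrable (fun x => V x * φ x) := by
  refine Continuous.integrable_of_hasCompactSupport ?_ hφ.2.mul_left
  refine continuous_iff_continuousAt.2 fun x => ?_
  by_cases hx : x ∈ tsupport φ
  · exact (hV.continuousAt (hΩ.mem_nhds (hs hx))).mul hφ.1.continuous.continuousAt
  · have h1 : φ =ᶠ[𝓝 x] 0 := notMem_tsupport_iff_eventuallyEq.1 hx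
    have h2 : (fun x => V x * φ x) =ᶠ[𝓝 x] fun _ => 0 := by
      filter_upwards [h1] with y hy
      simp [hy]
    exact continuousAt_const.congr h2.symm

/-- The part of the pairing inside the contour. -/
def insidePart {d : ℕ} (R : RSpace d → ℝ) (b : RSpace (d + 1) → RSpace (d + 1) → ℂ)
    (f : RSpace (d + 1) → ℂ) (x : RSpace (d + 1)) : ℂ :=
  ∫ w in insideSet R, Complex.exp (Complex.I * cdot x (snocC w.1 (w.2 : ℂ))) *
    b x (snocR w.1 w.2) * hatC f (snocC w.1 (w.2 : ℂ))

/-- The part of the pairing with a symbol `b` outside the contour. -/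
def outsidePart {d : ℕ} (R : RSpace d → ℝ) (b : RSpace (d + 1) → RSpace (d + 1) → ℂ)
    (f : RSpace (d + 1) → ℂ) (x : RSpace (d + 1)) : ℂ :=
  ∫ w in outsideSet R, Complex.exp (Complex.I * cdot x (snocC w.1 (w.2 : ℂ))) *
    b x (snocR w.1 w.2) * hatC f (snocC w.1 (w.2 : ℂ))

/-- The part of the pairing on the contour. -/
def arcPart {d : ℕ} (B : ℝ) (R : RSpace d → ℝ) (m : ℤ)
    (c : RSpace d → ℝ → RSpace (d + 1) → ℂ) (f : RSpace (d + 1) → ℂ) (x : RSpace (d + 1)) : ℂ :=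
  ∫ w, Complex.exp (Complex.I * cdot x (snocC w.1 (arcPt (R w.1) w.2.2))) *
    c w.1 w.2.1 x * arcKernel B R m f w ∂(arcMeasure d)

namespace IsRatExpansion

variable {d : ℕ} {μ ν θ : ℝ} {m₁ : ℤ} {m₂ : ℝ} {a : RSpace (d + 1) → RSpace (d + 1) → ℂ}
  {p q : ℕ → RSpace (d + 1) → MvPolynomial (Fin (d + 1)) ℂ} {C D B r₀ : ℝ}

/-- The sum of all the parts of the pairing. -/
def density (h : IsRatExpansion μ ν m₁ m₂ a p q C D B r₀) (k : Fin (d + 1)) (l M : ℕ)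
    (f : RSpace (d + 1) → ℂ) (x : RSpace (d + 1)) : ℂ :=
  insidePart (radius B (μ + ν - 1) M) (symIter k l a) f x +
    outsidePart (radius B (μ + ν - 1) M) (h.rem k l M) f x +
    ∑ j ∈ Finset.range M, arcPart B (radius B (μ + ν - 1) M) (m₁ - j - l + 1)
      (circ k l B (p j) (q j)) f x

/-- On the half lines no majorant uniform in ε is at hand. On the arc there is one, since damping
factors are at most 1 there; hence the limit is taken after the move. The support of φ in x_n > 0
keeps the exponential bounded on the arc. -/
theorem tendsto_integral_damped (h : IsRatExpansion μ ν m₁ m₂ a p q C D B r₀)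
    (ha : IsSGSymbol μ ν m₁ m₂ a) (hμ : 1 ≤ μ) (hν : 1 ≤ ν) {f : RSpace (d + 1) → ℂ}
    (hf : LowerSupported f) {c : ℝ}
    (hdec : ∀ (ξ' : RSpace d) (z : ℂ), 0 ≤ z.im →
      bracket ξ' ^ (d + 1) * ‖hatC f (snocC ξ' z)‖ ≤ c)
    (k : Fin (d + 1)) (l j : ℕ) {M : ℕ} (hj : j < M)
    (hmeas : ∀ x, AEStronglyMeasurable (fun w : RSpace d × (ℝ × ℝ) =>
      Complex.exp (Complex.I * cdot x (snocC w.1 (arcPt (radius B (μ + ν - 1) M w.1) w.2.2))) *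
        circ k l B (p j) (q j) w.1 w.2.1 x *
        arcKernel B (radius B (μ + ν - 1) M) (m₁ - j - l + 1) f w) (arcMeasure d))
    (harc : DominatedOn (arcMeasure d) (upperHalf d) m₂ (fun w x =>
      Complex.exp (Complex.I * cdot x (snocC w.1 (arcPt (radius B (μ + ν - 1) M w.1) w.2.2))) *
        circ k l B (p j) (q j) w.1 w.2.1 x *
        arcKernel B (radius B (μ + ν - 1) M) (m₁ - j - l + 1) f w))
    {φ : RSpace (d + 1) → ℂ} (hφ : IsTest φ) (hs : tsupport φ ⊆ upperHalf d) :
    Tendsto (fun N : ℕ => ∫ x, (∫ w in outsideSet (radius (d := d) B (μ + ν - 1) M),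
        h.damped f (1 / ((N : ℝ) + 1)) k l j w x) * φ x) atTop
      (𝓝 (∫ x, arcPart B (radius B (μ + ν - 1) M) (m₁ - j - l + 1)
        (circ k l B (p j) (q j)) f x * φ x)) := by
  obtain ⟨G, hG, hGb⟩ := harc
  have hτ0 : 0 ≤ μ + ν - 1 := by linarith
  have hε : ∀ N : ℕ, (0 : ℝ) < 1 / ((N : ℝ) + 1) := fun N => by positivity
  set R := radius (d := d) B (μ + ν - 1) M with hR
  have hRc : Continuous R := continuous_radius
  have hR1 : ∀ ξ', 1 ≤ R ξ' := fun ξ' => one_le_radius h.hB.le hτ0 ξ'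
  have hmS : MeasurableSet (outsideSet R) := (isOpen_outsideSet hRc).measurableSet
  have hφ0 : ∀ x ∉ upperHalf d, φ x = 0 := fun x hx =>
    image_eq_zero_of_notMem_tsupport fun hx' => hx (hs hx')
  have hint : ∀ x ∈ upperHalf d, Integrable (fun w : RSpace d × (ℝ × ℝ) =>
      Complex.exp (Complex.I * cdot x (snocC w.1 (arcPt (R w.1) w.2.2))) *
        circ k l B (p j) (q j) w.1 w.2.1 x *
        arcKernel B R (m₁ - j - l + 1) f w) (arcMeasure d) := fun x hx => by
    refine (hG.mul_const (bracket x ^ m₂)).mono' (hmeas x) ?_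
    filter_upwards [hGb] with w hw
    exact hw x hx
  have hdm : ∀ N : ℕ, AEStronglyMeasurable (fun w : RSpace d × (ℝ × ℝ) =>
      damp (m₁.toNat + 2) (1 / ((N : ℝ) + 1)) (arcPt (R w.1) w.2.2)) (arcMeasure d) := fun N => by
    have hm : Measurable (damp (m₁.toNat + 2) (1 / ((N : ℝ) + 1))) := by unfold damp; fun_prop
    exact (hm.comp (continuous_arcPt_comp hRc).measurable).aestronglyMeasurable
  have hbd : ∀ N : ℕ, ∀ x ∈ upperHalf d, ∀ᵐ w ∂(arcMeasure d),
      ‖damp (m₁.toNat + 2) (1 / ((N : ℝ) + 1)) (arcPt (R w.1) w.2.2) *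
        (Complex.exp (Complex.I * cdot x (snocC w.1 (arcPt (R w.1) w.2.2))) *
        circ k l B (p j) (q j) w.1 w.2.1 x * arcKernel B R (m₁ - j - l + 1) f w)‖
      ≤ G w * bracket x ^ m₂ := fun N x hx => by
    filter_upwards [ae_arcMeasure d, hGb] with w hw hw2
    rw [norm_mul]
    have h1 := norm_damp_le_one (m₁.toNat + 2) (hε N).le
      (arcPt_im_nonneg (R := R w.1) (by linarith [hR1 w.1]) hw)
    exact (mul_le_of_le_one_left (norm_nonneg _) h1).trans (hw2 x hx)
  refine tendsto_integral_of_dominated_convergence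
    (bound := fun x => (∫ w, G w ∂(arcMeasure d)) * (bracket x ^ m₂ * ‖φ x‖)) (fun N => ?_)
    ((integrable_bracket_mul hφ m₂).const_mul _) (fun N => ?_) ?_
  · obtain ⟨G', hG', hGb'⟩ := h.dominatedOn_damped ha hμ hν hdec (hε N) k l j hj
    exact (integral_integral_mul_test hφ (aestronglyMeasurable_of_continuousOn_prod hmS
      (h.continuousOn_damped hf (hε N) k l j hτ0 M)) hG'
      (by filter_upwards [hGb'] with w hw x using hw x (Set.mem_univ _))).2.1.aestronglyMeasurable
  · refine Eventually.of_forall fun x => ?_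
    by_cases hx : x ∈ upperHalf d
    · rw [h.integral_damped ha hμ hν hf hdec (hε N) k l j hj hx (hint x hx), norm_mul, ← mul_assoc]
      gcongr
      rw [← integral_mul_const]
      exact norm_integral_le_of_norm_le (hG.mul_const _) (hbd N x hx)
    · simp [hφ0 x hx]
  · refine Eventually.of_forall fun x => ?_
    by_cases hx : x ∈ upperHalf d
    · refine Tendsto.mul_const _ ?_
      refine Tendsto.congr (fun N => (h.integral_damped ha hμ hν hf hdec (hε N) k l j hj hx
        (hint x hx)).symm) ?_
      refine tendsto_integral_of_dominated_convergence (bound := fun w => G w * bracket x ^ m₂)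
        (fun N => (hdm N).mul (hmeas x)) (hG.mul_const _) (fun N => hbd N x hx) ?_
      refine Eventually.of_forall fun w => ?_
      simpa using (tendsto_damp (m₁.toNat + 2) (arcPt (R w.1) w.2.2)).mul_const
        (Complex.exp (Complex.I * cdot x (snocC w.1 (arcPt (R w.1) w.2.2))) *
          circ k l B (p j) (q j) w.1 w.2.1 x * arcKernel B R (m₁ - j - l + 1) f w)
    · simp [hφ0 x hx]

/-- The limit ε → 0 of the damped expansion is computed twice: on the frequency side, where
integration against φ has already produced an integrable function, and on the x side after the
change of contour. Equating the two avoids undamped integrals of the terms over the half lines at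
fixed x. -/
theorem pairing_eq_integral (h : IsRatExpansion μ ν m₁ m₂ a p q C D B r₀)
    (ha : IsSGSymbol μ ν m₁ m₂ a) (hμ : 1 ≤ μ) (hν : 1 ≤ ν) {f : RSpace (d + 1) → ℂ}
    (hf : LowerSupported f) {c : ℝ}
    (hdec : ∀ (ξ' : RSpace d) (z : ℂ), 0 ≤ z.im →
      bracket ξ' ^ (d + 1) * ‖hatC f (snocC ξ' z)‖ ≤ c)
    (k : Fin (d + 1)) (l M : ℕ)
    (hin : DominatedOn (volume.restrict (insideSet (radius (d := d) B (μ + ν - 1) M))) Set.univ m₂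
      (fun w x => Complex.exp (Complex.I * cdot x (snocC w.1 (w.2 : ℂ))) *
        symIter k l a x (snocR w.1 w.2) * hatC f (snocC w.1 (w.2 : ℂ))))
    (hrem : DominatedOn (volume.restrict (outsideSet (radius (d := d) B (μ + ν - 1) M))) Set.univ
      m₂ (fun w x => Complex.exp (Complex.I * cdot x (snocC w.1 (w.2 : ℂ))) *
        h.rem k l M x (snocR w.1 w.2) * hatC f (snocC w.1 (w.2 : ℂ))))
    (hmeas : ∀ j < M, ∀ x, AEStronglyMeasurable (fun w : RSpace d × (ℝ × ℝ) =>
      Complex.exp (Complex.I * cdot x (snocC w.1 (arcPt (radius B (μ + ν - 1) M w.1) w.2.2))) *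
        circ k l B (p j) (q j) w.1 w.2.1 x *
        arcKernel B (radius B (μ + ν - 1) M) (m₁ - j - l + 1) f w) (arcMeasure d))
    (harc : ∀ j < M, DominatedOn (arcMeasure d) (upperHalf d) m₂ (fun w x =>
      Complex.exp (Complex.I * cdot x (snocC w.1 (arcPt (radius B (μ + ν - 1) M w.1) w.2.2))) *
        circ k l B (p j) (q j) w.1 w.2.1 x *
        arcKernel B (radius B (μ + ν - 1) M) (m₁ - j - l + 1) f w))
    (hcont : ∀ j < M, ContinuousOn (arcPart B (radius B (μ + ν - 1) M) (m₁ - j - l + 1)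
      (circ k l B (p j) (q j)) f) (upperHalf d))
    {φ : RSpace (d + 1) → ℂ} (hφ : IsTest φ) (hs : tsupport φ ⊆ upperHalf d) :
    pairing (symIter k l a) f φ = ∫ x, h.density k l M f x * φ x := by
  have hτ0 : 0 ≤ μ + ν - 1 := by linarith
  have hε : ∀ N : ℕ, (0 : ℝ) < 1 / ((N : ℝ) + 1) := fun N => by positivity
  set R := radius (d := d) B (μ + ν - 1) M with hR
  have hRc : Continuous R := continuous_radius
  have hmI : MeasurableSet (insideSet R) := (isClosed_insideSet hRc).measurableSet
  have hmO : MeasurableSet (outsideSet R) := (isOpen_outsideSet hRc).measurableSet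
  have htame := ha.isTame_symIter (by linarith) k l
  have hP : Integrable (fun w : RSpace d × ℝ => hat f (snocR w.1 w.2) *
      testTransform (symIter k l a) φ (snocR w.1 w.2)) :=
    integrable_snocR (htame.integrable_pairing hf.integrable hφ (Nat.succ_pos d))
  have hs1 : Continuous (fun w : (RSpace d × ℝ) × RSpace (d + 1) =>
      symIter k l a w.2 (snocR w.1.1 w.1.2)) :=
    (ha.contDiff_symIter k l).continuous.comp
      (f := fun w : (RSpace d × ℝ) × RSpace (d + 1) => (w.2, snocR w.1.1 w.1.2))
      (continuous_snd.prodMk (continuous_snocR.comp continuous_fst))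
  have hw1 : Continuous (fun w : (RSpace d × ℝ) × RSpace (d + 1) =>
      hatC f (snocC w.1.1 (w.1.2 : ℂ))) := hf.continuous_hatC_real.comp continuous_fst
  -- inside the contour
  obtain ⟨Gi, hGi, hGib⟩ := hin
  obtain ⟨-, i2, i3⟩ := integral_integral_mul_test (m := volume.restrict (insideSet R)) hφ
    (f := fun w x => Complex.exp (Complex.I * cdot x (snocC w.1 (w.2 : ℂ))) *
      symIter k l a x (snocR w.1 w.2) * hatC f (snocC w.1 (w.2 : ℂ)))
    (aestronglyMeasurable_of_continuousOn_prod hmI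
      ((continuous_cexp_cdot_real.mul hs1).mul hw1).continuousOn) hGi
    (by filter_upwards [hGib] with w hw x using hw x (Set.mem_univ _))
  simp only [← hat_mul_testTransform] at i3
  -- the remainder
  obtain ⟨Gr, hGr, hGrb⟩ := hrem
  obtain ⟨r1, r2, r3⟩ := integral_integral_mul_test (m := volume.restrict (outsideSet R)) hφ
    (f := fun w x => Complex.exp (Complex.I * cdot x (snocC w.1 (w.2 : ℂ))) *
      h.rem k l M x (snocR w.1 w.2) * hatC f (snocC w.1 (w.2 : ℂ)))
    (aestronglyMeasurable_of_continuousOn_prod hmO (fun w hw =>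
      ((continuous_cexp_cdot_real.continuousAt.mul (h.continuousAt_rem ha k l M
        (h.B_le_abs_of_mem_outsideSet hτ0 hw.1))).mul hw1.continuousAt).continuousWithinAt)) hGr
    (by filter_upwards [hGrb] with w hw x using hw x (Set.mem_univ _))
  simp only [← hat_mul_testTransform] at r1 r3
  -- the terms of the expansion
  set bj : ℕ → RSpace (d + 1) → RSpace (d + 1) → ℂ := fun j =>
    symIter k l (fun y η => ratFun (p j) (q j) y (toC η)) with hbj
  set E : RSpace d × ℝ → ℂ := fun w => ∑ j ∈ Finset.range M, hat f (snocR w.1 w.2) *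
    testTransform (bj j) φ (snocR w.1 w.2) with hE
  have hsplit : ∀ w ∈ outsideSet R, hat f (snocR w.1 w.2) *
      testTransform (symIter k l a) φ (snocR w.1 w.2) =
      hat f (snocR w.1 w.2) * testTransform (h.rem k l M) φ (snocR w.1 w.2) + E w := by
    intro w hw
    have hBw := h.B_le_abs_of_mem_outsideSet hτ0 hw
    have hexp : Continuous (fun x : RSpace (d + 1) =>
        Complex.exp (Complex.I * (inner ℝ x (snocR w.1 w.2) : ℝ))) := by fun_prop
    have t1 := hφ.integrable_mul (g := fun x => Complex.exp (Complex.I *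
      (inner ℝ x (snocR w.1 w.2) : ℝ)) * h.rem k l M x (snocR w.1 w.2))
      (hexp.mul (h.contDiff_rem_left ha k l M (by simpa using hBw)).continuous)
    have t2 : ∀ j ∈ Finset.range M, Integrable (fun x => Complex.exp (Complex.I *
      (inner ℝ x (snocR w.1 w.2) : ℝ)) * bj j x (snocR w.1 w.2) * φ x) := fun j _ =>
      hφ.integrable_mul (g := fun x => Complex.exp (Complex.I *
        (inner ℝ x (snocR w.1 w.2) : ℝ)) * bj j x (snocR w.1 w.2))
        (hexp.mul (h.contDiff_real_left k l j (by simpa using hBw)).continuous)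
    simp only [hE]
    rw [← Finset.mul_sum, ← mul_add]
    congr 1
    unfold testTransform
    rw [← integral_finsetSum _ t2, ← integral_add t1 (integrable_finsetSum _ t2)]
    congr 1
    ext x
    simp only [rem, hbj]
    rw [← Finset.sum_mul, ← Finset.mul_sum]
    ring
  -- No term is estimated separately: the sum is integrable as the difference of the full pairing
  -- and the remainder.
  have hEI : Integrable E (volume.restrict (outsideSet R)) := by
    refine (hP.restrict.sub r1).congr ((ae_restrict_iff' hmO).2 (Eventually.of_forall
      fun w hw => ?_))
    simp only [Pi.sub_apply, hsplit w hw]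
    ring
  have hlim1 : Tendsto (fun N : ℕ => ∫ w in outsideSet R,
      damp (m₁.toNat + 2) (1 / ((N : ℝ) + 1)) (w.2 : ℂ) * E w) atTop
      (𝓝 (∫ w in outsideSet R, E w)) := by
    refine tendsto_integral_of_dominated_convergence (bound := fun w => ‖E w‖) (fun N => ?_)
      hEI.norm (fun N => ?_) ?_
    · have hm : Measurable (damp (m₁.toNat + 2) (1 / ((N : ℝ) + 1))) := by unfold damp; fun_prop
      exact (hm.comp (by fun_prop : Measurable fun w : RSpace d × ℝ =>
        (w.2 : ℂ))).aestronglyMeasurable.mul hEI.aestronglyMeasurable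
    · refine Eventually.of_forall fun w => ?_
      rw [norm_mul]
      exact mul_le_of_le_one_left (norm_nonneg _) (norm_damp_le_one _ (hε N).le (by simp))
    · refine Eventually.of_forall fun w => ?_
      simpa using (tendsto_damp (m₁.toNat + 2) (w.2 : ℂ)).mul_const (E w)
  have hlim2 : Tendsto (fun N : ℕ => ∫ w in outsideSet R,
      damp (m₁.toNat + 2) (1 / ((N : ℝ) + 1)) (w.2 : ℂ) * E w) atTop
      (𝓝 (∑ j ∈ Finset.range M, ∫ x, arcPart B R (m₁ - j - l + 1)
        (circ k l B (p j) (q j)) f x * φ x)) := by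
    have heq : ∀ N : ℕ, ∫ w in outsideSet R,
        damp (m₁.toNat + 2) (1 / ((N : ℝ) + 1)) (w.2 : ℂ) * E w =
        ∑ j ∈ Finset.range M, ∫ x, (∫ w in outsideSet R,
          h.damped f (1 / ((N : ℝ) + 1)) k l j w x) * φ x := by
      intro N
      have hj : ∀ j ∈ Finset.range M, Integrable (fun w => ∫ x, h.damped f (1 / ((N : ℝ) + 1))
          k l j w x * φ x) (volume.restrict (outsideSet R)) ∧
          ∫ w in outsideSet R, (∫ x, h.damped f (1 / ((N : ℝ) + 1)) k l j w x * φ x) =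
            ∫ x, (∫ w in outsideSet R, h.damped f (1 / ((N : ℝ) + 1)) k l j w x) * φ x := by
        intro j hj
        obtain ⟨G', hG', hGb'⟩ :=
          h.dominatedOn_damped ha hμ hν hdec (hε N) k l j (Finset.mem_range.1 hj)
        have key := integral_integral_mul_test hφ (aestronglyMeasurable_of_continuousOn_prod hmO
          (h.continuousOn_damped hf (hε N) k l j hτ0 M)) hG'
          (by filter_upwards [hGb'] with w hw x using hw x (Set.mem_univ _))
        exact ⟨key.1, key.2.2⟩
      rw [← Finset.sum_congr rfl fun j hj' => (hj j hj').2,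
        ← integral_finsetSum _ fun j hj' => (hj j hj').1]
      congr 1
      ext w
      simp only [hE]
      rw [Finset.mul_sum]
      refine Finset.sum_congr rfl fun j _ => ?_
      rw [hat_mul_testTransform, ← integral_const_mul]
      congr 1
      ext x
      simp only [damped, hbj]
      ring
    simp only [heq]
    exact tendsto_finsetSum _ fun j hj => h.tendsto_integral_damped ha hμ hν hf hdec k l j
      (Finset.mem_range.1 hj) (hmeas j (Finset.mem_range.1 hj)) (harc j (Finset.mem_range.1 hj))
      hφ hs
  -- Uniqueness of limits identifies the expansion on the half lines with its arc form.
  have hEeq := tendsto_nhds_unique hlim1 hlim2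
  have hA : ∀ j ∈ Finset.range M, Integrable (fun x => arcPart B R (m₁ - j - l + 1)
      (circ k l B (p j) (q j)) f x * φ x) := fun j hj =>
    integrable_mul_test (isOpen_upperHalf d) (hcont j (Finset.mem_range.1 hj)) hφ hs
  -- conclusion
  have r4 : Integrable (fun x => (∫ w in outsideSet R,
      Complex.exp (Complex.I * cdot x (snocC w.1 (w.2 : ℂ))) * h.rem k l M x (snocR w.1 w.2) *
        hatC f (snocC w.1 (w.2 : ℂ))) * φ x + ∑ j ∈ Finset.range M,
          arcPart B R (m₁ - j - l + 1) (circ k l B (p j) (q j)) f x * φ x) :=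
    r2.add (integrable_finsetSum _ hA)
  unfold pairing
  rw [integral_snocR, ← integral_add_compl hmI hP, compl_insideSet, i3,
    setIntegral_congr_fun hmO hsplit, integral_add r1 hEI, r3, hEeq,
    ← integral_finsetSum _ hA, ← integral_add r2 (integrable_finsetSum _ hA), ← integral_add i2 r4]
  congr 1
  ext x
  simp only [density, insidePart, outsidePart, ← hR]
  rw [← Finset.sum_mul]
  ring

end IsRatExpansion

end SGHalfSpace

end


noncomputable section

namespace SGHalfSpace

open MeasureTheory Filter Topology

/-! ### Combination of the bounds -/

theorem gevrey_mono {K K' A A' : ℝ} (hK : 0 ≤ K) (hKK : K ≤ K') (hA : 0 ≤ A) (hAA : A ≤ A')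
    (θ : ℝ) (S l r : ℕ) : gevrey K A θ S l r ≤ gevrey K' A' θ S l r := by
  have h1 := rfac_pos θ S
  have h2 := rfac_pos θ l
  have h3 := rfac_pos θ r
  have hK' : 0 ≤ K' := hK.trans hKK
  unfold gevrey
  gcongr

theorem pow_mul_gevrey_le {K A c I I' : ℝ} (hK : 0 ≤ K) (hA : 0 ≤ A) (hc : 1 ≤ c) (hI : I ≤ I')
    (hI' : 0 ≤ I') (θ : ℝ) (S l r : ℕ) :
    c ^ S * (gevrey K A θ S l r * I) ≤ gevrey (K * I') (A * c) θ S l r := by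
  have h1 := rfac_pos θ S
  have h2 := rfac_pos θ l
  have h3 := rfac_pos θ r
  have hcS : c ^ S ≤ c ^ (S + l + r) := pow_le_pow_right₀ hc (by omega)
  unfold gevrey
  calc _ ≤ c ^ S * (K * A ^ (S + l + r) * (rfac θ S * rfac θ l * rfac θ r) * I') := by
        gcongr
    _ ≤ c ^ (S + l + r) * (K * A ^ (S + l + r) * (rfac θ S * rfac θ l * rfac θ r) * I') := by
        gcongr
    _ = _ := by rw [mul_pow]; ring

theorem gevrey_add_le {K₁ K₂ A₁ A₂ : ℝ} (hK₁ : 0 ≤ K₁) (hK₂ : 0 ≤ K₂) (hA₁ : 1 ≤ A₁)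
    (hA₂ : 1 ≤ A₂) (θ : ℝ) (S l r : ℕ) :
    gevrey K₁ A₁ θ S l r + gevrey K₂ A₂ θ S l r ≤ gevrey (K₁ + K₂) (A₁ * A₂) θ S l r := by
  have e1 := gevrey_mono (A := A₁) (A' := A₁ * A₂) hK₁ le_rfl (by linarith)
    (le_mul_of_one_le_right (by linarith) hA₂) θ S l r
  have e2 := gevrey_mono (A := A₂) (A' := A₁ * A₂) hK₂ le_rfl (by linarith)
    (le_mul_of_one_le_left (by linarith) hA₁) θ S l r
  refine (add_le_add e1 e2).trans (le_of_eq ?_)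
  unfold gevrey
  ring

/-- The number S + M₀ of terms is swallowed by a geometric factor. -/
theorem natCast_add_le (S M₀ : ℕ) : ((S + M₀ : ℕ) : ℝ) ≤ (M₀ + 1) * 2 ^ S := by
  have h1 : (S : ℝ) + 1 ≤ 2 ^ S := by exact_mod_cast Nat.lt_two_pow_self
  have h2 : (1 : ℝ) ≤ 2 ^ S := one_le_pow₀ (by norm_num)
  push_cast
  nlinarith [Nat.cast_nonneg (α := ℝ) M₀, Nat.cast_nonneg (α := ℝ) S]

/-- The constants are uniform in k, l, r and S, although the contour, and with it the formula for V,
changes with S. -/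
theorem exists_density {d : ℕ} {μ ν θ : ℝ} {m₁ : ℤ} {m₂ : ℝ}
    {a : RSpace (d + 1) → RSpace (d + 1) → ℂ} {u : RSpace (d + 1) → ℂ}
    (hμ : 1 ≤ μ) (hν : 1 ≤ ν) (hθ : μ + ν - 1 ≤ θ) (ha : IsSGSymbol μ ν m₁ m₂ a)
    (hA : AssumptionA μ ν m₁ m₂ a) (hu : IsGelfandShilov θ θ (lowerHalf d) u) :
    ∃ K A : ℝ, 0 ≤ K ∧ 1 ≤ A ∧ ∀ (k : Fin (d + 1)) (l r S : ℕ), ∃ V : RSpace (d + 1) → ℂ,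
      BoundedOrder (upperHalf d) m₂ S (gevrey K A θ S l r) V ∧
      ∀ φ, IsTest φ → tsupport φ ⊆ upperHalf d →
        pairing (symIter k l a) (moment k u r) φ = ∫ x, V x * φ x := by
  obtain ⟨p, q, C, D, B, r₀, h⟩ := hA.exists_isRatExpansion
  -- The number of extra terms that makes the remainder integrable in all d + 1 frequencies.
  set M₀ := m₁.toNat + d + 3 with hM₀
  obtain ⟨K₁, A₁, q₁, hK₁, hA₁, hq₁, h₁⟩ :=
    exists_oscData_inside hμ hν hθ h.hB.le ha hu M₀
  obtain ⟨K₂, A₂, q₂, hK₂, hA₂, hq₂, h₂⟩ := h.exists_oscData_rem hμ hν hθ ha hu hM₀.symm.le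
  obtain ⟨K₃, A₃, q₃, hK₃, hA₃, hq₃, h₃⟩ := h.exists_oscData_arc (m₂ := m₂) hμ hν hθ hu M₀
  obtain ⟨K₀, A₀, hK₀, hA₀, h₀⟩ := hu.exists_hatC_moment_le (by linarith)
  set I := ∫ w : RSpace d × ℝ, freqWeight w with hI
  set J := ∫ w, arcWeight w ∂(arcMeasure d) with hJ
  have hfw : ∀ w : RSpace d × ℝ, 0 ≤ freqWeight w := fun w => by
    unfold freqWeight; have := bracket_pos w.1; positivity
  have hI0 : 0 ≤ I := integral_nonneg hfw
  have hJ0 : 0 ≤ J := integral_nonneg fun w => by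
    unfold arcWeight; have := bracket_pos w.1; positivity
  have hIs : ∀ s : Set (RSpace d × ℝ), ∫ w in s, freqWeight w ≤ I := fun s =>
    setIntegral_le_integral (integrable_freqWeight d) (Eventually.of_forall hfw)
  refine ⟨K₁ * I + K₂ * I + K₃ * ((M₀ + 1) * J), A₁ * (1 + q₁) * (A₂ * (1 + q₂)) *
    (A₃ * ((1 + q₃) * 2)), by positivity, ?_, fun k l r S => ?_⟩
  · refine one_le_mul_of_one_le_of_one_le (one_le_mul_of_one_le_of_one_le
      (one_le_mul_of_one_le_of_one_le hA₁ (by linarith))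
      (one_le_mul_of_one_le_of_one_le hA₂ (by linarith)))
      (one_le_mul_of_one_le_of_one_le hA₃ (by linarith))
  obtain ⟨G₁, Z₁, o₁⟩ := h₁ k l r S
  obtain ⟨G₂, Z₂, o₂⟩ := h₂ k l r S
  have hβ₁ := (integrable_freqWeight d).restrict
    (s := insideSet (radius B (μ + ν - 1) (S + M₀)))
  have hβ₂ := (integrable_freqWeight d).restrict
    (s := outsideSet (radius B (μ + ν - 1) (S + M₀)))
  have b₁ := (o₁.boundedOrder isOpen_univ hq₁ hβ₁).subset (Set.subset_univ (upperHalf d))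
  have b₂ := (o₂.boundedOrder isOpen_univ hq₂ hβ₂).subset (Set.subset_univ (upperHalf d))
  have b₃ : ∀ j < S + M₀, BoundedOrder (upperHalf d) m₂ S
      ((1 + q₃) ^ S * (gevrey K₃ A₃ θ S l r * J))
      (arcPart B (radius B (μ + ν - 1) (S + M₀)) (m₁ - j - l + 1) (circ k l B (p j) (q j))
        (moment k u r)) := fun j hj => by
    obtain ⟨G₃, Z₃, o₃⟩ := h₃ k l r S j hj
    exact o₃.boundedOrder (isOpen_upperHalf d) hq₃ (integrable_arcWeight d)
  refine ⟨h.density k l (S + M₀) (moment k u r), ?_, fun φ hφ hs => ?_⟩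
  · refine ((b₁.add (isOpen_upperHalf d) b₂).add (isOpen_upperHalf d)
      (BoundedOrder.sum (isOpen_upperHalf d) (S + M₀) b₃)).mono ?_
    have c₁ := pow_mul_gevrey_le (A := A₁) hK₁.le (by linarith) (show 1 ≤ 1 + q₁ by linarith)
      (hIs (insideSet (radius B (μ + ν - 1) (S + M₀)))) hI0 θ S l r
    have c₂ := pow_mul_gevrey_le (A := A₂) hK₂.le (by linarith) (show 1 ≤ 1 + q₂ by linarith)
      (hIs (outsideSet (radius B (μ + ν - 1) (S + M₀)))) hI0 θ S l r
    have c₃ : ((S + M₀ : ℕ) : ℝ) * ((1 + q₃) ^ S * (gevrey K₃ A₃ θ S l r * J)) ≤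
        gevrey (K₃ * ((M₀ + 1) * J)) (A₃ * ((1 + q₃) * 2)) θ S l r := by
      have g0 := gevrey_pos hK₃ (by linarith : 0 < A₃) θ S l r
      refine le_trans ?_ (pow_mul_gevrey_le (A := A₃) hK₃.le (by linarith)
        (show 1 ≤ (1 + q₃) * 2 by linarith) le_rfl (by positivity) θ S l r)
      calc _ ≤ ((M₀ + 1) * 2 ^ S) * ((1 + q₃) ^ S * (gevrey K₃ A₃ θ S l r * J)) :=
            mul_le_mul_of_nonneg_right (natCast_add_le S M₀) (by positivity)
        _ = _ := by rw [mul_pow]; ring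
    refine (add_le_add (add_le_add c₁ c₂) c₃).trans ?_
    refine (add_le_add_left (gevrey_add_le (by positivity) (by positivity)
      (one_le_mul_of_one_le_of_one_le hA₁ (by linarith))
      (one_le_mul_of_one_le_of_one_le hA₂ (by linarith)) θ S l r) _).trans ?_
    exact gevrey_add_le (by positivity) (by positivity)
      (one_le_mul_of_one_le_of_one_le (one_le_mul_of_one_le_of_one_le hA₁ (by linarith))
        (one_le_mul_of_one_le_of_one_le hA₂ (by linarith)))
      (one_le_mul_of_one_le_of_one_le hA₃ (by linarith)) θ S l r
  · refine h.pairing_eq_integral ha hμ hν (hu.lowerSupported_moment (by linarith) k r)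
      (fun ξ' z hz => h₀ k r (d + 1) ξ' z hz) k l (S + M₀) (o₁.dominatedOn hβ₁)
      (o₂.dominatedOn hβ₂) (fun j hj => ?_) (fun j hj => ?_)
      (fun j hj => (b₃ j hj).1.continuousOn) hφ hs
    · obtain ⟨G₃, Z₃, o₃⟩ := h₃ k l r S j hj
      exact o₃.meas
    · obtain ⟨G₃, Z₃, o₃⟩ := h₃ k l r S j hj
      exact o₃.dominatedOn (integrable_arcWeight d)

end SGHalfSpace

end


noncomputable section

namespace SGHalfSpace

open MeasureTheory Filter Topology

/-! ### Moments of the density -/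

theorem IsTest.coord_pow_mul {n : ℕ} {φ : RSpace n → ℂ} (hφ : IsTest φ) (k : Fin n) (N : ℕ) :
    IsTest (fun x => (x k : ℂ) ^ N * φ x) :=
  ⟨(contDiff_coord_pow k N).mul hφ.1, hφ.2.mul_left⟩

/-- Each factor x_k either passes to u as a moment or differentiates the symbol. Both alternatives
raise l + r by one, so N steps give 2^N terms governed by the same factorial of l + r + N. -/
theorem exists_density_coord_pow {d : ℕ} {μ ν θ : ℝ} {m₁ : ℤ} {m₂ : ℝ}
    {a : RSpace (d + 1) → RSpace (d + 1) → ℂ} {u : RSpace (d + 1) → ℂ}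
    (hμ : 1 ≤ μ) (hν : 1 ≤ ν) (hθ : μ + ν - 1 ≤ θ) (ha : IsSGSymbol μ ν m₁ m₂ a)
    (hA : AssumptionA μ ν m₁ m₂ a) (hu : IsGelfandShilov θ θ (lowerHalf d) u) :
    ∃ K A : ℝ, 0 ≤ K ∧ 1 ≤ A ∧ ∀ (k : Fin (d + 1)) (S N l r : ℕ), ∃ V : RSpace (d + 1) → ℂ,
      BoundedOrder (upperHalf d) m₂ S
        (K * A ^ (S + l + r) * rfac θ S * ((2 * A) ^ N * rfac θ (l + r + N))) V ∧
      ∀ φ, IsTest φ → tsupport φ ⊆ upperHalf d →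
        pairing (symIter k l a) (moment k u r) (fun x => (x k : ℂ) ^ N * φ x) =
          ∫ x, V x * φ x := by
  obtain ⟨K, A, hK, hA, h⟩ := exists_density hμ hν hθ ha hA hu
  refine ⟨K, A, hK, hA, fun k S N => ?_⟩
  induction N with
  | zero =>
    intro l r
    obtain ⟨V, hV, hp⟩ := h k l r S
    refine ⟨V, hV.mono ?_, fun φ hφ hs => by simpa using hp φ hφ hs⟩
    have h1 := rfac_mul_le (θ := θ) (by linarith) l r
    have h2 := rfac_pos θ S
    unfold gevrey
    calc K * A ^ (S + l + r) * (rfac θ S * rfac θ l * rfac θ r)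
        = K * A ^ (S + l + r) * rfac θ S * (rfac θ l * rfac θ r) := by ring
      _ ≤ K * A ^ (S + l + r) * rfac θ S * rfac θ (l + r) := by gcongr
      _ = _ := by simp
  | succ N ih =>
    intro l r
    obtain ⟨V₁, hV₁, hp₁⟩ := ih l (r + 1)
    obtain ⟨V₂, hV₂, hp₂⟩ := ih (l + 1) r
    refine ⟨fun x => 1 * V₁ x + Complex.I * V₂ x,
      (hV₁.lin (isOpen_upperHalf d) hV₂ 1 Complex.I).mono (le_of_eq ?_), fun φ hφ hs => ?_⟩
    -- Both branches have the same bound; their sum gives a factor 2, and the additional unit of l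
    -- or r a factor A.
    · rw [norm_one, Complex.norm_I, show l + (r + 1) + N = l + r + (N + 1) by ring,
        show l + 1 + r + N = l + r + (N + 1) by ring]
      ring
    · have hm := hu.lowerSupported_moment (by linarith) k r
      have e1 : symIter k 1 (symIter k l a) = symIter k (l + 1) a := by
        ext x ξ
        simp only [symIter, Function.iterate_succ_apply', Function.iterate_zero, id]
        rfl
      have e2 : (fun x : RSpace (d + 1) => (x k : ℂ) ^ (N + 1) * φ x) =
          fun x => (x k : ℂ) * ((x k : ℂ) ^ N * φ x) := by
        ext x; ring
      have ht := ha.isTame_symIter (by linarith) k (l + 1)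
      rw [← e1] at ht
      rw [e2, pairing_coord_mul k (ha.isTame_symIter (by linarith) k l) ht hm.meas hm.int
        (hφ.coord_pow_mul k N), coord_mul_moment, e1, hp₁ φ hφ hs, hp₂ φ hφ hs,
        ← integral_const_mul, ← integral_add
          (integrable_mul_test (isOpen_upperHalf d) hV₁.1.continuousOn hφ hs)
          ((integrable_mul_test (isOpen_upperHalf d) hV₂.1.continuousOn hφ hs).const_mul _)]
      congr 1
      ext x
      ring

/-- The fundamental lemma of the calculus of variations: real test functions give equality almost
everywhere, and continuity improves it to equality on Ω. -/
theorem eqOn_of_integral_mul_test {n : ℕ} {Ω : Set (RSpace n)} (hΩ : IsOpen Ω)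
    {V W : RSpace n → ℂ} (hV : ContinuousOn V Ω) (hW : ContinuousOn W Ω)
    (h : ∀ φ, IsTest φ → tsupport φ ⊆ Ω → ∫ x, V x * φ x = ∫ x, W x * φ x) :
    Set.EqOn V W Ω := by
  have h0 := hΩ.ae_eq_zero_of_integral_contDiff_smul_eq_zero (μ := volume) (f := fun x => V x - W x)
    ((hV.sub hW).locallyIntegrableOn hΩ.measurableSet) fun g hg hgc hgs => by
      have hsupp : tsupport (fun x => (g x : ℂ)) ⊆ tsupport g :=
        tsupport_comp_subset Complex.ofReal_zero g
      have hφ : IsTest (fun x => (g x : ℂ)) :=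
        ⟨Complex.ofRealCLM.contDiff.comp hg, hgc.comp_left Complex.ofReal_zero⟩
      have e := h _ hφ (hsupp.trans hgs)
      have := integral_sub (integrable_mul_test hΩ hV hφ (hsupp.trans hgs))
        (integrable_mul_test hΩ hW hφ (hsupp.trans hgs))
      rw [e, sub_self] at this
      rw [← this]
      congr 1
      ext x
      rw [Complex.real_smul]
      ring
  refine Measure.eqOn_open_of_ae_eq (μ := volume) ?_ hΩ hV hW
  rw [EventuallyEq, ae_restrict_iff' hΩ.measurableSet]
  filter_upwards [h0] with x hx hxΩ
  exact sub_eq_zero.1 (hx hxΩ)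

/-- The density of the restriction to the upper half space, with bounds for the derivatives of its
products with powers of the coordinates. -/
theorem exists_smooth_density {d : ℕ} {μ ν θ : ℝ} {m₁ : ℤ} {m₂ : ℝ}
    {a : RSpace (d + 1) → RSpace (d + 1) → ℂ} {u : RSpace (d + 1) → ℂ}
    (hμ : 1 ≤ μ) (hν : 1 ≤ ν) (hθ : μ + ν - 1 ≤ θ) (ha : IsSGSymbol μ ν m₁ m₂ a)
    (hA : AssumptionA μ ν m₁ m₂ a) (hu : IsGelfandShilov θ θ (lowerHalf d) u) :
    ∃ (v : RSpace (d + 1) → ℂ) (K A E : ℝ), 0 ≤ K ∧ 1 ≤ A ∧ 1 ≤ E ∧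
      ContDiffOn ℝ ∞ v (upperHalf d) ∧
      (∀ φ, IsTest φ → tsupport φ ⊆ upperHalf d →
        pairing a (extendZero (lowerHalf d) u) φ = ∫ x, v x * φ x) ∧
      ∀ (k : Fin (d + 1)) (N : ℕ) (W : List (Fin (d + 1))), ∀ x ∈ upperHalf d,
        ‖wderiv W (fun y => (y k : ℂ) ^ N * v y) x‖ ≤
          K * bracket x ^ m₂ * (A ^ W.length * rfac θ W.length) * (E ^ N * rfac θ N) := by
  obtain ⟨K, A, hK, hA, h⟩ := exists_density_coord_pow hμ hν hθ ha hA hu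
  have e0 : ∀ k : Fin (d + 1), moment k u 0 = extendZero (lowerHalf d) u := fun k => by
    simp [moment]
  have e1 : ∀ k : Fin (d + 1), symIter k 0 a = a := fun k => rfl
  have hU := isOpen_upperHalf d
  choose V hV hp using fun k S N => h k S N 0 0
  simp only [e0, e1] at hp
  set v := V (Fin.last d) 0 0 with hv
  have hvp : ∀ φ, IsTest φ → tsupport φ ⊆ upperHalf d →
      pairing a (extendZero (lowerHalf d) u) φ = ∫ x, v x * φ x := fun φ hφ hs => by
    simpa using hp (Fin.last d) 0 0 φ hφ hs
  have hvc : ContinuousOn v (upperHalf d) := (hV (Fin.last d) 0 0).1.continuousOn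
  -- x_k^N v and V k S N represent the same distribution, so v does not depend on the contours used
  -- and inherits all the bounds.
  have key : ∀ k S N, Set.EqOn (V k S N) (fun x => (x k : ℂ) ^ N * v x) (upperHalf d) :=
    fun k S N => by
    refine eqOn_of_integral_mul_test hU (hV k S N).1.continuousOn
      ((contDiff_coord_pow k N).continuous.continuousOn.mul hvc) fun φ hφ hs => ?_
    rw [← hp k S N φ hφ hs, hvp _ (hφ.coord_pow_mul k N)
      ((tsupport_mul_subset_right).trans hs)]
    congr 1
    ext x
    ring
  refine ⟨v, K, A, 2 * A, hK, hA, by linarith, ?_, hvp, fun k N W x hx => ?_⟩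
  -- For each S the density built with S derivatives shows v to be of class C^S.
  · refine contDiffOn_infty.2 fun S => (hV (Fin.last d) S 0).1.congr fun x hx => ?_
    simpa using (key (Fin.last d) S 0 hx).symm
  -- The density for S = |W| is the one whose bound has the right factorial.
  · rw [← wderiv_congr hU W (key k W.length N) hx]
    refine ((hV k W.length N).2 W le_rfl x hx).trans (le_of_eq ?_)
    simp only [add_zero, zero_add]
    ring

/-! ### Characterisation of the Gelfand-Shilov functions -/

/-- x_k^N ∂_i g equals ∂_i(x_k^N g) minus N x_k^{N-1} g when i = k, and just the first term
otherwise. Both pieces obey the bound for one more derivative, so moving a whole word past the power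
costs 2^{|W|}. -/
theorem norm_wderiv_coord_pow_mul_wderiv_le {n : ℕ} {Ω : Set (RSpace n)} (hΩ : IsOpen Ω)
    {v : RSpace n → ℂ} (hv : ContDiffOn ℝ ∞ v Ω) (k : Fin n) {θ A E H : ℝ} (hθ : 1 ≤ θ)
    (hA : 1 ≤ A) (hE : 1 ≤ E) (hH : 0 ≤ H) {x : RSpace n} (hx : x ∈ Ω)
    (hb : ∀ (V : List (Fin n)) (N : ℕ), ‖wderiv V (fun y => (y k : ℂ) ^ N * v y) x‖ ≤
      H * (A ^ V.length * rfac θ V.length) * (E ^ N * rfac θ N)) (W : List (Fin n)) :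
    ∀ (V : List (Fin n)) (N : ℕ), ‖wderiv V (fun y => (y k : ℂ) ^ N * wderiv W v y) x‖ ≤
      H * (A ^ (V.length + W.length) * rfac θ (V.length + W.length)) * (E ^ N * rfac θ N)
        * 2 ^ W.length := by
  induction W with
  | nil => intro V N; simpa using hb V N
  | cons i W ih =>
    intro V N
    have hw := contDiffOn_wderiv hΩ W hv
    have hg : ∀ N, ContDiffOn ℝ ∞ (fun y => (y k : ℂ) ^ N * wderiv W v y) Ω := fun N =>
      (contDiff_coord_pow k N).contDiffOn.mul hw
    set c : ℂ := if i = k then (N : ℂ) else 0 with hc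
    have hcN : ‖c‖ ≤ N := by
      rw [hc]; split_ifs <;> simp
    have e : Set.EqOn (fun y => (y k : ℂ) ^ N * wderiv (i :: W) v y)
        (fun y => 1 * pderiv ℝ i (fun y => (y k : ℂ) ^ N * wderiv W v y) y
          + (-c) * ((y k : ℂ) ^ (N - 1) * wderiv W v y)) Ω := fun y hy => by
      have hd : DifferentiableAt ℝ (wderiv W v) y :=
        (hw.contDiffAt (hΩ.mem_nhds hy)).differentiableAt (by simp)
      simp only [wderiv_cons]
      rw [pderiv_coord_pow_mul k i N hd]
      ring
    rw [wderiv_congr hΩ V e hx, wderiv_lin_nat hΩ (S := V.length) V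
      ((contDiffOn_pderiv hΩ i (hg N) (m := ∞) (by simp)).of_le (by exact_mod_cast le_top))
      ((hg (N - 1)).of_le (by exact_mod_cast le_top)) 1 (-c) le_rfl hx]
    set L := V.length + W.length with hL
    have hlen : V.length + (i :: W).length = L + 1 := by simp [hL]; ring
    have hr := rfac_mono (θ := θ) (by linarith) (Nat.le_succ L)
    have hL0 := rfac_pos θ L
    have hL1 := rfac_pos θ (L + 1)
    have hN0 := rfac_pos θ N
    have t1 : ‖wderiv V (pderiv ℝ i (fun y => (y k : ℂ) ^ N * wderiv W v y)) x‖ ≤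
        H * (A ^ (L + 1) * rfac θ (L + 1)) * (E ^ N * rfac θ N) * 2 ^ W.length := by
      have := ih (V ++ [i]) N
      rw [wderiv_append, wderiv_cons, wderiv_nil] at this
      refine this.trans (le_of_eq ?_)
      rw [show (V ++ [i]).length + W.length = L + 1 by simp [hL]; ring]
    have t2 : ‖c‖ * ‖wderiv V (fun y => (y k : ℂ) ^ (N - 1) * wderiv W v y) x‖ ≤
        H * (A ^ (L + 1) * rfac θ (L + 1)) * (E ^ N * rfac θ N) * 2 ^ W.length := by
      -- The factor N meets (N-1)!^θ and restores N!^θ; for N = 0 the term is absent.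
      rcases N with _ | N
      · have : ‖c‖ = 0 := le_antisymm (by simpa using hcN) (norm_nonneg _)
        rw [this, zero_mul]
        positivity
      · have i1 := ih V N
        have i2 := natCast_mul_rfac_le hθ N
        have hN1 := rfac_pos θ N
        push_cast at hcN
        rw [Nat.add_sub_cancel]
        calc _ ≤ (N + 1 : ℝ) *
              (H * (A ^ L * rfac θ L) * (E ^ N * rfac θ N) * 2 ^ W.length) := by gcongr
          _ = H * (A ^ L * rfac θ L) * (E ^ N * ((N + 1 : ℝ) * rfac θ N)) * 2 ^ W.length := by ring
          _ ≤ H * (A ^ (L + 1) * rfac θ (L + 1)) * (E ^ (N + 1) * rfac θ (N + 1))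
              * 2 ^ W.length := by
            gcongr
            · omega
            · omega
    rw [hlen]
    refine (norm_add_le _ _).trans ?_
    rw [norm_mul, norm_mul, norm_one, one_mul, norm_neg]
    refine (add_le_add t1 t2).trans (le_of_eq ?_)
    rw [List.length_cons]
    ring

theorem bracket_pow_le_sum {n : ℕ} (hn : 0 < n) (x : RSpace n) (p : ℕ) :
    bracket x ^ p ≤ (2 * n : ℝ) ^ p * (∑ i, |x i| ^ p + 2) := by
  have hn1 : (1 : ℝ) ≤ (n : ℝ) ^ p := one_le_pow₀ (by exact_mod_cast hn)
  have h1 : bracket x ^ p ≤ 2 ^ p * (1 + ‖x‖ ^ p) := by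
    refine (pow_le_pow_left₀ (bracket_pos x).le (bracket_le_one_add_norm x) p).trans ?_
    refine (add_pow_le zero_le_one (norm_nonneg x) p).trans ?_
    rw [one_pow]
    gcongr
    · norm_num
    · omega
  have h2 := norm_mul_pow_le_sum x p
  have h3 : 0 ≤ ∑ i, |x i| ^ p := Finset.sum_nonneg fun i _ => by positivity
  calc bracket x ^ p ≤ 2 ^ p * (1 + ‖x‖ ^ p) := h1
    _ ≤ 2 ^ p * ((n : ℝ) ^ p + (n : ℝ) ^ p * (∑ i, |x i| ^ p + 1)) := by gcongr
    _ = _ := by rw [mul_pow]; ring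

theorem abs_mpow_le {n : ℕ} (x : RSpace n) (α : Fin n → ℕ) : |mpow x α| ≤ bracket x ^ msum α := by
  unfold mpow msum
  rw [Finset.abs_prod, ← Finset.prod_pow_eq_pow_sum]
  refine Finset.prod_le_prod (fun i _ => abs_nonneg _) fun i _ => ?_
  rw [abs_pow]
  exact pow_le_pow_left₀ (abs_nonneg _) (abs_apply_le_bracket x i) _

theorem rfac_msum_le {n : ℕ} {θ : ℝ} (hθ : 0 ≤ θ) (α : Fin n → ℕ) :
    rfac θ (msum α) ≤ ((n : ℝ) ^ θ) ^ msum α * mfact α ^ θ := by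
  unfold rfac
  refine (Real.rpow_le_rpow (by positivity) (factorial_msum_le α) hθ).trans (le_of_eq ?_)
  rw [Real.mul_rpow (by positivity) (mfact_pos α).le, ← Real.rpow_natCast, ← Real.rpow_natCast,
    ← Real.rpow_mul (by positivity), ← Real.rpow_mul (by positivity), mul_comm θ]

/-- Single coordinate powers control ⟨x⟩^p, hence all monomials. Using ⌈|m₂|⌉ more powers than the
monomial requires cancels the factor ⟨x⟩^{m₂}, at the price of a shifted factorial. -/
theorem isGelfandShilov_of_coord_pow {n : ℕ} (hn : 0 < n) {Ω : Set (RSpace n)} {v : RSpace n → ℂ}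
    (hv : ContDiffOn ℝ ∞ v Ω) {θ K A E m₂ : ℝ} (hθ : 0 ≤ θ) (hK : 0 ≤ K) (hA : 1 ≤ A) (hE : 1 ≤ E)
    (hb : ∀ (k : Fin n) (N : ℕ) (W : List (Fin n)), ∀ x ∈ Ω, |x k| ^ N * ‖wderiv W v x‖ ≤
      K * bracket x ^ m₂ * (A ^ W.length * rfac θ W.length) * (E ^ N * rfac θ N)) :
    IsGelfandShilov θ θ Ω v := by
  set c := ⌈|m₂|⌉₊ with hc
  obtain ⟨K₀, A₀, hK₀, hA₀, h₀⟩ := rfac_add_const_le hθ c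
  have hn1 : (1 : ℝ) ≤ n := by exact_mod_cast hn
  have hnθ : (1 : ℝ) ≤ (n : ℝ) ^ θ := Real.one_le_rpow hn1 hθ
  set F : ℝ := 2 * n * E with hF
  have hF1 : 1 ≤ F := one_le_mul_of_one_le_of_one_le (by linarith) hE
  set X : ℝ := F * A₀ * (n : ℝ) ^ θ with hX
  set Y : ℝ := A * (n : ℝ) ^ θ with hY
  have hX1 : 1 ≤ X := one_le_mul_of_one_le_of_one_le (one_le_mul_of_one_le_of_one_le hF1 hA₀) hnθ
  have hY1 : 1 ≤ Y := one_le_mul_of_one_le_of_one_le hA hnθ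
  have hcb : ∀ x : RSpace n, bracket x ^ m₂ ≤ bracket x ^ c := fun x => by
    rw [← Real.rpow_natCast]
    exact Real.rpow_le_rpow_of_exponent_le (bracket_ge_one x)
      ((le_abs_self m₂).trans (Nat.le_ceil _))
  refine ⟨hv, (n + 2) * (K + 1) * F ^ c * K₀, X * Y, by positivity, by positivity,
    fun α β x hx => ?_⟩
  rw [mderiv_eq_wderiv]
  set W := mword β with hW
  have hWl : W.length = msum β := length_mword β
  set N := msum α with hN
  set G := ‖wderiv W v x‖ with hG
  have hG0 : 0 ≤ G := norm_nonneg _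
  have hbc : 0 < bracket x ^ c := pow_pos (bracket_pos x) c
  -- The c surplus powers are divided out at the end, against the bound ⟨x⟩^{m₂} ≤ ⟨x⟩^c.
  set p := N + c with hp
  have hrW := rfac_pos θ (msum β)
  have hrp := rfac_pos θ p
  set R := (K + 1) * bracket x ^ c * (A ^ msum β * rfac θ (msum β)) * (E ^ p * rfac θ p) with hR
  have hR0 : 0 ≤ R := by positivity
  have s1 : ∀ k : Fin n, |x k| ^ p * G ≤ R := fun k => by
    refine (hb k p W x hx).trans ?_
    rw [hWl, hR]
    gcongr
    · have := bracket_pos x; positivity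
    · linarith
    · exact hcb x
  have s2 : G ≤ R := by
    have := hb ⟨0, hn⟩ 0 W x hx
    rw [pow_zero, one_mul, hWl] at this
    refine this.trans ?_
    have h1 : rfac θ 0 ≤ rfac θ p := rfac_mono hθ (Nat.zero_le p)
    have h2 := rfac_pos θ 0
    rw [hR]
    gcongr
    · have := bracket_pos x; positivity
    · linarith
    · exact hcb x
    · omega
  have s3 : bracket x ^ p * G ≤ (2 * n : ℝ) ^ p * ((n + 2) * R) := by
    calc bracket x ^ p * G ≤ (2 * n : ℝ) ^ p * (∑ i, |x i| ^ p + 2) * G := by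
          gcongr; exact bracket_pow_le_sum hn x p
      _ = (2 * n : ℝ) ^ p * (∑ i, |x i| ^ p * G + 2 * G) := by
          rw [← Finset.sum_mul]; ring
      _ ≤ (2 * n : ℝ) ^ p * (∑ _i : Fin n, R + 2 * R) := by
          gcongr with i _; exact s1 i
      _ = _ := by
          rw [Finset.sum_const, Finset.card_univ, Fintype.card_fin, nsmul_eq_mul]; ring
  have s4 : bracket x ^ N * G ≤
      (n + 2) * (K + 1) * F ^ p * (A ^ msum β * rfac θ (msum β)) * rfac θ p := by
    refine le_of_mul_le_mul_right ?_ hbc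
    calc bracket x ^ N * G * bracket x ^ c = bracket x ^ p * G := by rw [hp, pow_add]; ring
      _ ≤ _ := s3
      _ = _ := by rw [hR, hF, mul_pow]; ring
  have hα := rfac_msum_le hθ α
  have hβ := rfac_msum_le hθ β
  have hfα : 0 < mfact α ^ θ := Real.rpow_pos_of_pos (mfact_pos α) θ
  have hfβ : 0 < mfact β ^ θ := Real.rpow_pos_of_pos (mfact_pos β) θ
  calc |mpow x α| * G ≤ bracket x ^ N * G := by gcongr; exact abs_mpow_le x α
    _ ≤ _ := s4
    _ ≤ (n + 2) * (K + 1) * F ^ p * (A ^ msum β * (((n : ℝ) ^ θ) ^ msum β * mfact β ^ θ))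
        * (K₀ * A₀ ^ N * (((n : ℝ) ^ θ) ^ N * mfact α ^ θ)) := by
        have : rfac θ p ≤ K₀ * A₀ ^ N * (((n : ℝ) ^ θ) ^ N * mfact α ^ θ) :=
          (h₀ N).trans (mul_le_mul_of_nonneg_left hα (by positivity))
        gcongr
    _ = (n + 2) * (K + 1) * F ^ c * K₀ * (X ^ N * Y ^ msum β) * mfact α ^ θ * mfact β ^ θ := by
        rw [hX, hY, mul_pow, mul_pow, mul_pow, hp, pow_add]; ring
    _ ≤ (n + 2) * (K + 1) * F ^ c * K₀ * (X * Y) ^ (N + msum β) * mfact α ^ θ * mfact β ^ θ := by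
        have : X ^ N * Y ^ msum β ≤ (X * Y) ^ (N + msum β) := by
          rw [mul_pow X Y]
          exact mul_le_mul (pow_le_pow_right₀ hX1 (Nat.le_add_right _ _))
            (pow_le_pow_right₀ hY1 (Nat.le_add_left _ _)) (by positivity) (by positivity)
        gcongr

end SGHalfSpace

end

/-! ### Conclusion: normalisation and Gelfand-Shilov bounds -/

theorem mainTheorem6 (d : ℕ) (μ ν θ : ℝ) (hμ : 1 < μ) (hν : 1 < ν) (hθ : μ + ν - 1 ≤ θ)
    (m₁ : ℤ) (m₂ : ℝ)
    (a : SGHalfSpace.RSpace (d + 1) → SGHalfSpace.RSpace (d + 1) → ℂ)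
    (ha : SGHalfSpace.IsSGSymbol μ ν m₁ m₂ a)
    (hA : SGHalfSpace.AssumptionA μ ν m₁ m₂ a)
    (u : SGHalfSpace.RSpace (d + 1) → ℂ)
    (hu : SGHalfSpace.IsGelfandShilov θ θ (SGHalfSpace.lowerHalf d) u) :
    ∃ v : SGHalfSpace.RSpace (d + 1) → ℂ,
      SGHalfSpace.IsGelfandShilov θ θ (SGHalfSpace.upperHalf d) v ∧
      SGHalfSpace.OpRestrictsTo a (SGHalfSpace.extendZero (SGHalfSpace.lowerHalf d) u)
        (SGHalfSpace.upperHalf d) v := by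
  open SGHalfSpace MeasureTheory in
  have hU := isOpen_upperHalf d
  obtain ⟨v, K, A, E, hK, hA1, hE, hv, hp, hb⟩ :=
    exists_smooth_density hμ.le hν.le hθ ha hA hu
  set c : ℂ := ((2 * Real.pi : ℝ) : ℂ)⁻¹ ^ (d + 1) with hc
  refine ⟨fun x => c * v x, ?_, fun φ hφ hφc hs => ⟨?_, ?_⟩⟩
  · have hcv : ContDiffOn ℝ ∞ (fun x => c * v x) (upperHalf d) := contDiffOn_const.mul hv
    -- The constant A is doubled because taking the power x_k^N out of the derivative costs 2^{|W|}.
    refine isGelfandShilov_of_coord_pow (K := ‖c‖ * K) (A := A * 2) (E := E) (m₂ := m₂)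
      d.succ_pos hcv (by linarith) (by positivity) (by linarith) hE fun k N W x hx => ?_
    -- The outer word is empty: this is the bound on |x_k|^N |∂_W v| itself.
    have h0 := norm_wderiv_coord_pow_mul_wderiv_le hU hv k (H := K * bracket x ^ m₂)
      (by linarith : 1 ≤ θ) hA1 hE
      (mul_nonneg hK (Real.rpow_nonneg (bracket_pos x).le _)) hx
      (fun V N => hb k N V x hx) W [] N
    rw [wderiv_const_mul hU W c hv hx, norm_mul]
    simp only [wderiv_nil, norm_mul, norm_pow, Complex.norm_real, Real.norm_eq_abs,
      List.length_nil, zero_add] at h0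
    calc _ = ‖c‖ * (|x k| ^ N * ‖wderiv W v x‖) := by ring
      _ ≤ ‖c‖ * _ := mul_le_mul_of_nonneg_left h0 (norm_nonneg c)
      _ = _ := by rw [mul_pow]; ring
  · have h0 := hu.lowerSupported_moment (by linarith) (Fin.last d) 0
    have e0 : moment (Fin.last d) u 0 = extendZero (lowerHalf d) u := by simp [moment]
    rw [e0] at h0
    exact (ha.isTame_symIter (by linarith) (Fin.last d) 0).integrable_pairing h0.integrable
      ⟨hφ, hφc⟩ d.succ_pos
  · rw [setIntegral_eq_integral_of_forall_compl_eq_zero fun x hx => ?_]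
    · unfold opPairing
      rw [show (∫ ξ, hat (extendZero (lowerHalf d) u) ξ * testTransform a φ ξ) =
        ∫ x, v x * φ x from hp φ ⟨hφ, hφc⟩ hs, ← hc, ← integral_const_mul]
      simp only [mul_assoc]
    · rw [image_eq_zero_of_notMem_tsupport fun h => hx (hs h), mul_zero]
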